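/- **Setting.** Let $N\ge 2$ and $X=\mathbb{R}^N\times\mathbb{R}^{N-1}\times\mathbb{R}$ with elements $(\boldsymbol r,\boldsymbol\phi,\rho)$. For $\varepsilon>0$ consider, for $(\boldsymbol r,\boldsymbol\phi,\rho,\mu)\in X\times[0,1]$, the system $$0=\lambda(r_n,\mu)r_n+\mathrm{i}(\omega(r_n,\mu,\varepsilon)-\rho)r_n+\varepsilon\big(r_{n+1}\mathrm{e}^{\mathrm{i}\phi_n}-2r_n+r_{n-1}\mathrm{e}^{-\mathrm{i}\phi_{n-1}}\big),\qquad 1\le n\le N, \tag{1}$$ with $(r_{N+1},\phi_N)=(r_N,0)$ and either $(r_0,\phi_0)=(r_2,-\phi_1)$ (on-site) or $(r_0,\phi_0)=(r_1,0)$ (off-site). Its solutions are called on-site, respectively off-site, localized synchrony patterns. **Assumptions.** (H1) $\lambda:\mathbb{R}^2\to\mathbb{R}$ is $C^\infty$ and even in $r$, and there are continuous $r_\pm:[0,1]\to\mathbb{R}$ such that: for $\mu\in(0,1)$, $0<r_-(\mu)<r_+(\mu)$ are exactly the positive roots of $\lambda(\cdot,\mu)$ and $\lambda_r(r_-(\mu),\mu)>0$;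 $\lambda(0,\mu)<0$ for $\mu\in(0,1]$ and $\lambda_r(r_+(\mu),\mu)<0$ for $\mu\in[0,1)$; at $\mu=0$ there is a generic subcritical pitchfork, $r_-(0)=0$, $\lambda(0,0)=0$, $\lambda_\mu(0,0)<0<\lambda_{rr}(0,0)$; at $\mu=1$ there is a generic fold, $r_\pm(1)=1$, $\lambda(1,1)=\lambda_r(1,1)=0$, $\lambda_\mu(1,1)<0$, $\lambda_{rr}(1,1)<0$. (H2) $\omega(r,\mu,\varepsilon)=\omega_0(\mu)+\varepsilon^2\omega_2(r,\mu,\varepsilon)$ with $\omega_0,\omega_2$ real-valued and $C^\infty$. **The set at $\varepsilon=0$.** For $0\le s\le 2$ let $\mu_*(s)=s$ if $s\le1$ and $\mu_*(s)=2-s$ if $s\geq 1$, $R_+(s)=r_+(\mu_*(s))$, and let $R_0(s)=r_-(\mu_*(s))$ if $s\le 1$, $R_0(s)=r_+(\mu_*(s))$ if $s\geq 1$. For $0\le k\le N-1$ put $$\gamma_0(2k+s)=\big((\underbrace{R_+(s),\dots,R_+(s)}_{k},R_0(s),0,\dots,0),\boldsymbol 0,\omega_0(\mu_*(s)),\mu_*(s)\big),\quad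 0\le s\le 2,$$ which is a continuous curve. For $0<\delta<1$ let $I^\delta=[\delta,2N-1-\delta]$, $J^\delta=(\frac\delta2,2N-1-\frac\delta2)$ and $\Gamma_0^\delta(N)=\gamma_0(I^\delta)$. For $S\subset X\times[0,1]$ let $\mathcal U_\eta(S)$ be the open $\eta$-neighbourhood of $S$ in $X\times[0,1]$, and write $W=X\times\{0,1\}$. **Theorem.** Assume (H1) and (H2). For each $N\ge2$ and $\delta\in(0,1)$, for every sufficiently small $\delta_*>0$ there is $\varepsilon_*>0$ such that, for each of the two boundary conditions (on-site and off-site), there is a family of curves $\gamma_\varepsilon:J^\delta\to X\times[0,1]$, $0<\varepsilon<\varepsilon_*$, with the following properties. 1. (Existence and uniqueness.) For each $\varepsilon\in(0,\varepsilon_*)$, $\gamma_\varepsilon$ is an injective smooth curve with nowhere vanishing derivative, it consists of solutions of (1), and the branch $\Gamma_\varepsilon(N):=\gamma_\varepsilon(I^\delta)$ lies in $\mathcal U_{\delta_*}(\Gamma_0^\delta(N))$. Every connected set of solutions of (1) in $\mathcal U_{\delta_*}(\Gamma_0^\delta(N))$ that is not contained in $\mathcal U_{\delta_*}(W)$ is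 contained in $\gamma_\varepsilon(J^\delta)$, that is, in the branch continued slightly past its end points. 2. (Smoothness in $\varepsilon$, $C^0$ convergence.) $(\varepsilon,s)\mapsto\gamma_\varepsilon(s)$ is $C^\infty$ on $(0,\varepsilon_*)\times J^\delta$, and $\gamma_\varepsilon\to\gamma_0$ uniformly on $J^\delta$ as $\varepsilon\to0^+$. 3. ($C^m$ convergence, folds.) If $\gamma_0(s)\notin\mathcal U_{\delta_*}(W)$, then $\gamma_\varepsilon(s)$ and $\gamma_0(s)$ have the same $\mu$-component, and on the set of such $s\in J^\delta$ every derivative $\partial_s^m\gamma_\varepsilon$, $m\geq 0$, converges uniformly to $\partial_s^m\gamma_0$ as $\varepsilon\to0^+$. If $\gamma_0(s)\in\mathcal U_{\delta_*}(W)$, then $\gamma_\varepsilon(s)\in\mathcal U_{\delta_*}(W)$. For each $\varepsilon\in(0,\varepsilon_*)$ and each integer $1\le j\le 2N-2$, the $\mu$-component of $\gamma_\varepsilon$ has exactly one critical point $s_j$ in $(j-\delta_*,j+\delta_*)$; its second derivative there is nonzero, and $\gamma_\varepsilon(s_j)$ is a generic fold of (1): writing (1) as $F(x,\mu)=0$ with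 $x\in X$, the kernel of $D_xF$ there is one-dimensional, spanned by some $v$, and neither $D_\mu F$ nor $D_x^2F[v,v]$ lies in the range of $D_xF$. -/

import Mathlib

open Set Filter Topology
open scoped ContDiff

noncomputable section

namespace Snaking

/-- Bistability of `lam r μ`, with `rm μ < rp μ` its positive roots.  The roots are taken on the
closed interval `[0,1]`, as limits at the two ends: `rm` meets `0` at `μ = 0`, the two roots meet
at `r = 1` when `μ = 1`, and `rp` persists as a stable root at `μ = 0`. -/
structure Bistable (lam : ℝ → ℝ → ℝ) (rm rp : ℝ → ℝ) : Prop where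
  smooth : ContDiff ℝ ∞ (fun q : ℝ × ℝ => lam q.1 q.2)
  even : ∀ r μ, lam (-r) μ = lam r μ
  ordered : ∀ μ ∈ Ioo (0 : ℝ) 1, 0 < rm μ ∧ rm μ < rp μ
  roots : ∀ μ ∈ Ioo (0 : ℝ) 1, ∀ r, 0 < r → (lam r μ = 0 ↔ r = rm μ ∨ r = rp μ)
  rm_continuous : ContinuousOn rm (Icc 0 1)
  rp_continuous : ContinuousOn rp (Icc 0 1)
  stable_zero : ∀ μ ∈ Ioc (0 : ℝ) 1, lam 0 μ < 0
  stable_rp : ∀ μ ∈ Ico (0 : ℝ) 1, deriv (fun r => lam r μ) (rp μ) < 0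
  unstable_rm : ∀ μ ∈ Ioo (0 : ℝ) 1, 0 < deriv (fun r => lam r μ) (rm μ)
  /-- generic subcritical pitchfork of `r * lam r μ` at `(r, μ) = (0, 0)` -/
  pitchfork_root : rm 0 = 0 ∧ lam 0 0 = 0
  pitchfork_mu : deriv (fun μ => lam 0 μ) 0 < 0
  pitchfork_cubic : 0 < iteratedDeriv 2 (fun r => lam r 0) 0
  /-- generic saddle-node at `(r, μ) = (1, 1)` -/
  fold_root : rm 1 = 1 ∧ rp 1 = 1 ∧ lam 1 1 = 0 ∧ deriv (fun r => lam r 1) 1 = 0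
  fold_mu : deriv (fun μ => lam 1 μ) 1 < 0
  fold_quadratic : iteratedDeriv 2 (fun r => lam r 1) 1 < 0

/-- The unknowns `(r, φ, ρ)`: amplitudes `r_1,…,r_N` (stored at indices `0,…,N-1`), phase
differences `φ_1,…,φ_{N-1}` (stored at `0,…,N-2`) and the frequency `ρ`. -/
abbrev X (N : ℕ) : Type := (Fin N → ℝ) × (Fin (N - 1) → ℝ) × ℝ

/-- Pairs of unknowns and parameter `μ`. -/
abbrev P (N : ℕ) : Type := X N × ℝ

/-- Which reflection symmetry is imposed at the left end. -/
inductive Site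
  | on
  | off

/-- The `n`-th entry (counted from `1`) of a finite vector. -/
def entry {M : ℕ} (v : Fin M → ℝ) (n : ℕ) : ℝ :=
  if h : 1 ≤ n ∧ n ≤ M then v ⟨n - 1, by omega⟩ else 0

/-- Amplitudes `r_0, …, r_{N+1}` with the boundary conditions. -/
def amp {N : ℕ} (b : Site) (x : X N) (n : ℕ) : ℝ :=
  if n = 0 then
    match b with
    | Site.on => entry x.1 2
    | Site.off => entry x.1 1
  else if n = N + 1 then entry x.1 N
  else entry x.1 n

/-- Phase differences `φ_0, …, φ_N` with the boundary conditions. -/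
def phase {N : ℕ} (b : Site) (x : X N) (n : ℕ) : ℝ :=
  if n = 0 then
    match b with
    | Site.on => -entry x.2.1 1
    | Site.off => 0
  else if n = N then 0
  else entry x.2.1 n

/-- The right-hand side of the algebraic system with coupling constant `c = 1`; the component with
index `j : Fin N` is the equation at the node `n = j + 1`. -/
def system {N : ℕ} (lam : ℝ → ℝ → ℝ) (om : ℝ → ℝ → ℝ → ℝ) (b : Site) (ε : ℝ)
    (x : X N) (μ : ℝ) : Fin N → ℂ := fun j =>
  ((lam (amp b x (j + 1)) μ * amp b x (j + 1) : ℝ) : ℂ)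
    + Complex.I * (((om (amp b x (j + 1)) μ ε - x.2.2) * amp b x (j + 1) : ℝ) : ℂ)
    + (ε : ℂ) * ((amp b x (j + 2) : ℂ) * Complex.exp (Complex.I * (phase b x (j + 1) : ℂ))
        - 2 * (amp b x (j + 1) : ℂ)
        + (amp b x j : ℂ) * Complex.exp (-(Complex.I * (phase b x j : ℂ))))

/-- The localized synchrony patterns: solutions `(x, μ)` at coupling strength `ε`. -/
def solutions {N : ℕ} (lam : ℝ → ℝ → ℝ) (om : ℝ → ℝ → ℝ → ℝ) (b : Site) (ε : ℝ) : Set (P N) :=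
  {p | system lam om b ε p.1 p.2 = 0}

def muStar (s : ℝ) : ℝ := if s ≤ 1 then s else 2 - s

def RPlus (rp : ℝ → ℝ) (s : ℝ) : ℝ := rp (muStar s)

def RZero (rm rp : ℝ → ℝ) (s : ℝ) : ℝ := if s ≤ 1 then rm (muStar s) else rp (muStar s)

/-- The pattern at `ε = 0` with `k` leading nodes at `RPlus s`, the next one at `RZero s` and the
remaining ones at `0`; here `0 ≤ s ≤ 2`. -/
def sheet (N : ℕ) (rm rp om0 : ℝ → ℝ) (k : ℕ) (s : ℝ) : P N :=
  ((fun j => if (j : ℕ) < k then RPlus rp s else if (j : ℕ) = k then RZero rm rp s else 0,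
    fun _ => 0, om0 (muStar s)), muStar s)

/-- The snaking set `Γ_0^δ(N)` at `ε = 0`. -/
def Gamma0 (N : ℕ) (rm rp om0 : ℝ → ℝ) (δ : ℝ) : Set (P N) :=
  (sheet N rm rp om0 0 '' Icc δ 2)
    ∪ (⋃ k ∈ Icc 1 (N - 2), sheet N rm rp om0 k '' Icc 0 2)
    ∪ (sheet N rm rp om0 (N - 1) '' Icc 0 (1 - δ))

/-- All sheets joined into one curve: `s ∈ [2k, 2k+2]` runs through the sheet `k`, so that
`Γ_0^δ(N)` is the arc `δ ≤ s ≤ 2N - 1 - δ`. -/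
def curve0 (N : ℕ) (rm rp om0 : ℝ → ℝ) (s : ℝ) : P N :=
  sheet N rm rp om0 ⌊s / 2⌋₊ (s - 2 * (⌊s / 2⌋₊ : ℝ))

/-- Open `δ`-neighbourhood of `S` in `X × [0,1]`. -/
def nbhd {N : ℕ} (δ : ℝ) (S : Set (P N)) : Set (P N) :=
  {p | p.2 ∈ Icc (0 : ℝ) 1} ∩ Metric.thickening δ S

/-- `X × {0, 1}`. -/
def walls (N : ℕ) : Set (P N) := {p | p.2 = 0 ∨ p.2 = 1}

/-- `(x₀, μ₀)` is a generic fold (saddle-node) of `F x μ = 0`: the kernel of `D_x F` is spanned by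
one vector `v`, and neither `D_μ F` nor `D_x² F [v, v]` lies in the range of `D_x F`. -/
def IsGenericFold {E Y : Type*} [NormedAddCommGroup E] [NormedSpace ℝ E]
    [NormedAddCommGroup Y] [NormedSpace ℝ Y] (F : E → ℝ → Y) (x₀ : E) (μ₀ : ℝ) : Prop :=
  F x₀ μ₀ = 0 ∧
  deriv (fun μ => F x₀ μ) μ₀ ∉ range (fderiv ℝ (fun x => F x μ₀) x₀) ∧
  ∃ v : E, v ≠ 0 ∧
    (∀ w : E, fderiv ℝ (fun x => F x μ₀) x₀ w = 0 ↔ ∃ a : ℝ, w = a • v) ∧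
    fderiv ℝ (fun x => fderiv ℝ (fun y => F y μ₀) x) x₀ v v
      ∉ range (fderiv ℝ (fun x => F x μ₀) x₀)

end Snaking

end

open Set Filter Topology
open scoped ContDiff

noncomputable section

namespace Snaking

section

/-! ### Inverse and implicit functions, the latter along a compact set of parameters -/

section Calculus

variable {E F Y : Type*} [NormedAddCommGroup E] [NormedSpace ℝ E] [FiniteDimensional ℝ E]
  [NormedAddCommGroup F] [NormedSpace ℝ F] [FiniteDimensional ℝ F]
  [NormedAddCommGroup Y] [NormedSpace ℝ Y] [FiniteDimensional ℝ Y]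

/-! At `ε = 0` the nodes decouple and each amplitude is `0` or a root of `lam · μ`. Along the
unperturbed curve degeneracy occurs only at the integers `1 ≤ j ≤ 2N - 2`, where the last excited
node passes the pitchfork (`j` even) or excited nodes pass the saddle-node (`j` odd). The branch is
glued from arcs between these integers and arcs across them.

Two reductions are used everywhere. First, multiplying the imaginary equations by the amplitudes and
summing with suitable weights makes the fluxes telescope (`sum_weight_flux`); hence `ρ` equals `om0`
plus `ε²` times a weighted mean of `om2`, and one equation becomes redundant. Second, behind the
last excited node `m` each amplitude is small compared with the preceding one; with the quotients as
unknowns these equations can be divided by `ε` times the preceding amplitude. What remains is a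
smooth system with a triangular, invertible linearization at the unperturbed patterns (`Zone`,
`Zone.Base`, `Base.injective`). The implicit function theorem along a compact set then gives a
surface of solutions over two parameters.

Between folds the two parameters are `(μ, ε)`. The surface is smooth up to `ε = 0`, which yields
`C^m` convergence (`exists_regularPiece`).

At a fold the bifurcation is blown up. Here `h²` is the distance of `μ` to `0` or `1`, and `w`
places the amplitude of the node `m` between the two roots that meet (`0` and `rm`, or `rm` and
`rp`). The equation of this node has the form `h^d w (1 - w) P = ε × coupling` up to sign and a
positive factor, with `d = 3` at the pitchfork and `d = 2` at the saddle-node. The coupling has the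
sign that makes `ε` positive for `0 < w < 1`. So `g = ε / (h^d w (1 - w))` replaces `ε` as an
unknown, the parameters `(w, h)` are free, and `ε = 0` exactly on the edges `w = 0`, `w = 1`, `h =
0`. Solutions for a given `ε` form a level curve of `h^d w (1 - w) G(w, h)`, which comes down along
one edge, turns, and goes up along the other. At `h = 0` the factor `w (1 - w) G` is strictly
log-concave, so every critical point of `h` on a level curve is a strict minimum; there is exactly
one, the fold. The parameter `σ = h² ψ(w)`, with `ψ = -1` and `ψ = 1` near the two edges, makes the
arc match the unperturbed curve in `μ` outside a small interval (`exists_fold_curve`,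
`FoldScaling.exists_branch`).

The kernel of the linearized original system is spanned by the tangent of the arc, because tangent
vectors lift to the scaled variables (`exists_lift`, `deriv_ne_zero_and_kernel`). Differentiating
the system twice along the curve turns a nondegenerate turning point into a generic fold
(`isGenericFold_of_curve`).

For uniqueness, the roots separate like the square root of the distance to a bifurcation, so a
solution near the curve with `μ` away from `0, 1` is close to one pattern at the same `μ`
(`exists_near_half`). Its scaled variables then converge to the unperturbed ones, so it lies on a
regular arc. Near the folds connectedness takes over: the one-dimensional kernel makes the branch
open in the solution set (`eventually_mem_image_of_kernel`), and a compact subarc is closed. -/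

/-- An injective linear map between spaces of the same finite dimension, as an equivalence. -/
def equivOfInjective (hd : Module.finrank ℝ E = Module.finrank ℝ F) (L : E →L[ℝ] F)
    (hL : ∀ v, L v = 0 → v = 0) : E ≃L[ℝ] F :=
  (LinearEquiv.ofInjectiveOfFinrankEq (L : E →ₗ[ℝ] F)
    ((injective_iff_map_eq_zero _).2 hL) hd).toContinuousLinearEquiv

theorem coe_equivOfInjective (hd : Module.finrank ℝ E = Module.finrank ℝ F) (L : E →L[ℝ] F)
    (hL : ∀ v, L v = 0 → v = 0) : (equivOfInjective hd L hL : E →L[ℝ] F) = L := by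
  ext v; rfl

/-- Inverse function theorem in the form used below. -/
theorem exists_smooth_local_inverse (hd : Module.finrank ℝ E = Module.finrank ℝ F)
    {f : E → F} {a : E} (hf : ContDiffAt ℝ ∞ f a) (hinj : ∀ v, fderiv ℝ f a v = 0 → v = 0) :
    ∃ g : F → E, ContDiffAt ℝ ∞ g (f a) ∧ g (f a) = a ∧ (∀ᶠ y in 𝓝 (f a), f (g y) = y) ∧
      ∀ᶠ x in 𝓝 a, g (f x) = x := by
  have h1 : (∞ : WithTop ℕ∞) ≠ 0 := by simp
  have hf' : HasFDerivAt f (equivOfInjective hd (fderiv ℝ f a) hinj : E →L[ℝ] F) a := by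
    rw [coe_equivOfInjective]
    exact (hf.differentiableAt h1).hasFDerivAt
  have hs := hf.hasStrictFDerivAt' hf' h1
  exact ⟨hf.localInverse hf' h1, hf.to_localInverse hf' h1, hf.localInverse_apply_image hf' h1,
    hs.eventually_right_inverse, hs.eventually_left_inverse⟩

/-- Inverse of a smooth injective immersion between spaces of the same dimension. -/
theorem contDiffOn_rightInverse (hd : Module.finrank ℝ E = Module.finrank ℝ F)
    {f : E → F} {g : F → E} {s : Set E} {t : Set F} (hs : IsOpen s) (hf : ContDiffOn ℝ ∞ f s)
    (hinj : InjOn f s) (hder : ∀ x ∈ s, ∀ v, fderiv ℝ f x v = 0 → v = 0)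
    (ht : IsOpen t) (hg : MapsTo g t s) (hfg : ∀ y ∈ t, f (g y) = y) : ContDiffOn ℝ ∞ g t := by
  intro y hy
  obtain ⟨k, hk, hk1, hk2, -⟩ := exists_smooth_local_inverse hd
    (hf.contDiffAt (hs.mem_nhds (hg hy))) (hder _ (hg hy))
  rw [hfg y hy] at hk hk1 hk2
  have h1 : ∀ᶠ z in 𝓝 y, k z ∈ s := by
    have := hk.continuousAt
    apply this.eventually
    rw [hk1]
    exact hs.mem_nhds (hg hy)
  refine (hk.congr_of_eventuallyEq ?_).contDiffWithinAt
  filter_upwards [h1, hk2, ht.mem_nhds hy] with z hz1 hz2 hz3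
  exact hinj (hg hz3) hz1 (by rw [hfg z hz3, hz2])

/-- Implicit function theorem along a compact set of parameters. -/
theorem exists_smooth_implicit_of_isCompact {f : E × Y → Y} {O : Set (E × Y)} (hO : IsOpen O)
    (hf : ContDiffOn ℝ ∞ f O) {K : Set E} (hK : IsCompact K) {y₀ : E → Y}
    (hy₀ : ContinuousOn y₀ K) (hmem : ∀ p ∈ K, (p, y₀ p) ∈ O) (hzero : ∀ p ∈ K, f (p, y₀ p) = 0)
    (hinj : ∀ p ∈ K, ∀ v : Y, fderiv ℝ f (p, y₀ p) (0, v) = 0 → v = 0) :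
    ∃ (U : Set E) (y : E → Y) (V : Set (E × Y)), IsOpen U ∧ K ⊆ U ∧ ContDiffOn ℝ ∞ y U ∧
      (∀ p ∈ K, y p = y₀ p) ∧
      (∀ p ∈ U, (p, y p) ∈ O ∧ f (p, y p) = 0 ∧
        ∀ v : Y, fderiv ℝ f (p, y p) (0, v) = 0 → v = 0) ∧
      IsOpen V ∧ (∀ p ∈ K, (p, y₀ p) ∈ V) ∧
      ∀ p z, (p, z) ∈ V → f (p, z) = 0 → p ∈ U ∧ z = y p := by
  have hd : Module.finrank ℝ (E × Y) = Module.finrank ℝ (E × Y) := rfl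
  -- `Φ` is a local diffeomorphism wherever the partial derivative of `f` in `Y` is invertible, and
  -- it turns zeros of `f` into points with vanishing second coordinate.
  set Φ : E × Y → E × Y := fun q => (q.1, f q) with hΦ
  have hfd : ∀ q ∈ O, DifferentiableAt ℝ f q := fun q hq =>
    (hf.contDiffAt (hO.mem_nhds hq)).differentiableAt (by simp)
  have hΦs : ContDiffOn ℝ ∞ Φ O := contDiffOn_fst.prodMk hf
  have hΦ' : ∀ q ∈ O, ∀ v, fderiv ℝ Φ q v = (v.1, fderiv ℝ f q v) := by
    intro q hq v
    have h : HasFDerivAt Φ ((ContinuousLinearMap.fst ℝ E Y).prod (fderiv ℝ f q)) q :=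
      hasFDerivAt_fst.prodMk (hfd q hq).hasFDerivAt
    rw [h.fderiv]; rfl
  set O' : Set (E × Y) := O ∩ fderiv ℝ Φ ⁻¹' (range ((↑) : ((E × Y) ≃L[ℝ] (E × Y)) → (E × Y →L[ℝ] E × Y)))
    with hO'
  have hO'o : IsOpen O' := by
    have hc : ContinuousOn (fderiv ℝ Φ) O := hΦs.continuousOn_fderiv_of_isOpen hO (by simp)
    exact hc.isOpen_inter_preimage hO (ContinuousLinearEquiv.isOpen)
  have hO'inj : ∀ q ∈ O', ∀ v, fderiv ℝ Φ q v = 0 → v = 0 := by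
    rintro q ⟨-, e, he⟩ v hv
    rw [← he] at hv
    exact (map_eq_zero_iff e e.injective).1 hv
  have hKO' : ∀ p ∈ K, (p, y₀ p) ∈ O' := by
    intro p hp
    refine ⟨hmem p hp, equivOfInjective hd (fderiv ℝ Φ (p, y₀ p)) ?_, coe_equivOfInjective _ _ _⟩
    rintro ⟨u, v⟩ huv
    rw [hΦ' _ (hmem p hp)] at huv
    obtain ⟨h1, h2⟩ := Prod.mk_inj.1 huv
    simp only at h1 h2
    subst h1
    rw [hinj p hp v h2]; rfl
  have hgr : IsCompact ((fun p => (p, y₀ p)) '' K) :=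
    hK.image_of_continuousOn (continuousOn_id.prodMk hy₀)
  have hloc : ∀ q ∈ O', ∃ g : E × Y → E × Y, ContDiffAt ℝ ∞ g (Φ q) ∧ g (Φ q) = q ∧
      (∀ᶠ y in 𝓝 (Φ q), Φ (g y) = y) ∧ ∀ᶠ x in 𝓝 q, g (Φ x) = x := fun q hq =>
    exists_smooth_local_inverse hd (hΦs.contDiffAt (hO.mem_nhds hq.1)) (hO'inj q hq)
  -- Local injectivity at each point of the compact graph, together with injectivity on the graph,
  -- gives injectivity on a neighbourhood of the whole graph. This makes the implicit function
  -- single-valued over all of `K` at once.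
  obtain ⟨V₀, hV₀, hV₀inj⟩ : ∃ t ∈ 𝓝ˢ ((fun p => (p, y₀ p)) '' K), InjOn Φ t := by
    apply Set.InjOn.exists_mem_nhdsSet _ hgr
    · rintro _ ⟨p, hp, rfl⟩
      exact (hΦs.contDiffAt (hO.mem_nhds (hmem p hp))).continuousAt
    · rintro _ ⟨p, hp, rfl⟩
      obtain ⟨g, -, -, -, hg⟩ := hloc _ (hKO' p hp)
      exact ⟨_, hg, fun a ha b hb hab => by
        have ha' : g (Φ a) = a := ha
        have hb' : g (Φ b) = b := hb
        rw [← ha', ← hb', hab]⟩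
    · rintro _ ⟨p, hp, rfl⟩ _ ⟨p', hp', rfl⟩ h
      have h1 : p = p' := (Prod.mk_inj.1 h).1
      subst h1; rfl
  set V := interior V₀ ∩ O' with hV
  have hVo : IsOpen V := isOpen_interior.inter hO'o
  have hVinj : InjOn Φ V := hV₀inj.mono fun q hq => interior_subset hq.1
  have hΦV : IsOpen (Φ '' V) := by
    rw [isOpen_iff_mem_nhds]
    rintro _ ⟨q, hq, rfl⟩
    obtain ⟨g, hg, hgq, hg1, -⟩ := hloc q hq.2
    have h2 : ∀ᶠ y in 𝓝 (Φ q), g y ∈ V := by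
      apply hg.continuousAt.eventually
      rw [hgq]; exact hVo.mem_nhds hq
    filter_upwards [hg1, h2] with y h1 h2
    exact ⟨g y, h2, h1⟩
  -- These are the parameters over which `V` contains a zero of `f`.
  set U : Set E := {p | (p, (0 : Y)) ∈ Φ '' V} with hU
  have hUo : IsOpen U := hΦV.preimage (by fun_prop : Continuous fun p : E => (p, (0 : Y)))
  have hex : ∀ p ∈ U, ∃ z, (p, z) ∈ V ∧ f (p, z) = 0 := by
    rintro p ⟨⟨p', z⟩, hz, hpz⟩
    obtain ⟨h1, h2⟩ := Prod.mk_inj.1 hpz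
    simp only at h1 h2
    subst h1
    exact ⟨z, hz, h2⟩
  choose! y hyV hy0 using hex
  have huniq : ∀ p z, (p, z) ∈ V → f (p, z) = 0 → p ∈ U ∧ z = y p := by
    intro p z hz h0
    have hpU : p ∈ U := ⟨(p, z), hz, by simp [hΦ, h0]⟩
    refine ⟨hpU, ?_⟩
    have := hVinj hz (hyV p hpU) (by simp [hΦ, h0, hy0 p hpU])
    exact (Prod.mk_inj.1 this).2
  have hKV : ∀ p ∈ K, (p, y₀ p) ∈ V := fun p hp =>
    ⟨mem_interior_iff_mem_nhds.2 (mem_nhdsSet_iff_forall.1 hV₀ _ ⟨p, hp, rfl⟩), hKO' p hp⟩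
  refine ⟨U, y, V, hUo, fun p hp => (huniq p _ (hKV p hp) (hzero p hp)).1, ?_,
    fun p hp => (huniq p _ (hKV p hp) (hzero p hp)).2.symm, ?_, hVo, hKV, huniq⟩
  · intro p hp
    obtain ⟨g, hg, hgq, hg1, -⟩ := hloc _ (hyV p hp).2
    have hΦp : Φ (p, y p) = (p, 0) := by simp [hΦ, hy0 p hp]
    rw [hΦp] at hg hgq hg1
    have hc : ContDiffAt ℝ ∞ (fun p' : E => (p', (0 : Y))) p := contDiffAt_id.prodMk contDiffAt_const
    have hg2 : ContDiffAt ℝ ∞ (fun p' : E => g (p', 0)) p := ContDiffAt.comp p hg hc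
    have h2 : ∀ᶠ p' in 𝓝 p, g (p', 0) ∈ V := by
      apply hg2.continuousAt.eventually
      change ∀ᶠ q in 𝓝 (g (p, 0)), q ∈ V
      rw [hgq]; exact hVo.mem_nhds (hyV p hp)
    have h1 : ∀ᶠ p' in 𝓝 p, Φ (g (p', 0)) = (p', 0) := hc.continuousAt.eventually hg1
    refine (hg2.snd.congr_of_eventuallyEq ?_).contDiffWithinAt
    filter_upwards [h1, h2] with p' h1 h2
    obtain ⟨h3, h4⟩ := Prod.mk_inj.1 h1
    have h5 : g (p', 0) = (p', (g (p', 0)).2) := Prod.ext h3 rfl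
    rw [h5] at h2 h4
    exact (huniq p' _ h2 h4).2.symm
  · intro p hp
    refine ⟨(hyV p hp).2.1, hy0 p hp, fun v hv => ?_⟩
    have := hO'inj _ (hyV p hp).2 (0, v) (by rw [hΦ' _ (hyV p hp).2.1, hv]; rfl)
    exact (Prod.mk_inj.1 this).2

end Calculus

end

/-! ### Divided differences and the normal form at a critical zero -/

section DividedDifference

/-- Differentiation under the integral sign, iterated. The target `G` is quantified inside the
statement because the induction step applies the hypothesis to the partial derivative, which takes
values in `E →L[ℝ] G`. -/
theorem contDiff_nat_parametric_integral {E : Type} [NormedAddCommGroup E] [NormedSpace ℝ E]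
    [FiniteDimensional ℝ E] (n : ℕ) : ∀ {G : Type} [NormedAddCommGroup G] [NormedSpace ℝ G]
    [CompleteSpace G] {f : E × ℝ → G}, ContDiff ℝ ∞ f →
    ContDiff ℝ n (fun x => ∫ u in (0 : ℝ)..1, f (x, u)) := by
  have hder : ∀ {G : Type} [NormedAddCommGroup G] [NormedSpace ℝ G] [CompleteSpace G]
      {f : E × ℝ → G}, ContDiff ℝ ∞ f → ∀ x, HasFDerivAt (fun x => ∫ u in (0 : ℝ)..1, f (x, u))
        (∫ u in (0 : ℝ)..1, (fderiv ℝ f (x, u)).comp (ContinuousLinearMap.inl ℝ E ℝ)) x := by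
    intro G _ _ _ f hf x
    have hc : Continuous (fun q : E × ℝ => (fderiv ℝ f q).comp (ContinuousLinearMap.inl ℝ E ℝ)) :=
      (hf.continuous_fderiv (by simp)).clm_comp continuous_const
    obtain ⟨C, hC⟩ := ((isCompact_closedBall x 1).prod (isCompact_Icc (a := (0 : ℝ)) (b := 1))
      ).exists_bound_of_continuousOn hc.continuousOn
    refine intervalIntegral.hasFDerivAt_integral_of_dominated_of_fderiv_le
      (μ := MeasureTheory.volume) (a := 0) (b := 1) (bound := fun _ => C)
      (F := fun x u => f (x, u))
      (F' := fun x u => (fderiv ℝ f (x, u)).comp (ContinuousLinearMap.inl ℝ E ℝ)) (x₀ := x)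
      (s := Metric.closedBall x 1) (Metric.closedBall_mem_nhds x one_pos) ?_ ?_ ?_ ?_ ?_ ?_
    · refine Eventually.of_forall fun y => ?_
      exact (hf.continuous.comp (by fun_prop : Continuous fun u : ℝ => (y, u))).aestronglyMeasurable
    · exact (hf.continuous.comp
        (by fun_prop : Continuous fun u : ℝ => (x, u))).intervalIntegrable _ _
    · exact (hc.comp (by fun_prop : Continuous fun u : ℝ => (x, u))).aestronglyMeasurable
    · refine Eventually.of_forall fun u hu y hy => ?_
      rw [uIoc_of_le zero_le_one] at hu
      exact hC (y, u) ⟨hy, hu.1.le, hu.2⟩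
    · exact intervalIntegrable_const
    · refine Eventually.of_forall fun u hu y hy => ?_
      have h1 : HasFDerivAt f (fderiv ℝ f (y, u)) (y, u) :=
        (hf.differentiable (by simp)).differentiableAt.hasFDerivAt
      exact h1.comp y (hasFDerivAt_prodMk_left y u)
  induction n with
  | zero =>
    intro G _ _ _ f hf
    rw [Nat.cast_zero, contDiff_zero]
    exact continuous_iff_continuousAt.2 fun x => (hder hf x).continuousAt
  | succ n ih =>
    intro G _ _ _ f hf
    rw [Nat.cast_succ, contDiff_succ_iff_hasFDerivAt]
    refine ⟨_, ?_, hder hf⟩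
    have hc : ContDiff ℝ ∞
        (fun q : E × ℝ => (fderiv ℝ f q).comp (ContinuousLinearMap.inl ℝ E ℝ)) :=
      (hf.fderiv_right (m := ∞) (by simp)).clm_comp contDiff_const
    exact ih hc

/-- Divided differences of a smooth function with parameters are smooth. -/
theorem exists_divided_difference {E : Type} [NormedAddCommGroup E] [NormedSpace ℝ E]
    [FiniteDimensional ℝ E] {f : ℝ × E → ℝ} (hf : ContDiff ℝ ∞ f) :
    ∃ D : ℝ × ℝ × E → ℝ, ContDiff ℝ ∞ D ∧
      ∀ a b e, f (a, e) - f (b, e) = (a - b) * D (a, b, e) := by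
  -- Hadamard's formula: the divided difference is the mean of the derivative of `f` over the
  -- segment from `b` to `a`.
  set k : (ℝ × ℝ × E) × ℝ → ℝ := fun q =>
    fderiv ℝ f (q.1.2.1 + q.2 * (q.1.1 - q.1.2.1), q.1.2.2) (1, 0) with hk
  have hks : ContDiff ℝ ∞ k := by
    refine ContDiff.clm_apply ?_ contDiff_const
    exact (hf.fderiv_right (m := ∞) (by simp)).comp (by fun_prop)
  refine ⟨fun x => ∫ u in (0 : ℝ)..1, k (x, u),
    contDiff_infty.2 fun n => contDiff_nat_parametric_integral n hks, fun a b e => ?_⟩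
  have h1 : ∀ u : ℝ, HasDerivAt (fun u : ℝ => f (b + u * (a - b), e))
      ((a - b) * k ((a, b, e), u)) u := by
    intro u
    have h2 : HasFDerivAt f (fderiv ℝ f (b + u * (a - b), e)) (b + u * (a - b), e) :=
      (hf.differentiable (by simp)).differentiableAt.hasFDerivAt
    have h3 : HasDerivAt (fun u : ℝ => (b + u * (a - b), e)) (a - b, (0 : E)) u := by
      refine HasDerivAt.prodMk ?_ (hasDerivAt_const _ _)
      simpa using ((hasDerivAt_id u).mul_const (a - b)).const_add b
    have h4 := h2.comp_hasDerivAt u h3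
    have h5 : ((a - b, (0 : E)) : ℝ × E) = (a - b) • (1, 0) := by simp
    rw [h5, map_smul, smul_eq_mul] at h4
    exact h4
  have h2 := intervalIntegral.integral_eq_sub_of_hasDerivAt (a := 0) (b := 1)
    (fun u _ => h1 u) (Continuous.intervalIntegrable (by
      have := hks.continuous
      fun_prop) _ _)
  simp only [intervalIntegral.integral_const_mul] at h2
  simp only [h2]
  simp

theorem divided_difference_self {E : Type} [NormedAddCommGroup E] [NormedSpace ℝ E]
    {f : ℝ × E → ℝ} {D : ℝ × ℝ × E → ℝ} (hD : Continuous D)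
    (h : ∀ a b e, f (a, e) - f (b, e) = (a - b) * D (a, b, e)) (a : ℝ) (e : E) :
    HasDerivAt (fun x => f (x, e)) (D (a, a, e)) a := by
  rw [hasDerivAt_iff_tendsto_slope]
  have h1 : Tendsto (fun x => D (x, a, e)) (𝓝[≠] a) (𝓝 (D (a, a, e))) := by
    have : Continuous fun x => D (x, a, e) := by fun_prop
    exact (this.tendsto a).mono_left nhdsWithin_le_nhds
  refine h1.congr' ?_
  filter_upwards [self_mem_nhdsWithin] with x hx
  have hx' : x - a ≠ 0 := sub_ne_zero.2 hx
  rw [slope_def_field, h x a e]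
  field_simp

/-- Normal form of a smooth function of `(x, ν)` with a critical zero in `x` at the origin. -/
theorem exists_quadratic_form {f : ℝ → ℝ → ℝ} (hf : ContDiff ℝ ∞ (fun q : ℝ × ℝ => f q.1 q.2))
    (h0 : f 0 0 = 0) (h1 : deriv (fun x => f x 0) 0 = 0) :
    ∃ (A : ℝ × ℝ → ℝ) (C : ℝ → ℝ), ContDiff ℝ ∞ A ∧ ContDiff ℝ ∞ C ∧
      (∀ x ν, f x ν = x ^ 2 * C x + ν * A (x, ν)) ∧
      A (0, 0) = deriv (fun ν => f 0 ν) 0 ∧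
      2 * C 0 = iteratedDeriv 2 (fun x => f x 0) 0 := by
  have hf' : ContDiff ℝ ∞ (fun q : ℝ × ℝ => f q.2 q.1) := hf.comp (contDiff_snd.prodMk contDiff_fst)
  -- `D` splits the factor `ν` off `f x ν - f x 0`. At `ν = 0`, `D₁` and `D₂` split off two factors
  -- `x`; the second one exists because `D₁ (0, 0, 0)` is the derivative in `x`, which vanishes.
  obtain ⟨D, hD, hDf⟩ := exists_divided_difference hf'
  obtain ⟨D₁, hD₁, hDf₁⟩ := exists_divided_difference hf
  have hk : ContDiff ℝ ∞ (fun q : ℝ × ℝ => D₁ (q.1, 0, q.2)) := hD₁.comp (by fun_prop)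
  obtain ⟨D₂, hD₂, hDf₂⟩ := exists_divided_difference hk
  have hz : D₁ (0, 0, 0) = 0 := by
    exact ((divided_difference_self (f := fun q : ℝ × ℝ => f q.1 q.2)
      hD₁.continuous hDf₁ 0 0).deriv).symm.trans h1
  have hform : ∀ x, f x 0 = x ^ 2 * D₂ (x, 0, 0) := by
    intro x
    have a1 := hDf₁ x 0 0
    have a2 := hDf₂ x 0 0
    simp only [h0, hz, sub_zero] at a1 a2
    rw [a1, a2]; ring
  have hC : ContDiff ℝ ∞ (fun x : ℝ => D₂ (x, 0, 0)) := hD₂.comp (by fun_prop)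
  refine ⟨fun q => D (q.2, 0, q.1), fun x => D₂ (x, 0, 0), hD.comp (by fun_prop), hC, ?_, ?_, ?_⟩
  · intro x ν
    have a1 := hDf ν 0 x
    simp only [sub_zero] at a1
    rw [← hform, ← a1]; ring
  · exact ((divided_difference_self (f := fun q : ℝ × ℝ => f q.2 q.1) hD.continuous hDf 0 0).deriv).symm
  · have hd : ∀ x, HasDerivAt (fun x => D₂ (x, 0, 0)) (deriv (fun x => D₂ (x, 0, 0)) x) x := fun x =>
      (hC.differentiable (by simp)).differentiableAt.hasDerivAt
    have e1 : deriv (fun x => f x 0) = fun x =>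
        2 * x * D₂ (x, 0, 0) + x ^ 2 * deriv (fun x => D₂ (x, 0, 0)) x := by
      funext x
      simp only [hform]
      have := ((hasDerivAt_pow 2 x).fun_mul (hd x)).deriv
      simpa using this
    rw [iteratedDeriv_succ, iteratedDeriv_one, e1]
    have hd2 : HasDerivAt (deriv (fun x => D₂ (x, 0, 0))) (deriv (deriv (fun x => D₂ (x, 0, 0))) 0) 0 :=
      ((contDiff_infty_iff_deriv.1 hC).2.differentiable (by simp)).differentiableAt.hasDerivAt
    have := ((((hasDerivAt_id (0 : ℝ)).const_mul 2).mul (hd 0)).add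
      ((hasDerivAt_pow 2 (0 : ℝ)).mul hd2)).deriv
    simp at this
    rw [← this]; rfl

end DividedDifference

section

/-! ### Real and imaginary parts of the system; balance of fluxes -/

section Algebra

variable {N : ℕ}

/-- Real part of the coupling term at the node `j + 1`. -/
def coupling (b : Site) (x : X N) (j : ℕ) : ℝ :=
  amp b x (j + 2) * Real.cos (phase b x (j + 1)) - 2 * amp b x (j + 1)
    + amp b x j * Real.cos (phase b x j)

/-- Imaginary part of the coupling term at the node `j + 1`. -/
def flux (b : Site) (x : X N) (j : ℕ) : ℝ :=
  amp b x (j + 2) * Real.sin (phase b x (j + 1)) - amp b x j * Real.sin (phase b x j)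

def realPart (lam : ℝ → ℝ → ℝ) (b : Site) (ε : ℝ) (x : X N) (μ : ℝ) (j : ℕ) : ℝ :=
  lam (amp b x (j + 1)) μ * amp b x (j + 1) + ε * coupling b x j

def imagPart (om : ℝ → ℝ → ℝ → ℝ) (b : Site) (ε : ℝ) (x : X N) (μ : ℝ) (j : ℕ) : ℝ :=
  (om (amp b x (j + 1)) μ ε - x.2.2) * amp b x (j + 1) + ε * flux b x j

theorem system_apply (lam : ℝ → ℝ → ℝ) (om : ℝ → ℝ → ℝ → ℝ) (b : Site) (ε : ℝ) (x : X N) (μ : ℝ)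
    (j : Fin N) : system lam om b ε x μ j
      = ⟨realPart lam b ε x μ j, imagPart om b ε x μ j⟩ := by
  have h1 : ∀ t : ℝ, Complex.exp (Complex.I * (t : ℂ)) = ⟨Real.cos t, Real.sin t⟩ := by
    intro t
    rw [mul_comm, Complex.exp_mul_I]
    apply Complex.ext <;>
    simp [Complex.cos_ofReal_re, Complex.sin_ofReal_re, Complex.cos_ofReal_im,
      Complex.sin_ofReal_im]
  have h2 : ∀ t : ℝ, Complex.exp (-(Complex.I * (t : ℂ))) = ⟨Real.cos t, -Real.sin t⟩ := by
    intro t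
    have := h1 (-t)
    rw [Real.cos_neg, Real.sin_neg] at this
    rw [← this]; push_cast; ring_nf
  unfold system realPart imagPart coupling flux
  rw [h1, h2]
  apply Complex.ext <;> simp <;> ring_nf <;> simp

theorem mem_solutions_iff (lam : ℝ → ℝ → ℝ) (om : ℝ → ℝ → ℝ → ℝ) (b : Site) (ε : ℝ) (p : P N) :
    p ∈ solutions lam om b ε ↔
      ∀ j < N, realPart lam b ε p.1 p.2 j = 0 ∧ imagPart om b ε p.1 p.2 j = 0 := by
  constructor
  · intro h j hj
    have h1 : system lam om b ε p.1 p.2 ⟨j, hj⟩ = 0 := by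
      have : system lam om b ε p.1 p.2 = 0 := h
      rw [this]; rfl
    rw [system_apply] at h1
    exact ⟨congrArg Complex.re h1, congrArg Complex.im h1⟩
  · intro h
    change system lam om b ε p.1 p.2 = 0
    funext j
    rw [system_apply, (h j j.2).1, (h j j.2).2]; rfl

theorem amp_succ (b : Site) (x : X N) (j : Fin N) : amp b x (j + 1) = x.1 j := by
  have := j.2
  unfold amp entry
  rw [if_neg (by omega), if_neg (by omega), dif_pos (by omega)]
  congr

theorem amp_last (b : Site) (x : X N) : amp b x (N + 1) = amp b x N := by
  unfold amp
  rcases Nat.eq_zero_or_pos N with h | h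
  · subst h
    cases b <;> simp [entry]
  · rw [if_neg (by omega), if_pos rfl, if_neg (by omega), if_neg (by omega)]

theorem phase_last (hN : 1 ≤ N) (b : Site) (x : X N) : phase b x N = 0 := by
  unfold phase
  rw [if_neg (by omega), if_pos rfl]

theorem phase_succ (b : Site) (x : X N) (j : Fin (N - 1)) : phase b x (j + 1) = x.2.1 j := by
  have := j.2
  unfold phase entry
  rw [if_neg (by omega), if_neg (by omega), dif_pos (by omega)]
  congr

theorem amp_congr {b : Site} {x x' : X N} (h : x.1 = x'.1) (n : ℕ) : amp b x n = amp b x' n := by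
  unfold amp; rw [h]

theorem phase_congr {b : Site} {x x' : X N} (h : x.2.1 = x'.2.1) (n : ℕ) :
    phase b x n = phase b x' n := by
  unfold phase; rw [h]

theorem contDiff_entry {M : ℕ} (n : ℕ) : ContDiff ℝ ∞ (fun v : Fin M → ℝ => entry v n) := by
  unfold entry
  split_ifs
  · exact contDiff_apply ℝ ℝ _
  · exact contDiff_const

theorem contDiff_amp (b : Site) (n : ℕ) : ContDiff ℝ ∞ (fun x : X N => amp b x n) := by
  have h := fun k => (contDiff_entry (M := N) k).comp (contDiff_fst (𝕜 := ℝ)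
    (E := Fin N → ℝ) (F := (Fin (N - 1) → ℝ) × ℝ) (n := ∞))
  unfold amp
  split_ifs
  · cases b
    · exact h 2
    · exact h 1
  · exact h _
  · exact h _

theorem contDiff_phase (b : Site) (n : ℕ) : ContDiff ℝ ∞ (fun x : X N => phase b x n) := by
  have h := fun k => (contDiff_entry (M := N - 1) k).comp (((contDiff_fst (𝕜 := ℝ)
    (E := Fin (N - 1) → ℝ) (F := ℝ) (n := ∞))).comp (contDiff_snd (𝕜 := ℝ)
    (E := Fin N → ℝ) (F := (Fin (N - 1) → ℝ) × ℝ) (n := ∞)))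
  unfold phase
  split_ifs
  · cases b
    · exact (h 1).neg
    · exact contDiff_const
  · exact contDiff_const
  · exact h _

theorem contDiff_coupling (b : Site) (j : ℕ) : ContDiff ℝ ∞ (fun x : X N => coupling b x j) := by
  unfold coupling
  exact (((contDiff_amp b _).mul (contDiff_phase b _).cos).sub
    (contDiff_const.mul (contDiff_amp b _))).add ((contDiff_amp b _).mul (contDiff_phase b _).cos)

theorem contDiff_flux (b : Site) (j : ℕ) : ContDiff ℝ ∞ (fun x : X N => flux b x j) := by
  unfold flux
  exact ((contDiff_amp b _).mul (contDiff_phase b _).sin).sub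
    ((contDiff_amp b _).mul (contDiff_phase b _).sin)

/-- Weights of the nodes in the balance of fluxes. -/
def weight (b : Site) (j : ℕ) : ℝ :=
  match b with
  | Site.on => if j = 0 then 1 / 2 else 1
  | Site.off => 1

theorem weight_pos (b : Site) (j : ℕ) : 0 < weight b j := by
  unfold weight
  cases b
  · simp only; split_ifs <;> norm_num
  · norm_num

/-- Amplitude times flux is a difference of consecutive edge currents `J n = r_n r_{n+1} sin φ_n`,
so the sum telescopes. At the right end `φ_N = 0` kills the current. At the left end the off-site
condition gives `J 0 = 0`, while the on-site reflection gives `J 0 = -J 1`; the first node then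
contributes `2 J 1`, which its weight `1 / 2` compensates. -/
theorem sum_weight_flux (hN : 2 ≤ N) (b : Site) (x : X N) :
    ∑ j ∈ Finset.range N, weight b j * (amp b x (j + 1) * flux b x j) = 0 := by
  obtain ⟨M, rfl⟩ : ∃ M, N = M + 1 := ⟨N - 1, by omega⟩
  set J : ℕ → ℝ := fun n => amp b x n * amp b x (n + 1) * Real.sin (phase b x n) with hJ
  have h1 : ∀ j, amp b x (j + 1) * flux b x j = J (j + 1) - J j := by
    intro j
    simp only [hJ, flux]; ring
  have hlast : J (M + 1) = 0 := by simp only [hJ]; rw [phase_last (by omega)]; simp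
  simp only [h1]
  rw [Finset.sum_range_succ']
  have h2 : ∀ j ∈ Finset.range M, weight b (j + 1) * (J (j + 1 + 1) - J (j + 1))
      = J (j + 1 + 1) - J (j + 1) := by
    intro j _
    unfold weight
    cases b <;> simp
  rw [Finset.sum_congr rfl h2, Finset.sum_range_sub (fun j => J (j + 1)), hlast]
  cases b
  · have h3 : J 0 = - J 1 := by
      simp only [hJ, amp, phase]
      rw [if_neg (by omega : ¬ (1 = M + 1))]
      rw [if_neg (by omega : ¬ (1 + 1 = M + 1 + 1))]
      simp; ring_nf; simp
    simp [weight, h3]; ring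
  · have h3 : J 0 = 0 := by
      simp [hJ, phase]
    simp [weight, h3]

/-- Weighted sum of squares of the amplitudes. -/
def mass (b : Site) (x : X N) : ℝ := ∑ i : Fin N, weight b i * x.1 i ^ 2

/-- Weighted mean of `om2`. -/
def meanFreq (om2 : ℝ → ℝ → ℝ → ℝ) (b : Site) (x : X N) (μ ε : ℝ) : ℝ :=
  (∑ i : Fin N, weight b i * (om2 (x.1 i) μ ε * x.1 i ^ 2)) / mass b x

theorem mass_pos {b : Site} {x : X N} (i : Fin N) (hx : x.1 i ≠ 0) : 0 < mass b x := by
  have h1 : ∀ i ∈ Finset.univ, 0 ≤ weight b (i : Fin N) * x.1 i ^ 2 := fun i _ =>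
    mul_nonneg (weight_pos b _).le (sq_nonneg _)
  refine lt_of_lt_of_le ?_ (Finset.single_le_sum h1 (Finset.mem_univ i))
  have := weight_pos b i
  positivity

theorem contDiff_mass (b : Site) : ContDiff ℝ ∞ (fun x : X N => mass b x) := by
  unfold mass
  fun_prop

variable {om : ℝ → ℝ → ℝ → ℝ} {om0 : ℝ → ℝ} {om2 : ℝ → ℝ → ℝ → ℝ}

/-- With the fluxes cancelled only the frequency mismatch survives. Thus the frequency of a solution
is forced by its amplitudes and `μ`, and conversely, once the frequency has this value, the
imaginary equation at one node follows from the others. -/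
theorem sum_weight_imagPart (hN : 2 ≤ N) (hom : ∀ r μ ε, om r μ ε = om0 μ + ε ^ 2 * om2 r μ ε)
    (b : Site) (ε : ℝ) (x : X N) (μ : ℝ) (hm : mass b x ≠ 0) :
    ∑ j ∈ Finset.range N, weight b j * (amp b x (j + 1) * imagPart om b ε x μ j)
      = (om0 μ + ε ^ 2 * meanFreq om2 b x μ ε - x.2.2) * mass b x := by
  have h1 : ∀ j ∈ Finset.range N, weight b j * (amp b x (j + 1) * imagPart om b ε x μ j)
      = (om0 μ - x.2.2) * (weight b j * amp b x (j + 1) ^ 2)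
        + ε ^ 2 * (weight b j * (om2 (amp b x (j + 1)) μ ε * amp b x (j + 1) ^ 2))
        + ε * (weight b j * (amp b x (j + 1) * flux b x j)) := by
    intro j _
    unfold imagPart
    rw [hom]; ring
  rw [Finset.sum_congr rfl h1, Finset.sum_add_distrib, Finset.sum_add_distrib, ← Finset.mul_sum,
    ← Finset.mul_sum, ← Finset.mul_sum, sum_weight_flux hN, mul_zero, add_zero]
  have h2 : ∑ j ∈ Finset.range N, weight b j * amp b x (j + 1) ^ 2 = mass b x := by
    rw [← Fin.sum_univ_eq_sum_range (fun j => weight b j * amp b x (j + 1) ^ 2)]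
    simp only [amp_succ]; rfl
  have h3 : ∑ j ∈ Finset.range N, weight b j * (om2 (amp b x (j + 1)) μ ε * amp b x (j + 1) ^ 2)
      = meanFreq om2 b x μ ε * mass b x := by
    rw [← Fin.sum_univ_eq_sum_range
      (fun j => weight b j * (om2 (amp b x (j + 1)) μ ε * amp b x (j + 1) ^ 2))]
    simp only [amp_succ]
    unfold meanFreq
    field_simp
  rw [h2, h3]; ring

theorem contDiffAt_meanFreq (hom2 : ContDiff ℝ ∞ (fun q : ℝ × ℝ × ℝ => om2 q.1 q.2.1 q.2.2))
    {E : Type*} [NormedAddCommGroup E] [NormedSpace ℝ E] {b : Site} {x : E → X N} {μ ε : E → ℝ}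
    {z : E} (hx : ContDiffAt ℝ ∞ x z) (hμ : ContDiffAt ℝ ∞ μ z) (hε : ContDiffAt ℝ ∞ ε z)
    (hm : mass b (x z) ≠ 0) :
    ContDiffAt ℝ ∞ (fun z => meanFreq om2 b (x z) (μ z) (ε z)) z := by
  unfold meanFreq
  have hi : ∀ i : Fin N, ContDiffAt ℝ ∞ (fun z => (x z).1 i) z := fun i =>
    (contDiffAt_pi.1 hx.fst) i
  refine ContDiffAt.div ?_ ((contDiff_mass b).contDiffAt.comp z hx) hm
  refine ContDiffAt.sum fun i _ => contDiffAt_const.mul (ContDiffAt.mul ?_ ((hi i).pow 2))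
  exact hom2.contDiffAt.comp z ((hi i).prodMk (hμ.prodMk hε))

theorem contDiff_realPart {lam : ℝ → ℝ → ℝ} (hlam : ContDiff ℝ ∞ (fun q : ℝ × ℝ => lam q.1 q.2))
    (b : Site) (ε : ℝ) (j : ℕ) : ContDiff ℝ ∞ (fun p : P N => realPart lam b ε p.1 p.2 j) := by
  unfold realPart
  have h1 : ContDiff ℝ ∞ (fun p : P N => amp b p.1 (j + 1)) := (contDiff_amp b _).comp contDiff_fst
  exact ((hlam.comp (h1.prodMk contDiff_snd)).mul h1).add
    (contDiff_const.mul ((contDiff_coupling b j).comp contDiff_fst))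

theorem contDiff_imagPart (hom0 : ContDiff ℝ ∞ om0)
    (hom2 : ContDiff ℝ ∞ (fun q : ℝ × ℝ × ℝ => om2 q.1 q.2.1 q.2.2))
    (hom : ∀ r μ ε, om r μ ε = om0 μ + ε ^ 2 * om2 r μ ε)
    (b : Site) (ε : ℝ) (j : ℕ) : ContDiff ℝ ∞ (fun p : P N => imagPart om b ε p.1 p.2 j) := by
  unfold imagPart
  have h1 : ContDiff ℝ ∞ (fun p : P N => amp b p.1 (j + 1)) := (contDiff_amp b _).comp contDiff_fst
  simp only [hom]
  exact ((((hom0.comp contDiff_snd).add (contDiff_const.mul (hom2.comp (h1.prodMk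
    (contDiff_snd.prodMk contDiff_const))))).sub contDiff_fst.snd.snd).mul h1).add
    (contDiff_const.mul ((contDiff_flux b j).comp contDiff_fst))

theorem contDiff_system {lam : ℝ → ℝ → ℝ} (hlam : ContDiff ℝ ∞ (fun q : ℝ × ℝ => lam q.1 q.2))
    (hom0 : ContDiff ℝ ∞ om0)
    (hom2 : ContDiff ℝ ∞ (fun q : ℝ × ℝ × ℝ => om2 q.1 q.2.1 q.2.2))
    (hom : ∀ r μ ε, om r μ ε = om0 μ + ε ^ 2 * om2 r μ ε)
    (b : Site) (ε : ℝ) : ContDiff ℝ ∞ (fun p : P N => system lam om b ε p.1 p.2) := by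
  rw [contDiff_pi]
  intro j
  have : (fun p : P N => system lam om b ε p.1 p.2 j) = fun p : P N =>
      Complex.equivRealProdCLM.symm (realPart lam b ε p.1 p.2 j, imagPart om b ε p.1 p.2 j) := by
    funext p
    rw [system_apply]; rfl
  rw [this]
  exact Complex.equivRealProdCLM.symm.contDiff.comp
    ((contDiff_realPart hlam b ε j).prodMk (contDiff_imagPart hom0 hom2 hom b ε j))

end Algebra

end

/-! ### The scaled system -/

section

/-- Standing smoothness assumptions on the nonlinearities. -/
structure Model (N : ℕ) (lam : ℝ → ℝ → ℝ) (om : ℝ → ℝ → ℝ → ℝ) (om0 : ℝ → ℝ)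
    (om2 : ℝ → ℝ → ℝ → ℝ) : Prop where
  two_le : 2 ≤ N
  lam_smooth : ContDiff ℝ ∞ (fun q : ℝ × ℝ => lam q.1 q.2)
  om0_smooth : ContDiff ℝ ∞ om0
  om2_smooth : ContDiff ℝ ∞ (fun q : ℝ × ℝ × ℝ => om2 q.1 q.2.1 q.2.2)
  om_eq : ∀ r μ ε, om r μ ε = om0 μ + ε ^ 2 * om2 r μ ε

/-- Scaled unknowns: one for each node and the phase differences. -/
abbrev Y (N : ℕ) : Type := (Fin N → ℝ) × (Fin (N - 1) → ℝ)

/-- Two parameters and the scaled unknowns. -/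
abbrev Z (N : ℕ) : Type := (ℝ × ℝ) × Y N

/-- Scaling of the system: there are `m` inner nodes, and the amplitude at a node behind them is
`tau` times its scaled unknown times the amplitude at the preceding node.  `mu` and `eps` are the
parameters of the original system, `ain` is the amplitude at the nodes before `m`, `sc * xm` the
amplitude at `m`, and `Din`, `Dm`, `L` are the scaled nonlinearities. -/
structure Zone where
  m : ℕ
  mu : ℝ × ℝ → ℝ
  sc : ℝ × ℝ → ℝ
  fin : ℝ × ℝ → ℝ
  fm : ℝ × ℝ → ℝ
  eps : (ℝ × ℝ) × ℝ → ℝ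
  tau : (ℝ × ℝ) × ℝ → ℝ
  L : (ℝ × ℝ) × ℝ → ℝ
  ain : (ℝ × ℝ) × ℝ → ℝ
  Din : (ℝ × ℝ) × ℝ → ℝ
  xm : (ℝ × ℝ) × ℝ → ℝ
  kin : (ℝ × ℝ) × ℝ → ℝ
  km : (ℝ × ℝ) × ℝ → ℝ
  Dm : (ℝ × ℝ) × ℝ → ℝ

namespace Zone

variable {N : ℕ} (zn : Zone)

structure Smooth : Prop where
  mu : ContDiff ℝ ∞ zn.mu
  sc : ContDiff ℝ ∞ zn.sc
  fin : ContDiff ℝ ∞ zn.fin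
  fm : ContDiff ℝ ∞ zn.fm
  eps : ContDiff ℝ ∞ zn.eps
  tau : ContDiff ℝ ∞ zn.tau
  L : ContDiff ℝ ∞ zn.L
  ain : ContDiff ℝ ∞ zn.ain
  Din : ContDiff ℝ ∞ zn.Din
  xm : ContDiff ℝ ∞ zn.xm
  kin : ContDiff ℝ ∞ zn.kin
  km : ContDiff ℝ ∞ zn.km
  Dm : ContDiff ℝ ∞ zn.Dm

/-- The scaled functions represent the original ones. -/
structure Valid (lam : ℝ → ℝ → ℝ) (p : ℝ × ℝ) (g : ℝ) : Prop where
  L : ∀ x, zn.sc p ^ 2 * zn.L (p, x) = lam (zn.sc p * x) (zn.mu p)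
  tau : zn.sc p ^ 2 * zn.tau (p, g) = zn.eps (p, g)
  Din : ∀ ζ, zn.fin p * zn.Din (p, ζ) = lam (zn.ain (p, ζ)) (zn.mu p) * zn.ain (p, ζ)
  kin : zn.fin p * zn.kin (p, g) = zn.eps (p, g)
  Dm : zn.fm p * zn.Dm (p, g)
    = lam (zn.sc p * zn.xm (p, g)) (zn.mu p) * (zn.sc p * zn.xm (p, g))
  km : zn.fm p * zn.km (p, g) = zn.eps (p, g)

/-- The parameters together with the unknown of the node `m`. -/
def pg (z : Z N) : (ℝ × ℝ) × ℝ := (z.1, entry z.2.1 zn.m)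

/-- Unknowns behind `m` are quotients of consecutive amplitudes divided by `tau`, so the amplitude
is recovered as a product. -/
def tailAmp (z : Z N) (n : ℕ) : ℝ :=
  zn.xm (zn.pg z) * ∏ l ∈ Finset.Ioc zn.m n, (zn.tau (zn.pg z) * entry z.2.1 l)

def radius (z : Z N) (n : ℕ) : ℝ :=
  if n < zn.m then zn.ain (z.1, entry z.2.1 n) else zn.sc z.1 * zn.tailAmp z n

/-- The frequency slot is filled with `0`: couplings, fluxes, `mass` and `meanFreq` only see
amplitudes and phases. -/
def pre (z : Z N) : X N := (fun i => zn.radius z (i + 1), z.2.2, 0)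

/-- Quotient of the amplitudes at `n` and `n - 1` behind the node `m`; at `N + 1` the boundary
condition makes it `1`. -/
def ratio (z : Z N) (n : ℕ) : ℝ := if n = N + 1 then 1 else zn.tau (zn.pg z) * entry z.2.1 n

/-- The point of the original phase space that belongs to scaled variables. -/
def pt (om0 : ℝ → ℝ) (om2 : ℝ → ℝ → ℝ → ℝ) (b : Site) (z : Z N) : P N :=
  (((zn.pre z).1, z.2.2, om0 (zn.mu z.1)
    + zn.eps (zn.pg z) ^ 2 * meanFreq om2 b (zn.pre z) (zn.mu z.1) (zn.eps (zn.pg z))), zn.mu z.1)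

/-- Scaled frequency mismatch at the node `n`. -/
def detuning (om2 : ℝ → ℝ → ℝ → ℝ) (b : Site) (z : Z N) (n : ℕ) : ℝ :=
  om2 (amp b (zn.pre z) n) (zn.mu z.1) (zn.eps (zn.pg z))
    - meanFreq om2 b (zn.pre z) (zn.mu z.1) (zn.eps (zn.pg z))

/-- The real equation at the node `j + 1` after division by `fin` before the node `m`, by `fm` at
it, and by `eps` times the preceding amplitude behind it. -/
def ampEq (b : Site) (z : Z N) (j : ℕ) : ℝ :=
  if j + 1 < zn.m then
    zn.Din (z.1, entry z.2.1 (j + 1)) + zn.kin (zn.pg z) * coupling b (zn.pre z) j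
  else if j + 1 = zn.m then zn.Dm (zn.pg z) + zn.km (zn.pg z) * coupling b (zn.pre z) j
  else zn.L (z.1, zn.tailAmp z (j + 1)) * entry z.2.1 (j + 1)
    + zn.tau (zn.pg z) * entry z.2.1 (j + 1)
      * (zn.ratio z (j + 2) * Real.cos (phase b (zn.pre z) (j + 1)) - 2)
    + Real.cos (phase b (zn.pre z) j)

/-- The imaginary equation at the node `j + 2`, after elimination of the frequency and division by
`-eps`, and behind `m` also by the preceding amplitude. The first node is left out, since its
equation follows from the balance of fluxes. -/
def phaseEq (om2 : ℝ → ℝ → ℝ → ℝ) (b : Site) (z : Z N) (j : ℕ) : ℝ :=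
  if j + 2 ≤ zn.m then
    - flux b (zn.pre z) (j + 1)
      - zn.eps (zn.pg z) * amp b (zn.pre z) (j + 2) * zn.detuning om2 b z (j + 2)
  else Real.sin (phase b (zn.pre z) (j + 1)) - zn.tau (zn.pg z) * entry z.2.1 (j + 2)
    * (zn.eps (zn.pg z) * zn.detuning om2 b z (j + 2)
      + zn.ratio z (j + 3) * Real.sin (phase b (zn.pre z) (j + 2)))

/-- The scaled system. -/
def sys (om2 : ℝ → ℝ → ℝ → ℝ) (b : Site) (z : Z N) : Y N :=
  (fun i => zn.ampEq b z i, fun i => zn.phaseEq om2 b z i)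

theorem amp_pre (b : Site) (z : Z N) {n : ℕ} (h1 : 1 ≤ n) (h2 : n ≤ N) :
    amp b (zn.pre z) n = zn.radius z n := by
  have := amp_succ b (zn.pre z) ⟨n - 1, by omega⟩
  simp only [Nat.sub_add_cancel h1] at this
  rw [this]
  simp [pre, Nat.sub_add_cancel h1]

theorem amp_pre_succ (b : Site) (z : Z N) {n : ℕ} (hm : 1 ≤ zn.m) (h1 : zn.m ≤ n) (h2 : n ≤ N) :
    amp b (zn.pre z) (n + 1) = zn.ratio z (n + 1) * amp b (zn.pre z) n := by
  rcases h2.eq_or_lt with h | h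
  · subst h
    rw [amp_last, ratio, if_pos rfl, one_mul]
  · rw [zn.amp_pre b z (by omega) (by omega), zn.amp_pre b z (by omega) (by omega), ratio,
      if_neg (by omega), radius, radius, if_neg (by omega), if_neg (by omega), tailAmp, tailAmp,
      Finset.prod_Ioc_succ_top (by omega)]
    ring

variable {zn} {lam : ℝ → ℝ → ℝ} {om2 : ℝ → ℝ → ℝ → ℝ} {b : Site} {z : Z N}

/-- Behind `m`, `lam = sc² L` and `eps = sc² tau`, while the amplitude is `tau` times the unknown
times the preceding amplitude. Hence nonlinearity and coupling share the factor `eps` times the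
preceding amplitude. -/
theorem realPart_pre (hm : 1 ≤ zn.m) (hv : zn.Valid lam z.1 (entry z.2.1 zn.m)) {j : ℕ}
    (hj : j < N) : realPart lam b (zn.eps (zn.pg z)) (zn.pre z) (zn.mu z.1) j
      = (if j + 1 < zn.m then zn.fin z.1 else if j + 1 = zn.m then zn.fm z.1
          else zn.eps (zn.pg z) * amp b (zn.pre z) j) * zn.ampEq b z j := by
  unfold realPart ampEq
  have ha : amp b (zn.pre z) (j + 1) = zn.radius z (j + 1) := zn.amp_pre b z (by omega) (by omega)
  split_ifs with h1 h2
  · have e : zn.radius z (j + 1) = zn.ain (z.1, entry z.2.1 (j + 1)) := by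
      rw [radius, if_pos h1]
    rw [ha, e, mul_add, hv.Din, ← mul_assoc]
    congr 2
    exact hv.kin.symm
  · have e : zn.radius z (j + 1) = zn.sc z.1 * zn.xm (zn.pg z) := by
      rw [radius, if_neg h1, tailAmp, h2]; simp
    rw [ha, e, mul_add]
    have h3 := hv.Dm
    have h4 := hv.km
    change zn.fm z.1 * zn.Dm (zn.pg z) = _ at h3
    change zn.fm z.1 * zn.km (zn.pg z) = _ at h4
    rw [h3, ← mul_assoc (zn.fm z.1), h4]; rfl
  · have h3 := zn.amp_pre_succ b z hm (n := j) (by omega) (by omega)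
    have h4 := zn.amp_pre_succ b z hm (n := j + 1) (by omega) (by omega)
    have e : zn.radius z (j + 1) = zn.sc z.1 * zn.tailAmp z (j + 1) := by
      rw [radius, if_neg h1]
    have h5 := hv.L (zn.tailAmp z (j + 1))
    have h6 := hv.tau
    change _ * zn.tau (zn.pg z) = zn.eps (zn.pg z) at h6
    have h7 : zn.ratio z (j + 1) = zn.tau (zn.pg z) * entry z.2.1 (j + 1) := by
      rw [ratio, if_neg (by omega)]
    unfold coupling
    rw [h4]
    have h8 : lam (amp b (zn.pre z) (j + 1)) (zn.mu z.1)
        = zn.sc z.1 ^ 2 * zn.L (z.1, zn.tailAmp z (j + 1)) := by rw [h5, ha, e]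
    rw [h8, h3, h7, ← h6]
    ring

theorem imagPart_pre {om : ℝ → ℝ → ℝ → ℝ} {om0 : ℝ → ℝ}
    (hom : ∀ r μ ε, om r μ ε = om0 μ + ε ^ 2 * om2 r μ ε) (hm : 1 ≤ zn.m) {x : X N}
    (hx1 : x.1 = (zn.pre z).1) (hx2 : x.2.1 = z.2.2) {j : ℕ} (hj : j + 1 < N) :
    imagPart om b (zn.eps (zn.pg z)) x (zn.mu z.1) (j + 1)
      = -(zn.eps (zn.pg z) * (if j + 2 ≤ zn.m then 1 else amp b (zn.pre z) (j + 1)))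
          * zn.phaseEq om2 b z j
        + (om0 (zn.mu z.1) + zn.eps (zn.pg z) ^ 2
            * meanFreq om2 b (zn.pre z) (zn.mu z.1) (zn.eps (zn.pg z)) - x.2.2)
          * amp b (zn.pre z) (j + 2) := by
  have hA : ∀ n, amp b x n = amp b (zn.pre z) n := amp_congr hx1
  have hP : ∀ n, phase b x n = phase b (zn.pre z) n := phase_congr hx2
  unfold imagPart phaseEq detuning flux
  simp only [hom, hA, hP]
  split_ifs with h1
  · ring
  · have h3 := zn.amp_pre_succ b z hm (n := j + 1) (by omega) (by omega)
    have h4 := zn.amp_pre_succ b z hm (n := j + 2) (by omega) (by omega)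
    have h7 : zn.ratio z (j + 2) = zn.tau (zn.pg z) * entry z.2.1 (j + 2) := by
      rw [ratio, if_neg (by omega)]
    have e1 : j + 1 + 1 = j + 2 := rfl
    have e2 : j + 1 + 2 = j + 3 := rfl
    have e3 : j + 2 + 1 = j + 3 := rfl
    rw [e1] at h3
    rw [e3] at h4
    rw [e1, e2, h4, h3, h7]
    ring

/-- Zeros of the scaled system give solutions of the original one. -/
theorem pt_mem_solutions {om : ℝ → ℝ → ℝ → ℝ} {om0 : ℝ → ℝ} (hM : Model N lam om om0 om2)
    (hm : 1 ≤ zn.m) (hv : zn.Valid lam z.1 (entry z.2.1 zn.m)) (hr : (zn.pre z).1 ⟨0, by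
      have := hM.two_le; omega⟩ ≠ 0)
    (hz : zn.sys om2 b z = 0) : zn.pt om0 om2 b z ∈ solutions lam om b (zn.eps (zn.pg z)) := by
  have hN := hM.two_le
  have hmass := (mass_pos (b := b) (x := zn.pre z) _ hr).ne'
  set x := (zn.pt om0 om2 b z).1 with hx
  have hx1 : x.1 = (zn.pre z).1 := rfl
  have hA : ∀ n, amp b x n = amp b (zn.pre z) n := amp_congr hx1
  have hP : ∀ n, phase b x n = phase b (zn.pre z) n := phase_congr rfl
  have him : ∀ j, j + 1 < N → imagPart om b (zn.eps (zn.pg z)) x (zn.mu z.1) (j + 1) = 0 := by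
    intro j hj
    have h0 : zn.phaseEq om2 b z j = 0 := congrFun (congrArg Prod.snd hz) ⟨j, by omega⟩
    rw [imagPart_pre hM.om_eq hm hx1 rfl hj, h0]
    simp [hx, pt]
  rw [mem_solutions_iff]
  intro j hj
  constructor
  · have h0 : zn.ampEq b z j = 0 := congrFun (congrArg Prod.fst hz) ⟨j, hj⟩
    have := realPart_pre (b := b) hm hv hj
    rw [h0, mul_zero] at this
    rw [← this]
    unfold realPart coupling
    change lam (amp b x _) _ * amp b x _ + _ * (amp b x _ * Real.cos (phase b x _) - 2 * amp b x _
      + amp b x _ * Real.cos (phase b x _)) = _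
    simp only [hA, hP]; rfl
  -- In the balance of fluxes every term but that of the first node vanishes; weight and amplitude
  -- there are nonzero, so its imaginary equation holds too.
  · rcases j with _ | j
    · have h1 := sum_weight_imagPart hN hM.om_eq b (zn.eps (zn.pg z)) x (zn.mu z.1)
        (by exact hmass)
      have h2 : om0 (zn.mu z.1) + zn.eps (zn.pg z) ^ 2 * meanFreq om2 b x (zn.mu z.1)
          (zn.eps (zn.pg z)) - x.2.2 = 0 := sub_self _
      rw [h2, zero_mul, Finset.sum_eq_single 0] at h1
      · rcases mul_eq_zero.1 h1 with h | h
        · exact absurd h (weight_pos b 0).ne'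
        · rcases mul_eq_zero.1 h with h | h
          · rw [hA] at h
            exact absurd (by rw [← amp_succ b]; exact h) hr
          · exact h
      · intro k hk hk0
        obtain ⟨k, rfl⟩ : ∃ l, k = l + 1 := ⟨k - 1, by omega⟩
        rw [him k (by simpa using hk)]; ring
      · intro h; simp at h; omega
    · exact him j hj

end Zone

end

/-! ### Smoothness of the scaled system and its linearization at unperturbed parameters -/

section

theorem entry_add_smul {M : ℕ} (u v : Fin M → ℝ) (t : ℝ) (n : ℕ) :
    entry (u + t • v) n = entry u n + t * entry v n := by
  unfold entry
  split_ifs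
  · simp
  · simp

theorem entry_zero {M : ℕ} (n : ℕ) : entry (0 : Fin M → ℝ) n = 0 := by
  unfold entry
  split_ifs <;> rfl

theorem entry_succ {M : ℕ} (u : Fin M → ℝ) {j : ℕ} (hj : j < M) : entry u (j + 1) = u ⟨j, hj⟩ := by
  unfold entry
  rw [dif_pos (by omega)]
  rfl

theorem eq_zero_of_entry {M : ℕ} {u : Fin M → ℝ} (h : ∀ j < M, entry u (j + 1) = 0) : u = 0 := by
  funext i
  have := h i i.2
  rwa [entry_succ u i.2] at this

theorem phase_zero {N : ℕ} (b : Site) {x : X N} (hx : x.2.1 = 0) (n : ℕ) : phase b x n = 0 := by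
  unfold phase
  simp only [hx, entry_zero, neg_zero]
  cases b <;> simp

namespace Zone

variable {N : ℕ} {zn : Zone}

theorem contDiff_pg : ContDiff ℝ ∞ (fun z : Z N => zn.pg z) :=
  contDiff_fst.prodMk ((contDiff_entry _).comp contDiff_snd.fst)

theorem contDiff_scaled (n : ℕ) : ContDiff ℝ ∞ (fun z : Z N => entry z.2.1 n) :=
  (contDiff_entry _).comp contDiff_snd.fst

theorem contDiff_tailAmp (hs : zn.Smooth) (n : ℕ) :
    ContDiff ℝ ∞ (fun z : Z N => zn.tailAmp z n) := by
  unfold tailAmp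
  refine (hs.xm.comp contDiff_pg).mul (contDiff_prod fun l _ => ?_)
  exact (hs.tau.comp contDiff_pg).mul (contDiff_scaled _)

theorem contDiff_radius (hs : zn.Smooth) (n : ℕ) :
    ContDiff ℝ ∞ (fun z : Z N => zn.radius z n) := by
  unfold radius
  split_ifs
  · exact hs.ain.comp (contDiff_fst.prodMk (contDiff_scaled _))
  · exact (hs.sc.comp contDiff_fst).mul (contDiff_tailAmp hs n)

theorem contDiff_pre (hs : zn.Smooth) : ContDiff ℝ ∞ (fun z : Z N => zn.pre z) := by
  unfold pre
  exact (contDiff_pi.2 fun i => contDiff_radius hs _).prodMk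
    (contDiff_snd.snd.prodMk contDiff_const)

theorem contDiff_ratio (hs : zn.Smooth) (n : ℕ) : ContDiff ℝ ∞ (fun z : Z N => zn.ratio z n) := by
  unfold ratio
  split_ifs
  · exact contDiff_const
  · exact (hs.tau.comp contDiff_pg).mul (contDiff_scaled _)

theorem contDiff_eps (hs : zn.Smooth) : ContDiff ℝ ∞ (fun z : Z N => zn.eps (zn.pg z)) :=
  hs.eps.comp contDiff_pg

theorem contDiff_ampEq (hs : zn.Smooth) (b : Site) (j : ℕ) :
    ContDiff ℝ ∞ (fun z : Z N => zn.ampEq b z j) := by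
  have hc := (contDiff_coupling b j).comp (contDiff_pre (N := N) hs)
  have hp := fun n => (contDiff_phase b n).comp (contDiff_pre (N := N) hs)
  unfold ampEq
  split_ifs
  · exact (hs.Din.comp (contDiff_fst.prodMk (contDiff_scaled _))).add
      ((hs.kin.comp contDiff_pg).mul hc)
  · exact (hs.Dm.comp contDiff_pg).add ((hs.km.comp contDiff_pg).mul hc)
  · exact (((hs.L.comp (contDiff_fst.prodMk (contDiff_tailAmp hs _))).mul (contDiff_scaled _)).add
      (((hs.tau.comp contDiff_pg).mul (contDiff_scaled _)).mul
        (((contDiff_ratio hs _).mul (hp _).cos).sub contDiff_const))).add (hp _).cos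

theorem contDiffAt_meanFreq_pre (hs : zn.Smooth) {om2 : ℝ → ℝ → ℝ → ℝ}
    (hom2 : ContDiff ℝ ∞ (fun q : ℝ × ℝ × ℝ => om2 q.1 q.2.1 q.2.2)) {b : Site} {z : Z N}
    (hz : mass b (zn.pre z) ≠ 0) :
    ContDiffAt ℝ ∞ (fun z : Z N => meanFreq om2 b (zn.pre z) (zn.mu z.1) (zn.eps (zn.pg z))) z :=
  contDiffAt_meanFreq hom2 (contDiff_pre hs).contDiffAt (hs.mu.comp contDiff_fst).contDiffAt
    (contDiff_eps hs).contDiffAt hz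

theorem contDiffAt_sys (hs : zn.Smooth) {om2 : ℝ → ℝ → ℝ → ℝ}
    (hom2 : ContDiff ℝ ∞ (fun q : ℝ × ℝ × ℝ => om2 q.1 q.2.1 q.2.2)) {b : Site} {z : Z N}
    (hz : mass b (zn.pre z) ≠ 0) : ContDiffAt ℝ ∞ (fun z : Z N => zn.sys om2 b z) z := by
  refine ContDiffAt.prodMk (contDiffAt_pi.2 fun i => (contDiff_ampEq hs b i).contDiffAt)
    (contDiffAt_pi.2 fun i => ?_)
  have hf := fun n => ((contDiff_flux b n).comp (contDiff_pre (N := N) hs)).contDiffAt (x := z)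
  have hp := fun n => ((contDiff_phase b n).comp (contDiff_pre (N := N) hs)).contDiffAt (x := z)
  have ha := fun n => ((contDiff_amp b n).comp (contDiff_pre (N := N) hs)).contDiffAt (x := z)
  have he := (contDiff_eps (N := N) hs).contDiffAt (x := z)
  have hd : ∀ n, ContDiffAt ℝ ∞ (fun z : Z N => zn.detuning om2 b z n) z := fun n =>
    (hom2.contDiffAt.comp z ((ha n).prodMk
      ((hs.mu.comp contDiff_fst).contDiffAt.prodMk he))).sub (contDiffAt_meanFreq_pre hs hom2 hz)
  unfold phaseEq
  split_ifs
  · exact (hf _).neg.sub ((he.mul (ha _)).mul (hd _))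
  · exact (hp _).sin.sub ((((hs.tau.comp contDiff_pg).mul (contDiff_scaled _)).contDiffAt).mul
      ((he.mul (hd _)).add ((contDiff_ratio hs _).contDiffAt.mul (hp _).sin)))

theorem contDiffAt_pt (hs : zn.Smooth) {om0 : ℝ → ℝ} (hom0 : ContDiff ℝ ∞ om0)
    {om2 : ℝ → ℝ → ℝ → ℝ}
    (hom2 : ContDiff ℝ ∞ (fun q : ℝ × ℝ × ℝ => om2 q.1 q.2.1 q.2.2)) {b : Site} {z : Z N}
    (hz : mass b (zn.pre z) ≠ 0) : ContDiffAt ℝ ∞ (fun z : Z N => zn.pt om0 om2 b z) z := by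
  have hμ : ContDiffAt ℝ ∞ (fun z : Z N => zn.mu z.1) z := (hs.mu.comp contDiff_fst).contDiffAt
  exact ((contDiff_pre hs).contDiffAt.fst.prodMk (contDiffAt_snd.snd.prodMk
    ((hom0.contDiffAt.comp z hμ).add (((contDiff_eps hs).contDiffAt.pow 2).mul
      (contDiffAt_meanFreq_pre hs hom2 hz))))).prodMk hμ

variable (zn)

/-- The unperturbed values of the scaled unknowns. -/
def baseVec (N : ℕ) (p : ℝ × ℝ) (a g : ℝ) : Fin N → ℝ := fun i =>
  if (i : ℕ) + 1 < zn.m then a else if (i : ℕ) + 1 = zn.m then g else -1 / zn.L (p, 0)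

theorem entry_baseVec {p : ℝ × ℝ} {a g : ℝ} {j : ℕ} (hj : j < N) :
    entry (zn.baseVec N p a g) (j + 1)
      = if j + 1 < zn.m then a else if j + 1 = zn.m then g else -1 / zn.L (p, 0) := by
  rw [entry_succ _ hj]; rfl

/-- Nondegenerate solution of the scaled system at an unperturbed parameter. -/
structure Base (N : ℕ) (b : Site) (p : ℝ × ℝ) (a g : ℝ) : Prop where
  tau : ∀ g, zn.tau (p, g) = 0
  eps : ∀ g, zn.eps (p, g) = 0
  L : zn.L (p, 0) < 0
  inner : (∀ g, zn.kin (p, g) = 0) ∨ (∀ ζ, zn.ain (p, ζ) = 1) ∧ ∀ g, zn.sc p * zn.xm (p, g) = 1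
  Din : zn.Din (p, a) = 0
  Din_deriv : ∃ D, D ≠ 0 ∧ HasDerivAt (fun ζ => zn.Din (p, ζ)) D a
  ain : 0 < zn.ain (p, a)
  first : zn.m = 1 → 0 < zn.sc p * zn.xm (p, g)
  Dm : zn.Dm (p, g) + zn.km (p, g)
    * coupling b (zn.pre (N := N) (p, zn.baseVec N p a g, 0)) (zn.m - 1) = 0
  Dm_deriv : ∃ D, D ≠ 0 ∧ HasDerivAt (fun t => zn.Dm (p, t) + zn.km (p, t)
    * coupling b (zn.pre (N := N) (p, zn.baseVec N p a t, 0)) (zn.m - 1)) D g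

variable {zn}

theorem tailAmp_eq_zero {z : Z N} (h : zn.tau (zn.pg z) = 0) {n : ℕ} (hn : zn.m < n) :
    zn.tailAmp z n = 0 := by
  rw [tailAmp, Finset.prod_eq_zero (i := n) (by simp [hn]) (by rw [h, zero_mul]), mul_zero]

/-- At an unperturbed parameter with zero phases the inner equations decouple. -/
theorem Base.ampEq_inner {b : Site} {p : ℝ × ℝ} {a g : ℝ} (hb : zn.Base N b p a g)
    (hmN : zn.m ≤ N) (ζ : Fin N → ℝ) {j : ℕ} (hj : j + 1 < zn.m) :
    zn.ampEq b (p, ζ, 0) j = zn.Din (p, entry ζ (j + 1)) := by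
  rw [ampEq, if_pos hj]
  rcases hb.inner with h | ⟨h1, h2⟩
  · simp [pg, h]
  · have hR : ∀ n, 1 ≤ n → n ≤ zn.m → amp b (zn.pre (N := N) (p, ζ, 0)) n = 1 := by
      intro n h3 h4
      rw [zn.amp_pre b _ h3 (by omega), radius]
      split_ifs with h5
      · exact h1 _
      · have : n = zn.m := by omega
        subst this
        simp [tailAmp, pg, h2]
    have hP := phase_zero (N := N) b (x := zn.pre (N := N) (p, ζ, 0)) rfl
    -- For `j = 0` the reflected neighbour is the node `2` or the node `1`, and both have index at
    -- most `m` here.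
    have h0 : amp b (zn.pre (N := N) (p, ζ, 0)) j = 1 := by
      rcases Nat.eq_zero_or_pos j with h | h
      · subst h
        have e1 := hR 1 le_rfl (by omega)
        have e2 := hR 2 (by omega) (by omega)
        unfold amp at e1 e2 ⊢
        rw [if_neg (by omega), if_neg (by omega)] at e1 e2
        rw [if_pos rfl]
        cases b
        · exact e2
        · exact e1
      · exact hR j h (by omega)
    -- The coupling is a discrete Laplacian, and it annihilates constant amplitudes with zero
    -- phases.
    simp only [coupling, hP, hR (j + 1) (by omega) (by omega), hR (j + 2) (by omega) (by omega), h0,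
      Real.cos_zero]
    norm_num

/-- With `tau = 0` all amplitudes behind `m` vanish, so `L` is taken at `0` and of the coupling only
the drive by the preceding node is left, normalized to `1` by the scaling. Hence the value `-1 / L`
in `baseVec`. -/
theorem Base.ampEq_outer {b : Site} {p : ℝ × ℝ} {a g : ℝ} (hb : zn.Base N b p a g)
    (ζ : Fin N → ℝ) {j : ℕ} (hj : zn.m < j + 1) :
    zn.ampEq b (p, ζ, 0) j = zn.L (p, 0) * entry ζ (j + 1) + 1 := by
  have hP := phase_zero (N := N) b (x := zn.pre (N := N) (p, ζ, 0)) rfl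
  have ht : zn.tau (zn.pg (N := N) (p, ζ, 0)) = 0 := hb.tau _
  rw [ampEq, if_neg (by omega), if_neg (by omega), tailAmp_eq_zero ht hj, ht]
  simp [hP]

theorem Base.phaseEq {b : Site} {om2 : ℝ → ℝ → ℝ → ℝ} {p : ℝ × ℝ} {a g : ℝ}
    (hb : zn.Base N b p a g) (ζ : Y N) (j : ℕ) :
    zn.phaseEq om2 b (p, ζ) j = if j + 2 ≤ zn.m then - flux b (zn.pre (p, ζ)) (j + 1)
      else Real.sin (phase b (zn.pre (p, ζ)) (j + 1)) := by
  have h1 : zn.eps (zn.pg (N := N) (p, ζ)) = 0 := hb.eps _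
  have h2 : zn.tau (zn.pg (N := N) (p, ζ)) = 0 := hb.tau _
  rw [Zone.phaseEq, h1, h2]
  simp

theorem Base.sys_eq_zero {b : Site} {om2 : ℝ → ℝ → ℝ → ℝ} {p : ℝ × ℝ} {a g : ℝ}
    (hb : zn.Base N b p a g) (hmN : zn.m ≤ N) :
    zn.sys om2 b (p, zn.baseVec N p a g, 0) = 0 := by
  have hP := phase_zero (N := N) b (x := zn.pre (N := N) (p, zn.baseVec N p a g, 0)) rfl
  refine Prod.ext (funext fun i => ?_) (funext fun i => ?_)
  · change zn.ampEq b _ (i : ℕ) = 0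
    rcases lt_trichotomy ((i : ℕ) + 1) zn.m with h | h | h
    · rw [hb.ampEq_inner hmN _ h, zn.entry_baseVec i.2, if_pos h, hb.Din]
    · rw [ampEq, if_neg (by omega), if_pos h]
      have h1 := hb.Dm
      have h2 : zn.pg (N := N) (p, zn.baseVec N p a g, 0) = (p, g) := by
        rw [pg, ← h, zn.entry_baseVec i.2, if_neg (by omega), if_pos h]
      rw [h2]
      rw [← h] at h1
      exact h1
    · rw [hb.ampEq_outer _ h, zn.entry_baseVec i.2, if_neg (by omega), if_neg (by omega)]
      have := hb.L.ne
      field_simp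
      norm_num
  · change zn.phaseEq om2 b _ (i : ℕ) = 0
    rw [hb.phaseEq]
    simp [flux, hP]

theorem Base.radius_pos {b : Site} {p : ℝ × ℝ} {a g : ℝ} (hb : zn.Base N b p a g)
    (hmN : zn.m ≤ N) {n : ℕ} (hn : n < zn.m) (h1 : 1 ≤ n) (φ : Fin (N - 1) → ℝ) :
    0 < zn.radius (N := N) (p, zn.baseVec N p a g, φ) n := by
  obtain ⟨j, rfl⟩ : ∃ j, n = j + 1 := ⟨n - 1, by omega⟩
  rw [radius, if_pos hn]
  simp only
  rw [zn.entry_baseVec (by omega), if_pos hn]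
  exact hb.ain

theorem Base.first_pos {b : Site} {p : ℝ × ℝ} {a g : ℝ} (hb : zn.Base N b p a g)
    (hm : 1 ≤ zn.m) (hmN : zn.m ≤ N) : 0 < zn.radius (N := N) (p, zn.baseVec N p a g, 0) 1 := by
  rcases hm.eq_or_lt with h | h
  · rw [radius, if_neg (by omega), tailAmp]
    have h2 : zn.pg (N := N) (p, zn.baseVec N p a g, 0) = (p, g) := by
      rw [pg, ← h]
      have := zn.entry_baseVec (N := N) (p := p) (a := a) (g := g) (j := 0) (by omega)
      rw [if_neg (by omega), if_pos (by omega)] at this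
      exact congrArg (Prod.mk p) this
    rw [h2]
    simpa [← h] using hb.first h.symm
  · exact hb.radius_pos hmN h le_rfl _

/-- The linearization of the scaled system in the unknowns is injective at the base. -/
theorem Base.injective {b : Site} {om2 : ℝ → ℝ → ℝ → ℝ} {p : ℝ × ℝ} {a g : ℝ}
    (hb : zn.Base N b p a g) (hs : zn.Smooth)
    (hom2 : ContDiff ℝ ∞ (fun q : ℝ × ℝ × ℝ => om2 q.1 q.2.1 q.2.2)) (hN : 2 ≤ N)
    (hm : 1 ≤ zn.m) (hmN : zn.m ≤ N) (v : Y N)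
    (hv : fderiv ℝ (fun z : Z N => zn.sys om2 b z) (p, zn.baseVec N p a g, 0) (0, v) = 0) :
    v = 0 := by
  obtain ⟨ζ', φ'⟩ := v
  set y₀ : Y N := (zn.baseVec N p a g, 0) with hy₀
  have hmass : mass b (zn.pre (N := N) (p, y₀)) ≠ 0 :=
    (mass_pos ⟨0, by omega⟩ (hb.first_pos hm hmN).ne').ne'
  have hline : ∀ v : Z N, HasDerivAt (fun t : ℝ => ((p, y₀) : Z N) + t • v) v 0 := fun v => by
    simpa using ((hasDerivAt_id (0 : ℝ)).smul_const v).const_add ((p, y₀) : Z N)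
  have hD : HasDerivAt (fun t : ℝ => zn.sys om2 b (((p, y₀) : Z N) + t • ((0, ζ', φ') : Z N))) 0 0 := by
    have h1 : HasFDerivAt (fun z : Z N => zn.sys om2 b z)
        (fderiv ℝ (fun z : Z N => zn.sys om2 b z) (p, y₀))
        (((p, y₀) : Z N) + (0 : ℝ) • ((0, ζ', φ') : Z N)) := by
      rw [zero_smul, add_zero]
      exact ((contDiffAt_sys hs hom2 hmass).differentiableAt (by simp)).hasFDerivAt
    have := h1.comp_hasDerivAt 0 (hline (0, ζ', φ'))
    rwa [hv] at this
  have hz : ∀ t : ℝ, ((p, y₀) : Z N) + t • ((0, ζ', φ') : Z N)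
      = (p, zn.baseVec N p a g + t • ζ', t • φ') := by
    intro t; simp [hy₀]
  simp only [hz] at hD
  have hamp : ∀ i : Fin N, HasDerivAt (fun t : ℝ => zn.ampEq b
      ((p, zn.baseVec N p a g + t • ζ', t • φ') : Z N) i) 0 0 := fun i =>
    hasDerivAt_pi.1 (HasFDerivAt.hasDerivAt hD.hasFDerivAt.fst) i |>.congr_deriv (by simp)
  have hph : ∀ i : Fin (N - 1), HasDerivAt (fun t : ℝ => zn.phaseEq om2 b
      ((p, zn.baseVec N p a g + t • ζ', t • φ') : Z N) i) 0 0 := fun i =>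
    hasDerivAt_pi.1 (HasFDerivAt.hasDerivAt hD.hasFDerivAt.snd) i |>.congr_deriv (by simp)
  -- the phases
  have hphase : ∀ n, 1 ≤ n → ∀ t : ℝ, phase b (zn.pre
      ((p, zn.baseVec N p a g + t • ζ', t • φ') : Z N)) n = t * entry φ' n := by
    intro n hn t
    have h0 := entry_add_smul (0 : Fin (N - 1) → ℝ) φ' t n
    rw [zero_add, entry_zero, zero_add] at h0
    unfold phase
    rw [if_neg (by omega)]
    split_ifs with h
    · have : entry φ' n = 0 := by unfold entry; rw [dif_neg (by omega)]
      rw [this, mul_zero]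
    · exact h0
  have hsin : ∀ n, 1 ≤ n → HasDerivAt (fun t : ℝ => Real.sin (phase b (zn.pre
      ((p, zn.baseVec N p a g + t • ζ', t • φ') : Z N)) n)) (entry φ' n) 0 := by
    intro n hn
    simp only [hphase n hn]
    have := ((hasDerivAt_id (0 : ℝ)).mul_const (entry φ' n)).sin
    simpa using this
  have hcont : ∀ n, DifferentiableAt ℝ (fun t : ℝ => amp b (zn.pre
      ((p, zn.baseVec N p a g + t • ζ', t • φ') : Z N)) n) 0 := by
    intro n
    have h1 := ((contDiff_amp b n).comp (contDiff_pre (N := N) hs)).differentiable (by simp)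
    simp only [← hz]
    exact DifferentiableAt.comp (0 : ℝ) (h1 _) (hline _).differentiableAt
  have hprod : ∀ k n, 1 ≤ n → HasDerivAt (fun t : ℝ => amp b (zn.pre
      ((p, zn.baseVec N p a g + t • ζ', t • φ') : Z N)) k * Real.sin (phase b (zn.pre
      ((p, zn.baseVec N p a g + t • ζ', t • φ') : Z N)) n))
      (amp b (zn.pre ((p, y₀) : Z N)) k * entry φ' n) 0 := by
    intro k n hn
    have := (hcont k).hasDerivAt.mul (hsin n hn)
    refine this.congr_deriv ?_
    rw [hphase n hn]
    simp [hy₀]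
  -- The phase rows are triangular when read from the right end. The start `n = N` lies beyond the
  -- last entry, where `entry` is `0` by default; each further row has a positive amplitude, or `1`,
  -- on its diagonal.
  have hφ : ∀ k n, 1 ≤ n → n + k = N → entry φ' n = 0 := by
    intro k
    induction k with
    | zero =>
      intro n hn hk
      unfold entry; rw [dif_neg (by omega)]
    | succ k ih =>
      intro n hn hk
      obtain ⟨j, rfl⟩ : ∃ j, n = j + 1 := ⟨n - 1, by omega⟩
      have h1 := hph ⟨j, by omega⟩
      simp only [hb.phaseEq] at h1
      split_ifs at h1 with h2
      · have h3 := ((hprod (j + 3) (j + 2) (by omega)).sub (hprod (j + 1) (j + 1) (by omega))).neg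
        have h4 := h1.unique h3
        rw [ih (j + 2) (by omega) (by omega), mul_zero, zero_sub, neg_neg] at h4
        rcases mul_eq_zero.1 h4.symm with h5 | h5
        · rw [zn.amp_pre b _ (by omega) (by omega)] at h5
          exact absurd h5 (hb.radius_pos hmN (by omega) (by omega) _).ne'
        · exact h5
      · exact ((h1.unique (hsin (j + 1) (by omega)))).symm
  have hφ0 : φ' = 0 := eq_zero_of_entry fun j hj => hφ (N - (j + 1)) (j + 1) (by omega) (by omega)
  subst hφ0
  simp only [smul_zero] at hamp
  -- the amplitudes other than the one at `m`
  have hζ : ∀ j < N, j + 1 ≠ zn.m → entry ζ' (j + 1) = 0 := by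
    intro j hj hjm
    have h1 := hamp ⟨j, hj⟩
    rcases lt_or_gt_of_ne hjm with h | h
    · simp only [hb.ampEq_inner hmN _ h, entry_add_smul, zn.entry_baseVec hj, if_pos h] at h1
      obtain ⟨D, hD0, hD⟩ := hb.Din_deriv
      have h2 : HasDerivAt (fun t : ℝ => a + t * entry ζ' (j + 1)) (entry ζ' (j + 1)) 0 := by
        simpa using ((hasDerivAt_id (0 : ℝ)).mul_const (entry ζ' (j + 1))).const_add a
      have h3 : HasDerivAt (fun ζ => zn.Din (p, ζ)) D (a + 0 * entry ζ' (j + 1)) := by simpa using hD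
      have h5 := h3.comp (0 : ℝ) h2
      have h4 := h5.unique h1
      exact (mul_eq_zero.1 h4).resolve_left hD0
    · simp only [hb.ampEq_outer _ h, entry_add_smul] at h1
      have h2 : HasDerivAt (fun t : ℝ => zn.L (p, 0) * (entry (zn.baseVec N p a g) (j + 1)
          + t * entry ζ' (j + 1)) + 1) (zn.L (p, 0) * entry ζ' (j + 1)) 0 := by
        simpa using ((((hasDerivAt_id (0 : ℝ)).mul_const (entry ζ' (j + 1))).const_add
          (entry (zn.baseVec N p a g) (j + 1))).const_mul (zn.L (p, 0))).add_const 1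
      exact (mul_eq_zero.1 (h2.unique h1)).resolve_left hb.L.ne
  have hζm : entry ζ' zn.m = 0 := by
    obtain ⟨j, hj⟩ : ∃ j, zn.m = j + 1 := ⟨zn.m - 1, by omega⟩
    -- The remaining direction changes only the unknown at `m`, so the line stays in the family
    -- `baseVec` and the row `m` becomes exactly the function whose derivative `Dm_deriv` provides.
    have hvec : ∀ t : ℝ, zn.baseVec N p a g + t • ζ'
        = zn.baseVec N p a (g + t * entry ζ' zn.m) := by
      intro t
      funext i
      have h1 := hζ i i.2
      rw [entry_succ _ i.2] at h1
      simp only [baseVec, Pi.add_apply, Pi.smul_apply, smul_eq_mul]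
      by_cases h2 : (i : ℕ) + 1 = zn.m
      · rw [if_neg (by omega), if_pos h2, if_neg (by omega), if_pos h2, ← h2, entry_succ _ i.2]
      · rw [h1 h2, mul_zero, add_zero]
        simp [h2]
    have h1 := hamp ⟨j, by omega⟩
    simp only [hvec] at h1
    have hpg : ∀ s : ℝ, zn.pg (N := N) (p, zn.baseVec N p a s, 0) = (p, s) := by
      intro s
      have := zn.entry_baseVec (N := N) (p := p) (a := a) (g := s) (j := j) (by omega)
      rw [if_neg (by omega), if_pos (by omega), ← hj] at this
      exact congrArg (Prod.mk p) this
    simp only [ampEq, if_neg (by omega : ¬ (j + 1 < zn.m)), if_pos hj.symm, hpg] at h1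
    obtain ⟨D, hD0, hD⟩ := hb.Dm_deriv
    have h2 : HasDerivAt (fun t : ℝ => g + t * entry ζ' zn.m) (entry ζ' zn.m) 0 := by
      simpa using ((hasDerivAt_id (0 : ℝ)).mul_const (entry ζ' zn.m)).const_add g
    have h3 := hD
    have hj' : zn.m - 1 = j := by omega
    rw [hj', show g = g + 0 * entry ζ' zn.m by ring] at h3
    have h5 := h3.comp (0 : ℝ) h2
    have h4 := h5.unique h1
    exact (mul_eq_zero.1 h4).resolve_left hD0
  have hζ0 : ζ' = 0 := eq_zero_of_entry fun j hj => by
    by_cases h : j + 1 = zn.m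
    · rw [h, hζm]
    · exact hζ j hj h
  rw [hζ0]; rfl

end Zone

end

/-! ### Local inverses of the scaling and lifts of tangent vectors -/

section

/-- Rows of the original and of the scaled system differ by nonvanishing factors, up to terms that
vanish to first order. At a zero the product rule ignores the derivative of the factor, so a row
constant to first order stays so after division. -/
theorem deriv_eq_zero_of_mul {f k h : ℝ → ℝ} {f' : ℝ} (hf : HasDerivAt f f' 0)
    (hk : DifferentiableAt ℝ k 0) (hh : HasDerivAt h 0 0) (hmul : ∀ᶠ t in 𝓝 0, h t = f t * k t)
    (f0 : f 0 = 0) (k0 : k 0 ≠ 0) : f' = 0 := by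
  have h1 := (hf.mul hk.hasDerivAt).congr_of_eventuallyEq (f₁ := h) hmul
  have h2 := h1.unique hh
  rw [f0, zero_mul, add_zero] at h2
  exact (mul_eq_zero.1 h2).resolve_right k0

namespace Zone

variable {N : ℕ} {zn : Zone} {lam : ℝ → ℝ → ℝ} {om : ℝ → ℝ → ℝ → ℝ} {om0 : ℝ → ℝ}
  {om2 : ℝ → ℝ → ℝ → ℝ} {b : Site}

/-- Local inverse of the scaling at the scaled variables `z`: `pinv` recovers the parameters and the
unknown of the node `m` from `mu` and the amplitude at `m`, and `ainv` the other inner unknowns from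
the amplitudes. -/
structure LocalInverse (lam : ℝ → ℝ → ℝ) (zn : Zone) (z : Z N)
    (pinv : ℝ × ℝ → (ℝ × ℝ) × ℝ) (ainv : (ℝ × ℝ) × ℝ → ℝ) : Prop where
  one_le : 1 ≤ zn.m
  le : zn.m ≤ N
  eps_ne : zn.eps (zn.pg z) ≠ 0
  fin_ne : zn.fin z.1 ≠ 0
  fm_ne : zn.fm z.1 ≠ 0
  radius_ne : ∀ n, 1 ≤ n → n ≤ N → zn.radius z n ≠ 0
  pinv_self : pinv (zn.mu z.1, zn.radius z zn.m) = zn.pg z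
  pinv_diff : DifferentiableAt ℝ pinv (zn.mu z.1, zn.radius z zn.m)
  pinv_spec : ∀ᶠ c in 𝓝 ((zn.mu z.1, zn.radius z zn.m) : ℝ × ℝ),
    zn.mu (pinv c).1 = c.1 ∧ zn.sc (pinv c).1 * zn.xm (pinv c) = c.2 ∧
      zn.eps (pinv c) = zn.eps (zn.pg z) ∧ zn.Valid lam (pinv c).1 (pinv c).2
  ainv_self : ∀ n, 1 ≤ n → n < zn.m → ainv (z.1, zn.radius z n) = entry z.2.1 n
  ainv_diff : ∀ n, 1 ≤ n → n < zn.m → DifferentiableAt ℝ ainv (z.1, zn.radius z n)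
  ainv_spec : ∀ n, 1 ≤ n → n < zn.m → ∀ᶠ c in 𝓝 ((z.1, zn.radius z n) : (ℝ × ℝ) × ℝ),
    zn.ain (c.1, ainv c) = c.2

/-- The scaled variables of a point of the original phase space. -/
def coords (zn : Zone) (b : Site) (pinv : ℝ × ℝ → (ℝ × ℝ) × ℝ) (ainv : (ℝ × ℝ) × ℝ → ℝ)
    (q : P N) : Z N :=
  ((pinv (q.2, amp b q.1 zn.m)).1, fun i =>
    if (i : ℕ) + 1 < zn.m then ainv ((pinv (q.2, amp b q.1 zn.m)).1, amp b q.1 (i + 1))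
    else if (i : ℕ) + 1 = zn.m then (pinv (q.2, amp b q.1 zn.m)).2
    else amp b q.1 (i + 1) / (zn.tau (pinv (q.2, amp b q.1 zn.m)) * amp b q.1 i), q.1.2.1)

theorem Valid.tau_ne {p : ℝ × ℝ} {g : ℝ} (hv : zn.Valid lam p g) (h : zn.eps (p, g) ≠ 0) :
    zn.tau (p, g) ≠ 0 := by
  intro h1
  rw [← hv.tau, h1, mul_zero] at h
  exact h rfl

theorem pg_coords {pinv : ℝ × ℝ → (ℝ × ℝ) × ℝ} {ainv : (ℝ × ℝ) × ℝ → ℝ} (hm : 1 ≤ zn.m)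
    (hmN : zn.m ≤ N) (q : P N) :
    zn.pg (zn.coords b pinv ainv q) = pinv (q.2, amp b q.1 zn.m) := by
  obtain ⟨j, hj⟩ : ∃ j, zn.m = j + 1 := ⟨zn.m - 1, by omega⟩
  refine Prod.ext rfl ?_
  change entry _ zn.m = _
  have : entry (zn.coords b pinv ainv q).2.1 (j + 1) = (pinv (q.2, amp b q.1 zn.m)).2 := by
    rw [entry_succ _ (by omega : j < N)]
    simp only [coords]
    rw [if_neg (by omega), if_pos hj.symm]
  rw [← this, ← hj]

theorem entry_coords {pinv : ℝ × ℝ → (ℝ × ℝ) × ℝ} {ainv : (ℝ × ℝ) × ℝ → ℝ} {q : P N} {j : ℕ}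
    (hj : j < N) : entry (zn.coords b pinv ainv q).2.1 (j + 1)
      = if j + 1 < zn.m then ainv ((pinv (q.2, amp b q.1 zn.m)).1, amp b q.1 (j + 1))
        else if j + 1 = zn.m then (pinv (q.2, amp b q.1 zn.m)).2
        else amp b q.1 (j + 1) / (zn.tau (pinv (q.2, amp b q.1 zn.m)) * amp b q.1 j) := by
  rw [entry_succ _ hj]; rfl

/-- From the node `m` on, each amplitude is rebuilt from the preceding one by the quotient stored in
`coords`, by induction on the distance to `m`; before `m` the map `ainv` does it node by node. -/
theorem pre_coords {pinv : ℝ × ℝ → (ℝ × ℝ) × ℝ} {ainv : (ℝ × ℝ) × ℝ → ℝ} (hm : 1 ≤ zn.m)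
    (hmN : zn.m ≤ N) {q : P N}
    (hx : zn.sc (pinv (q.2, amp b q.1 zn.m)).1 * zn.xm (pinv (q.2, amp b q.1 zn.m))
      = amp b q.1 zn.m)
    (hτ : zn.tau (pinv (q.2, amp b q.1 zn.m)) ≠ 0)
    (hr : ∀ n, 1 ≤ n → n ≤ N → amp b q.1 n ≠ 0)
    (ha : ∀ n, 1 ≤ n → n < zn.m → zn.ain ((pinv (q.2, amp b q.1 zn.m)).1,
      ainv ((pinv (q.2, amp b q.1 zn.m)).1, amp b q.1 n)) = amp b q.1 n) :
    zn.pre (zn.coords b pinv ainv q) = (q.1.1, q.1.2.1, 0) := by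
  have hpg := pg_coords (b := b) (pinv := pinv) (ainv := ainv) hm hmN q
  have key : ∀ k, zn.m + k ≤ N →
      zn.radius (zn.coords b pinv ainv q) (zn.m + k) = amp b q.1 (zn.m + k) := by
    intro k
    induction k with
    | zero =>
      intro _
      rw [add_zero, radius, if_neg (by omega), tailAmp, hpg]
      simpa [coords] using hx
    | succ k ih =>
      intro hk
      have h1 := zn.amp_pre_succ b (zn.coords b pinv ainv q) hm (n := zn.m + k) (by omega)
        (by omega)
      rw [zn.amp_pre b _ (by omega) (by omega), zn.amp_pre b _ (by omega) (by omega),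
        ih (by omega), ratio, if_neg (by omega), hpg, entry_coords (by omega), if_neg (by omega),
        if_neg (by omega)] at h1
      rw [← add_assoc, h1]
      have := hr (zn.m + k) (by omega) (by omega)
      field_simp
  refine Prod.ext (funext fun i => ?_) rfl
  change zn.radius _ ((i : ℕ) + 1) = q.1.1 i
  rw [← amp_succ b]
  by_cases h : (i : ℕ) + 1 < zn.m
  · rw [radius, if_pos h, entry_coords i.2, if_pos h]
    exact ha _ (by omega) h
  · obtain ⟨k, hk⟩ : ∃ k, (i : ℕ) + 1 = zn.m + k := ⟨i + 1 - zn.m, by omega⟩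
    rw [hk]
    exact key k (by have := i.2; omega)

theorem coords_pt {pinv : ℝ × ℝ → (ℝ × ℝ) × ℝ} {ainv : (ℝ × ℝ) × ℝ → ℝ} {z : Z N}
    (hL : LocalInverse lam zn z pinv ainv) (hv : zn.Valid lam z.1 (entry z.2.1 zn.m)) :
    zn.coords b pinv ainv (zn.pt om0 om2 b z) = z := by
  have hm := hL.one_le
  have hmN := hL.le
  have hA : ∀ n, amp b (zn.pt om0 om2 b z).1 n = amp b (zn.pre z) n := amp_congr rfl
  have hp : pinv ((zn.pt om0 om2 b z).2, amp b (zn.pt om0 om2 b z).1 zn.m) = zn.pg z := by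
    rw [hA, zn.amp_pre b z hL.one_le hL.le]
    exact hL.pinv_self
  have hp1 := congrArg Prod.fst hp
  refine Prod.ext hp1 (Prod.ext (funext fun i => ?_) rfl)
  simp only [coords, hp]
  simp only [hA]
  rw [← entry_succ z.2.1 i.2]
  split_ifs with h1 h2
  · rw [zn.amp_pre b z (by omega) (by omega)]
    exact hL.ainv_self _ (by omega) h1
  · rw [h2]; rfl
  · rw [zn.amp_pre_succ b z hL.one_le (by omega) (by omega), ratio, if_neg (by omega)]
    have h3 := hL.radius_ne i (by omega) (by omega)
    rw [← zn.amp_pre b z (by omega) (by omega)] at h3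
    have h4 : zn.tau (zn.pg z) ≠ 0 := hv.tau_ne hL.eps_ne
    field_simp

/-- Tangent vectors of the solution set lift to the scaled variables. -/
theorem exists_lift (hM : Model N lam om om0 om2) (hs : zn.Smooth)
    {pinv : ℝ × ℝ → (ℝ × ℝ) × ℝ} {ainv : (ℝ × ℝ) × ℝ → ℝ} {z : Z N}
    (hL : LocalInverse lam zn z pinv ainv) (hz : zn.sys om2 b z = 0) {v : P N}
    (hv : fderiv ℝ (fun p : P N => system lam om b (zn.eps (zn.pg z)) p.1 p.2)
      (zn.pt om0 om2 b z) v = 0) :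
    ∃ ξ : Z N, fderiv ℝ (fun z : Z N => zn.sys om2 b z) z ξ = 0 ∧
      fderiv ℝ (fun z : Z N => zn.eps (zn.pg z)) z ξ = 0 ∧
      fderiv ℝ (fun z : Z N => zn.pt om0 om2 b z) z ξ = v := by
  have hN := hM.two_le
  have hm := hL.one_le
  have hmN := hL.le
  set ε := zn.eps (zn.pg z) with hε
  set q₀ := zn.pt om0 om2 b z with hq₀
  -- The tangent vector is represented by a straight line. Its points solve the system only to first
  -- order, so every identity below is compared at the level of derivatives at `0`.
  set q : ℝ → P N := fun t => q₀ + t • v with hq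
  have hq0 : q 0 = q₀ := by simp [hq]
  have hqd : HasDerivAt q v 0 := by
    simpa [hq] using ((hasDerivAt_id (0 : ℝ)).smul_const v).const_add q₀
  have hA₀ : ∀ n, amp b q₀.1 n = amp b (zn.pre z) n := amp_congr rfl
  have hR₀ : ∀ n, 1 ≤ n → n ≤ N → amp b q₀.1 n = zn.radius z n := fun n h1 h2 => by
    rw [hA₀, zn.amp_pre b z h1 h2]
  have hvalid : zn.Valid lam z.1 (entry z.2.1 zn.m) := by
    have := hL.pinv_spec.self_of_nhds
    rw [hL.pinv_self] at this
    exact this.2.2.2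
  have hr₁ : (zn.pre z).1 ⟨0, by omega⟩ ≠ 0 := hL.radius_ne 1 le_rfl (by omega)
  have hmass : mass b (zn.pre z) ≠ 0 := (mass_pos _ hr₁).ne'
  have hsol : ∀ j < N, realPart lam b ε q₀.1 q₀.2 j = 0 ∧ imagPart om b ε q₀.1 q₀.2 j = 0 :=
    (mem_solutions_iff lam om b ε q₀).1 (pt_mem_solutions hM hm hvalid hr₁ hz)
  -- amplitudes along the line
  have hAd : ∀ n, HasFDerivAt (fun p : P N => amp b p.1 n)
      (fderiv ℝ (fun p : P N => amp b p.1 n) q₀) q₀ := fun n =>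
    (((contDiff_amp b n).comp contDiff_fst).differentiable (by simp)).differentiableAt.hasFDerivAt
  have hAt : ∀ n, DifferentiableAt ℝ (fun t => amp b (q t).1 n) 0 := fun n => by
    have h1 := hAd n
    rw [← hq0] at h1
    exact (h1.comp_hasDerivAt 0 hqd).differentiableAt
  -- equations along the line
  have hsys : HasDerivAt (fun t => system lam om b ε (q t).1 (q t).2) 0 0 := by
    have h1 := ((contDiff_system hM.lam_smooth hM.om0_smooth hM.om2_smooth hM.om_eq b
      ε).differentiable (by simp)).differentiableAt (x := q₀) |>.hasFDerivAt
    rw [← hq0] at h1 hv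
    have := h1.comp_hasDerivAt 0 hqd
    rwa [hv] at this
  have hre : ∀ j < N, HasDerivAt (fun t => realPart lam b ε (q t).1 (q t).2 j) 0 0 := by
    intro j hj
    have h1 := Complex.reCLM.hasFDerivAt.comp_hasDerivAt (0 : ℝ) (hasDerivAt_pi.1 hsys ⟨j, hj⟩)
    simp only [Pi.zero_apply, map_zero] at h1
    refine h1.congr_of_eventuallyEq (Eventually.of_forall fun t => ?_)
    simp [system_apply]
  have him : ∀ j < N, HasDerivAt (fun t => imagPart om b ε (q t).1 (q t).2 j) 0 0 := by
    intro j hj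
    have h1 := Complex.imCLM.hasFDerivAt.comp_hasDerivAt (0 : ℝ) (hasDerivAt_pi.1 hsys ⟨j, hj⟩)
    simp only [Pi.zero_apply, map_zero] at h1
    refine h1.congr_of_eventuallyEq (Eventually.of_forall fun t => ?_)
    simp [system_apply]
  -- the frequency
  set rho : P N → ℝ := fun p => om0 p.2 + ε ^ 2 * meanFreq om2 b p.1 p.2 ε with hrho
  have hmass₀ : mass b q₀.1 ≠ 0 := hmass
  have hrhos : ContDiffAt ℝ ∞ rho q₀ :=
    (hM.om0_smooth.contDiffAt.comp q₀ contDiffAt_snd).add (contDiffAt_const.mul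
      (contDiffAt_meanFreq hM.om2_smooth contDiffAt_fst contDiffAt_snd contDiffAt_const hmass₀))
  have hrho0 : rho q₀ - q₀.1.2.2 = 0 := sub_self _
  have hrhod : HasDerivAt (fun t => rho (q t) - (q t).1.2.2)
      (fderiv ℝ rho q₀ v - v.1.2.2) 0 := by
    have h1 : HasFDerivAt rho (fderiv ℝ rho q₀) (q 0) := by
      rw [hq0]; exact (hrhos.differentiableAt (by simp)).hasFDerivAt
    refine (h1.comp_hasDerivAt 0 hqd).sub ?_
    exact (((ContinuousLinearMap.snd ℝ _ _).comp ((ContinuousLinearMap.snd ℝ _ _).comp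
      (ContinuousLinearMap.fst ℝ (X N) ℝ))).hasFDerivAt (x := q 0)).comp_hasDerivAt 0 hqd
  have hmasst : DifferentiableAt ℝ (fun t => mass b (q t).1) 0 := by
    have h1 : DifferentiableAt ℝ (fun p : P N => mass b p.1) (q 0) :=
      (((contDiff_mass b).comp contDiff_fst).differentiable (by simp)).differentiableAt
    exact h1.comp (0 : ℝ) hqd.differentiableAt
  -- The weighted sum of imaginary parts is the frequency mismatch times `mass`. Since the sum has
  -- derivative zero and `mass` is nonzero, the mismatch vanishes to first order.
  have hrho1 : fderiv ℝ rho q₀ v - v.1.2.2 = 0 := by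
    have hne : ∀ᶠ t in 𝓝 (0 : ℝ), mass b (q t).1 ≠ 0 := by
      apply hmasst.continuousAt.eventually_ne
      rw [hq0]; exact hmass₀
    have hsum : HasDerivAt (fun t => ∑ j ∈ Finset.range N,
        weight b j * (amp b (q t).1 (j + 1) * imagPart om b ε (q t).1 (q t).2 j)) 0 0 := by
      have h1 : ∀ j ∈ Finset.range N, HasDerivAt (fun t =>
          weight b j * (amp b (q t).1 (j + 1) * imagPart om b ε (q t).1 (q t).2 j)) 0 0 := by
        intro j hj
        have hj' : j < N := by simpa using hj
        have := ((hAt (j + 1)).hasDerivAt.mul (him j hj')).const_mul (weight b j)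
        refine this.congr_deriv ?_
        rw [hq0, (hsol j hj').2]; ring
      have := HasDerivAt.fun_sum h1
      simpa using this
    refine deriv_eq_zero_of_mul hrhod hmasst hsum ?_ (by simp only [hq0]; exact hrho0)
      (by simp only [hq0]; exact hmass₀)
    filter_upwards [hne] with t ht
    exact sum_weight_imagPart hN hM.om_eq b ε _ _ ht
  rw [hrho1] at hrhod
  -- the scaled variables along the line
  set Q : P N → Z N := zn.coords b pinv ainv with hQ
  have hQ0 : Q q₀ = z := coords_pt hL hvalid
  have hc₀ : ((q₀.2, amp b q₀.1 zn.m) : ℝ × ℝ) = (zn.mu z.1, zn.radius z zn.m) := by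
    rw [hR₀ _ hm hmN]; rfl
  have hcd : DifferentiableAt ℝ (fun p : P N => (p.2, amp b p.1 zn.m)) q₀ :=
    differentiableAt_snd.prodMk (hAd _).differentiableAt
  have hpd : DifferentiableAt ℝ (fun p : P N => pinv (p.2, amp b p.1 zn.m)) q₀ := by
    have := hL.pinv_diff
    rw [← hc₀] at this
    exact this.comp q₀ hcd
  have hp₀ : pinv (q₀.2, amp b q₀.1 zn.m) = zn.pg z := by rw [hc₀]; exact hL.pinv_self
  have hτ₀ : zn.tau (zn.pg z) ≠ 0 := hvalid.tau_ne hL.eps_ne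
  have hQd : DifferentiableAt ℝ Q q₀ := by
    refine hpd.fst.prodMk (DifferentiableAt.prodMk (differentiableAt_pi.2 fun i => ?_)
      differentiableAt_fst.snd.fst)
    split_ifs with h1 h2
    · have h3 := hL.ainv_diff (i + 1) (by omega) h1
      have h4 : (((pinv (q₀.2, amp b q₀.1 zn.m)).1, amp b q₀.1 (i + 1)) : (ℝ × ℝ) × ℝ)
          = (z.1, zn.radius z (i + 1)) := by
        rw [hp₀, hR₀ _ (by omega) (by omega)]; rfl
      rw [← h4] at h3
      exact h3.comp q₀ (hpd.fst.prodMk (hAd _).differentiableAt)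
    · exact hpd.snd
    · have h3 : DifferentiableAt ℝ (fun p : P N => zn.tau (pinv (p.2, amp b p.1 zn.m))
          * amp b p.1 i) q₀ :=
        (((hs.tau.differentiable (by simp)).differentiableAt).comp q₀ hpd).fun_mul
          (hAd _).differentiableAt
      simp only [div_eq_mul_inv]
      refine (hAd _).differentiableAt.fun_mul (h3.fun_inv ?_)
      · rw [hp₀, hR₀ _ (by omega) (by omega)]
        exact mul_ne_zero hτ₀ (hL.radius_ne _ (by omega) (by omega))
  set ξ := fderiv ℝ Q q₀ v with hξ
  have hQt : HasDerivAt (fun t => Q (q t)) ξ 0 := by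
    have h1 : HasFDerivAt Q (fderiv ℝ Q q₀) (q 0) := by rw [hq0]; exact hQd.hasFDerivAt
    exact h1.comp_hasDerivAt 0 hqd
  have hQt0 : Q (q 0) = z := by rw [hq0, hQ0]
  -- Near `q₀` the scaled variables `Q` reproduce amplitudes, phases, `μ` and `ε` exactly; only the
  -- frequency of `q t` may differ from the one that `pt` computes.
  have hgood : ∀ᶠ t in 𝓝 (0 : ℝ), zn.pre (Q (q t)) = ((q t).1.1, (q t).1.2.1, 0) ∧
      zn.mu (Q (q t)).1 = (q t).2 ∧ zn.eps (zn.pg (Q (q t))) = ε ∧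
      zn.Valid lam (Q (q t)).1 (entry (Q (q t)).2.1 zn.m) := by
    have hqc : ContinuousAt q 0 := hqd.continuousAt
    have e1 : ∀ᶠ p in 𝓝 q₀, _ := hcd.continuousAt.eventually (hc₀ ▸ hL.pinv_spec)
    have e2 : ∀ᶠ p in 𝓝 q₀, ∀ n ∈ Finset.Icc 1 N, amp b p.1 n ≠ 0 := by
      rw [Filter.eventually_all_finset]
      intro n hn
      rw [Finset.mem_Icc] at hn
      apply (hAd n).continuousAt.eventually_ne
      rw [hR₀ n hn.1 hn.2]
      exact hL.radius_ne n hn.1 hn.2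
    have e3 : ∀ᶠ p in 𝓝 q₀, ∀ n ∈ Finset.Ico 1 zn.m, zn.ain ((pinv (p.2, amp b p.1 zn.m)).1,
        ainv ((pinv (p.2, amp b p.1 zn.m)).1, amp b p.1 n)) = amp b p.1 n := by
      rw [Filter.eventually_all_finset]
      intro n hn
      rw [Finset.mem_Ico] at hn
      have h5 : ContinuousAt (fun p : P N => (((pinv (p.2, amp b p.1 zn.m)).1, amp b p.1 n) :
          (ℝ × ℝ) × ℝ)) q₀ := hpd.continuousAt.fst.prodMk (hAd n).continuousAt
      apply h5.eventually (p := fun c => zn.ain (c.1, ainv c) = c.2)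
      change ∀ᶠ c in 𝓝 (((pinv (q₀.2, amp b q₀.1 zn.m)).1, amp b q₀.1 n) : (ℝ × ℝ) × ℝ), _
      rw [hp₀, hR₀ n hn.1 (by omega)]
      exact hL.ainv_spec n hn.1 hn.2
    have e := e1.and (e2.and e3)
    rw [← hq0] at e
    filter_upwards [hqc.eventually e] with t ht
    obtain ⟨⟨a1, a2, a3, a4⟩, a5, a6⟩ := ht
    have hpg := pg_coords (b := b) (pinv := pinv) (ainv := ainv) hm hmN (q t)
    refine ⟨pre_coords hm hmN a2 ?_ (fun n h1 h2 => a5 n (by simp [h1, h2]))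
      (fun n h1 h2 => a6 n (by simp [h1, h2])), a1, ?_, ?_⟩
    · refine a4.tau_ne ?_
      rw [Prod.mk.eta, a3]
      exact hL.eps_ne
    · rw [hpg]; exact a3
    · have h6 : entry (Q (q t)).2.1 zn.m = (pinv ((q t).2, amp b (q t).1 zn.m)).2 :=
        congrArg Prod.snd hpg
      rw [h6]
      exact a4
  have hampQ : ∀ᶠ t in 𝓝 (0 : ℝ), ∀ n, amp b (zn.pre (Q (q t))) n = amp b (q t).1 n := by
    filter_upwards [hgood] with t ht n
    exact amp_congr (by rw [ht.1]) n
  have hphQ : ∀ᶠ t in 𝓝 (0 : ℝ), ∀ n, phase b (zn.pre (Q (q t))) n = phase b (q t).1 n := by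
    filter_upwards [hgood] with t ht n
    exact phase_congr (by rw [ht.1]) n
  have hsysd : HasDerivAt (fun t => zn.sys om2 b (Q (q t)))
      (fderiv ℝ (fun z : Z N => zn.sys om2 b z) z ξ) 0 := by
    have h1 : HasFDerivAt (fun z : Z N => zn.sys om2 b z)
        (fderiv ℝ (fun z : Z N => zn.sys om2 b z) z) (Q (q 0)) := by
      rw [hQt0]
      exact ((contDiffAt_sys hs hM.om2_smooth hmass).differentiableAt (by simp)).hasFDerivAt
    exact h1.comp_hasDerivAt 0 hQt
  have hcomp : ∀ {k : Z N → ℝ}, ContDiff ℝ ∞ k → DifferentiableAt ℝ (fun t => k (Q (q t))) 0 :=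
    fun hk => ((hk.differentiable (by simp)).differentiableAt).comp (0 : ℝ) hQt.differentiableAt
  have hξ1 : fderiv ℝ (fun z : Z N => zn.sys om2 b z) z ξ = 0 := by
    refine Prod.ext (funext fun i => ?_) (funext fun i => ?_)
    · have h1 := hasDerivAt_pi.1 (HasFDerivAt.hasDerivAt hsysd.hasFDerivAt.fst) i
      simp only [ContinuousLinearMap.comp_apply, ContinuousLinearMap.toSpanSingleton_apply, one_smul,
        ContinuousLinearMap.coe_fst'] at h1
      refine deriv_eq_zero_of_mul (k := fun t => if (i : ℕ) + 1 < zn.m then zn.fin (Q (q t)).1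
          else if (i : ℕ) + 1 = zn.m then zn.fm (Q (q t)).1
          else zn.eps (zn.pg (Q (q t))) * amp b (zn.pre (Q (q t))) i) h1 ?_ (hre i i.2) ?_ ?_ ?_
      · split_ifs
        · exact hcomp (hs.fin.comp contDiff_fst)
        · exact hcomp (hs.fm.comp contDiff_fst)
        · exact hcomp ((contDiff_eps hs).mul ((contDiff_amp b _).comp (contDiff_pre hs)))
      · filter_upwards [hgood, hampQ, hphQ] with t ht ht2 ht3
        have h2 := realPart_pre (b := b) hm ht.2.2.2 i.2
        rw [ht.2.1, ht.2.2.1] at h2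
        rw [mul_comm]
        change _ = _ * zn.ampEq b (Q (q t)) i
        rw [ht.2.2.1, ← h2]
        unfold realPart coupling
        simp only [ht2, ht3]
      · change zn.ampEq b (Q (q 0)) i = 0
        rw [hQt0]
        exact congrFun (congrArg Prod.fst hz) i
      · rw [hQt0]
        split_ifs with h2 h3
        · exact hL.fin_ne
        · exact hL.fm_ne
        · rw [zn.amp_pre b z (by omega) (by omega)]
          exact mul_ne_zero hL.eps_ne (hL.radius_ne _ (by omega) (by omega))
    · have h1 := hasDerivAt_pi.1 (HasFDerivAt.hasDerivAt hsysd.hasFDerivAt.snd) i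
      simp only [ContinuousLinearMap.comp_apply, ContinuousLinearMap.toSpanSingleton_apply, one_smul,
        ContinuousLinearMap.coe_snd'] at h1
      have hi := i.2
      -- `phaseEq` assumes the frequency already eliminated, so the mismatch term has to be
      -- subtracted; it has value and derivative zero at `t = 0`.
      have h3 : HasDerivAt (fun t => imagPart om b ε (q t).1 (q t).2 (i + 1)
          - (rho (q t) - (q t).1.2.2) * amp b (q t).1 (i + 2)) 0 0 := by
        refine ((him (i + 1) (by omega)).sub (hrhod.mul (hAt (i + 2)).hasDerivAt)).congr_deriv ?_
        rw [hq0, hrho0]; ring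
      refine deriv_eq_zero_of_mul (k := fun t => -(zn.eps (zn.pg (Q (q t)))
        * (if (i : ℕ) + 2 ≤ zn.m then 1 else amp b (zn.pre (Q (q t))) (i + 1)))) h1 ?_ h3 ?_ ?_ ?_
      · split_ifs
        · exact hcomp ((contDiff_eps hs).mul contDiff_const).neg
        · exact hcomp ((contDiff_eps hs).mul ((contDiff_amp b _).comp (contDiff_pre hs))).neg
      · filter_upwards [hgood, hampQ] with t ht ht2
        have h2 := imagPart_pre (b := b) (z := Q (q t)) (x := (q t).1) hM.om_eq hm
          (by rw [ht.1]) rfl (j := i) (by omega)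
        rw [ht.2.1, ht.2.2.1, ht2 (i + 2)] at h2
        have h4 : meanFreq om2 b (zn.pre (Q (q t))) (q t).2 ε = meanFreq om2 b (q t).1 (q t).2 ε := by
          rw [ht.1]; rfl
        rw [h2, h4, ht.2.2.1]
        change _ = zn.phaseEq om2 b (Q (q t)) i * _
        simp only [hrho]
        ring
      · change zn.phaseEq om2 b (Q (q 0)) i = 0
        rw [hQt0]
        exact congrFun (congrArg Prod.snd hz) i
      · rw [hQt0]
        refine neg_ne_zero.2 (mul_ne_zero hL.eps_ne ?_)
        split_ifs
        · exact one_ne_zero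
        · rw [zn.amp_pre b z (by omega) (by omega)]
          exact hL.radius_ne _ (by omega) (by omega)
  refine ⟨ξ, hξ1, ?_, ?_⟩
  · have h1 : HasDerivAt (fun t => zn.eps (zn.pg (Q (q t))))
        (fderiv ℝ (fun z : Z N => zn.eps (zn.pg z)) z ξ) 0 := by
      have h2 : HasFDerivAt (fun z : Z N => zn.eps (zn.pg z))
          (fderiv ℝ (fun z : Z N => zn.eps (zn.pg z)) z) (Q (q 0)) := by
        rw [hQt0]
        exact ((contDiff_eps hs).differentiable (by simp)).differentiableAt.hasFDerivAt
      exact h2.comp_hasDerivAt 0 hQt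
    refine h1.unique ((hasDerivAt_const (0 : ℝ) ε).congr_of_eventuallyEq ?_)
    filter_upwards [hgood] with t ht
    exact ht.2.2.1
  · have h1 : HasDerivAt (fun t => zn.pt om0 om2 b (Q (q t)))
        (fderiv ℝ (fun z : Z N => zn.pt om0 om2 b z) z ξ) 0 := by
      have h2 : HasFDerivAt (fun z : Z N => zn.pt om0 om2 b z)
          (fderiv ℝ (fun z : Z N => zn.pt om0 om2 b z) z) (Q (q 0)) := by
        rw [hQt0]
        exact ((contDiffAt_pt hs hM.om0_smooth hM.om2_smooth hmass).differentiableAt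
          (by simp)).hasFDerivAt
      exact h2.comp_hasDerivAt 0 hQt
    -- Scaling back returns `q t` with its frequency corrected by the mismatch, which does not
    -- change the derivative.
    have h3 : HasDerivAt (fun t => q t + (((0, 0, rho (q t) - (q t).1.2.2), 0) : P N)) v 0 := by
      have h4 : HasDerivAt (fun t => (((0, 0, rho (q t) - (q t).1.2.2), 0) : P N)) 0 0 :=
        ((hasDerivAt_const _ _).prodMk ((hasDerivAt_const _ _).prodMk hrhod)).prodMk
          (hasDerivAt_const _ _)
      have := hqd.fun_add h4
      rwa [add_zero] at this
    refine h1.unique (h3.congr_of_eventuallyEq ?_)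
    filter_upwards [hgood] with t ht
    have h4 : meanFreq om2 b (zn.pre (Q (q t))) (q t).2 ε = meanFreq om2 b (q t).1 (q t).2 ε := by
      rw [ht.1]; rfl
    refine Prod.ext (Prod.ext ?_ (Prod.ext ?_ ?_)) ?_
    · simp [pt, ht.1]
    · simp [pt, hQ, coords]
    · simp only [pt, ht.2.1, ht.2.2.1, h4, hrho]
      simp
    · simp [pt, ht.2.1]

end Zone

end

/-! ### Kernel along solution curves; generic folds from turning points -/

section

/-- The kernel of a nonzero functional on the plane is a line: the determinant of `c` and `d` is
annihilated by both coefficients of `L`, one of which is nonzero. -/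
theorem exists_smul_of_functional {L : ℝ × ℝ →L[ℝ] ℝ} (hL : L ≠ 0) {c d : ℝ × ℝ} (hc : c ≠ 0)
    (h1 : L c = 0) (h2 : L d = 0) : ∃ a : ℝ, d = a • c := by
  have hLe : ∀ x : ℝ × ℝ, L x = x.1 * L (1, 0) + x.2 * L (0, 1) := by
    intro x
    have : x = x.1 • ((1, 0) : ℝ × ℝ) + x.2 • ((0, 1) : ℝ × ℝ) := by ext <;> simp
    conv_lhs => rw [this]
    rw [map_add, map_smul, map_smul]
    rfl
  have hab : L (1, 0) ≠ 0 ∨ L (0, 1) ≠ 0 := by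
    by_contra! h
    exact hL (ContinuousLinearMap.ext fun x => by rw [hLe, h.1, h.2]; simp)
  obtain ⟨c1, c2⟩ := c
  obtain ⟨d1, d2⟩ := d
  rw [hLe] at h1 h2
  simp only at h1 h2
  set α := L (1, 0)
  set β := L (0, 1)
  have hcross : c1 * d2 - c2 * d1 = 0 := by
    rcases hab with h | h
    · have : α * (c1 * d2 - c2 * d1) = 0 := by linear_combination d2 * h1 - c2 * h2
      exact (mul_eq_zero.1 this).resolve_left h
    · have : β * (c1 * d2 - c2 * d1) = 0 := by linear_combination c1 * h2 - d1 * h1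
      exact (mul_eq_zero.1 this).resolve_left h
  by_cases hc1 : c1 = 0
  · have hc2 : c2 ≠ 0 := by rintro rfl; exact hc (by rw [hc1]; rfl)
    refine ⟨d2 / c2, Prod.ext ?_ ?_⟩
    · rw [hc1] at hcross ⊢
      have : d1 = 0 := by
        have : c2 * d1 = 0 := by linarith
        exact (mul_eq_zero.1 this).resolve_left hc2
      simp [this]
    · simp; field_simp
  · refine ⟨d1 / c1, Prod.ext ?_ ?_⟩
    · simp; field_simp
    · simp; field_simp; linarith

namespace Zone

variable {N : ℕ} {zn : Zone} {lam : ℝ → ℝ → ℝ} {om : ℝ → ℝ → ℝ → ℝ} {om0 : ℝ → ℝ}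
  {om2 : ℝ → ℝ → ℝ → ℝ} {b : Site}

/-- A curve in the surface of scaled solutions along which `eps` is constant spans the kernel of the
linearization of the original system. -/
theorem deriv_ne_zero_and_kernel (hM : Model N lam om om0 om2) (hs : zn.Smooth) {U : Set (ℝ × ℝ)}
    (hU : IsOpen U) {y : ℝ × ℝ → Y N} (hy : ContDiffOn ℝ ∞ y U)
    (hzero : ∀ p ∈ U, zn.sys om2 b (p, y p) = 0) {c : ℝ → ℝ × ℝ} {c' : ℝ × ℝ} {t₀ : ℝ}
    (hc : HasDerivAt c c' t₀) (hc' : c' ≠ 0) (hcU : c t₀ ∈ U)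
    (hinj : ∀ v : Y N, fderiv ℝ (fun z : Z N => zn.sys om2 b z) (c t₀, y (c t₀)) (0, v) = 0 → v = 0)
    {pinv : ℝ × ℝ → (ℝ × ℝ) × ℝ} {ainv : (ℝ × ℝ) × ℝ → ℝ}
    (hL : LocalInverse lam zn ((c t₀, y (c t₀)) : Z N) pinv ainv)
    (hpinv : ∀ᶠ t in 𝓝 t₀, (pinv (zn.mu (c t), zn.radius ((c t, y (c t)) : Z N) zn.m)).1 = c t)
    {ε : ℝ} (hε : ∀ᶠ t in 𝓝 t₀, zn.eps (zn.pg ((c t, y (c t)) : Z N)) = ε)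
    (hΦ : fderiv ℝ (fun p => zn.eps (zn.pg ((p, y p) : Z N))) (c t₀) ≠ 0) :
    deriv (fun t => zn.pt om0 om2 b ((c t, y (c t)) : Z N)) t₀ ≠ 0 ∧
    ∀ v : P N, fderiv ℝ (fun p : P N => system lam om b ε p.1 p.2)
      (zn.pt om0 om2 b ((c t₀, y (c t₀)) : Z N)) v = 0 →
      ∃ a : ℝ, v = a • deriv (fun t => zn.pt om0 om2 b ((c t, y (c t)) : Z N)) t₀ := by
  set z₀ : Z N := (c t₀, y (c t₀)) with hz₀
  have hN := hM.two_le
  have hmass : mass b (zn.pre z₀) ≠ 0 :=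
    (mass_pos ⟨0, by omega⟩ (hL.radius_ne 1 le_rfl (by omega))).ne'
  have hyd : HasFDerivAt y (fderiv ℝ y (c t₀)) (c t₀) :=
    ((hy.contDiffAt (hU.mem_nhds hcU)).differentiableAt (by simp)).hasFDerivAt
  have hgr : HasFDerivAt (fun p => ((p, y p) : Z N))
      ((ContinuousLinearMap.id ℝ (ℝ × ℝ)).prod (fderiv ℝ y (c t₀))) (c t₀) :=
    (hasFDerivAt_id _).prodMk hyd
  have hpt : HasFDerivAt (fun z : Z N => zn.pt om0 om2 b z)
      (fderiv ℝ (fun z : Z N => zn.pt om0 om2 b z) z₀) z₀ :=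
    ((contDiffAt_pt hs hM.om0_smooth hM.om2_smooth hmass).differentiableAt (by simp)).hasFDerivAt
  have hept : HasFDerivAt (fun z : Z N => zn.eps (zn.pg z))
      (fderiv ℝ (fun z : Z N => zn.eps (zn.pg z)) z₀) z₀ :=
    ((contDiff_eps hs).differentiable (by simp)).differentiableAt.hasFDerivAt
  have hsysd : HasFDerivAt (fun z : Z N => zn.sys om2 b z)
      (fderiv ℝ (fun z : Z N => zn.sys om2 b z) z₀) z₀ :=
    ((contDiffAt_sys hs hM.om2_smooth hmass).differentiableAt (by simp)).hasFDerivAt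
  have hΨ : HasFDerivAt (fun p => zn.pt om0 om2 b ((p, y p) : Z N))
      ((fderiv ℝ (fun z : Z N => zn.pt om0 om2 b z) z₀).comp
        ((ContinuousLinearMap.id ℝ (ℝ × ℝ)).prod (fderiv ℝ y (c t₀)))) (c t₀) := by
    have h := HasFDerivAt.comp (f := fun p => ((p, y p) : Z N)) (c t₀) hpt hgr
    exact h
  have hΦd : HasFDerivAt (fun p => zn.eps (zn.pg ((p, y p) : Z N)))
      ((fderiv ℝ (fun z : Z N => zn.eps (zn.pg z)) z₀).comp
        ((ContinuousLinearMap.id ℝ (ℝ × ℝ)).prod (fderiv ℝ y (c t₀)))) (c t₀) := by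
    have h := HasFDerivAt.comp (f := fun p => ((p, y p) : Z N)) (c t₀) hept hgr
    exact h
  have hγ : HasDerivAt (fun t => zn.pt om0 om2 b ((c t, y (c t)) : Z N)) _ t₀ :=
    hΨ.comp_hasDerivAt t₀ hc
  have hΦc : fderiv ℝ (fun p => zn.eps (zn.pg ((p, y p) : Z N))) (c t₀) c' = 0 := by
    have h1 := hΦd.comp_hasDerivAt t₀ hc
    rw [hΦd.fderiv]
    exact h1.unique ((hasDerivAt_const t₀ ε).congr_of_eventuallyEq hε)
  have hsys0 : ∀ d : ℝ × ℝ, fderiv ℝ (fun z : Z N => zn.sys om2 b z) z₀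
      (d, fderiv ℝ y (c t₀) d) = 0 := by
    intro d
    have h1 := HasFDerivAt.comp (f := fun p => ((p, y p) : Z N)) (c t₀) hsysd hgr
    have h2 : HasFDerivAt (fun p => zn.sys om2 b ((p, y p) : Z N)) 0 (c t₀) :=
      (hasFDerivAt_const (𝕜 := ℝ) (0 : Y N) (c t₀)).congr_of_eventuallyEq (by
        filter_upwards [hU.mem_nhds hcU] with p hp using hzero p hp)
    exact DFunLike.congr_fun (h1.unique h2) d
  rw [hγ.deriv]
  constructor
  -- `pinv` recovers `c t` from the image point, so a vanishing derivative of the image would force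
  -- `c' = 0`.
  · intro h0
    have hA : DifferentiableAt ℝ (fun q : P N => (q.2, amp b q.1 zn.m))
        (zn.pt om0 om2 b z₀) :=
      differentiableAt_snd.prodMk (((contDiff_amp b _).comp contDiff_fst).differentiable
        (by simp)).differentiableAt
    have hm := hL.one_le
    have hmN := hL.le
    have hval : ∀ z : Z N, (((zn.pt om0 om2 b z).2, amp b (zn.pt om0 om2 b z).1 zn.m) : ℝ × ℝ)
        = (zn.mu z.1, zn.radius z zn.m) := fun z => by
      have : amp b (zn.pt om0 om2 b z).1 zn.m = amp b (zn.pre z) zn.m := amp_congr rfl _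
      rw [this, zn.amp_pre b z hm hmN]; rfl
    have hB : DifferentiableAt ℝ (fun q : P N => (pinv (q.2, amp b q.1 zn.m)).1)
        (zn.pt om0 om2 b z₀) := by
      have h1 := hL.pinv_diff
      rw [← hval] at h1
      exact (DifferentiableAt.comp (zn.pt om0 om2 b z₀) (g := pinv) h1 hA).fst
    have h2 := hB.hasFDerivAt.comp_hasDerivAt t₀ hγ
    rw [h0, map_zero] at h2
    have h3 := h2.unique (hc.congr_of_eventuallyEq (by
      filter_upwards [hpinv] with t ht
      simp only [Function.comp]
      rw [hval]
      exact ht))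
    exact hc' h3.symm
  · intro v hv
    have hε0 : ε = zn.eps (zn.pg z₀) := hε.self_of_nhds.symm
    rw [hε0] at hv
    obtain ⟨ξ, h1, h2, h3⟩ := exists_lift hM hs hL (hzero _ hcU) hv
    -- The lift is tangent to the surface: its difference from the graph direction is vertical and
    -- lies in the kernel of the linearization, which is injective on vertical vectors.
    have h4 : ξ = (ξ.1, fderiv ℝ y (c t₀) ξ.1) := by
      have h5 := hsys0 ξ.1
      have h6 : fderiv ℝ (fun z : Z N => zn.sys om2 b z) z₀
          (0, ξ.2 - fderiv ℝ y (c t₀) ξ.1) = 0 := by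
        have : ((0, ξ.2 - fderiv ℝ y (c t₀) ξ.1) : Z N) = ξ - (ξ.1, fderiv ℝ y (c t₀) ξ.1) := by
          refine Prod.ext ?_ rfl
          simp
        rw [this, map_sub, h1, h5, sub_zero]
      have h7 := hinj _ h6
      exact Prod.ext rfl (sub_eq_zero.1 h7)
    have h5 : fderiv ℝ (fun p => zn.eps (zn.pg ((p, y p) : Z N))) (c t₀) ξ.1 = 0 := by
      rw [hΦd.fderiv, ← h2]
      conv_rhs => rw [h4]
      rfl
    -- Both `c'` and the parameter part of the lift are tangent to the level set of `eps` in the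
    -- parameter plane.
    obtain ⟨a, ha⟩ := exists_smul_of_functional hΦ hc' hΦc h5
    refine ⟨a, ?_⟩
    rw [← h3, h4, ← map_smul, ha]
    rfl

end Zone

/-- A turning point of a regular curve of solutions is a generic fold if the curve spans the kernel
of the linearization. -/
theorem isGenericFold_of_curve {E F : Type*} [NormedAddCommGroup E] [NormedSpace ℝ E]
    [NormedAddCommGroup F] [NormedSpace ℝ F] {f : E → ℝ → F}
    (hf : ContDiff ℝ ∞ (fun p : E × ℝ => f p.1 p.2)) {γ : ℝ → E × ℝ} {s₀ : ℝ}
    (hγ : ContDiffAt ℝ ∞ γ s₀) (hzero : ∀ᶠ s in 𝓝 s₀, f (γ s).1 (γ s).2 = 0)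
    (hne : deriv γ s₀ ≠ 0)
    (hker : ∀ v : E × ℝ, fderiv ℝ (fun p : E × ℝ => f p.1 p.2) (γ s₀) v = 0 →
      ∃ a : ℝ, v = a • deriv γ s₀)
    (h1 : deriv (fun s => (γ s).2) s₀ = 0) (h2 : deriv (deriv (fun s => (γ s).2)) s₀ ≠ 0) :
    IsGenericFold f (γ s₀).1 (γ s₀).2 := by
  set G : E × ℝ → F := fun p => f p.1 p.2 with hG
  have hGd : ∀ p, HasFDerivAt G (fderiv ℝ G p) p := fun p =>
    (hf.differentiable (by simp)).differentiableAt.hasFDerivAt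
  have hγ2 : ContDiffAt ℝ 2 γ s₀ := hγ.of_le (WithTop.coe_le_coe.2 le_top)
  have hγev : ∀ᶠ s in 𝓝 s₀, HasDerivAt γ (deriv γ s) s := by
    filter_upwards [hγ2.eventually (by simp)] with s hs
    exact (hs.differentiableAt (by simp)).hasDerivAt
  have hγ1 : DifferentiableAt ℝ (deriv γ) s₀ := by
    have h3 : ContDiffAt ℝ 1 (fderiv ℝ γ) s₀ := hγ2.fderiv_right (by norm_num)
    have h4 := (h3.differentiableAt (by simp)).clm_apply (differentiableAt_const (1 : ℝ))
    exact h4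
  have hμ : (fun s => deriv (fun s => (γ s).2) s) =ᶠ[𝓝 s₀] fun s => (deriv γ s).2 := by
    filter_upwards [hγev] with s hs
    exact ((ContinuousLinearMap.snd ℝ E ℝ).hasFDerivAt.comp_hasDerivAt s hs).deriv
  have hγ'' : HasDerivAt (deriv γ) (deriv (deriv γ) s₀) s₀ := hγ1.hasDerivAt
  have hv2 : (deriv γ s₀).2 = 0 := by rw [← h1]; exact hμ.self_of_nhds.symm
  have hw2 : (deriv (deriv γ) s₀).2 ≠ 0 := by
    intro h
    apply h2
    have h3 := ((ContinuousLinearMap.snd ℝ E ℝ).hasFDerivAt.comp_hasDerivAt s₀ hγ'')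
    have h4 := h3.congr_of_eventuallyEq (f₁ := deriv (fun s => (γ s).2)) hμ
    rw [h4.deriv]; exact h
  have hDγ : ∀ᶠ s in 𝓝 s₀, fderiv ℝ G (γ s) (deriv γ s) = 0 := by
    filter_upwards [hγev, hzero.eventually_nhds] with s hs hs'
    have h3 := (hGd (γ s)).comp_hasDerivAt s hs
    exact h3.unique ((hasDerivAt_const s (0 : F)).congr_of_eventuallyEq hs')
  have hx : ∀ p : E × ℝ, HasFDerivAt (fun x => f x p.2)
      ((fderiv ℝ G p).comp (ContinuousLinearMap.inl ℝ E ℝ)) p.1 := by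
    intro p
    have h3 : HasFDerivAt (fun x : E => (x, p.2)) (ContinuousLinearMap.inl ℝ E ℝ) p.1 :=
      hasFDerivAt_prodMk_left p.1 p.2
    exact (hGd p).comp p.1 h3
  set x₀ := (γ s₀).1
  set μ₀ := (γ s₀).2
  have hDx : ∀ x, fderiv ℝ (fun x => f x μ₀) x
      = (fderiv ℝ G (x, μ₀)).comp (ContinuousLinearMap.inl ℝ E ℝ) := fun x => (hx (x, μ₀)).fderiv
  have hDxx : ∀ x w, fderiv ℝ (fun x => f x μ₀) x w = fderiv ℝ G (x, μ₀) (w, 0) := by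
    intro x w; rw [hDx]; rfl
  have hDμ : deriv (fun μ => f x₀ μ) μ₀ = fderiv ℝ G (γ s₀) (0, 1) := by
    have h3 : HasDerivAt (fun μ : ℝ => ((x₀, μ) : E × ℝ)) (0, 1) μ₀ :=
      (hasDerivAt_const _ _).prodMk (hasDerivAt_id _)
    exact ((hGd (γ s₀)).comp_hasDerivAt μ₀ h3).deriv
  have hv : deriv γ s₀ = ((deriv γ s₀).1, 0) := Prod.ext rfl hv2
  refine ⟨hzero.self_of_nhds, ?_, (deriv γ s₀).1, ?_, ?_, ?_⟩
  -- Otherwise `(w, -1)` would be in the kernel, hence a multiple of the tangent, whose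
  -- `μ`-component is zero.
  · rintro ⟨w, hw⟩
    rw [hDxx, hDμ] at hw
    obtain ⟨a, ha⟩ := hker (w, -1) (by
      have : ((w, -1) : E × ℝ) = (w, 0) - (0, 1) := by ext <;> simp
      rw [this, map_sub, ← hw]; exact sub_self _)
    have := congrArg Prod.snd ha
    rw [Prod.smul_snd, hv2] at this
    norm_num at this
  · intro h
    rw [h] at hv
    exact hne hv
  · intro w
    rw [hDxx]
    constructor
    · intro hw
      obtain ⟨a, ha⟩ := hker (w, 0) hw
      exact ⟨a, congrArg Prod.fst ha⟩
    · rintro ⟨a, rfl⟩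
      have : ((a • (deriv γ s₀).1, 0) : E × ℝ) = a • deriv γ s₀ := by
        rw [hv]; ext <;> simp
      rw [this, map_smul]
      have := hDγ.self_of_nhds
      rw [this, smul_zero]
  · rintro ⟨w, hw⟩
    rw [hDxx] at hw
    have hG2 : HasFDerivAt (fderiv ℝ G) (fderiv ℝ (fderiv ℝ G) (γ s₀)) (γ s₀) := by
      have h3 : ContDiff ℝ 1 (fderiv ℝ G) := hf.fderiv_right (WithTop.coe_le_coe.2 le_top)
      exact (h3.differentiable (by simp)).differentiableAt.hasFDerivAt
    have hsec : fderiv ℝ (fun x => fderiv ℝ (fun y => f y μ₀) x) x₀ (deriv γ s₀).1 (deriv γ s₀).1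
        = fderiv ℝ (fderiv ℝ G) (γ s₀) (deriv γ s₀) (deriv γ s₀) := by
      have h3 : HasFDerivAt (fun x : E => (x, μ₀)) (ContinuousLinearMap.inl ℝ E ℝ) x₀ :=
        hasFDerivAt_prodMk_left x₀ μ₀
      have h4 : HasFDerivAt (fun x => fderiv ℝ G (x, μ₀)) ((fderiv ℝ (fderiv ℝ G) (γ s₀)).comp
        (ContinuousLinearMap.inl ℝ E ℝ)) x₀ := by
        have h := HasFDerivAt.comp (f := fun x : E => (x, μ₀)) x₀ hG2 h3
        exact h
      have h5 := h4.clm_comp (hasFDerivAt_const (ContinuousLinearMap.inl ℝ E ℝ) x₀)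
      have h6 : (fun x => fderiv ℝ (fun y => f y μ₀) x)
        = fun x => (fderiv ℝ G (x, μ₀)).comp (ContinuousLinearMap.inl ℝ E ℝ) := funext hDx
      rw [h6, h5.fderiv]
      conv_rhs => rw [hv]
      simp
    -- The second derivative of the system along the curve is `D²G[γ', γ'] + DG γ'' = 0`. If the
    -- first term were `D_x F w`, then `γ'' + (w, 0)` would be in the kernel, although its
    -- `μ`-component is nonzero.
    have h3 := (hG2.comp_hasDerivAt s₀ hγev.self_of_nhds).clm_apply hγ''
    have h4 := h3.unique ((hasDerivAt_const s₀ (0 : F)).congr_of_eventuallyEq hDγ)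
    rw [hsec] at hw
    obtain ⟨a, ha⟩ := hker (deriv (deriv γ) s₀ + (w, 0)) (by
      rw [map_add]
      rw [show fderiv ℝ G (γ s₀) (w, 0) = _ from hw, add_comm]
      exact h4)
    have := congrArg Prod.snd ha
    rw [Prod.smul_snd, hv2, Prod.snd_add] at this
    exact hw2 (by simpa using this)

end

/-! ### Blow-up coordinates and level curves through a fold -/

theorem clm_prod_apply (L : ℝ × ℝ →L[ℝ] ℝ) (x : ℝ × ℝ) :
    L x = x.1 * L (1, 0) + x.2 * L (0, 1) := by
  have : x = x.1 • ((1, 0) : ℝ × ℝ) + x.2 • ((0, 1) : ℝ × ℝ) := by ext <;> simp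
  conv_lhs => rw [this]
  rw [map_add, map_smul, map_smul]
  rfl

/-- The open strip of blow-up coordinates `(w, h)`. -/
def strip : Set (ℝ × ℝ) := Ioo 0 1 ×ˢ Ioi 0

theorem isOpen_strip : IsOpen strip := isOpen_Ioo.prod isOpen_Ioi

theorem hasDerivAt_fst_of_fderiv {f : ℝ × ℝ → ℝ} {q : ℝ × ℝ} (hf : DifferentiableAt ℝ f q) :
    HasDerivAt (fun w => f (w, q.2)) (fderiv ℝ f q (1, 0)) q.1 :=
  hf.hasFDerivAt.comp_hasDerivAt q.1 ((hasDerivAt_id q.1).prodMk (hasDerivAt_const q.1 q.2))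

theorem hasDerivAt_snd_of_fderiv {f : ℝ × ℝ → ℝ} {q : ℝ × ℝ} (hf : DifferentiableAt ℝ f q) :
    HasDerivAt (fun h => f (q.1, h)) (fderiv ℝ f q (0, 1)) q.2 :=
  hf.hasFDerivAt.comp_hasDerivAt q.2 ((hasDerivAt_const q.2 q.1).prodMk (hasDerivAt_id q.2))

/-- On the level sets of a function increasing in `h` one can use the height as a coordinate. -/
theorem exists_level_height {d : ℕ} (hd : d ≠ 0) {f : ℝ × ℝ → ℝ} (hf : ContDiffOn ℝ ∞ f strip)
    {c C : ℝ} (hc : 0 < c)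
    (hlow : ∀ q ∈ strip, c * (q.2 ^ d * (q.1 * (1 - q.1))) ≤ f q)
    (hup : ∀ q ∈ strip, f q ≤ C * (q.2 ^ d * (q.1 * (1 - q.1))))
    (hfh : ∀ q ∈ strip, 0 < fderiv ℝ f q (0, 1)) :
    (∀ w ∈ Ioo (0 : ℝ) 1, StrictMonoOn (fun h => f (w, h)) (Ioi 0)) ∧
    ∃ H : ℝ × ℝ → ℝ, ContDiffOn ℝ ∞ H strip ∧ ∀ q ∈ strip, 0 < H q ∧ f (q.1, H q) = q.2 := by
  have hdf : ∀ q ∈ strip, DifferentiableAt ℝ f q := fun q hq =>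
    (hf.contDiffAt (isOpen_strip.mem_nhds hq)).differentiableAt (by simp)
  have hmono : ∀ w ∈ Ioo (0 : ℝ) 1, StrictMonoOn (fun h => f (w, h)) (Ioi 0) := by
    intro w hw
    have hd' : ∀ h ∈ Ioi (0 : ℝ), HasDerivAt (fun h => f (w, h)) (fderiv ℝ f (w, h) (0, 1)) h :=
      fun h hh => hasDerivAt_snd_of_fderiv (q := (w, h)) (hdf (w, h) ⟨hw, hh⟩)
    apply strictMonoOn_of_deriv_pos (convex_Ioi 0)
      (fun h hh => (hd' h hh).continuousAt.continuousWithinAt)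
    intro h hh
    rw [interior_Ioi] at hh
    rw [(hd' h hh).deriv]
    exact hfh (w, h) ⟨hw, hh⟩
  have hCpos : 0 < C := by
    have hq : ((1 / 2, 1) : ℝ × ℝ) ∈ strip := ⟨by constructor <;> norm_num, by simp⟩
    have h1 := (hlow _ hq).trans (hup _ hq)
    norm_num at h1
    linarith
  have hex : ∀ q ∈ strip, ∃ h, 0 < h ∧ f (q.1, h) = q.2 := by
    rintro ⟨w, e⟩ ⟨hw, he⟩
    have hw' : 0 < w * (1 - w) := mul_pos hw.1 (by linarith [hw.2])
    simp only [mem_Ioi] at he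
    set A := e / (C * (w * (1 - w))) with hA
    set B := e / (c * (w * (1 - w))) with hB
    have hA0 : 0 < A := by positivity
    have hB0 : 0 < B := by positivity
    -- Truncation at `1` avoids roots: `a ^ d ≤ a ≤ A` and `B ≤ bb ≤ bb ^ d`, so the two-sided bound
    -- on `f` brackets the level `e`.
    set a := min 1 A
    set bb := max 1 B
    have ha0 : 0 < a := lt_min one_pos hA0
    have hb0 : 0 < bb := lt_of_lt_of_le one_pos (le_max_left _ _)
    have hab : a ≤ bb := (min_le_left _ _).trans (le_max_left _ _)
    have hcont : ContinuousOn (fun h => f (w, h)) (Icc a bb) := by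
      intro h hh
      exact ((hasDerivAt_snd_of_fderiv (q := (w, h)) (hdf (w, h)
        ⟨hw, lt_of_lt_of_le ha0 hh.1⟩)).continuousAt).continuousWithinAt
    have h1 : f (w, a) ≤ e := by
      refine (hup (w, a) ⟨hw, ha0⟩).trans ?_
      have : a ^ d ≤ A := (pow_le_of_le_one ha0.le (min_le_left _ _) hd).trans (min_le_right _ _)
      calc C * (a ^ d * (w * (1 - w))) ≤ C * (A * (w * (1 - w))) := by gcongr
        _ = e := by
          rw [hA, div_mul_eq_mul_div, mul_div_assoc', div_eq_iff (by positivity)]; ring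
    have h2 : e ≤ f (w, bb) := by
      refine le_trans ?_ (hlow (w, bb) ⟨hw, hb0⟩)
      have : B ≤ bb ^ d := (le_max_right _ _).trans (le_self_pow₀ (le_max_left _ _) hd)
      calc e = c * (B * (w * (1 - w))) := by
            rw [hB, div_mul_eq_mul_div, mul_div_assoc', eq_div_iff (by positivity)]; ring
        _ ≤ c * (bb ^ d * (w * (1 - w))) := by gcongr
    obtain ⟨h, hh, hh'⟩ := intermediate_value_Icc hab hcont ⟨h1, h2⟩
    exact ⟨h, lt_of_lt_of_le ha0 hh.1, hh'⟩
  choose! H hH using hex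
  refine ⟨hmono, H, ?_, hH⟩
  have hmap : MapsTo (fun q : ℝ × ℝ => (q.1, H q)) strip strip := fun q hq => ⟨hq.1, (hH q hq).1⟩
  have hfs : ContDiffOn ℝ ∞ (fun q : ℝ × ℝ => (q.1, f q)) strip := contDiffOn_fst.prodMk hf
  have h1 := contDiffOn_rightInverse (E := ℝ × ℝ) (F := ℝ × ℝ) rfl isOpen_strip hfs ?_ ?_
    isOpen_strip hmap ?_
  · exact contDiff_snd.comp_contDiffOn h1
  · rintro ⟨w, h⟩ hq ⟨w', h'⟩ hq' heq
    simp only [Prod.mk.injEq] at heq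
    obtain ⟨rfl, h3⟩ := heq
    have h4 : h = h' := (hmono w hq.1).injOn hq.2 hq'.2 h3
    rw [h4]
  · intro q hq v hv
    have h2 : HasFDerivAt (fun q : ℝ × ℝ => (q.1, f q))
        ((ContinuousLinearMap.fst ℝ ℝ ℝ).prod (fderiv ℝ f q)) q :=
      hasFDerivAt_fst.prodMk (hdf q hq).hasFDerivAt
    rw [h2.fderiv] at hv
    have h3 : v.1 = 0 := congrArg Prod.fst hv
    have h4 : fderiv ℝ f q v = 0 := congrArg Prod.snd hv
    rw [clm_prod_apply, h3, zero_mul, zero_add] at h4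
    exact Prod.ext h3 ((mul_eq_zero.1 h4).resolve_right (hfh q hq).ne')
  · intro q hq
    exact Prod.ext rfl (hH q hq).2

/-- The map `(w, h) ↦ (h² ψ(w), f(w, h))` is invertible. -/
theorem exists_blowup_inverse {d : ℕ} (hd : d ≠ 0) {f : ℝ × ℝ → ℝ} (hf : ContDiffOn ℝ ∞ f strip)
    {c C : ℝ} (hc : 0 < c)
    (hlow : ∀ q ∈ strip, c * (q.2 ^ d * (q.1 * (1 - q.1))) ≤ f q)
    (hup : ∀ q ∈ strip, f q ≤ C * (q.2 ^ d * (q.1 * (1 - q.1))))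
    (hfh : ∀ q ∈ strip, 0 < fderiv ℝ f q (0, 1)) {ψ : ℝ → ℝ} (hψ : ContDiff ℝ ∞ ψ)
    {κ : ℝ} (hκ : 0 < κ) (hψ0 : ∀ w ≤ κ, ψ w = -1) (hψ1 : ∀ w, 1 - κ ≤ w → ψ w = 1)
    (hdet : ∀ q ∈ strip, 0 < q.2 * deriv ψ q.1 * fderiv ℝ f q (0, 1)
      - 2 * ψ q.1 * fderiv ℝ f q (1, 0)) :
    ∃ g : ℝ × ℝ → ℝ × ℝ, ContDiffOn ℝ ∞ g (univ ×ˢ Ioi 0) ∧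
      ∀ σ e, 0 < e → g (σ, e) ∈ strip ∧ (g (σ, e)).2 ^ 2 * ψ (g (σ, e)).1 = σ ∧
        f (g (σ, e)) = e := by
  obtain ⟨hmono, H, hHs, hH⟩ := exists_level_height hd hf hc hlow hup hfh
  have hdf : ∀ q ∈ strip, DifferentiableAt ℝ f q := fun q hq =>
    (hf.contDiffAt (isOpen_strip.mem_nhds hq)).differentiableAt (by simp)
  have hψd : ∀ w, HasDerivAt ψ (deriv ψ w) w := fun w =>
    (hψ.differentiable (by simp)).differentiableAt.hasDerivAt
  have hCpos : 0 < C := by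
    have hq : ((1 / 2, 1) : ℝ × ℝ) ∈ strip := ⟨by constructor <;> norm_num, by simp⟩
    have h1 := (hlow _ hq).trans (hup _ hq)
    norm_num at h1
    linarith
  have hHd : ∀ q ∈ strip, DifferentiableAt ℝ H q := fun q hq =>
    (hHs.contDiffAt (isOpen_strip.mem_nhds hq)).differentiableAt (by simp)
  -- Along the level curve `h = H(w, e)` the slope of `H` is `-f_w / f_h`. The derivative of `h²
  -- ψ(w)` is therefore `h / f_h` times the determinant assumed positive.
  have hσd : ∀ e, 0 < e → ∀ w ∈ Ioo (0 : ℝ) 1, ∃ s, 0 < s ∧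
      HasDerivAt (fun w => H (w, e) ^ 2 * ψ w) s w := by
    intro e he w hw
    have hq : ((w, e) : ℝ × ℝ) ∈ strip := ⟨hw, he⟩
    have hHw := hasDerivAt_fst_of_fderiv (hHd _ hq)
    set k := fderiv ℝ H (w, e) (1, 0)
    simp only at hHw
    obtain ⟨hpos, hfe⟩ := hH _ hq
    have hq' : ((w, H (w, e)) : ℝ × ℝ) ∈ strip := ⟨hw, hpos⟩
    have h1 := (hdf _ hq').hasFDerivAt.comp_hasDerivAt w ((hasDerivAt_id w).prodMk hHw)
    have h2 : HasDerivAt (fun w => f (w, H (w, e))) 0 w :=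
      (hasDerivAt_const w e).congr_of_eventuallyEq (by
        filter_upwards [isOpen_Ioo.mem_nhds hw] with w' hw'
        exact (hH (w', e) ⟨hw', he⟩).2)
    have h3 := h1.unique h2
    rw [clm_prod_apply] at h3
    simp only at h3
    have h4 := (hHw.pow 2).mul (hψd w)
    refine ⟨_, ?_, h4⟩
    have h5 := hdet _ hq'
    have h6 := hfh _ hq'
    simp only at h5
    set A := fderiv ℝ f (w, H (w, e)) (0, 1)
    set B := fderiv ℝ f (w, H (w, e)) (1, 0)
    have h7 : k = - B / A := by
      field_simp; linarith
    have h8 : ((2 : ℕ) * H (w, e) ^ (2 - 1) * k * ψ w + H (w, e) ^ 2 * deriv ψ w)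
        = H (w, e) / A * (H (w, e) * deriv ψ w * A - 2 * ψ w * B) := by
      rw [h7]; field_simp; push_cast; ring
    simp only [Pi.pow_apply]
    rw [h8]
    positivity
  have hσmono : ∀ e, 0 < e → StrictMonoOn (fun w => H (w, e) ^ 2 * ψ w) (Ioo 0 1) := by
    intro e he
    apply strictMonoOn_of_deriv_pos (convex_Ioo 0 1)
    · intro w hw
      obtain ⟨s, -, hs⟩ := hσd e he w hw
      exact hs.continuousAt.continuousWithinAt
    · intro w hw
      rw [interior_Ioo] at hw
      obtain ⟨s, hs0, hs⟩ := hσd e he w hw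
      rw [hs.deriv]; exact hs0
  -- Close to the two ends of `(0, 1)` the upper bound on `f` forces the level curve to be high.
  have hlarge : ∀ e, 0 < e → ∀ R, 1 ≤ R → ∀ w ∈ Ioo (0 : ℝ) 1,
      w * (1 - w) ≤ e / (C * R ^ d) → R ≤ H (w, e) := by
    intro e he R hR w hw hle
    have hw' : 0 < w * (1 - w) := mul_pos hw.1 (by linarith [hw.2])
    obtain ⟨hpos, hfe⟩ := hH (w, e) ⟨hw, he⟩
    have h1 := hup (w, H (w, e)) ⟨hw, hpos⟩
    simp only at h1 hfe
    rw [hfe] at h1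
    have hR0 : 0 < R := by linarith
    by_contra! hlt
    have h2 : H (w, e) ^ d < R ^ d := pow_lt_pow_left₀ hlt hpos.le hd
    have h3 : w * (1 - w) * (C * R ^ d) ≤ e := by
      rwa [le_div_iff₀ (by positivity)] at hle
    have h4 : C * (H (w, e) ^ d * (w * (1 - w))) < C * (R ^ d * (w * (1 - w))) := by gcongr
    nlinarith
  have hex : ∀ σ e, 0 < e → ∃ w ∈ Ioo (0 : ℝ) 1, H (w, e) ^ 2 * ψ w = σ := by
    intro σ e he
    -- Where `ψ = ∓1` and the height is at least `R`, the function `h² ψ` passes below and above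
    -- `σ`, since `R² ≥ |σ|`.
    set R := 1 + |σ|
    have hR : 1 ≤ R := by simp [R]
    have hR0 : 0 < R := by linarith
    have hR2 : |σ| ≤ R ^ 2 := by
      have := abs_nonneg σ
      have : R = 1 + |σ| := rfl
      nlinarith
    set t := min (e / (C * R ^ d)) (min κ (1 / 2)) with ht
    have ht0 : 0 < t := lt_min (by positivity) (lt_min hκ (by norm_num))
    have htk : t ≤ κ := (min_le_right _ _).trans (min_le_left _ _)
    have hth : t ≤ 1 / 2 := (min_le_right _ _).trans (min_le_right _ _)
    have hte : t ≤ e / (C * R ^ d) := min_le_left _ _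
    have hw1 : t ∈ Ioo (0 : ℝ) 1 := ⟨ht0, by linarith⟩
    have hw2 : 1 - t ∈ Ioo (0 : ℝ) 1 := ⟨by linarith, by linarith⟩
    have hR1 := hlarge e he R hR t hw1 (by nlinarith)
    have hR3 := hlarge e he R hR (1 - t) hw2 (by nlinarith)
    have hcont : ContinuousOn (fun w => H (w, e) ^ 2 * ψ w) (Icc t (1 - t)) := by
      intro w hw
      obtain ⟨s, -, hs⟩ := hσd e he w ⟨by linarith [hw.1], by linarith [hw.2]⟩
      exact hs.continuousAt.continuousWithinAt
    obtain ⟨w, hw, hw'⟩ := intermediate_value_Icc (by linarith) hcont (show σ ∈ Icc _ _ from ⟨by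
      simp only [hψ0 t htk]
      have : R ^ 2 ≤ H (t, e) ^ 2 := by gcongr
      linarith [neg_abs_le σ], by
      simp only [hψ1 (1 - t) (by linarith)]
      have : R ^ 2 ≤ H (1 - t, e) ^ 2 := by gcongr
      linarith [le_abs_self σ]⟩)
    exact ⟨w, ⟨by linarith [hw.1], by linarith [hw.2]⟩, hw'⟩
  choose! W hW using hex
  have hW' : ∀ σ e, 0 < e → ((W σ e, e) : ℝ × ℝ) ∈ strip := fun σ e he => ⟨(hW σ e he).1, he⟩
  refine ⟨fun q => (W q.1 q.2, H (W q.1 q.2, q.2)), ?_, fun σ e he => ⟨⟨(hW σ e he).1,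
    (hH _ (hW' σ e he)).1⟩, (hW σ e he).2, (hH _ (hW' σ e he)).2⟩⟩
  have hΘ : ContDiffOn ℝ ∞ (fun q : ℝ × ℝ => (q.2 ^ 2 * ψ q.1, f q)) strip :=
    (((contDiff_snd.pow 2).mul (hψ.comp contDiff_fst)).contDiffOn).prodMk hf
  apply contDiffOn_rightInverse (E := ℝ × ℝ) (F := ℝ × ℝ) rfl isOpen_strip hΘ ?_ ?_
    (isOpen_univ.prod isOpen_Ioi) ?_ ?_
  · have hHinv : ∀ q ∈ strip, H (q.1, f q) = q.2 ∧ 0 < f q := by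
      rintro ⟨w, h⟩ ⟨hw, hh⟩
      have hpos : 0 < f (w, h) := lt_of_lt_of_le (by
        have : 0 < w * (1 - w) := mul_pos hw.1 (by linarith [hw.2])
        simp only [mem_Ioi] at hh
        positivity) (hlow (w, h) ⟨hw, hh⟩)
      have h1 := hH (w, f (w, h)) ⟨hw, hpos⟩
      exact ⟨(hmono w hw).injOn h1.1 hh h1.2, hpos⟩
    rintro ⟨w, h⟩ hq ⟨w', h'⟩ hq' heq
    simp only [Prod.mk.injEq] at heq
    have h1 := hHinv _ hq
    have h2 := hHinv _ hq'
    simp only at h1 h2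
    have h3 : w = w' := by
      apply (hσmono _ h1.2).injOn hq.1 hq'.1
      simp only
      rw [h1.1]
      rw [heq.2, h2.1]
      exact heq.1
    subst h3
    rw [← h1.1, heq.2, h2.1]
  · intro q hq v hv
    have h1 := (((hasFDerivAt_snd (𝕜 := ℝ) (p := q)).pow 2).mul
      ((hψd q.1).comp_hasFDerivAt q (hasFDerivAt_fst (𝕜 := ℝ) (p := q)))).prodMk (hdf q hq).hasFDerivAt
    have h2 : fderiv ℝ (fun q : ℝ × ℝ => (q.2 ^ 2 * ψ q.1, f q)) q v = _ :=
      congrArg (fun L => L v) h1.fderiv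
    rw [h2] at hv
    have h3 := congrArg Prod.fst hv
    have h4 : fderiv ℝ f q v = 0 := congrArg Prod.snd hv
    simp at h3
    rw [clm_prod_apply] at h4
    have h5 := hdet q hq
    have hq2 : 0 < q.2 := hq.2
    set A := fderiv ℝ f q (0, 1)
    set B := fderiv ℝ f q (1, 0)
    have h6 : q.2 * (q.2 * deriv ψ q.1 * v.1 + 2 * ψ q.1 * v.2) = 0 := by linarith
    have h7 := (mul_eq_zero.1 h6).resolve_left hq2.ne'
    have hA := hfh q hq
    have h8 : v.1 * (q.2 * deriv ψ q.1 * A - 2 * ψ q.1 * B) = 0 := by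
      linear_combination A * h7 - 2 * ψ q.1 * h4
    have h9 : v.1 = 0 := (mul_eq_zero.1 h8).resolve_right h5.ne'
    rw [h9, zero_mul, zero_add] at h4
    exact Prod.ext h9 ((mul_eq_zero.1 h4).resolve_right hA.ne')
  · rintro ⟨σ, e⟩ ⟨-, he⟩
    exact ⟨(hW σ e he).1, (hH _ (hW' σ e he)).1⟩
  · rintro ⟨σ, e⟩ ⟨-, he⟩
    exact Prod.ext (hW σ e he).2 (hH _ (hW' σ e he)).2

/-- Odd smooth step function around `a`. -/
theorem exists_smooth_sign {a : ℝ} (h0 : 0 < a) (h1 : a < 1) : ∃ (ψ : ℝ → ℝ) (κ : ℝ),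
    ContDiff ℝ ∞ ψ ∧ 0 < κ ∧ κ < 1 / 2 ∧ (∀ w ≤ κ, ψ w = -1) ∧ (∀ w, 1 - κ ≤ w → ψ w = 1) ∧
    (∀ w, |ψ w| ≤ 1) ∧ (∀ w, 0 ≤ deriv ψ w) ∧ 0 < deriv ψ a ∧ (∀ w < a, ψ w < 0) ∧
    ∀ w, a < w → 0 < ψ w := by
  set r := min a (1 - a) / 2 with hr
  have hr0 : 0 < r := by
    have : 0 < min a (1 - a) := lt_min h0 (by linarith)
    positivity
  have hra : r ≤ a / 2 := by have := min_le_left a (1 - a); linarith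
  have hra' : r ≤ (1 - a) / 2 := by have := min_le_right a (1 - a); linarith
  let T := Real.smoothTransition
  let l : ℝ → ℝ := fun w => (w - a) / (2 * r) + 1 / 2
  have hl : ContDiff ℝ ∞ l := ((contDiff_id.sub contDiff_const).div_const _).add contDiff_const
  have hld : ∀ w, HasDerivAt l (1 / (2 * r)) w := fun w =>
    (((hasDerivAt_id w).sub_const a).div_const _).add_const _
  have hT : ContDiff ℝ ∞ T := Real.smoothTransition.contDiff
  have hTd : ∀ x, HasDerivAt T (deriv T x) x := fun x =>
    (hT.differentiable (by simp)).differentiableAt.hasDerivAt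
  have hψd : ∀ w, HasDerivAt (fun w => 2 * T (l w) - 1) (2 * (deriv T (l w) * (1 / (2 * r)))) w :=
    fun w => (((hTd (l w)).comp w (hld w)).const_mul 2).sub_const 1
  -- The transition is `E(x) / (E(x) + E(1 - x))` with `E = expNegInvGlue`; at the midpoint both
  -- values of `E` agree and the derivative is computed from the quotient rule.
  have hThalf : 0 < deriv T (1 / 2) := by
    have hE2 : HasDerivAt expNegInvGlue (Real.exp (-(1 / 2 : ℝ)⁻¹) * 4) (1 / 2) := by
      have h2 : HasDerivAt (fun x : ℝ => Real.exp (-x⁻¹)) (Real.exp (-(1 / 2 : ℝ)⁻¹) * 4) (1 / 2) := by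
        have := ((hasDerivAt_inv (show (1 / 2 : ℝ) ≠ 0 by norm_num)).fun_neg).exp
        convert this using 2
        norm_num
      apply h2.congr_of_eventuallyEq
      filter_upwards [isOpen_Ioi.mem_nhds (show (1 / 2 : ℝ) ∈ Ioi 0 by norm_num)] with x hx
      simp [expNegInvGlue, not_le.2 (mem_Ioi.1 hx)]
    set e' := Real.exp (-(1 / 2 : ℝ)⁻¹) * 4 with he'
    have he0 : 0 < e' := by positivity
    have hE3 : HasDerivAt (fun x : ℝ => expNegInvGlue (1 - x)) (e' * (-1)) (1 / 2) := by
      have h3 : HasDerivAt (fun x : ℝ => 1 - x) (-1) (1 / 2) := (hasDerivAt_id _).const_sub 1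
      have h4 : HasDerivAt expNegInvGlue e' (1 - 1 / 2) := by norm_num at hE2 ⊢; exact hE2
      exact h4.comp (1 / 2) h3
    have h5 := hE2.fun_div (hE2.fun_add hE3) (Real.smoothTransition.pos_denom (1 / 2)).ne'
    have h6 : deriv T (1 / 2) = _ := h5.deriv
    rw [h6]
    have h7 : 0 < expNegInvGlue (1 / 2) := expNegInvGlue.pos_of_pos (by norm_num)
    have h8 : (1 - 1 / 2 : ℝ) = 1 / 2 := by norm_num
    rw [h8]
    apply div_pos _ (by positivity)
    ring_nf
    positivity
  have hTmono : ∀ x, 0 ≤ deriv T x := fun x => Real.smoothTransition.monotone.deriv_nonneg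
  have hla : l a = 1 / 2 := by simp [l]
  have hThv : T (1 / 2) = 1 / 2 := by
    have h7 : 0 < expNegInvGlue (1 / 2) := expNegInvGlue.pos_of_pos (by norm_num)
    have h8 : (1 - 1 / 2 : ℝ) = 1 / 2 := by norm_num
    change expNegInvGlue (1 / 2) / (expNegInvGlue (1 / 2) + expNegInvGlue (1 - 1 / 2)) = _
    rw [h8]; field_simp; norm_num
  have hψmono : Monotone (fun w => 2 * T (l w) - 1) :=
    monotone_of_deriv_nonneg (fun w => (hψd w).differentiableAt) (fun w => by
      rw [(hψd w).deriv]; have := hTmono (l w); positivity)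
  have hψa : 2 * T (l a) - 1 = 0 := by rw [hla, hThv]; norm_num
  -- A second zero would make the monotone function vanish on an interval ending at `a`, against its
  -- positive derivative there.
  have hsl : ∀ w, w ≠ a → 2 * T (l w) - 1 ≠ 0 := by
    intro w hw h
    have hder := (hψd a)
    have hpos : 0 < 2 * (deriv T (l a) * (1 / (2 * r))) := by rw [hla]; positivity
    rcases lt_or_gt_of_ne hw with hlt | hlt
    · have hev : ∀ x ∈ Icc w a, 2 * T (l x) - 1 = 0 := fun x hx =>
        le_antisymm (by rw [← hψa]; exact hψmono hx.2) (by rw [← h]; exact hψmono hx.1)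
      have h2 : HasDerivWithinAt (fun w => 2 * T (l w) - 1) 0 (Icc w a) a :=
        (hasDerivWithinAt_const a _ 0).congr (fun x hx => hev x hx) (hev a ⟨hlt.le, le_rfl⟩)
      have h3 := (uniqueDiffOn_Icc hlt a ⟨hlt.le, le_rfl⟩).eq_deriv _ hder.hasDerivWithinAt h2
      exact hpos.ne' h3
    · have hev : ∀ x ∈ Icc a w, 2 * T (l x) - 1 = 0 := fun x hx =>
        le_antisymm (by rw [← h]; exact hψmono hx.2) (by rw [← hψa]; exact hψmono hx.1)
      have h2 : HasDerivWithinAt (fun w => 2 * T (l w) - 1) 0 (Icc a w) a :=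
        (hasDerivWithinAt_const a _ 0).congr (fun x hx => hev x hx) (hev a ⟨le_rfl, hlt.le⟩)
      have h3 := (uniqueDiffOn_Icc hlt a ⟨le_rfl, hlt.le⟩).eq_deriv _ hder.hasDerivWithinAt h2
      exact hpos.ne' h3
  refine ⟨fun w => 2 * T (l w) - 1, r / 2, (contDiff_const.mul (hT.comp hl)).sub contDiff_const,
    by positivity, by linarith, ?_, ?_, ?_, ?_, ?_, ?_, ?_⟩
  · intro w hw
    have : T (l w) = 0 := Real.smoothTransition.zero_of_nonpos (by
      have : (w - a) / (2 * r) ≤ -(1 / 2) := by rw [div_le_iff₀ (by positivity)]; linarith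
      simp only [l]; linarith)
    simp only [this]; norm_num
  · intro w hw
    have : T (l w) = 1 := Real.smoothTransition.one_of_one_le (by
      have : (1 / 2) ≤ (w - a) / (2 * r) := by rw [le_div_iff₀ (by positivity)]; linarith
      simp only [l]; linarith)
    simp only [this]; norm_num
  · intro w
    have h2 := Real.smoothTransition.nonneg (l w)
    have h3 := Real.smoothTransition.le_one (l w)
    rw [abs_le]
    constructor <;> linarith
  · intro w
    rw [(hψd w).deriv]; have := hTmono (l w); positivity
  · rw [(hψd a).deriv, hla]; positivity
  · intro w hw
    exact lt_of_le_of_ne (by rw [← hψa]; exact hψmono hw.le) (hsl w hw.ne)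
  · intro w hw
    exact lt_of_le_of_ne (by rw [← hψa]; exact hψmono hw.le) (hsl w hw.ne').symm

/-- The boundary values are known only for `0 ≤ x ≤ 1`. At the end points the formula determines the
derivative because derivatives within a nondegenerate interval are unique. -/
theorem fderiv_eq_of_eqOn_Icc {F : ℝ × ℝ → ℝ} {w : ℝ} (hF : DifferentiableAt ℝ F (w, 0))
    (hw : w ∈ Icc (0 : ℝ) 1) {p : ℝ → ℝ} {p' : ℝ} (hp : HasDerivAt p p' w)
    (h : ∀ x ∈ Icc (0 : ℝ) 1, F (x, 0) = p x) : fderiv ℝ F (w, 0) (1, 0) = p' := by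
  have h1 := (hasDerivAt_fst_of_fderiv hF).hasDerivWithinAt (s := Icc 0 1)
  have h2 : HasDerivWithinAt (fun w => F (w, 0)) p' (Icc 0 1) w :=
    hp.hasDerivWithinAt.congr h (h w hw)
  exact (uniqueDiffOn_Icc one_pos w hw).eq_deriv _ h1 h2

/-- Turning points of a level curve of a function concave in its first argument at critical
points. -/
theorem deriv_deriv_pos_of_level {f : ℝ × ℝ → ℝ} {c : ℝ → ℝ × ℝ} {t e : ℝ}
    (hf : ContDiffAt ℝ ∞ f (c t)) (hc : ContDiffAt ℝ ∞ c t) (hconst : ∀ᶠ s in 𝓝 t, f (c s) = e)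
    (hc' : deriv c t ≠ 0) (hfh : 0 < fderiv ℝ f (c t) (0, 1))
    (hww : fderiv ℝ f (c t) (1, 0) = 0 →
      fderiv ℝ (fun q => fderiv ℝ f q (1, 0)) (c t) (1, 0) < 0)
    (h0 : deriv (fun s => (c s).2) t = 0) : 0 < deriv (deriv (fun s => (c s).2)) t := by
  have hc2 : ContDiffAt ℝ 2 c t := hc.of_le (WithTop.coe_le_coe.2 le_top)
  have hf2 : ContDiffAt ℝ 2 f (c t) := hf.of_le (WithTop.coe_le_coe.2 le_top)
  have hcev : ∀ᶠ s in 𝓝 t, HasDerivAt c (deriv c s) s := by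
    filter_upwards [hc2.eventually (by simp)] with s hs
    exact (hs.differentiableAt (by simp)).hasDerivAt
  have hfev : ∀ᶠ s in 𝓝 t, HasFDerivAt f (fderiv ℝ f (c s)) (c s) := by
    filter_upwards [hc.continuousAt.eventually (hf2.eventually (by simp))] with s hs
    exact (hs.differentiableAt (by simp)).hasFDerivAt
  have hc1 : HasDerivAt (deriv c) (deriv (deriv c) t) t := by
    have h3 : ContDiffAt ℝ 1 (fderiv ℝ c) t := hc2.fderiv_right (by norm_num)
    have h4 := (h3.differentiableAt (by simp)).clm_apply (differentiableAt_const (1 : ℝ))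
    exact DifferentiableAt.hasDerivAt h4
  have hfd : HasFDerivAt (fderiv ℝ f) (fderiv ℝ (fderiv ℝ f) (c t)) (c t) := by
    have h3 : ContDiffAt ℝ 1 (fderiv ℝ f) (c t) := hf2.fderiv_right (by norm_num)
    exact (h3.differentiableAt (by simp)).hasFDerivAt
  have hsnd : (fun s => deriv (fun s => (c s).2) s) =ᶠ[𝓝 t] fun s => (deriv c s).2 := by
    filter_upwards [hcev] with s hs
    exact ((ContinuousLinearMap.snd ℝ ℝ ℝ).hasFDerivAt.comp_hasDerivAt s hs).deriv
  have hD : ∀ᶠ s in 𝓝 t, fderiv ℝ f (c s) (deriv c s) = 0 := by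
    filter_upwards [hcev, hfev, hconst.eventually_nhds] with s h1 h2 h3
    exact (h2.comp_hasDerivAt s h1).unique ((hasDerivAt_const s e).congr_of_eventuallyEq h3)
  have h1 : (deriv c t).2 = 0 := by rw [← h0]; exact hsnd.self_of_nhds.symm
  have h2 : deriv (deriv (fun s => (c s).2)) t = (deriv (deriv c) t).2 := by
    have h3 := ((ContinuousLinearMap.snd ℝ ℝ ℝ).hasFDerivAt.comp_hasDerivAt t hc1)
    exact (h3.congr_of_eventuallyEq (f₁ := deriv (fun s => (c s).2)) hsnd).deriv
  -- Differentiating `f (c s) = e` twice at the turning point leaves `f_ww (c₁')² + f_h c₂'' = 0`,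
  -- where `f_ww < 0 < f_h`.
  have h3 := ((hfd.comp_hasDerivAt t hcev.self_of_nhds).clm_apply hc1).unique
    ((hasDerivAt_const t (0 : ℝ)).congr_of_eventuallyEq hD)
  have hW : (deriv c t).1 ≠ 0 := fun h => hc' (Prod.ext h h1)
  have hv : deriv c t = (deriv c t).1 • ((1, 0) : ℝ × ℝ) := by
    ext
    · simp
    · simp [h1]
  have h4 : fderiv ℝ f (c t) (1, 0) = 0 := by
    have := hD.self_of_nhds
    rw [hv, map_smul, smul_eq_mul] at this
    exact (mul_eq_zero.1 this).resolve_left hW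
  have h5 := hww h4
  have h6 : fderiv ℝ (fun q => fderiv ℝ f q (1, 0)) (c t) (1, 0)
      = fderiv ℝ (fderiv ℝ f) (c t) (1, 0) (1, 0) := by
    rw [(hfd.clm_apply (hasFDerivAt_const ((1, 0) : ℝ × ℝ) (c t))).fderiv]
    simp
  rw [h6] at h5
  rw [h2]
  simp only [Function.comp_apply] at h3
  rw [clm_prod_apply (fderiv ℝ f (c t)), h4, hv, map_smul, map_smul, smul_apply,
    smul_eq_mul, smul_eq_mul, mul_zero, zero_add] at h3
  have h7 : 0 < (deriv c t).1 ^ 2 := by positivity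
  have h8 : 0 < (deriv (deriv c) t).2 * fderiv ℝ f (c t) (0, 1) := by nlinarith
  exact (mul_pos_iff_of_pos_right hfh).1 h8

/-- A cutoff of the identity with small values and small logarithmic derivative. -/
theorem exists_cutoff {r : ℝ} (hr : 0 < r) : ∃ (a : ℝ) (χ : ℝ → ℝ), 0 < a ∧ a < r ∧
    ContDiff ℝ ∞ χ ∧ (∀ h ≤ a, χ h = h) ∧ ∀ h, 0 < h → |χ h| < r ∧ |h * deriv χ h| < r := by
  let T := Real.smoothTransition
  have hT : ContDiff ℝ ∞ T := Real.smoothTransition.contDiff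
  set k : ℝ → ℝ := fun u => u * T (2 - u) with hk
  have hks : ContDiff ℝ ∞ k := contDiff_id.mul (hT.comp (contDiff_const.sub contDiff_id))
  have hkd : ∀ u, HasDerivAt k (deriv k u) u := fun u =>
    (hks.differentiable (by simp)).differentiableAt.hasDerivAt
  have hk0 : ∀ u, 2 ≤ u → k u = 0 := fun u hu => by
    have : T (2 - u) = 0 := Real.smoothTransition.zero_of_nonpos (by linarith)
    simp [hk, this]
  have hkd0 : ∀ u, 2 < u → deriv k u = 0 := fun u hu => by
    have : k =ᶠ[𝓝 u] fun _ => 0 := by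
      filter_upwards [isOpen_Ioi.mem_nhds hu] with v hv using hk0 v (le_of_lt hv)
    rw [this.deriv_eq]; simp
  have hcont : Continuous fun u => |k u| + |u * deriv k u| :=
    (hks.continuous.abs).add ((continuous_id.mul (hks.continuous_deriv (by simp))).abs)
  obtain ⟨M, hM⟩ := (isCompact_Icc (a := (0 : ℝ)) (b := 2)).bddAbove_image hcont.continuousOn
  have hM' : ∀ u, 0 ≤ u → |k u| + |u * deriv k u| ≤ max M 0 := by
    intro u hu
    rcases le_or_gt u 2 with h | h
    · exact (hM ⟨u, ⟨hu, h⟩, rfl⟩).trans (le_max_left _ _)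
    · rw [hk0 u h.le, hkd0 u h]; simp
  set M' := max M 0
  have hM0 : 0 ≤ M' := le_max_right _ _
  -- Rescaling `k` to `a k(h / a)` multiplies both the value and `h` times the derivative by `a`, so
  -- the fixed bound `M'` becomes smaller than `r`. The summand `2` also ensures `a < r`.
  set a := r / (M' + 2) with ha
  have ha0 : 0 < a := by positivity
  have har : a * (M' + 2) = r := by rw [ha]; field_simp
  have hχd : ∀ h, HasDerivAt (fun h => a * k (h / a)) (a * (deriv k (h / a) * (1 / a))) h :=
    fun h => by
    have h1 : HasDerivAt (fun x : ℝ => x / a) (1 / a) h := (hasDerivAt_id h).div_const a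
    exact (HasDerivAt.comp (h₂ := k) h (hkd (h / a)) h1).const_mul a
  refine ⟨a, fun h => a * k (h / a), ha0, by nlinarith, contDiff_const.mul
    (hks.comp (contDiff_id.div_const a)), ?_, ?_⟩
  · intro h hh
    have h1 : T (2 - h / a) = 1 := Real.smoothTransition.one_of_one_le (by
      have : h / a ≤ 1 := by rw [div_le_one ha0]; exact hh
      linarith)
    simp only [hk, h1]; field_simp
  · intro h hh
    rw [(hχd h).deriv]
    have h1 := hM' (h / a) (by positivity)
    have h2 := abs_nonneg (k (h / a))
    have h3 := abs_nonneg (h / a * deriv k (h / a))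
    have h4 : h * (a * (deriv k (h / a) * (1 / a))) = a * (h / a * deriv k (h / a)) := by
      field_simp
    have h5 : ∀ y, |a * y| = a * |y| := fun y => by rw [abs_mul, abs_of_pos ha0]
    rw [h4, h5, h5]
    constructor <;> nlinarith

set_option maxHeartbeats 1000000 in
/-- Level curves of `h ^ d * w * (1 - w) * G` through the boundary layer at `h = 0`, parametrized so
that `h²` is the distance of the parameter to `0` outside a small interval. -/
theorem exists_fold_curve {d : ℕ} (hd : 1 ≤ d) {U : Set (ℝ × ℝ)} (hU : IsOpen U)
    {G : ℝ × ℝ → ℝ} (hG : ContDiffOn ℝ ∞ G U) {c₀ θ : ℝ} (hc₀ : 0 < c₀) (hθ0 : 0 ≤ θ) (hθ1 : θ ≤ 1)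
    (hKU : ∀ w ∈ Icc (0 : ℝ) 1, (w, 0) ∈ U)
    (hG0 : ∀ w ∈ Icc (0 : ℝ) 1, G (w, 0) = c₀ * (1 + θ * w)) {h₀ : ℝ} (hh₀ : 0 < h₀) :
    ∃ (h₁ : ℝ) (ψ : ℝ → ℝ) (cp : ℝ × ℝ → ℝ × ℝ), 0 < h₁ ∧ h₁ < h₀ ∧
      (∀ q ∈ Icc (0 : ℝ) 1 ×ˢ Icc 0 h₁, q ∈ U ∧ 0 < G q) ∧ Continuous ψ ∧ (∀ w, |ψ w| ≤ 1) ∧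
      ψ 0 = -1 ∧ ψ 1 = 1 ∧
      ContDiffOn ℝ ∞ cp (univ ×ˢ Ioi 0) ∧
      (∀ σ e, 0 < e → cp (σ, e) ∈ strip ∧ (cp (σ, e)).2 ^ 2 * ψ (cp (σ, e)).1 = σ ∧
        ((cp (σ, e)).2 < h₁ →
          (cp (σ, e)).2 ^ d * ((cp (σ, e)).1 * (1 - (cp (σ, e)).1) * G (cp (σ, e))) = e ∧
          0 < fderiv ℝ (fun q : ℝ × ℝ => q.2 ^ d * (q.1 * (1 - q.1) * G q)) (cp (σ, e)) (0, 1) ∧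
          deriv (fun t => cp (t, e)) σ ≠ 0 ∧
          (deriv (fun t => (cp (t, e)).2) σ = 0 →
            0 < deriv (deriv (fun t => (cp (t, e)).2)) σ))) ∧
      ∀ η > 0, ∃ ε₁ > 0, ∀ e, 0 < e → e < ε₁ → ∀ σ,
        (η ≤ |σ| → (cp (σ, e)).2 ^ 2 = |σ|) ∧ (|σ| < η → (cp (σ, e)).2 ^ 2 < η) := by
  set E : ℝ × ℝ → ℝ := fun q => q.1 * (1 - q.1) * G q with hE
  have hEs : ContDiffOn ℝ ∞ E U :=
    ((contDiff_fst.mul (contDiff_const.sub contDiff_fst)).contDiffOn).mul hG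
  set Ew : ℝ × ℝ → ℝ := fun q => fderiv ℝ E q (1, 0) with hEw
  have hEws : ContDiffOn ℝ ∞ Ew U := by
    have h1 : ContDiffOn ℝ ∞ (fderiv ℝ E) U := hEs.fderiv_of_isOpen hU (by simp)
    exact h1.clm_apply contDiffOn_const
  set Eww : ℝ × ℝ → ℝ := fun q => fderiv ℝ Ew q (1, 0) with hEww
  have hEwws : ContDiffOn ℝ ∞ Eww U := by
    have h1 : ContDiffOn ℝ ∞ (fderiv ℝ Ew) U := hEws.fderiv_of_isOpen hU (by simp)
    exact h1.clm_apply contDiffOn_const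
  set Gh : ℝ × ℝ → ℝ := fun q => fderiv ℝ G q (0, 1) with hGh
  have hGhs : ContDiffOn ℝ ∞ Gh U := by
    have h1 : ContDiffOn ℝ ∞ (fderiv ℝ G) U := hG.fderiv_of_isOpen hU (by simp)
    exact h1.clm_apply contDiffOn_const
  have hdiff : ∀ {F : ℝ × ℝ → ℝ}, ContDiffOn ℝ ∞ F U → ∀ q ∈ U, DifferentiableAt ℝ F q :=
    fun hF q hq => (hF.contDiffAt (hU.mem_nhds hq)).differentiableAt (by simp)
  have hE0 : ∀ w ∈ Icc (0 : ℝ) 1, E (w, 0) = c₀ * (w * (1 - w) * (1 + θ * w)) := by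
    intro w hw; simp only [hE]; rw [hG0 w hw]; ring
  have hEw0 : ∀ w ∈ Icc (0 : ℝ) 1,
      Ew (w, 0) = c₀ * (1 + 2 * (θ - 1) * w - 3 * θ * w ^ 2) := by
    intro w hw
    have h1 : HasDerivAt (fun w => c₀ * (w * (1 - w) * (1 + θ * w))) _ w :=
      (((hasDerivAt_id w).mul ((hasDerivAt_id w).const_sub 1)).mul
        (((hasDerivAt_id w).const_mul θ).const_add 1)).const_mul c₀
    have h2 := fderiv_eq_of_eqOn_Icc (hdiff hEs _ (hKU w hw)) hw h1 hE0
    simp only [hEw]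
    rw [h2]
    simp only [id_eq, Pi.mul_apply]
    ring
  have hEww0 : ∀ w ∈ Icc (0 : ℝ) 1, Eww (w, 0) = c₀ * (2 * (θ - 1) - 6 * θ * w) := by
    intro w hw
    have h1 : HasDerivAt (fun w => c₀ * (1 + 2 * (θ - 1) * w - 3 * θ * w ^ 2)) _ w :=
      ((((hasDerivAt_id w).const_mul (2 * (θ - 1))).const_add 1).sub
        (((hasDerivAt_id w).pow 2).const_mul (3 * θ))).const_mul c₀
    have h2 := fderiv_eq_of_eqOn_Icc (hdiff hEws _ (hKU w hw)) hw h1 hEw0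
    simp only [hEww]
    rw [h2]
    simp only [id_eq]
    push_cast
    ring
  obtain ⟨a, ha, hea⟩ : ∃ a ∈ Ioo (0 : ℝ) 1, 1 + 2 * (θ - 1) * a - 3 * θ * a ^ 2 = 0 := by
    have hcont : ContinuousOn (fun a : ℝ => 1 + 2 * (θ - 1) * a - 3 * θ * a ^ 2) (Icc 0 1) := by
      fun_prop
    obtain ⟨a, ha, h⟩ := intermediate_value_Ioo' zero_le_one hcont
      (show (0 : ℝ) ∈ Ioo _ _ from ⟨by simp; linarith, by simp⟩)
    exact ⟨a, ha, h⟩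
  -- Subtracting the vanishing value at `a` extracts the factor `a - w`, so the derivative of the
  -- profile at `h = 0` changes sign only at `a`. The step function `ψ` is centred there.
  have hsign : ∀ w, 0 ≤ w → ∃ k > 0, 1 + 2 * (θ - 1) * w - 3 * θ * w ^ 2 = (a - w) * k := by
    intro w hw
    refine ⟨2 * (1 - θ) + 3 * θ * (w + a), ?_, by linear_combination hea⟩
    rcases hθ0.eq_or_lt with h | h
    · rw [← h]; norm_num
    · have := ha.1
      have : 0 < 3 * θ * (w + a) := by positivity
      linarith
  obtain ⟨ψ, κ, hψ, hκ, hκ2, hψ0, hψ1, hψabs, hψd, hψda, hψneg, hψpos⟩ := exists_smooth_sign ha.1 ha.2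
  have hψdc : Continuous (deriv ψ) := hψ.continuous_deriv (by simp)
  set C := 2 * (c₀ * (1 + θ)) with hC
  -- The second and third variables stand for `χ h` and `h χ' h`. The conditions express, in order:
  -- the domain, lower and upper bounds for `G`, monotonicity in `h`, positivity of the Jacobian
  -- determinant, and strict log-concavity of `E` in `w`. They hold at `h = 0` and hence, by
  -- compactness, in a tube around `[0, 1]`.
  let Pr : ℝ × ℝ × ℝ → Prop := fun p => (p.1, p.2.1) ∈ U ∧ c₀ / 2 < G (p.1, p.2.1) ∧
    G (p.1, p.2.1) < C ∧ 0 < d * G (p.1, p.2.1) + p.2.2 * Gh (p.1, p.2.1) ∧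
    0 < p.1 * (1 - p.1) * (d * G (p.1, p.2.1) + p.2.2 * Gh (p.1, p.2.1)) * deriv ψ p.1
      - 2 * ψ p.1 * Ew (p.1, p.2.1) ∧
    E (p.1, p.2.1) * Eww (p.1, p.2.1) - Ew (p.1, p.2.1) ^ 2 < 0
  have hPr : ∀ w ∈ Icc (0 : ℝ) 1, ∀ᶠ p in 𝓝 ((w, 0, 0) : ℝ × ℝ × ℝ), Pr p := by
    intro w hw
    have hι : ContinuousAt (fun p : ℝ × ℝ × ℝ => (p.1, p.2.1)) (w, 0, 0) := by fun_prop
    have hcomp : ∀ {F : ℝ × ℝ → ℝ}, ContDiffOn ℝ ∞ F U →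
        ContinuousAt (fun p : ℝ × ℝ × ℝ => F (p.1, p.2.1)) (w, 0, 0) := fun {F} hF =>
      ContinuousAt.comp (g := F) (hdiff hF _ (hKU w hw)).continuousAt hι
    have c1 := hcomp hG
    have c2 := hcomp hGhs
    have c3 := hcomp hEws
    have c4 := hcomp hEs
    have c5 := hcomp hEwws
    have k1 : ContinuousAt (fun p : ℝ × ℝ × ℝ => p.2.2) (w, 0, 0) := by fun_prop
    have k2 : ContinuousAt (fun p : ℝ × ℝ × ℝ => p.1) (w, 0, 0) := by fun_prop
    have k3 : ContinuousAt (fun p : ℝ × ℝ × ℝ => ψ p.1) (w, 0, 0) :=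
      (hψ.continuous.comp continuous_fst).continuousAt
    have k4 : ContinuousAt (fun p : ℝ × ℝ × ℝ => deriv ψ p.1) (w, 0, 0) :=
      (hψdc.comp continuous_fst).continuousAt
    have c6 := (c1.const_mul (d : ℝ)).add (k1.mul c2)
    have hd1 : (1 : ℝ) ≤ d := by exact_mod_cast hd
    have hw0 := hw.1
    have hw1 := hw.2
    have hθw : θ * w ≤ θ := by nlinarith
    have hθw0 : 0 ≤ θ * w := by positivity
    have hGw := hG0 w hw
    have hGpos : 0 < G (w, 0) := by rw [hGw]; positivity
    refine (hι.eventually (hU.mem_nhds (hKU w hw))).and ((c1.eventually (lt_mem_nhds ?_)).and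
      ((c1.eventually (gt_mem_nhds ?_)).and ((c6.eventually (lt_mem_nhds ?_)).and
      ((((((k2.mul (k2.const_sub 1)).mul c6).mul k4).sub ((k3.const_mul 2).mul c3)).eventually
        (lt_mem_nhds ?_)).and (((c4.mul c5).sub (c3.pow 2)).eventually (gt_mem_nhds ?_))))))
    · change _ < G (w, 0); rw [hGw]; nlinarith
    · change G (w, 0) < _; rw [hGw, hC]; nlinarith
    · change 0 < d * G (w, 0) + 0 * Gh (w, 0)
      rw [zero_mul, add_zero]; positivity
    · change 0 < w * (1 - w) * (d * G (w, 0) + 0 * Gh (w, 0)) * deriv ψ w - 2 * ψ w * Ew (w, 0)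
      rw [zero_mul, add_zero]
      rw [hEw0 w hw]
      obtain ⟨k, hk, hk'⟩ := hsign w hw0
      rw [hk']
      have h1 : 0 ≤ w * (1 - w) * (d * G (w, 0)) := by
        have : 0 ≤ 1 - w := by linarith
        positivity
      have h2 := hψd w
      -- `ψ` and `E_w` have opposite signs on both sides of `a`, so the second term is positive
      -- there; at `a` itself `deriv ψ a > 0` makes the first term positive.
      rcases lt_trichotomy w a with h | h | h
      · have h3 := hψneg w h
        have h4 : 0 < -ψ w * (c₀ * ((a - w) * k)) :=
          mul_pos (by linarith) (mul_pos hc₀ (mul_pos (by linarith) hk))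
        nlinarith [mul_nonneg h1 h2]
      · subst h
        have : 0 < w * (1 - w) * (d * G (w, 0)) * deriv ψ w := by
          have := ha.1
          have : 0 < 1 - w := by linarith [ha.2]
          positivity
        simpa using this
      · have h3 := hψpos w h
        have h4 : 0 < ψ w * (c₀ * ((w - a) * k)) :=
          mul_pos h3 (mul_pos hc₀ (mul_pos (by linarith) hk))
        nlinarith [mul_nonneg h1 h2]
    · change E (w, 0) * Eww (w, 0) - Ew (w, 0) ^ 2 < 0
      rw [hE0 w hw, hEw0 w hw, hEww0 w hw]
      -- This is `E²` times the second logarithmic derivative: each of the three factors `w`, `1 -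
      -- w`, `1 + θ w` contributes minus a square.
      have : c₀ * (w * (1 - w) * (1 + θ * w)) * (c₀ * (2 * (θ - 1) - 6 * θ * w))
          - (c₀ * (1 + 2 * (θ - 1) * w - 3 * θ * w ^ 2)) ^ 2
          = -(c₀ ^ 2 * (((1 - w) * (1 + θ * w)) ^ 2 + (w * (1 + θ * w)) ^ 2
            + (θ * w * (1 - w)) ^ 2)) := by ring
      rw [this]
      have h1 : 0 < ((1 - w) * (1 + θ * w)) ^ 2 + (w * (1 + θ * w)) ^ 2 := by
        have : 0 < (1 + θ * w) ^ 2 := by positivity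
        have h2 : 0 < (1 - w) ^ 2 + w ^ 2 := by nlinarith [sq_nonneg (1 - 2 * w)]
        nlinarith
      have : 0 < c₀ ^ 2 * (((1 - w) * (1 + θ * w)) ^ 2 + (w * (1 + θ * w)) ^ 2
            + (θ * w * (1 - w)) ^ 2) := by positivity
      linarith
  obtain ⟨r, hr, hrS⟩ := (((isCompact_Icc (a := (0 : ℝ)) (b := 1)).image
      (show Continuous fun w : ℝ => ((w, 0, 0) : ℝ × ℝ × ℝ) by fun_prop)).exists_thickening_subset_open
    (isOpen_setOfPred_eventually_nhds (p := Pr)) (by rintro _ ⟨w, hw, rfl⟩; exact hPr w hw))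
  have htube : ∀ w ∈ Icc (0 : ℝ) 1, ∀ x k, |x| < r → |k| < r → Pr (w, x, k) := by
    intro w hw x k hx hk
    have : ((w, x, k) : ℝ × ℝ × ℝ) ∈ {q | ∀ᶠ p in 𝓝 q, Pr p} := by
      apply hrS
      rw [Metric.mem_thickening_iff]
      refine ⟨_, ⟨w, hw, rfl⟩, ?_⟩
      simp [Prod.dist_eq, hx, hk]
    exact Eventually.self_of_nhds this
  -- The cutoff extends `f` to the whole strip while keeping all the estimates, and leaves it
  -- unchanged for `h < α`. This allows a global inverse.
  obtain ⟨α, χ, hα0, hαr, hχ, hχid, hχb⟩ := exists_cutoff hr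
  have hχd : ∀ h, HasDerivAt χ (deriv χ h) h := fun h =>
    (hχ.differentiable (by simp)).differentiableAt.hasDerivAt
  set f : ℝ × ℝ → ℝ := fun q => q.2 ^ d * E (q.1, χ q.2) with hf
  have hPs : ∀ q ∈ strip, Pr (q.1, χ q.2, q.2 * deriv χ q.2) := fun q hq =>
    htube q.1 ⟨hq.1.1.le, hq.1.2.le⟩ _ _ (hχb q.2 hq.2).1 (hχb q.2 hq.2).2
  have hfs : ContDiffOn ℝ ∞ f strip := by
    have h1 : ContDiffOn ℝ ∞ (fun q : ℝ × ℝ => E (q.1, χ q.2)) strip :=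
      hEs.comp (contDiff_fst.prodMk (hχ.comp contDiff_snd)).contDiffOn (fun q hq => (hPs q hq).1)
    exact (contDiff_snd.pow d).contDiffOn.mul h1
  have hdf : ∀ q ∈ strip, DifferentiableAt ℝ f q := fun q hq =>
    (hfs.contDiffAt (isOpen_strip.mem_nhds hq)).differentiableAt (by simp)
  have hEh : ∀ q ∈ U, fderiv ℝ E q (0, 1) = q.1 * (1 - q.1) * Gh q := by
    intro q hq
    have h1 := hasDerivAt_snd_of_fderiv (hdiff hEs q hq)
    have h2 := (hasDerivAt_snd_of_fderiv (hdiff hG q hq)).const_mul (q.1 * (1 - q.1))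
    exact h1.unique h2
  have hfh : ∀ q ∈ strip, fderiv ℝ f q (0, 1) = q.2 ^ (d - 1) * (q.1 * (1 - q.1)
      * (d * G (q.1, χ q.2) + q.2 * deriv χ q.2 * Gh (q.1, χ q.2))) := by
    intro q hq
    have hq' := (hPs q hq).1
    have h1 := hasDerivAt_snd_of_fderiv (hdf q hq)
    have h2 := (hasDerivAt_pow d q.2).fun_mul ((hdiff hEs _ hq').hasFDerivAt.comp_hasDerivAt q.2
      ((hasDerivAt_const q.2 q.1).prodMk (hχd q.2)))
    have h3 := h1.unique h2
    rw [h3, clm_prod_apply]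
    simp only [Function.comp_apply, zero_mul, zero_add]
    rw [hEh _ hq']
    obtain ⟨d, rfl⟩ : ∃ l, d = l + 1 := ⟨d - 1, by omega⟩
    simp only [hE, Nat.add_sub_cancel]
    ring
  have hfw : ∀ q ∈ strip, fderiv ℝ f q (1, 0) = q.2 ^ d * Ew (q.1, χ q.2) := by
    intro q hq
    have hq' := (hPs q hq).1
    have h1 := hasDerivAt_fst_of_fderiv (hdf q hq)
    have h2 := (hasDerivAt_fst_of_fderiv (hdiff hEs _ hq')).const_mul (q.2 ^ d)
    exact h1.unique h2
  have hfhpos : ∀ q ∈ strip, 0 < fderiv ℝ f q (0, 1) := by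
    intro q hq
    rw [hfh q hq]
    have h1 : 0 < q.2 := hq.2
    have h2 : 0 < q.1 := hq.1.1
    have h3 : 0 < 1 - q.1 := by linarith [hq.1.2]
    have h4 := (hPs q hq).2.2.2.1
    simp only at h4
    positivity
  have hlow : ∀ q ∈ strip, c₀ / 2 * (q.2 ^ d * (q.1 * (1 - q.1))) ≤ f q := by
    intro q hq
    have h1 : 0 < q.2 := hq.2
    have h2 : 0 < q.1 := hq.1.1
    have h3 : 0 < 1 - q.1 := by linarith [hq.1.2]
    have h4 := (hPs q hq).2.1
    simp only at h4
    have h5 : 0 < q.2 ^ d * (q.1 * (1 - q.1)) := by positivity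
    simp only [hf, hE]
    nlinarith
  obtain ⟨cp, hcps, hcp⟩ := exists_blowup_inverse (d := d) (by omega) hfs (by positivity) hlow
    (C := C) (by
      intro q hq
      have h1 : 0 < q.2 := hq.2
      have h2 : 0 < q.1 := hq.1.1
      have h3 : 0 < 1 - q.1 := by linarith [hq.1.2]
      have h4 := (hPs q hq).2.2.1
      simp only at h4
      have h5 : 0 < q.2 ^ d * (q.1 * (1 - q.1)) := by positivity
      simp only [hf, hE]
      nlinarith) hfhpos hψ hκ hψ0 hψ1 (by
      intro q hq
      rw [hfh q hq, hfw q hq]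
      have h1 : 0 < q.2 := hq.2
      have h4 := (hPs q hq).2.2.2.2.1
      simp only at h4
      obtain ⟨d, rfl⟩ : ∃ l, d = l + 1 := ⟨d - 1, by omega⟩
      simp only [Nat.add_sub_cancel]
      have h5 : 0 < q.2 ^ (d + 1) := by positivity
      have h6 := mul_pos h5 h4
      refine h6.trans_eq ?_
      ring)
  refine ⟨min α (h₀ / 2), ψ, cp, lt_min hα0 (by positivity),
    (min_le_right _ _).trans_lt (by linarith), ?_, hψ.continuous, hψabs,
    hψ0 0 hκ.le, hψ1 1 (by linarith),
    hcps, ?_, ?_⟩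
  · rintro ⟨w, h⟩ ⟨hw, hh⟩
    have h2 := hh.2.trans (min_le_left _ _)
    have h1 := htube w hw h 0 (by rw [abs_of_nonneg hh.1]; exact lt_of_le_of_lt h2 hαr)
      (by simpa using hr)
    exact ⟨h1.1, lt_trans (by positivity) h1.2.1⟩
  · intro σ e he
    obtain ⟨h1, h2, h3⟩ := hcp σ e he
    refine ⟨h1, h2, fun hlt => ?_⟩
    have hlt' : (cp (σ, e)).2 < α := lt_of_lt_of_le hlt (min_le_left _ _)
    have hev : f =ᶠ[𝓝 (cp (σ, e))] fun q : ℝ × ℝ => q.2 ^ d * (q.1 * (1 - q.1) * G q) := by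
      filter_upwards [continuousAt_snd.eventually (gt_mem_nhds hlt')] with q hq
      simp only [hf, hE, hχid q.2 hq.le]
    have hcs : ContDiffAt ℝ ∞ (fun t => cp (t, e)) σ := by
      have := hcps.contDiffAt ((isOpen_univ.prod isOpen_Ioi).mem_nhds
        (show ((σ, e) : ℝ × ℝ) ∈ univ ×ˢ Ioi 0 from ⟨mem_univ _, he⟩))
      exact ContDiffAt.comp (g := cp) σ this (contDiffAt_id.prodMk contDiffAt_const)
    -- `σ` is recovered from the point as `h² ψ(w)`, so the curve cannot stop.
    have hc' : deriv (fun t => cp (t, e)) σ ≠ 0 := by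
      intro h0
      have h4 := (hcs.differentiableAt (by simp)).hasDerivAt
      rw [h0] at h4
      have h5 : HasFDerivAt (fun q : ℝ × ℝ => q.2 ^ 2 * ψ q.1) _ (cp (σ, e)) :=
        ((((contDiff_snd.pow 2).mul (hψ.comp contDiff_fst)).differentiable
          (by simp)).differentiableAt).hasFDerivAt (𝕜 := ℝ)
      have h6 := h5.comp_hasDerivAt σ h4
      rw [map_zero] at h6
      have h7 := h6.unique ((hasDerivAt_id σ).congr_of_eventuallyEq
        (Eventually.of_forall fun t => (hcp t e he).2.1))
      exact zero_ne_one h7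
    refine ⟨hev.self_of_nhds.symm.trans h3, by rw [← hev.fderiv_eq]; exact hfhpos _ h1, hc', ?_⟩
    refine deriv_deriv_pos_of_level (hfs.contDiffAt (isOpen_strip.mem_nhds h1)) hcs
      (Eventually.of_forall fun t => (hcp t e he).2.2) hc' (hfhpos _ h1) ?_
    intro h4
    have hcU : cp (σ, e) ∈ U := by
      have := (hPs _ h1).1
      rwa [hχid _ hlt'.le] at this
    have h5 : (fun q => fderiv ℝ f q (1, 0)) =ᶠ[𝓝 (cp (σ, e))] fun q => q.2 ^ d * Ew q := by
      filter_upwards [continuousAt_snd.eventually (gt_mem_nhds hlt'), isOpen_strip.mem_nhds h1]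
        with q hq hq'
      rw [hfw q hq', hχid q.2 hq.le]
    rw [h5.fderiv_eq]
    have hpos : 0 < (cp (σ, e)).2 := h1.2
    have h6 : fderiv ℝ (fun q : ℝ × ℝ => q.2 ^ d * Ew q) (cp (σ, e)) (1, 0)
        = (cp (σ, e)).2 ^ d * Eww (cp (σ, e)) := by
      have h7 := hasDerivAt_fst_of_fderiv (((contDiff_snd.pow d).contDiffOn.mul hEws |>
        fun h => hdiff h _ hcU))
      have h8 := (hasDerivAt_fst_of_fderiv (hdiff hEws _ hcU)).const_mul ((cp (σ, e)).2 ^ d)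
      exact h7.unique h8
    rw [h6]
    -- At a critical point log-concavity reduces to `E E_ww < 0`, and `E > 0` inside the strip.
    have h7 : Ew (cp (σ, e)) = 0 := by
      rw [hfw _ h1, hχid _ hlt'.le] at h4
      exact (mul_eq_zero.1 h4).resolve_left (by positivity)
    have h8 := (hPs _ h1).2.2.2.2.2
    simp only [hχid _ hlt'.le] at h8
    have h9 := (hPs _ h1).2.1
    simp only [hχid _ hlt'.le] at h9
    rw [show (((cp (σ, e)).1, (cp (σ, e)).2) : ℝ × ℝ) = cp (σ, e) from rfl] at h8 h9
    rw [h7] at h8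
    have h10 : 0 < E (cp (σ, e)) := by
      have k1 : 0 < (cp (σ, e)).1 := h1.1.1
      have k2 : 0 < 1 - (cp (σ, e)).1 := by linarith [h1.1.2]
      have k3 : 0 < G (cp (σ, e)) := by linarith
      simp only [hE]; positivity
    have h11 : Eww (cp (σ, e)) < 0 := by nlinarith
    have : 0 < (cp (σ, e)).2 ^ d := by positivity
    exact mul_neg_of_pos_of_neg this h11
  · intro η hη
    have hs : 0 < Real.sqrt η := Real.sqrt_pos.2 hη
    -- For `w` in `[κ, 1 - κ]` the lower bound gives `e ≥ (c₀ / 2) h^d κ²`, so `e` below this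
    -- threshold forces `h² < η`. For all other `w`, `ψ = ±1` and `h² = |σ|`.
    refine ⟨c₀ / 2 * (Real.sqrt η ^ d * (κ * κ)), by positivity, fun e he hlt σ => ?_⟩
    obtain ⟨h1, h2, h3⟩ := hcp σ e he
    have hpos : 0 < (cp (σ, e)).2 := h1.2
    have hcase : (cp (σ, e)).2 ^ 2 = |σ| ∨ (cp (σ, e)).2 ^ 2 < η := by
      by_cases hm : κ ≤ (cp (σ, e)).1 ∧ (cp (σ, e)).1 ≤ 1 - κ
      · right
        have h4 := hlow _ h1
        rw [h3] at h4
        have h5 : κ * κ ≤ (cp (σ, e)).1 * (1 - (cp (σ, e)).1) :=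
          mul_le_mul hm.1 (by linarith [hm.2]) hκ.le h1.1.1.le
        have h6 : (cp (σ, e)).2 ^ d < Real.sqrt η ^ d := by
          by_contra! h7
          have : Real.sqrt η ^ d * (κ * κ) ≤ (cp (σ, e)).2 ^ d
              * ((cp (σ, e)).1 * (1 - (cp (σ, e)).1)) :=
            mul_le_mul h7 h5 (by positivity) (by positivity)
          nlinarith
        have h7 := lt_of_pow_lt_pow_left₀ d hs.le h6
        have h8 := pow_lt_pow_left₀ h7 hpos.le (two_ne_zero)
        rwa [Real.sq_sqrt hη.le] at h8
      · left
        rw [not_and_or, not_le, not_le] at hm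
        rcases hm with h | h
        · rw [hψ0 _ h.le] at h2
          have : |σ| = -σ := abs_of_neg (by nlinarith)
          linarith
        · rw [hψ1 _ h.le] at h2
          have : |σ| = σ := abs_of_pos (by nlinarith)
          linarith
    have hge : |σ| ≤ (cp (σ, e)).2 ^ 2 := by
      have h5 : |σ| = (cp (σ, e)).2 ^ 2 * |ψ (cp (σ, e)).1| := by
        conv_lhs => rw [← h2]
        rw [abs_mul, abs_of_pos (by positivity : 0 < (cp (σ, e)).2 ^ 2)]
      have := hψabs (cp (σ, e)).1
      nlinarith [sq_nonneg (cp (σ, e)).2]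
    constructor
    · intro h4
      rcases hcase with h | h
      · exact h
      · linarith
    · intro h4
      rcases hcase with h | h
      · rwa [h]
      · exact h

/-! ### Surfaces of scaled solutions and scalings that resolve a fold -/

section

/-- The pattern with amplitude `a` before the node `m`, amplitude `r` at this node and `0` behind
it. -/
def pattern (N : ℕ) (om0 : ℝ → ℝ) (m : ℕ) (a r μ : ℝ) : P N :=
  ((fun i => if (i : ℕ) + 1 < m then a else if (i : ℕ) + 1 = m then r else 0, 0, om0 μ), μ)

namespace Zone

variable {N : ℕ} {zn : Zone} {lam : ℝ → ℝ → ℝ} {om : ℝ → ℝ → ℝ → ℝ} {om0 : ℝ → ℝ}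
  {om2 : ℝ → ℝ → ℝ → ℝ} {b : Site}

/-- Scaled variables with positive amplitudes. -/
def Regular (zn : Zone) (z : Z N) : Prop :=
  0 < zn.radius z 1 ∧ (∀ n, 1 ≤ n → n < zn.m → 0 < zn.ain (z.1, entry z.2.1 n)) ∧
    ∀ n, zn.m < n → n ≤ N → 0 < entry z.2.1 n

theorem isOpen_regular (hs : zn.Smooth) : IsOpen {z : Z N | zn.Regular z} := by
  have h1 : {z : Z N | zn.Regular z} = {z : Z N | 0 < zn.radius z 1} ∩
      ((⋂ n ∈ Finset.Ico 1 zn.m, {z : Z N | 0 < zn.ain (z.1, entry z.2.1 n)}) ∩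
      (⋂ n ∈ Finset.Ioc zn.m N, {z : Z N | 0 < entry z.2.1 n})) := by
    ext z
    simp only [Regular, mem_ofPred_eq, mem_inter_iff, mem_iInter, Finset.mem_Ico, Finset.mem_Ioc,
      and_imp]
  rw [h1]
  refine (isOpen_lt continuous_const (contDiff_radius hs 1).continuous).inter
    ((isOpen_biInter_finset fun n _ => isOpen_lt continuous_const ?_).inter
    (isOpen_biInter_finset fun n _ => isOpen_lt continuous_const (contDiff_scaled n).continuous))
  exact hs.ain.continuous.comp (continuous_fst.prodMk (contDiff_scaled n).continuous)

theorem Base.regular {p : ℝ × ℝ} {a g : ℝ} (hb : zn.Base N b p a g) (hm : 1 ≤ zn.m)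
    (hmN : zn.m ≤ N) : zn.Regular (N := N) (p, zn.baseVec N p a g, 0) := by
  refine ⟨hb.first_pos hm hmN, fun n h1 h2 => ?_, fun n h1 h2 => ?_⟩
  · have := hb.radius_pos hmN h2 h1 0
    rwa [radius, if_pos h2] at this
  · obtain ⟨j, rfl⟩ : ∃ j, n = j + 1 := ⟨n - 1, by omega⟩
    simp only
    rw [zn.entry_baseVec (by omega), if_neg (by omega), if_neg (by omega)]
    exact div_pos_of_neg_of_neg (by norm_num) hb.L

theorem Regular.mass_ne {z : Z N} (hz : zn.Regular z) (hN : 2 ≤ N) : mass b (zn.pre z) ≠ 0 :=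
  (mass_pos ⟨0, by omega⟩ hz.1.ne').ne'

/-- With `tau = eps = 0` the amplitudes behind `m` and the frequency correction vanish, so the
surface meets the unperturbed patterns over the unperturbed parameters. -/
theorem Base.pt_eq {p : ℝ × ℝ} {a g : ℝ} (hb : zn.Base N b p a g) (hm : 1 ≤ zn.m)
    (hmN : zn.m ≤ N) : zn.pt om0 om2 b ((p, zn.baseVec N p a g, 0) : Z N)
      = pattern N om0 zn.m (zn.ain (p, a)) (zn.sc p * zn.xm (p, g)) (zn.mu p) := by
  have hpg : zn.pg (N := N) (p, zn.baseVec N p a g, 0) = (p, g) := by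
    obtain ⟨j, hj⟩ : ∃ j, zn.m = j + 1 := ⟨zn.m - 1, by omega⟩
    rw [pg, hj]
    have := zn.entry_baseVec (N := N) (p := p) (a := a) (g := g) (j := j) (by omega)
    rw [if_neg (by omega), if_pos (by omega)] at this
    exact congrArg (Prod.mk p) this
  refine Prod.ext (Prod.ext (funext fun i => ?_) (Prod.ext rfl ?_)) rfl
  · change zn.radius _ ((i : ℕ) + 1) = _
    rw [radius]
    simp only [pattern]
    split_ifs with h1 h2
    · rw [zn.entry_baseVec i.2, if_pos h1]
    · rw [tailAmp, hpg, ← h2]; simp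
    · rw [tailAmp_eq_zero (by rw [hpg]; exact hb.tau g) (by omega), mul_zero]
  · simp [pt, hpg, hb.eps, pattern]

/-- The surface of scaled solutions near a compact set of unperturbed parameters. -/
theorem exists_solution_surface (hM : Model N lam om om0 om2) (hs : zn.Smooth) (hm : 1 ≤ zn.m)
    (hmN : zn.m ≤ N) {K : Set (ℝ × ℝ)} (hK : IsCompact K) {a g : ℝ × ℝ → ℝ}
    (ha : ContinuousOn a K) (hg : ContinuousOn g K) (hb : ∀ p ∈ K, zn.Base N b p (a p) (g p)) :
    ∃ (U : Set (ℝ × ℝ)) (y : ℝ × ℝ → Y N) (V : Set (Z N)), IsOpen U ∧ K ⊆ U ∧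
      ContDiffOn ℝ ∞ y U ∧ (∀ p ∈ K, y p = (zn.baseVec N p (a p) (g p), 0)) ∧
      (∀ p ∈ U, zn.Regular (p, y p) ∧ zn.sys om2 b (p, y p) = 0 ∧
        ∀ v : Y N, fderiv ℝ (fun z : Z N => zn.sys om2 b z) (p, y p) (0, v) = 0 → v = 0) ∧
      IsOpen V ∧ (∀ p ∈ K, ((p, zn.baseVec N p (a p) (g p), 0) : Z N) ∈ V) ∧
      ∀ p z, ((p, z) : Z N) ∈ V → zn.sys om2 b (p, z) = 0 → p ∈ U ∧ z = y p := by
  refine exists_smooth_implicit_of_isCompact (f := fun z : Z N => zn.sys om2 b z)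
    (O := {z : Z N | zn.Regular z}) (y₀ := fun p => (zn.baseVec N p (a p) (g p), 0))
    (isOpen_regular hs) ?_ hK ?_ (fun p hp => (hb p hp).regular hm hmN)
    (fun p hp => (hb p hp).sys_eq_zero hmN)
    (fun p hp v hv => (hb p hp).injective hs hM.om2_smooth hM.two_le hm hmN v hv)
  · intro z hz
    exact (contDiffAt_sys hs hM.om2_smooth (hz.mass_ne hM.two_le)).contDiffWithinAt
  · refine ContinuousOn.prodMk (continuousOn_pi.2 fun i => ?_) continuousOn_const
    unfold baseVec
    split_ifs
    · exact ha
    · exact hg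
    · exact continuousOn_const.div (hs.L.continuous.comp
        (continuous_id.prodMk continuous_const)).continuousOn (fun p hp => (hb p hp).L.ne)

/-- The parameters at which the blown-up system is unperturbed. -/
def edges (h₀ : ℝ) : Set (ℝ × ℝ) := Icc 0 1 ×ˢ {0} ∪ {0, 1} ×ˢ Icc 0 h₀

theorem isCompact_edges (h₀ : ℝ) : IsCompact (edges h₀) :=
  (isCompact_Icc.prod isCompact_singleton).union ((Set.toFinite _).isCompact.prod isCompact_Icc)

/-- A scaling that resolves a boundary layer at `h = 0`. -/
structure FoldScaling (N : ℕ) (lam : ℝ → ℝ → ℝ) (om0 : ℝ → ℝ) (b : Site) (zn : Zone) (d : ℕ)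
    (a g : ℝ × ℝ → ℝ) (h₀ c₀ θ α β : ℝ) (T : ℝ → P N) : Prop where
  smooth : zn.Smooth
  one_le : 1 ≤ zn.m
  le : zn.m ≤ N
  one_le_d : 1 ≤ d
  pos : 0 < h₀
  coeff_pos : 0 < c₀
  nonneg : 0 ≤ θ
  le_one : θ ≤ 1
  a_cont : ContinuousOn a (edges h₀)
  g_cont : ContinuousOn g (edges h₀)
  base : ∀ p ∈ edges h₀, zn.Base N b p (a p) (g p)
  eps : ∀ p t, zn.eps (p, t) = p.2 ^ d * (p.1 * (1 - p.1) * t)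
  g_zero : ∀ w ∈ Icc (0 : ℝ) 1, g (w, 0) = c₀ * (1 + θ * w)
  mu : ∀ p, zn.mu p = α + β * p.2 ^ 2
  beta_ne : β ≠ 0
  valid : ∀ p ∈ strip, p.2 < h₀ → ∀ t, zn.Valid lam p t
  ne : ∀ p ∈ strip, p.2 < h₀ → ∀ t, zn.fin p ≠ 0 ∧ zn.fm p ≠ 0 ∧ zn.sc p * zn.xm (p, t) ≠ 0
  pinv : ∀ z : (ℝ × ℝ) × ℝ, z.1 ∈ strip → z.1.2 < h₀ → 0 < z.2 → ∃ pinv : ℝ × ℝ → (ℝ × ℝ) × ℝ,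
    pinv (zn.mu z.1, zn.sc z.1 * zn.xm z) = z ∧
    DifferentiableAt ℝ pinv (zn.mu z.1, zn.sc z.1 * zn.xm z) ∧
    (∀ᶠ c in 𝓝 ((zn.mu z.1, zn.sc z.1 * zn.xm z) : ℝ × ℝ), zn.mu (pinv c).1 = c.1 ∧
      zn.sc (pinv c).1 * zn.xm (pinv c) = c.2 ∧ zn.eps (pinv c) = zn.eps z ∧
      zn.Valid lam (pinv c).1 (pinv c).2) ∧
    ∀ p ∈ strip, p.2 < h₀ → ∀ t, (pinv (zn.mu p, zn.sc p * zn.xm (p, t))).1 = p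
  ainv : ∃ ainv : (ℝ × ℝ) × ℝ → ℝ, (∀ p ∈ strip, ∀ t, ainv (p, zn.ain (p, t)) = t) ∧
    (∀ c : (ℝ × ℝ) × ℝ, c.1 ∈ strip → DifferentiableAt ℝ ainv c) ∧
    ∀ c : (ℝ × ℝ) × ℝ, c.1 ∈ strip → zn.ain (c.1, ainv c) = c.2
  limit_cont : ContinuousOn T (Icc (-h₀ ^ 2) (h₀ ^ 2))
  limit_zero : ∀ w ∈ Icc (0 : ℝ) 1,
    pattern N om0 zn.m (zn.ain ((w, 0), a (w, 0))) (zn.sc (w, 0) * zn.xm ((w, 0), g (w, 0)))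
      (zn.mu (w, 0)) = T 0
  limit_left : ∀ h ∈ Icc (0 : ℝ) h₀,
    pattern N om0 zn.m (zn.ain ((0, h), a (0, h))) (zn.sc (0, h) * zn.xm ((0, h), g (0, h)))
      (zn.mu (0, h)) = T (-h ^ 2)
  limit_right : ∀ h ∈ Icc (0 : ℝ) h₀,
    pattern N om0 zn.m (zn.ain ((1, h), a (1, h))) (zn.sc (1, h) * zn.xm ((1, h), g (1, h)))
      (zn.mu (1, h)) = T (h ^ 2)

theorem radius_m (z : Z N) : zn.radius z zn.m = zn.sc z.1 * zn.xm (zn.pg z) := by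
  rw [radius, if_neg (lt_irrefl _), tailAmp]; simp

theorem FoldScaling.exists_localInverse {d : ℕ} {a g : ℝ × ℝ → ℝ} {h₀ c₀ θ α β : ℝ} {T : ℝ → P N}
    (hF : FoldScaling N lam om0 b zn d a g h₀ c₀ θ α β T) {z : Z N} (hz : z.1 ∈ strip)
    (hh : z.1.2 < h₀) (hg : 0 < entry z.2.1 zn.m) (hr : zn.Regular z) :
    ∃ pinv ainv, LocalInverse lam zn z pinv ainv ∧
      ∀ p ∈ strip, p.2 < h₀ → ∀ t, (pinv (zn.mu p, zn.sc p * zn.xm (p, t))).1 = p := by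
  obtain ⟨pinv, h1, h2, h3, h4⟩ := hF.pinv (zn.pg z) hz hh hg
  obtain ⟨ainv, k1, k2, k3⟩ := hF.ainv
  obtain ⟨n1, n2, n3⟩ := hF.ne z.1 hz hh (entry z.2.1 zn.m)
  have hrad := radius_m (zn := zn) z
  have heps : zn.eps (zn.pg z) ≠ 0 := by
    rw [pg, hF.eps]
    have e1 : 0 < z.1.2 := hz.2
    have e2 : 0 < z.1.1 := hz.1.1
    have e3 : 0 < 1 - z.1.1 := by linarith [hz.1.2]
    positivity
  have hrn : ∀ n, n < zn.m → zn.radius z n = zn.ain (z.1, entry z.2.1 n) := fun n hn => by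
    rw [radius, if_pos hn]
  refine ⟨pinv, ainv, ⟨hF.one_le, hF.le, heps, n1, n2, ?_, by rw [hrad]; exact h1,
    by rw [hrad]; exact h2, by rw [hrad]; exact h3, ?_, ?_, ?_⟩, h4⟩
  · intro n hn hnN
    rcases lt_or_ge n zn.m with h | h
    · rw [hrn n h]; exact (hr.2.1 n hn h).ne'
    · rw [radius, if_neg (by omega), tailAmp, ← mul_assoc]
      refine mul_ne_zero n3 (Finset.prod_ne_zero_iff.2 fun l hl => ?_)
      rw [Finset.mem_Ioc] at hl
      exact mul_ne_zero ((hF.valid z.1 hz hh _).tau_ne heps) (hr.2.2 l hl.1 (by omega)).ne'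
  · intro n _ hn
    rw [hrn n hn]; exact k1 z.1 hz _
  · intro n _ hn
    exact k2 _ hz
  · intro n _ hn
    have : ∀ᶠ c in 𝓝 ((z.1, zn.radius z n) : (ℝ × ℝ) × ℝ), c.1 ∈ strip :=
      continuousAt_fst.eventually (isOpen_strip.mem_nhds hz)
    filter_upwards [this] with c hc using k3 c hc

end Zone

/-- If every critical point is a strict minimum of second order, there is at most one. -/
theorem unique_critical {f : ℝ → ℝ} {a b : ℝ} (hf : ContDiffOn ℝ 2 f (Ioo a b))
    (hpos : ∀ x ∈ Ioo a b, deriv f x = 0 → 0 < deriv (deriv f) x) {x y : ℝ} (hx : x ∈ Ioo a b)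
    (hy : y ∈ Ioo a b) (h1 : deriv f x = 0) (h2 : deriv f y = 0) : x = y := by
  have key : ∀ x ∈ Ioo a b, ∀ y ∈ Ioo a b, deriv f x = 0 → deriv f y = 0 → x < y → False := by
    intro x hx y hy h1 h2 hxy
    have hd2 : ∀ t ∈ Ioo a b, HasDerivAt (deriv f) (deriv (deriv f) t) t := by
      intro t ht
      have h3 : ContDiffAt ℝ 1 (fderiv ℝ f) t :=
        (hf.contDiffAt (isOpen_Ioo.mem_nhds ht)).fderiv_right (by norm_num)
      have h4 := (h3.differentiableAt (by simp)).clm_apply (differentiableAt_const (1 : ℝ))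
      exact DifferentiableAt.hasDerivAt h4
    have hsub : Icc x y ⊆ Ioo a b := fun t ht => ⟨hx.1.trans_le ht.1, ht.2.trans_lt hy.2⟩
    have hcont : ContinuousOn (deriv f) (Icc x y) := fun t ht =>
      (hd2 t (hsub ht)).continuousAt.continuousWithinAt
    have hright : ∀ᶠ t in 𝓝[>] x, 0 < deriv f t := by
      have := (hasDerivAt_iff_tendsto_slope.1 (hd2 x hx)).eventually (lt_mem_nhds (hpos x hx h1))
      have h3 : ∀ᶠ t in 𝓝[>] x, 0 < slope (deriv f) x t :=
        this.filter_mono (nhdsWithin_mono x fun t ht => ne_of_gt ht)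
      filter_upwards [h3, self_mem_nhdsWithin] with t ht ht'
      rw [slope_def_field, h1, sub_zero] at ht
      exact (div_pos_iff_of_pos_right (sub_pos.2 ht')).1 ht
    obtain ⟨u, hu, hux⟩ : ∃ u, 0 < deriv f u ∧ u ∈ Ioo x y :=
      (hright.and (Ioo_mem_nhdsGT hxy)).exists
    -- The first point after `u` where the derivative is not positive is a critical point approached
    -- from positive slopes, which contradicts a positive second derivative there.
    set S := Icc u y ∩ {t | deriv f t ≤ 0} with hS
    have hScl : IsClosed S := by
      have : S = Icc u y ∩ deriv f ⁻¹' Iic 0 := rfl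
      rw [this]
      exact (hcont.mono (Icc_subset_Icc hux.1.le le_rfl)).preimage_isClosed_of_isClosed
        isClosed_Icc isClosed_Iic
    have hSne : S.Nonempty := ⟨y, ⟨hux.2.le, le_rfl⟩, h2.le⟩
    have hSb : BddBelow S := ⟨u, fun t ht => ht.1.1⟩
    set c := sInf S
    have hc : c ∈ S := hScl.csInf_mem hSne hSb
    have huc : u < c := lt_of_le_of_ne hc.1.1 (by
      intro h; have := hc.2; rw [← h] at this; exact absurd hu (not_lt.2 this))
    have hcab : c ∈ Ioo a b := hsub ⟨hux.1.le.trans hc.1.1, hc.1.2⟩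
    have hlt : ∀ t ∈ Ico u c, 0 < deriv f t := by
      intro t ht
      by_contra! h
      exact absurd (csInf_le hSb (⟨⟨ht.1, ht.2.le.trans hc.1.2⟩, h⟩ : t ∈ S)) (not_le.2 ht.2)
    have hc0 : deriv f c = 0 := by
      refine le_antisymm hc.2 ?_
      have h3 : Tendsto (deriv f) (𝓝[<] c) (𝓝 (deriv f c)) :=
        (hd2 c hcab).continuousAt.tendsto.mono_left nhdsWithin_le_nhds
      exact ge_of_tendsto h3 (by
        filter_upwards [Ioo_mem_nhdsLT huc] with t ht using (hlt t ⟨ht.1.le, ht.2⟩).le)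
    have := (hasDerivAt_iff_tendsto_slope.1 (hd2 c hcab)).eventually
      (lt_mem_nhds (hpos c hcab hc0))
    have h3 : ∀ᶠ t in 𝓝[<] c, 0 < slope (deriv f) c t :=
      this.filter_mono (nhdsWithin_mono c fun t ht => ne_of_lt ht)
    obtain ⟨t, ht, htu⟩ := (h3.and (Ioo_mem_nhdsLT huc)).exists
    rw [slope_def_field, hc0, sub_zero] at ht
    have h4 := hlt t ⟨htu.1.le, htu.2⟩
    exact absurd ht (not_lt.2 (div_nonpos_of_nonneg_of_nonpos h4.le (sub_nonpos.2 htu.2.le)))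
  rcases lt_trichotomy x y with h | h | h
  · exact (key x hx y hy h1 h2 h).elim
  · exact h
  · exact (key y hy x hx h2 h1 h).elim

end

/-! ### Arcs of solutions through a fold -/

section

/-- A family of arcs of solutions `Γ (σ, e)`, `-σ₀ < σ < σ₀`, through a fold near `σ = 0`. -/
structure FoldPiece {N : ℕ} (lam : ℝ → ℝ → ℝ) (om : ℝ → ℝ → ℝ → ℝ) (b : Site) (α β σ₀ η ε₁ : ℝ)
    (Γ : ℝ × ℝ → P N) : Prop where
  smooth : ContDiffOn ℝ ∞ Γ (Ioo (-σ₀) σ₀ ×ˢ Ioo 0 ε₁)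
  sol : ∀ e ∈ Ioo 0 ε₁, ∀ σ ∈ Ioo (-σ₀) σ₀, Γ (σ, e) ∈ solutions lam om b e
  deriv_ne : ∀ e ∈ Ioo 0 ε₁, ∀ σ ∈ Ioo (-σ₀) σ₀, deriv (fun t => Γ (t, e)) σ ≠ 0
  kernel : ∀ e ∈ Ioo 0 ε₁, ∀ σ ∈ Ioo (-σ₀) σ₀, ∀ v : P N,
    fderiv ℝ (fun p : P N => system lam om b e p.1 p.2) (Γ (σ, e)) v = 0 →
      ∃ a : ℝ, v = a • deriv (fun t => Γ (t, e)) σ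
  injOn : ∀ e ∈ Ioo 0 ε₁, InjOn (fun t => Γ (t, e)) (Ioo (-σ₀) σ₀)
  mu_outer : ∀ e ∈ Ioo 0 ε₁, ∀ σ ∈ Ioo (-σ₀) σ₀, η ≤ |σ| → (Γ (σ, e)).2 = α + β * |σ|
  mu_inner : ∀ e ∈ Ioo 0 ε₁, ∀ σ ∈ Ioo (-σ₀) σ₀, |σ| < η →
    ∃ t ∈ Ioo 0 η, (Γ (σ, e)).2 = α + β * t
  crit : ∀ e ∈ Ioo 0 ε₁, ∃ σc ∈ Ioo (-η) η,
    deriv (deriv (fun t => (Γ (t, e)).2)) σc ≠ 0 ∧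
    ∀ σ ∈ Ioo (-σ₀) σ₀, deriv (fun t => (Γ (t, e)).2) σ = 0 ↔ σ = σc

/-- Since `μ' = 2 β H H'` and `H > 0`, turning points of `μ` are critical points of the height `H`.
Equal heights at `±η` give one by Rolle, and it is the only one because every critical point is a
strict minimum. -/
theorem crit_of_square {H : ℝ → ℝ} {α β σ₀ η : ℝ} (hη : 0 < η) (hησ : η < σ₀) (hβ : β ≠ 0)
    (hH : ContDiffOn ℝ ∞ H (Ioo (-σ₀) σ₀)) (hpos : ∀ σ ∈ Ioo (-σ₀) σ₀, 0 < H σ)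
    (h2 : ∀ σ ∈ Ioo (-σ₀) σ₀, deriv H σ = 0 → 0 < deriv (deriv H) σ)
    (h1 : H (-η) = H η) : ∃ σc ∈ Ioo (-η) η,
    deriv (deriv (fun t => α + β * H t ^ 2)) σc ≠ 0 ∧
    ∀ σ ∈ Ioo (-σ₀) σ₀, deriv (fun t => α + β * H t ^ 2) σ = 0 ↔ σ = σc := by
  have hd : ∀ σ ∈ Ioo (-σ₀) σ₀, HasDerivAt H (deriv H σ) σ := fun σ hσ =>
    ((hH.contDiffAt (isOpen_Ioo.mem_nhds hσ)).differentiableAt (by simp)).hasDerivAt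
  have hd2 : ∀ σ ∈ Ioo (-σ₀) σ₀, HasDerivAt (deriv H) (deriv (deriv H) σ) σ := by
    intro σ hσ
    have h3 : ContDiffAt ℝ 1 (fderiv ℝ H) σ :=
      ((hH.contDiffAt (isOpen_Ioo.mem_nhds hσ)).of_le (WithTop.coe_le_coe.2 le_top :
        (2 : WithTop ℕ∞) ≤ ∞)).fderiv_right (by norm_num)
    have h4 := (h3.differentiableAt (by simp)).clm_apply (differentiableAt_const (1 : ℝ))
    exact DifferentiableAt.hasDerivAt h4
  have hμ : ∀ σ ∈ Ioo (-σ₀) σ₀,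
      HasDerivAt (fun t => α + β * H t ^ 2) (2 * β * (H σ * deriv H σ)) σ := by
    intro σ hσ
    refine ((((hd σ hσ).fun_pow 2).const_mul β).const_add α).congr_deriv ?_
    push_cast; ring
  have hsub : Icc (-η) η ⊆ Ioo (-σ₀) σ₀ := fun t ht => ⟨by linarith [ht.1], by linarith [ht.2]⟩
  obtain ⟨σc, hσc, hc0⟩ := exists_deriv_eq_zero (f := H) (a := -η) (b := η) (by linarith)
    (fun t ht => (hd t (hsub ht)).continuousAt.continuousWithinAt) h1
  have hσc' : σc ∈ Ioo (-σ₀) σ₀ := hsub ⟨hσc.1.le, hσc.2.le⟩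
  refine ⟨σc, hσc, ?_, ?_⟩
  · have hev : deriv (fun t => α + β * H t ^ 2) =ᶠ[𝓝 σc] fun σ => 2 * β * (H σ * deriv H σ) := by
      filter_upwards [isOpen_Ioo.mem_nhds hσc'] with σ hσ using (hμ σ hσ).deriv
    rw [hev.deriv_eq, (((hd σc hσc').fun_mul (hd2 σc hσc')).const_mul (2 * β)).deriv, hc0]
    have h3 := h2 σc hσc' hc0
    have h4 := hpos σc hσc'
    simp only [zero_mul, zero_add]
    positivity
  · intro σ hσ
    rw [(hμ σ hσ).deriv]
    have h4 := hpos σ hσ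
    constructor
    · intro h
      have h5 : deriv H σ = 0 := by
        rcases mul_eq_zero.1 h with h | h
        · exact absurd h (by positivity)
        · exact (mul_eq_zero.1 h).resolve_left h4.ne'
      exact unique_critical (hH.of_le (WithTop.coe_le_coe.2 le_top)) h2 hσ hσc' h5 hc0
    · rintro rfl
      rw [hc0]; ring

namespace Zone

variable {N : ℕ} {zn : Zone} {lam : ℝ → ℝ → ℝ} {om : ℝ → ℝ → ℝ → ℝ} {om0 : ℝ → ℝ}
  {om2 : ℝ → ℝ → ℝ → ℝ} {b : Site}

-- The solution surface over a neighbourhood of the edges contains a whole box `[0, 1] × [0, h₁]`.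
-- There `ε` equals `h^d w (1 - w) G`, with `G` the unknown of the node `m`, and the arcs are the
-- images of the level curves from `exists_fold_curve`.
set_option maxHeartbeats 1000000 in
theorem FoldScaling.exists_branch (hM : Model N lam om om0 om2) {d : ℕ} {a g : ℝ × ℝ → ℝ}
    {h₀ c₀ θ α β : ℝ} {T : ℝ → P N} (hF : FoldScaling N lam om0 b zn d a g h₀ c₀ θ α β T) :
    ∃ σ₀ > 0, ∃ Γ : ℝ × ℝ → P N,
      (∀ η ∈ Ioo 0 σ₀, ∃ ε₁ > 0, FoldPiece lam om b α β σ₀ η ε₁ Γ) ∧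
      ∀ κ > 0, ∃ ε₂ > 0, ∀ e ∈ Ioo 0 ε₂, ∀ σ ∈ Ioo (-σ₀) σ₀, dist (Γ (σ, e)) (T σ) < κ := by
  obtain ⟨U, y, V, hU, hKU, hy, hyK, hyU, -, -, -⟩ := exists_solution_surface (b := b) hM hF.smooth
    hF.one_le hF.le (isCompact_edges h₀) hF.a_cont hF.g_cont hF.base
  set G : ℝ × ℝ → ℝ := fun p => entry (y p).1 zn.m with hG
  have hGs : ContDiffOn ℝ ∞ G U := (contDiff_entry zn.m).comp_contDiffOn (contDiff_fst.comp_contDiffOn hy)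
  have hmK0 : ∀ w ∈ Icc (0 : ℝ) 1, ((w, 0) : ℝ × ℝ) ∈ edges h₀ := fun w hw => Or.inl ⟨hw, rfl⟩
  have hG0 : ∀ w ∈ Icc (0 : ℝ) 1, G (w, 0) = c₀ * (1 + θ * w) := by
    intro w hw
    rw [← hF.g_zero w hw]
    simp only [hG]
    rw [hyK _ (hmK0 w hw)]
    obtain ⟨j, hj⟩ : ∃ j, zn.m = j + 1 := ⟨zn.m - 1, by have := hF.one_le; omega⟩
    have hmN := hF.le
    have := zn.entry_baseVec (N := N) (p := (w, 0)) (a := a (w, 0)) (g := g (w, 0)) (j := j)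
      (by omega)
    rw [if_neg (by omega), if_pos (by omega)] at this
    simp only
    rw [hj, this]
  obtain ⟨h₁, ψ, cp, hh1, hh10, hQ, hψ, hψabs, hψ0, hψ1, hcps, hcp, hη⟩ := exists_fold_curve
    hF.one_le_d hU hGs hF.coeff_pos hF.nonneg hF.le_one (fun w hw => hKU (hmK0 w hw)) hG0 hF.pos
  set Γ : ℝ × ℝ → P N := fun q => zn.pt om0 om2 b ((cp q, y (cp q)) : Z N) with hΓ
  have hσ₀ : 0 < h₁ ^ 2 := by positivity
  obtain ⟨εa, hεa, hbox⟩ := hη (h₁ ^ 2) hσ₀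
  have hlt : ∀ e, 0 < e → e < εa → ∀ σ ∈ Ioo (-h₁ ^ 2) (h₁ ^ 2), (cp (σ, e)).2 < h₁ := by
    intro e he hea σ hσ
    have h1 := (hbox e he hea σ).2 (abs_lt.2 hσ)
    exact lt_of_pow_lt_pow_left₀ 2 hh1.le h1
  have hcQ : ∀ e, 0 < e → e < εa → ∀ σ ∈ Ioo (-h₁ ^ 2) (h₁ ^ 2), cp (σ, e) ∈ Icc (0 : ℝ) 1 ×ˢ Icc 0 h₁ :=
    fun e he hea σ hσ => ⟨⟨(hcp σ e he).1.1.1.le, (hcp σ e he).1.1.2.le⟩, (hcp σ e he).1.2.le,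
      (hlt e he hea σ hσ).le⟩
  have hcU : ∀ e, 0 < e → e < εa → ∀ σ ∈ Ioo (-h₁ ^ 2) (h₁ ^ 2), cp (σ, e) ∈ U :=
    fun e he hea σ hσ => (hQ _ (hcQ e he hea σ hσ)).1
  have heps : ∀ p, zn.eps (zn.pg ((p, y p) : Z N)) = p.2 ^ d * (p.1 * (1 - p.1) * G p) :=
    fun p => hF.eps p _
  have hepsc : ∀ e, 0 < e → e < εa → ∀ σ ∈ Ioo (-h₁ ^ 2) (h₁ ^ 2),
      zn.eps (zn.pg ((cp (σ, e), y (cp (σ, e))) : Z N)) = e := fun e he hea σ hσ => by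
    rw [heps]; exact ((hcp σ e he).2.2 (hlt e he hea σ hσ)).1
  have hcs : ∀ e, 0 < e → ∀ σ, ContDiffAt ℝ ∞ (fun t => cp (t, e)) σ := by
    intro e he σ
    have := hcps.contDiffAt ((isOpen_univ.prod isOpen_Ioi).mem_nhds
      (show ((σ, e) : ℝ × ℝ) ∈ univ ×ˢ Ioi 0 from ⟨mem_univ _, he⟩))
    exact ContDiffAt.comp (g := cp) σ this (contDiffAt_id.prodMk contDiffAt_const)
  have hptU : ContDiffOn ℝ ∞ (fun p => zn.pt om0 om2 b ((p, y p) : Z N)) U := by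
    intro p hp
    have h1 := contDiffAt_pt (b := b) hF.smooth hM.om0_smooth hM.om2_smooth
      ((hyU p hp).1.mass_ne hM.two_le)
    have h2 : ContDiffAt ℝ ∞ (fun p => ((p, y p) : Z N)) p :=
      contDiffAt_id.prodMk (hy.contDiffAt (hU.mem_nhds hp))
    exact (ContDiffAt.comp (f := fun p => ((p, y p) : Z N)) p h1 h2).contDiffWithinAt
  have hker : ∀ e, 0 < e → e < εa → ∀ σ ∈ Ioo (-h₁ ^ 2) (h₁ ^ 2),
      deriv (fun t => Γ (t, e)) σ ≠ 0 ∧ ∀ v : P N,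
      fderiv ℝ (fun p : P N => system lam om b e p.1 p.2) (Γ (σ, e)) v = 0 →
      ∃ a : ℝ, v = a • deriv (fun t => Γ (t, e)) σ := by
    intro e he hea σ hσ
    have hp := hcU e he hea σ hσ
    obtain ⟨hst, -, hcp3⟩ := hcp σ e he
    obtain ⟨-, hfh, hc', -⟩ := hcp3 (hlt e he hea σ hσ)
    obtain ⟨pinv, ainv, hL, hpl⟩ := hF.exists_localInverse
      (z := ((cp (σ, e), y (cp (σ, e))) : Z N)) hst ((hlt e he hea σ hσ).trans hh10)
      (hQ _ (hcQ e he hea σ hσ)).2 (hyU _ hp).1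
    refine deriv_ne_zero_and_kernel hM hF.smooth hU hy (fun p hp => (hyU p hp).2.1)
      (c := fun t => cp (t, e)) ((hcs e he σ).differentiableAt (by simp)).hasDerivAt hc' hp
      (hyU _ hp).2.2 hL ?_ ?_ ?_
    · filter_upwards [isOpen_Ioo.mem_nhds hσ] with t ht
      rw [radius_m]
      exact hpl _ (hcp t e he).1 ((hlt e he hea t ht).trans hh10) _
    · filter_upwards [isOpen_Ioo.mem_nhds hσ] with t ht
      exact hepsc e he hea t ht
    · intro h0
      have : (fun p => zn.eps (zn.pg ((p, y p) : Z N)))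
        = fun q : ℝ × ℝ => q.2 ^ d * (q.1 * (1 - q.1) * G q) := funext heps
      rw [this] at h0
      rw [h0] at hfh
      exact absurd hfh (by simp)
  refine ⟨h₁ ^ 2, hσ₀, Γ, ?_, ?_⟩
  · intro η hηm
    obtain ⟨εb, hεb, hout⟩ := hη η hηm.1
    refine ⟨min εa εb, lt_min hεa hεb, ?_⟩
    have hea : ∀ e ∈ Ioo 0 (min εa εb), e < εa := fun e he => he.2.trans_le (min_le_left _ _)
    have heb : ∀ e ∈ Ioo 0 (min εa εb), e < εb := fun e he => he.2.trans_le (min_le_right _ _)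
    have hmu : ∀ q, (Γ q).2 = α + β * (cp q).2 ^ 2 := fun q => hF.mu _
    refine ⟨?_, ?_, fun e he σ hσ => (hker e he.1 (hea e he) σ hσ).1,
      fun e he σ hσ => (hker e he.1 (hea e he) σ hσ).2, ?_, ?_, ?_, ?_⟩
    · refine hptU.comp (hcps.mono fun q hq => ⟨mem_univ _, hq.2.1⟩) ?_
      rintro ⟨σ, e⟩ ⟨hσ, he⟩
      exact hcU e he.1 (hea e he) σ hσ
    · intro e he σ hσ
      have hp := hcU e he.1 (hea e he) σ hσ
      have h1 := pt_mem_solutions (b := b) (z := ((cp (σ, e), y (cp (σ, e))) : Z N)) hM hF.one_le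
        (hF.valid _ (hcp σ e he.1).1 ((hlt e he.1 (hea e he) σ hσ).trans hh10) _)
        (hyU _ hp).1.1.ne' (hyU _ hp).2.1
      rw [hepsc e he.1 (hea e he) σ hσ] at h1
      exact h1
    · intro e he σ hσ σ' hσ' heq
      have hp := hcU e he.1 (hea e he) σ hσ
      obtain ⟨pinv, ainv, hL, hpl⟩ := hF.exists_localInverse
        (z := ((cp (σ, e), y (cp (σ, e))) : Z N)) (hcp σ e he.1).1
        ((hlt e he.1 (hea e he) σ hσ).trans hh10)
        (hQ _ (hcQ e he.1 (hea e he) σ hσ)).2 (hyU _ hp).1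
      have hval : ∀ z : Z N, (((zn.pt om0 om2 b z).2, amp b (zn.pt om0 om2 b z).1 zn.m) : ℝ × ℝ)
          = (zn.mu z.1, zn.sc z.1 * zn.xm (zn.pg z)) := fun z => by
        have : amp b (zn.pt om0 om2 b z).1 zn.m = amp b (zn.pre z) zn.m := amp_congr rfl _
        rw [this, zn.amp_pre b z hF.one_le hF.le, radius_m]; rfl
      have h1 := hval (cp (σ, e), y (cp (σ, e)))
      have h2 := hval (cp (σ', e), y (cp (σ', e)))
      have heq' : zn.pt om0 om2 b ((cp (σ, e), y (cp (σ, e))) : Z N)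
        = zn.pt om0 om2 b ((cp (σ', e), y (cp (σ', e))) : Z N) := heq
      rw [heq', h2] at h1
      have h3 := hpl _ (hcp σ e he.1).1 ((hlt e he.1 (hea e he) σ hσ).trans hh10)
        (entry (y (cp (σ, e))).1 zn.m)
      have h4 := hpl _ (hcp σ' e he.1).1 ((hlt e he.1 (hea e he) σ' hσ').trans hh10)
        (entry (y (cp (σ', e))).1 zn.m)
      have h5 : cp (σ, e) = cp (σ', e) := by
        rw [← h3, ← h4]
        exact congrArg (fun x => (pinv x).1) h1.symm
      rw [← (hcp σ e he.1).2.1, ← (hcp σ' e he.1).2.1, h5]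
    · intro e he σ hσ h1
      rw [hmu, (hout e he.1 (heb e he) σ).1 h1]
    · intro e he σ hσ h1
      refine ⟨_, ⟨?_, (hout e he.1 (heb e he) σ).2 h1⟩, hmu _⟩
      have : 0 < (cp (σ, e)).2 := (hcp σ e he.1).1.2
      positivity
    · intro e he
      have h1 := crit_of_square (H := fun t => (cp (t, e)).2) (α := α) hηm.1 hηm.2 hF.beta_ne
        (fun t _ => (hcs e he.1 t).snd.contDiffWithinAt)
        (fun σ _ => (hcp σ e he.1).1.2)
        (fun σ hσ => ((hcp σ e he.1).2.2 (hlt e he.1 (hea e he) σ hσ)).2.2.2) ?_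
      · simpa only [hmu] using h1
      · have h2 := (hout e he.1 (heb e he) (-η)).1 (by rw [abs_neg, abs_of_pos hηm.1])
        have h3 := (hout e he.1 (heb e he) η).1 (by rw [abs_of_pos hηm.1])
        rw [abs_neg, ← h3] at h2
        exact (pow_left_inj₀ (hcp _ e he.1).1.2.le (hcp _ e he.1).1.2.le two_ne_zero).1 h2
  · intro κ hκ
    set Q := Icc (0 : ℝ) 1 ×ˢ Icc 0 h₁ with hQd
    have hQc : IsCompact Q := isCompact_Icc.prod isCompact_Icc
    set u : ℝ × ℝ → ℝ := fun q => dist (zn.pt om0 om2 b ((q, y q) : Z N)) (T (q.2 ^ 2 * ψ q.1))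
    have hσ : ∀ q ∈ Q, q.2 ^ 2 * ψ q.1 ∈ Icc (-h₀ ^ 2) (h₀ ^ 2) := by
      intro q hq
      rw [mem_Icc, ← abs_le, abs_mul, abs_of_nonneg (sq_nonneg q.2)]
      have h1 := hψabs q.1
      have h2 : q.2 ^ 2 ≤ h₀ ^ 2 := pow_le_pow_left₀ hq.2.1 (hq.2.2.trans hh10.le) 2
      nlinarith [sq_nonneg q.2]
    have hu : ContinuousOn u Q := by
      have h1 : ContinuousOn (fun q : ℝ × ℝ => T (q.2 ^ 2 * ψ q.1)) Q :=
        hF.limit_cont.comp ((continuous_snd.pow 2).mul (hψ.comp continuous_fst)).continuousOn hσ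
      exact continuous_dist.comp_continuousOn
        ((hptU.continuousOn.mono fun q hq => (hQ q hq).1).prodMk h1)
    set v : ℝ × ℝ → ℝ := fun q => q.2 ^ d * (q.1 * (1 - q.1) * G q)
    have hv : ContinuousOn v Q := by
      refine ContinuousOn.mul (by fun_prop) (ContinuousOn.mul (by fun_prop) ?_)
      exact hGs.continuousOn.mono fun q hq => (hQ q hq).1
    -- In the box the level is zero only on the edges `w = 0`, `w = 1`, `h = 0`, and there the
    -- surface consists of the limiting patterns.
    have hu0 : ∀ q ∈ Q, v q ≤ 0 → u q = 0 := by
      rintro ⟨w, h⟩ hq hvq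
      have hmem : w = 0 ∨ w = 1 ∨ h = 0 := by
        by_contra! hne
        have e1 : 0 < w := lt_of_le_of_ne hq.1.1 (Ne.symm hne.1)
        have e2 : 0 < 1 - w := sub_pos.2 (lt_of_le_of_ne hq.1.2 hne.2.1)
        have e3 : 0 < h := lt_of_le_of_ne hq.2.1 (Ne.symm hne.2.2)
        have e4 := (hQ _ hq).2
        have : 0 < v (w, h) := by simp only [v]; positivity
        linarith
      have hhm : h ∈ Icc 0 h₀ := ⟨hq.2.1, hq.2.2.trans hh10.le⟩
      have hK : ((w, h) : ℝ × ℝ) ∈ edges h₀ := by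
        rcases hmem with rfl | rfl | rfl
        · exact Or.inr ⟨by simp, hhm⟩
        · exact Or.inr ⟨by simp, hhm⟩
        · exact hmK0 w hq.1
      simp only [u]
      rw [hyK _ hK, (hF.base _ hK).pt_eq hF.one_le hF.le, dist_eq_zero]
      rcases hmem with rfl | rfl | rfl
      · rw [hF.limit_left h hhm, hψ0, mul_neg_one]
      · rw [hF.limit_right h hhm, hψ1, mul_one]
      · rw [hF.limit_zero w hq.1]; simp
    have hcl : IsCompact (Q ∩ u ⁻¹' Ici κ) := hQc.of_isClosed_subset
      (hu.preimage_isClosed_of_isClosed hQc.isClosed isClosed_Ici) inter_subset_left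
    -- On the compact set of points at distance at least `κ` from the limit the level has a positive
    -- minimum, so lower level curves avoid this set. No rate of convergence is needed.
    obtain ⟨ε₂, hε₂, hlow⟩ : ∃ ε₂ > 0, ∀ q ∈ Q ∩ u ⁻¹' Ici κ, ε₂ ≤ v q := by
      rcases (Q ∩ u ⁻¹' Ici κ).eq_empty_or_nonempty with h | h
      · exact ⟨1, one_pos, fun q hq => by rw [h] at hq; exact hq.elim⟩
      · obtain ⟨q₀, hq₀, hmin⟩ := hcl.exists_isMinOn h (hv.mono inter_subset_left)
        refine ⟨v q₀, ?_, fun q hq => hmin hq⟩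
        by_contra! hle
        have h1 := hu0 q₀ hq₀.1 hle
        have h2 : κ ≤ u q₀ := hq₀.2
        linarith
    refine ⟨min εa ε₂, lt_min hεa hε₂, fun e he σ hσm => ?_⟩
    have hea : e < εa := he.2.trans_le (min_le_left _ _)
    have hq := hcQ e he.1 hea σ hσm
    by_contra! hge
    have h1 : u (cp (σ, e)) = dist (Γ (σ, e)) (T σ) := by
      simp only [u]; rw [(hcp σ e he.1).2.1]
    have h2 := hlow (cp (σ, e)) ⟨hq, by rw [mem_preimage, h1]; exact hge⟩
    have h3 : v (cp (σ, e)) = e := ((hcp σ e he.1).2.2 (hlt e he.1 hea σ hσm)).1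
    rw [h3] at h2
    exact absurd he.2 (not_lt.2 ((min_le_right _ _).trans h2))

end Zone

end

/-! ### Scaled forms of the nonlinearity at the pitchfork and at the saddle-node -/

section

/-- A smooth map of the line into a small interval that is the identity near `0`. -/
theorem exists_retraction {r : ℝ} (hr : 0 < r) : ∃ χ : ℝ → ℝ, ContDiff ℝ ∞ χ ∧
    (∀ h, |h| < r / 2 → χ h = h) ∧ ∀ h, |χ h| < r := by
  let β : ContDiffBump (0 : ℝ) := ⟨r / 2, r, by positivity, by linarith⟩
  refine ⟨fun h => h * β h, contDiff_id.mul β.contDiff, fun h hh => ?_, fun h => ?_⟩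
  · have : β h = 1 := β.one_of_mem_closedBall (by
      rw [mem_closedBall_zero_iff, Real.norm_eq_abs]; exact hh.le)
    simp only [this, mul_one]
  · simp only
    rcases lt_or_ge |h| r with h1 | h1
    · rw [abs_mul, abs_of_nonneg (β.nonneg (x := h))]
      have := β.le_one (x := h)
      have h2 := β.nonneg (x := h)
      nlinarith [abs_nonneg h]
    · have : β h = 0 := β.zero_of_le_dist (by rw [dist_zero_right, Real.norm_eq_abs]; exact h1)
      rw [this]; simpa using hr

/-- Continuation of a simple nonzero root. -/
theorem exists_root_branch {Λ : ℝ × ℝ → ℝ} (hΛ : ContDiff ℝ ∞ Λ) {y₀ D : ℝ} (hy₀ : y₀ ≠ 0)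
    (h0 : Λ (y₀, 0) = 0) (hD : D ≠ 0) (hder : HasDerivAt (fun y => Λ (y, 0)) D y₀) :
    ∃ Y : ℝ → ℝ, ContDiff ℝ ∞ Y ∧ Y 0 = y₀ ∧ (∀ h, 0 < y₀ * Y h) ∧ ∃ a > 0, ∀ h, |h| < a →
      Λ (Y h, h) = 0 ∧ ∃ D, D ≠ 0 ∧ HasDerivAt (fun y => Λ (y, h)) D (Y h) := by
  set f : ℝ × ℝ → ℝ := fun q => Λ (q.2, q.1) with hf
  have hfs : ContDiff ℝ ∞ f := hΛ.comp (contDiff_snd.prodMk contDiff_fst)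
  have hfd : ∀ q : ℝ × ℝ, HasDerivAt (fun y => Λ (y, q.1)) (fderiv ℝ f q (0, 1)) q.2 := fun q =>
    hasDerivAt_snd_of_fderiv (hfs.differentiable (by simp)).differentiableAt
  have hO : IsOpen {q : ℝ × ℝ | 0 < y₀ * q.2} :=
    isOpen_lt continuous_const (continuous_const.mul continuous_snd)
  obtain ⟨U, y, V, hU, hKU, hy, hyK, hyU, -⟩ := exists_smooth_implicit_of_isCompact hO
    hfs.contDiffOn (isCompact_singleton (x := (0 : ℝ))) (y₀ := fun _ => y₀) continuousOn_const
    (by intro p _; exact mul_self_pos.2 hy₀) (by rintro p rfl; exact h0) (by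
      rintro p rfl v hv
      have h1 : ((0, v) : ℝ × ℝ) = v • (0, 1) := by ext <;> simp
      rw [h1, map_smul, (hfd (0, y₀)).unique hder, smul_eq_mul] at hv
      exact (mul_eq_zero.1 hv).resolve_right hD)
  obtain ⟨r, hr, hrU⟩ := Metric.isOpen_iff.1 hU 0 (hKU rfl)
  -- Composing with a retraction makes the locally defined branch smooth on the whole line, which
  -- `Zone.Smooth` demands of its data.
  obtain ⟨χ, hχ, hχid, hχr⟩ := exists_retraction hr
  have hm : ∀ h, χ h ∈ U := fun h => hrU (by
    rw [mem_ball_zero_iff, Real.norm_eq_abs]; exact hχr h)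
  refine ⟨fun h => y (χ h), ?_, ?_, ?_, r / 2, by positivity, ?_⟩
  · rw [← contDiffOn_univ]
    exact hy.comp hχ.contDiffOn (fun h _ => hm h)
  · simp only
    rw [hχid 0 (by simpa using hr), hyK 0 rfl]
  · intro h
    exact (hyU _ (hm h)).1
  · intro h hh
    have h1 := hyU _ (hm h)
    rw [hχid h hh] at h1
    simp only
    rw [hχid h hh]
    refine ⟨h1.2.1, _, ?_, hfd (h, y h)⟩
    intro h2
    exact one_ne_zero (h1.2.2 1 h2)

/-- Divided difference of a quadratic polynomial. -/
theorem divided_difference_quadratic {E : Type} [NormedAddCommGroup E] [NormedSpace ℝ E]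
    {f : ℝ × E → ℝ} {D : ℝ × ℝ × E → ℝ} (hD : ContDiff ℝ ∞ D)
    (h : ∀ a b e, f (a, e) - f (b, e) = (a - b) * D (a, b, e)) {e : E} {c₂ c₁ c₀ : ℝ}
    (hf : ∀ x, f (x, e) = c₂ * x ^ 2 + c₁ * x + c₀) (a b : ℝ) :
    D (a, b, e) = c₂ * (a + b) + c₁ := by
  have hne : ∀ t, t ≠ b → D (t, b, e) = c₂ * (t + b) + c₁ := by
    intro t ht
    have h1 := h t b e
    rw [hf, hf] at h1
    have h2 : (t - b) * (D (t, b, e) - (c₂ * (t + b) + c₁)) = 0 := by linear_combination -h1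
    exact sub_eq_zero.1 ((mul_eq_zero.1 h2).resolve_left (sub_ne_zero.2 ht))
  by_cases hab : a = b
  · subst hab
    have c1 : Continuous fun t => D (t, a, e) :=
      hD.continuous.comp (continuous_id.prodMk continuous_const)
    have c2 : Continuous fun t : ℝ => c₂ * (t + a) + c₁ := by fun_prop
    have h1 : Tendsto (fun t => D (t, a, e)) (𝓝[≠] a) (𝓝 (D (a, a, e))) :=
      (c1.tendsto a).mono_left nhdsWithin_le_nhds
    have h2 : Tendsto (fun t => D (t, a, e)) (𝓝[≠] a) (𝓝 (c₂ * (a + a) + c₁)) :=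
      ((c2.tendsto a).mono_left nhdsWithin_le_nhds).congr' (by
        filter_upwards [self_mem_nhdsWithin] with t ht using (hne t ht).symm)
    exact tendsto_nhds_unique h1 h2
  · exact hne a hab

namespace Bistable

variable {lam : ℝ → ℝ → ℝ} {rm rp : ℝ → ℝ}

theorem continuous_lam (hl : Bistable lam rm rp) : Continuous (fun q : ℝ × ℝ => lam q.1 q.2) := hl.smooth.continuous

theorem hasDerivAt_lam (hl : Bistable lam rm rp) (r μ : ℝ) :
    HasDerivAt (fun r => lam r μ) (deriv (fun r => lam r μ) r) r :=
  ((hl.smooth.comp (contDiff_id.prodMk contDiff_const)).differentiable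
    (by simp)).differentiableAt.hasDerivAt

theorem deriv_zero (hl : Bistable lam rm rp) (μ : ℝ) : deriv (fun r => lam r μ) 0 = 0 := by
  have h1 := hl.hasDerivAt_lam 0 μ
  have h2 : HasDerivAt (fun r => lam (-r) μ) (deriv (fun r => lam r μ) 0 * (-1)) 0 := by
    have h3 : HasDerivAt (fun r => lam r μ) (deriv (fun r => lam r μ) 0) (-0) := by rwa [neg_zero]
    exact HasDerivAt.comp (h₂ := fun r => lam r μ) 0 h3 (hasDerivAt_neg 0)
  have h4 : (fun r => lam (-r) μ) = fun r => lam r μ := funext fun r => hl.even r μ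
  rw [h4] at h2
  have := h1.unique h2
  linarith

theorem lam_rp (hl : Bistable lam rm rp) {μ : ℝ} (hμ : μ ∈ Icc (0 : ℝ) 1) : lam (rp μ) μ = 0 := by
  have hc : ContinuousOn (fun μ => lam (rp μ) μ) (Icc 0 1) :=
    hl.continuous_lam.comp_continuousOn (hl.rp_continuous.prodMk continuousOn_id)
  have h1 : ∀ μ ∈ Ioo (0 : ℝ) 1, lam (rp μ) μ = 0 := fun μ hμ =>
    (hl.roots μ hμ _ ((hl.ordered μ hμ).1.trans (hl.ordered μ hμ).2)).2 (Or.inr rfl)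
  have h2 : IsClosed (Icc (0 : ℝ) 1 ∩ (fun μ => lam (rp μ) μ) ⁻¹' {0}) :=
    hc.preimage_isClosed_of_isClosed isClosed_Icc isClosed_singleton
  have h3 : closure (Ioo (0 : ℝ) 1) ⊆ Icc (0 : ℝ) 1 ∩ (fun μ => lam (rp μ) μ) ⁻¹' {0} :=
    closure_minimal (fun μ hμ => ⟨Ioo_subset_Icc_self hμ, h1 μ hμ⟩) h2
  rw [closure_Ioo zero_ne_one] at h3
  exact (h3 hμ).2

theorem rm_le_rp (hl : Bistable lam rm rp) {μ : ℝ} (hμ : μ ∈ Icc (0 : ℝ) 1) : 0 ≤ rm μ ∧ rm μ ≤ rp μ := by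
  have h2 : IsClosed (Icc (0 : ℝ) 1 ∩ (fun μ => (rm μ, rp μ - rm μ)) ⁻¹' (Ici 0 ×ˢ Ici 0)) :=
    (hl.rm_continuous.prodMk (hl.rp_continuous.sub hl.rm_continuous)).preimage_isClosed_of_isClosed
      isClosed_Icc (isClosed_Ici.prod isClosed_Ici)
  have h3 : closure (Ioo (0 : ℝ) 1) ⊆
      Icc (0 : ℝ) 1 ∩ (fun μ => (rm μ, rp μ - rm μ)) ⁻¹' (Ici 0 ×ˢ Ici 0) :=
    closure_minimal (fun μ hμ => ⟨Ioo_subset_Icc_self hμ, (hl.ordered μ hμ).1.le,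
      sub_nonneg.2 (hl.ordered μ hμ).2.le⟩) h2
  rw [closure_Ioo zero_ne_one] at h3
  have := (h3 hμ).2
  exact ⟨this.1, sub_nonneg.1 this.2⟩

/-- Only `μ = 0` needs an argument: by evenness `lam · 0` has derivative zero at `0`, so `rp 0 = 0`
would contradict the negative slope at `rp 0`. -/
theorem rp_pos (hl : Bistable lam rm rp) {μ : ℝ} (hμ : μ ∈ Icc (0 : ℝ) 1) : 0 < rp μ := by
  rcases hμ.1.eq_or_lt with h | h
  · have h1 := (hl.rm_le_rp hμ).1.trans (hl.rm_le_rp hμ).2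
    refine lt_of_le_of_ne h1 fun h2 => ?_
    have h3 := hl.stable_rp μ ⟨hμ.1, by rw [← h]; exact one_pos⟩
    rw [← h2, hl.deriv_zero] at h3
    exact lt_irrefl _ h3
  · rcases hμ.2.eq_or_lt with h' | h'
    · rw [h', hl.fold_root.2.1]; exact one_pos
    · exact (hl.ordered μ ⟨h, h'⟩).1.trans (hl.ordered μ ⟨h, h'⟩).2

/-- The rescaled nonlinearity near the pitchfork. -/
theorem exists_pitchfork_scaling (hl : Bistable lam rm rp) :
    ∃ (Λ : ℝ × ℝ → ℝ) (P : ℝ × ℝ → ℝ) (Y : ℝ → ℝ) (c : ℝ),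
    ContDiff ℝ ∞ Λ ∧ ContDiff ℝ ∞ P ∧ ContDiff ℝ ∞ Y ∧ 0 < c ∧ (∀ h, 0 < Y h) ∧
    (∀ x h, h ^ 2 * Λ (x, h) = lam (h * x) (h ^ 2)) ∧ (∀ w, P (w, 0) = c * (1 + w)) ∧
    ∃ h₀ > 0, h₀ < 1 ∧ (∀ h, |h| < h₀ → Λ (0, h) < 0) ∧
      (∀ w h, |h| < h₀ → Λ (w * Y h, h) * (w * Y h) = -(w * (1 - w) * P (w, h))) ∧
      ∀ h ∈ Ico (0 : ℝ) h₀, rm (h ^ 2) = h * Y h := by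
  obtain ⟨A, C, hA, hC, hAC, hA0, hC0⟩ := exists_quadratic_form hl.smooth hl.pitchfork_root.2
    (hl.deriv_zero 0)
  have hA0' : A (0, 0) < 0 := by rw [hA0]; exact hl.pitchfork_mu
  have hC0' : 0 < C 0 := by have := hl.pitchfork_cubic; linarith
  -- With `r = h x` and `μ = h²` both terms `x² C` and `ν A` of the normal form carry the factor
  -- `h²`. At `h = 0` a quadratic polynomial in `x` with simple roots is left.
  set Λ : ℝ × ℝ → ℝ := fun q => q.1 ^ 2 * C (q.2 * q.1) + A (q.2 * q.1, q.2 ^ 2) with hΛ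
  have hΛs : ContDiff ℝ ∞ Λ := ((contDiff_fst.pow 2).mul (hC.comp (contDiff_snd.mul
    contDiff_fst))).add (hA.comp ((contDiff_snd.mul contDiff_fst).prodMk (contDiff_snd.pow 2)))
  have hΛl : ∀ x h, h ^ 2 * Λ (x, h) = lam (h * x) (h ^ 2) := by
    intro x h; rw [hAC]; simp only [hΛ]; ring
  have hΛ0 : ∀ x, Λ (x, 0) = C 0 * x ^ 2 + 0 * x + A (0, 0) := by
    intro x; simp only [hΛ]; norm_num; ring
  set Y₀ := Real.sqrt (-A (0, 0) / C 0) with hY₀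
  have hq : 0 < -A (0, 0) / C 0 := div_pos (by linarith) hC0'
  have hY₀p : 0 < Y₀ := Real.sqrt_pos.2 hq
  have hYsq : C 0 * Y₀ ^ 2 = -A (0, 0) := by rw [hY₀, Real.sq_sqrt hq.le]; field_simp
  obtain ⟨Y, hY, hY0, hYpos, a, ha, hYa⟩ := exists_root_branch hΛs hY₀p.ne'
    (by rw [hΛ0, hYsq]; ring) (D := 2 * (C 0 * Y₀)) (by positivity) (by
      have h1 : (fun y => Λ (y, 0)) = fun y => C 0 * y ^ 2 + A (0, 0) :=
        funext fun y => by rw [hΛ0]; ring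
      rw [h1]
      refine (((hasDerivAt_pow 2 Y₀).const_mul (C 0)).add_const _).congr_deriv ?_
      push_cast; ring)
  have hYpos' : ∀ h, 0 < Y h := fun h => (mul_pos_iff_of_pos_left hY₀p).1 (hYpos h)
  obtain ⟨D, hD, hDD⟩ := exists_divided_difference hΛs
  have hev1 : ∀ᶠ h in 𝓝 (0 : ℝ), Λ (0, h) < 0 := by
    have : ContinuousAt (fun h => Λ (0, h)) 0 :=
      (hΛs.continuous.comp (continuous_const.prodMk continuous_id)).continuousAt
    exact this.eventually (gt_mem_nhds (by simp only [hΛ0]; simpa using hA0'))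
  have hrp0 := hl.rp_pos (μ := 0) ⟨le_rfl, zero_le_one⟩
  have hev2 : ∀ᶠ h in 𝓝 (0 : ℝ), h * Y h < rp 0 / 2 := by
    have : ContinuousAt (fun h => h * Y h) 0 := (continuous_id.mul hY.continuous).continuousAt
    exact this.eventually (gt_mem_nhds (by simp only [zero_mul]; positivity))
  have hev3 : ∀ᶠ h in 𝓝 (0 : ℝ), h ^ 2 ∈ Icc (0 : ℝ) 1 → rp 0 / 2 < rp (h ^ 2) := by
    have h1 : Tendsto rp (𝓝[Icc 0 1] 0) (𝓝 (rp 0)) := hl.rp_continuous 0 ⟨le_rfl, zero_le_one⟩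
    have h2 : ∀ᶠ μ in 𝓝[Icc 0 1] (0 : ℝ), rp 0 / 2 < rp μ :=
      h1.eventually (lt_mem_nhds (by linarith))
    have h3 : Tendsto (fun h : ℝ => h ^ 2) (𝓝 0) (𝓝 0) := by
      have : ContinuousAt (fun h : ℝ => h ^ 2) 0 := by fun_prop
      simpa [ContinuousAt] using this
    exact h3.eventually (eventually_nhdsWithin_iff.1 h2)
  obtain ⟨r, hr, hball⟩ := Metric.eventually_nhds_iff.1 (hev1.and (hev2.and hev3))
  -- Because `Y` is a root, `Λ(wY) = (wY - Y) D`, so `Λ(wY) wY = -w (1 - w) Y² D`. At `h = 0`, `D =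
  -- C(0) Y₀ (1 + w)`, whence the constant `C(0) Y₀³`.
  refine ⟨Λ, fun q => Y q.2 ^ 2 * D (q.1 * Y q.2, Y q.2, q.2), Y, C 0 * Y₀ ^ 3, hΛs, ?_, hY,
    by positivity, hYpos', hΛl, ?_, min (min a r) (1 / 2), lt_min (lt_min ha hr) (by norm_num),
    (min_le_right _ _).trans_lt (by norm_num), ?_, ?_, ?_⟩
  · have hY2 : ContDiff ℝ ∞ (fun q : ℝ × ℝ => Y q.2) := hY.comp contDiff_snd
    exact (hY2.pow 2).mul (hD.comp ((contDiff_fst.mul hY2).prodMk (hY2.prodMk contDiff_snd)))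
  · intro w
    simp only
    rw [divided_difference_quadratic hD hDD hΛ0, hY0]; ring
  · intro h hh
    have h1 : dist h 0 < r := by
      rw [dist_zero_right, Real.norm_eq_abs]
      exact hh.trans_le ((min_le_left _ _).trans (min_le_right _ _))
    exact (hball h1).1
  · intro w h hh
    have h1 := (hYa h (hh.trans_le ((min_le_left _ _).trans (min_le_left _ _)))).1
    have h2 := hDD (w * Y h) (Y h) h
    rw [h1, sub_zero] at h2
    simp only
    rw [h2]; ring
  · intro h hh
    rcases hh.1.eq_or_lt with h0 | h0
    · rw [← h0]; simpa using hl.pitchfork_root.1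
    · have habs : |h| < min (min a r) (1 / 2) := by rw [abs_of_pos h0]; exact hh.2
      have hh1 : h < 1 / 2 := hh.2.trans_le (min_le_right _ _)
      have hμ : h ^ 2 ∈ Ioo (0 : ℝ) 1 := ⟨by positivity, by nlinarith⟩
      have h1 := (hYa h (habs.trans_le ((min_le_left _ _).trans (min_le_left _ _)))).1
      have h2 := hΛl (Y h) h
      rw [h1, mul_zero] at h2
      -- The scaled root is `rm` or `rp`; it is less than half of `rp 0`, whereas `rp (h²)` is
      -- larger than that, so it is `rm`.
      have h3 := (hl.roots _ hμ (h * Y h) (mul_pos h0 (hYpos' h))).1 h2.symm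
      rcases h3 with h3 | h3
      · exact h3.symm
      · have h4 := (hball (show dist h 0 < r by
          rw [dist_zero_right, Real.norm_eq_abs]
          exact habs.trans_le ((min_le_left _ _).trans (min_le_right _ _)))).2
        have h5 := h4.2 (Ioo_subset_Icc_self hμ)
        have h6 := h4.1
        linarith

/-- The rescaled nonlinearity near the fold. -/
theorem exists_saddle_node_scaling (hl : Bistable lam rm rp) :
    ∃ (Λ : ℝ × ℝ → ℝ) (P : ℝ × ℝ → ℝ) (Zm Zp : ℝ → ℝ) (c : ℝ),
    ContDiff ℝ ∞ Λ ∧ ContDiff ℝ ∞ P ∧ ContDiff ℝ ∞ Zm ∧ ContDiff ℝ ∞ Zp ∧ 0 < c ∧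
    (∀ h, Zm h < 0) ∧ (∀ h, 0 < Zp h) ∧
    (∀ x h, h ^ 2 * Λ (x, h) = lam (1 + h * x) (1 - h ^ 2)) ∧ (∀ w, P (w, 0) = c) ∧
    ∃ h₀ > 0, h₀ < 1 ∧
      (∀ h, |h| < h₀ → Λ (Zp h, h) = 0 ∧ ∃ D, D ≠ 0 ∧ HasDerivAt (fun y => Λ (y, h)) D (Zp h)) ∧
      (∀ w h, |h| < h₀ → Λ (Zm h + w * (Zp h - Zm h), h) = w * (1 - w) * P (w, h)) ∧
      (∀ h, |h| < h₀ → 0 < 1 + h * Zm h ∧ 0 < 1 + h * Zp h) ∧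
      ∀ h ∈ Ico (0 : ℝ) h₀, rm (1 - h ^ 2) = 1 + h * Zm h ∧ rp (1 - h ^ 2) = 1 + h * Zp h := by
  have hfs : ContDiff ℝ ∞ (fun q : ℝ × ℝ => lam (1 + q.1) (1 - q.2)) :=
    hl.smooth.comp ((contDiff_const.add contDiff_fst).prodMk (contDiff_const.sub contDiff_snd))
  have hd1 : ∀ x, deriv (fun x => lam (1 + x) (1 - 0)) x = deriv (fun r => lam r 1) (1 + x) := by
    intro x
    have h3 : (fun x => lam (1 + x) (1 - 0)) = fun x => (fun r => lam r 1) (1 + x) := by simp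
    rw [h3]
    exact deriv_comp_const_add (f := fun r => lam r 1) 1 x
  obtain ⟨A, C, hA, hC, hAC, hA0, hC0⟩ := exists_quadratic_form
    (f := fun x ν => lam (1 + x) (1 - ν)) hfs (by simpa using hl.fold_root.2.2.1)
    (by rw [hd1]; simpa using hl.fold_root.2.2.2)
  have hA0' : 0 < A (0, 0) := by
    rw [hA0]
    have h3 : (fun ν => lam (1 + 0) (1 - ν)) = fun ν => (fun μ => lam 1 μ) (1 - ν) := by simp
    rw [h3]
    have h4 := deriv_comp_const_sub (f := fun μ => lam 1 μ) 1 0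
    rw [h4]
    have := hl.fold_mu
    simp only [sub_zero]; linarith
  have hC0' : C 0 < 0 := by
    have h3 : iteratedDeriv 2 (fun x => lam (1 + x) (1 - 0)) 0
        = iteratedDeriv 2 (fun r => lam r 1) 1 := by
      rw [iteratedDeriv_succ, iteratedDeriv_one, iteratedDeriv_succ, iteratedDeriv_one, funext hd1,
        deriv_comp_const_add (f := deriv fun r => lam r 1), add_zero]
    have h4 := hl.fold_quadratic
    rw [h3] at hC0
    linarith
  set Λ : ℝ × ℝ → ℝ := fun q => q.1 ^ 2 * C (q.2 * q.1) + A (q.2 * q.1, q.2 ^ 2) with hΛ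
  have hΛs : ContDiff ℝ ∞ Λ := ((contDiff_fst.pow 2).mul (hC.comp (contDiff_snd.mul
    contDiff_fst))).add (hA.comp ((contDiff_snd.mul contDiff_fst).prodMk (contDiff_snd.pow 2)))
  have hΛl : ∀ x h, h ^ 2 * Λ (x, h) = lam (1 + h * x) (1 - h ^ 2) := by
    intro x h; rw [hAC]; simp only [hΛ]; ring
  have hΛ0 : ∀ x, Λ (x, 0) = C 0 * x ^ 2 + 0 * x + A (0, 0) := by
    intro x; simp only [hΛ]; norm_num; ring
  set Z₀ := Real.sqrt (-A (0, 0) / C 0) with hZ₀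
  have hq : 0 < -A (0, 0) / C 0 := div_pos_of_neg_of_neg (by linarith) hC0'
  have hZ₀p : 0 < Z₀ := Real.sqrt_pos.2 hq
  have hZsq : C 0 * Z₀ ^ 2 = -A (0, 0) := by
    rw [hZ₀, Real.sq_sqrt hq.le, mul_div_cancel₀ _ hC0'.ne]
  have hder : ∀ z, HasDerivAt (fun y => Λ (y, 0)) (2 * (C 0 * z)) z := by
    intro z
    have h1 : (fun y => Λ (y, 0)) = fun y => C 0 * y ^ 2 + A (0, 0) :=
      funext fun y => by rw [hΛ0]; ring
    rw [h1]
    refine (((hasDerivAt_pow 2 z).const_mul (C 0)).add_const _).congr_deriv ?_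
    push_cast; ring
  have hne : 2 * (C 0 * Z₀) ≠ 0 := by have := hC0'.ne; positivity
  obtain ⟨Zp, hZp, hZp0, hZpp, a, ha, hZpa⟩ := exists_root_branch hΛs hZ₀p.ne'
    (by rw [hΛ0, hZsq]; ring) hne (hder Z₀)
  obtain ⟨Zm, hZm, hZm0, hZmp, a', ha', hZma⟩ := exists_root_branch hΛs (neg_ne_zero.2 hZ₀p.ne')
    (by rw [hΛ0, neg_sq, hZsq]; ring) (D := 2 * (C 0 * -Z₀)) (by
      intro h; apply hne; linarith) (hder (-Z₀))
  have hZpp' : ∀ h, 0 < Zp h := fun h => (mul_pos_iff_of_pos_left hZ₀p).1 (hZpp h)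
  have hZmp' : ∀ h, Zm h < 0 := fun h => by have := hZmp h; nlinarith
  obtain ⟨D, hD, hDD⟩ := exists_divided_difference hΛs
  have hD1s : ContDiff ℝ ∞ (fun q : ℝ × (ℝ × ℝ) => D (q.1, q.2.1, q.2.2)) := hD
  obtain ⟨D2, hD2, hDD2⟩ := exists_divided_difference hD1s
  have hev : ∀ {Z : ℝ → ℝ}, ContDiff ℝ ∞ Z → ∀ᶠ h in 𝓝 (0 : ℝ), 0 < 1 + h * Z h := by
    intro Z hZ
    have : ContinuousAt (fun h => 1 + h * Z h) 0 :=
      (continuous_const.add (continuous_id.mul hZ.continuous)).continuousAt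
    exact this.eventually (lt_mem_nhds (by norm_num))
  obtain ⟨r, hr, hball⟩ := Metric.eventually_nhds_iff.1 ((hev hZm).and (hev hZp))
  set h₀ := min (min a a') (min r (1 / 2)) with hh₀
  have l1 : h₀ ≤ a := (min_le_left _ _).trans (min_le_left _ _)
  have l2 : h₀ ≤ a' := (min_le_left _ _).trans (min_le_right _ _)
  have l3 : h₀ ≤ r := (min_le_right _ _).trans (min_le_left _ _)
  have l4 : h₀ ≤ 1 / 2 := (min_le_right _ _).trans (min_le_right _ _)
  have hpos : ∀ h, |h| < h₀ → 0 < 1 + h * Zm h ∧ 0 < 1 + h * Zp h := fun h hh =>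
    hball (by rw [dist_zero_right, Real.norm_eq_abs]; exact hh.trans_le l3)
  -- Dividing out both roots, `Λ(x) = (x - Zm)(x - Zp) D2`; for `x = Zm + w (Zp - Zm)` this is `-w
  -- (1 - w) (Zp - Zm)² D2`. At `h = 0` the second divided difference is `C 0`.
  refine ⟨Λ, fun q => -((Zp q.2 - Zm q.2) ^ 2
    * D2 (Zm q.2 + q.1 * (Zp q.2 - Zm q.2), Zp q.2, Zm q.2, q.2)), Zm, Zp, -(C 0 * (2 * Z₀) ^ 2), hΛs,
    ?_, hZm, hZp, ?_, hZmp', hZpp', hΛl, ?_, h₀, lt_min (lt_min ha ha') (lt_min hr (by norm_num)),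
    l4.trans_lt (by norm_num), fun h hh => hZpa h (hh.trans_le l1), ?_, hpos, ?_⟩
  · have h1 : ContDiff ℝ ∞ (fun q : ℝ × ℝ => Zp q.2) := hZp.comp contDiff_snd
    have h2 : ContDiff ℝ ∞ (fun q : ℝ × ℝ => Zm q.2) := hZm.comp contDiff_snd
    exact (((h1.sub h2).pow 2).mul (hD2.comp ((h2.add (contDiff_fst.mul (h1.sub h2))).prodMk
      (h1.prodMk (h2.prodMk contDiff_snd))))).neg
  · have : 0 < (2 * Z₀) ^ 2 := by positivity
    nlinarith
  · intro w
    simp only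
    have h1 : ∀ x, (fun q : ℝ × (ℝ × ℝ) => D (q.1, q.2.1, q.2.2)) (x, (Zm 0, 0))
        = 0 * x ^ 2 + C 0 * x + C 0 * Zm 0 := by
      intro x
      simp only
      rw [divided_difference_quadratic hD hDD hΛ0]; ring
    rw [divided_difference_quadratic hD2 hDD2 h1, hZp0, hZm0]; ring
  · intro w h hh
    have e1 := (hZpa h (hh.trans_le l1)).1
    have e2 := (hZma h (hh.trans_le l2)).1
    have e3 := hDD (Zm h + w * (Zp h - Zm h)) (Zm h) h
    have e4 := hDD (Zp h) (Zm h) h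
    rw [e1, e2, sub_zero] at e4
    have e5 : D (Zp h, Zm h, h) = 0 := by
      refine (mul_eq_zero.1 e4.symm).resolve_left ?_
      have := hZpp' h; have := hZmp' h
      intro h; linarith
    have e6 := hDD2 (Zm h + w * (Zp h - Zm h)) (Zp h) (Zm h, h)
    simp only at e6
    rw [e5, sub_zero] at e6
    rw [e2, sub_zero, e6] at e3
    rw [e3]; ring
  · intro h hh
    rcases hh.1.eq_or_lt with h0 | h0
    · rw [← h0]; simpa using ⟨hl.fold_root.1, hl.fold_root.2.1⟩
    · have habs : |h| < h₀ := by rw [abs_of_pos h0]; exact hh.2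
      have hh1 : h < 1 / 2 := hh.2.trans_le l4
      have hμ : 1 - h ^ 2 ∈ Ioo (0 : ℝ) 1 := ⟨by nlinarith, by nlinarith⟩
      have k1 : lam (1 + h * Zm h) (1 - h ^ 2) = 0 := by
        rw [← hΛl, (hZma h (habs.trans_le l2)).1, mul_zero]
      have k2 : lam (1 + h * Zp h) (1 - h ^ 2) = 0 := by
        rw [← hΛl, (hZpa h (habs.trans_le l1)).1, mul_zero]
      have k3 := (hl.roots _ hμ _ (hpos h habs).1).1 k1
      have k4 := (hl.roots _ hμ _ (hpos h habs).2).1 k2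
      have k5 := (hl.ordered _ hμ).2
      have k6 : 1 + h * Zm h < 1 + h * Zp h := by
        have := hZpp' h; have := hZmp' h
        nlinarith
      rcases k3 with k3 | k3 <;> rcases k4 with k4 | k4
      · linarith
      · exact ⟨k3.symm, k4.symm⟩
      · linarith
      · linarith

end Bistable

end

/-! ### The pitchfork and the saddle-node as fold scalings -/

/-- Amplitude at the reflected neighbour of the first node, if only this node is excited. -/
def mirrorAmp (b : Site) (r : ℝ) : ℝ :=
  match b with
  | Site.on => 0
  | Site.off => r

/-- Coupling at the last excited node of a pattern. -/
def edgeCoupling (N m : ℕ) (b : Site) (a r : ℝ) : ℝ :=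
  (if m = N then r else 0) - (2 : ℝ) * r + (if 2 ≤ m then a else mirrorAmp b r)

theorem continuousOn_edgeCoupling {N m : ℕ} {b : Site} {α : Type*} [TopologicalSpace α] {s : Set α}
    {a r : α → ℝ} (ha : ContinuousOn a s) (hr : ContinuousOn r s) :
    ContinuousOn (fun x => edgeCoupling N m b (a x) (r x)) s := by
  unfold edgeCoupling
  refine ContinuousOn.add (ContinuousOn.sub ?_ (continuousOn_const.mul hr)) ?_
  · split_ifs
    · exact hr
    · exact continuousOn_const
  · split_ifs
    · exact ha
    · cases b
      · exact continuousOn_const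
      · exact hr

/-- At an unperturbed parameter the next node is off, or is the reflection of `m` if `m = N`; the
preceding one has the inner amplitude, or is the mirror image if `m = 1`. The value involves the
unknown at `m` only through the amplitude at `m`, so the equation of that node is affine in `g`
whenever `xm` does not depend on `g`. -/
theorem Zone.coupling_base {N : ℕ} {zn : Zone} {b : Site} (hN : 2 ≤ N) (hm : 1 ≤ zn.m)
    (hmN : zn.m ≤ N) {p : ℝ × ℝ} {a g : ℝ} (ht : zn.tau (p, g) = 0) :
    coupling b (zn.pre (N := N) (p, zn.baseVec N p a g, 0)) (zn.m - 1)
      = edgeCoupling N zn.m b (zn.ain (p, a)) (zn.sc p * zn.xm (p, g)) := by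
  set z : Z N := (p, zn.baseVec N p a g, 0) with hz
  have hP := phase_zero (N := N) b (x := zn.pre z) rfl
  obtain ⟨j, hj⟩ : ∃ j, zn.m = j + 1 := ⟨zn.m - 1, by omega⟩
  have hpg : zn.pg z = (p, g) := by
    have := zn.entry_baseVec (N := N) (p := p) (a := a) (g := g) (j := j) (by omega)
    rw [if_neg (by omega), if_pos (by omega)] at this
    rw [pg, hj]
    exact congrArg (Prod.mk p) this
  have hr : amp b (zn.pre z) zn.m = zn.sc p * zn.xm (p, g) := by
    rw [zn.amp_pre b z hm hmN, radius_m, hpg]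
  have hnext : zn.m < N → amp b (zn.pre z) (zn.m + 1) = 0 := by
    intro h
    rw [zn.amp_pre b z (by omega) (by omega), radius, if_neg (by omega),
      tailAmp_eq_zero (by rw [hpg]; exact ht) (by omega), mul_zero]
  have h1 : amp b (zn.pre z) (zn.m + 1) = if zn.m = N then zn.sc p * zn.xm (p, g) else 0 := by
    split_ifs with h
    · rw [← hr]
      conv_lhs => rw [h]
      conv_rhs => rw [h]
      exact amp_last b _
    · exact hnext (by omega)
  have h2 : amp b (zn.pre z) (zn.m - 1)
      = if 2 ≤ zn.m then zn.ain (p, a) else mirrorAmp b (zn.sc p * zn.xm (p, g)) := by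
    by_cases h : 2 ≤ zn.m
    · rw [if_pos h]
      obtain ⟨i, hi⟩ : ∃ i, zn.m = i + 2 := ⟨zn.m - 2, by omega⟩
      rw [zn.amp_pre b z (by omega) (by omega), radius, if_pos (by omega)]
      simp only [hz]
      have : zn.m - 1 = i + 1 := by omega
      rw [this, zn.entry_baseVec (by omega), if_pos (by omega)]
    · rw [if_neg h]
      have hm1 : zn.m = 1 := by omega
      cases b
      · have h3 := hnext (by omega)
        rw [hm1] at h3
        rw [hm1]
        unfold amp at h3 ⊢
        rw [if_neg (by omega), if_neg (by omega)] at h3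
        simpa [mirrorAmp] using h3
      · rw [mirrorAmp, ← hr, hm1]
        have e0 : amp Site.off (zn.pre z) 0 = entry (zn.pre z).1 1 := rfl
        have e1 : amp Site.off (zn.pre z) 1 = entry (zn.pre z).1 1 := by
          unfold amp
          rw [if_neg one_ne_zero, if_neg (by omega)]
        rw [e1]; exact e0
  have e1 : zn.m - 1 + 2 = zn.m + 1 := by omega
  have e2 : zn.m - 1 + 1 = zn.m := by omega
  unfold coupling edgeCoupling
  rw [e1, e2, hP, hP, Real.cos_zero, mul_one, mul_one, hr, h1, h2]

theorem continuousOn_pattern {N : ℕ} {om0 : ℝ → ℝ} (hom0 : Continuous om0) (m : ℕ) {s : Set ℝ}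
    {a r μ : ℝ → ℝ} (ha : ContinuousOn a s) (hr : ContinuousOn r s) (hμ : ContinuousOn μ s) :
    ContinuousOn (fun t => pattern N om0 m (a t) (r t) (μ t)) s := by
  refine ContinuousOn.prodMk (ContinuousOn.prodMk (continuousOn_pi.2 fun i => ?_)
    (continuousOn_const.prodMk (hom0.comp_continuousOn hμ))) hμ
  split_ifs
  · exact ha
  · exact hr
  · exact continuousOn_const

/-- Scaling of the branch on which the node `m` is switched on at the pitchfork. -/
def pitchforkZone (m : ℕ) (lam : ℝ → ℝ → ℝ) (Λ P : ℝ × ℝ → ℝ) (Y : ℝ → ℝ) : Zone where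
  m := m
  mu p := p.2 ^ 2
  sc p := p.2
  fin _ := 1
  fm p := p.2 ^ 3 * (p.1 * (1 - p.1))
  eps z := z.1.2 ^ 3 * (z.1.1 * (1 - z.1.1) * z.2)
  tau z := z.1.2 * (z.1.1 * (1 - z.1.1) * z.2)
  L z := Λ (z.2, z.1.2)
  ain z := z.2
  Din z := lam z.2 (z.1.2 ^ 2) * z.2
  xm z := z.1.1 * Y z.1.2
  kin z := z.1.2 ^ 3 * (z.1.1 * (1 - z.1.1) * z.2)
  km z := z.2
  Dm z := -P z.1

/-- The unperturbed branch near the pitchfork. -/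
def pitchforkLimit (N : ℕ) (om0 rm rp : ℝ → ℝ) (m : ℕ) (σ : ℝ) : P N :=
  pattern N om0 m (rp |σ|) (rm (max σ 0)) |σ|

theorem max_mem_Icc {σ : ℝ} (h : σ ∈ Icc (-1 : ℝ) 1) : max σ 0 ∈ Icc (0 : ℝ) 1 :=
  ⟨le_max_right _ _, max_le h.2 zero_le_one⟩

/-- The nonlinearity at `m` is `-h³ w (1 - w) P`, so `d = 3`. The coupling is positive, since the
node `m - 1` is excited while the node `m` is small; this is where `m ≥ 2` enters. Hence `g = P /
coupling > 0`, and `P(w, 0) = c (1 + w)` gives `θ = 1`. -/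
theorem exists_pitchfork_foldScaling {N : ℕ} {lam : ℝ → ℝ → ℝ} {rm rp om0 : ℝ → ℝ}
    (hl : Bistable lam rm rp) (hN : 2 ≤ N) (hom0 : Continuous om0) (b : Site) {m : ℕ} (hm : 2 ≤ m)
    (hmN : m ≤ N) : ∃ (zn : Zone) (a g : ℝ × ℝ → ℝ) (h₀ c₀ : ℝ),
      zn.FoldScaling N lam om0 b 3 a g h₀ c₀ 1 0 1 (pitchforkLimit N om0 rm rp m) := by
  obtain ⟨Λ, P, Y, c, hΛ, hP, hY, hc, hYpos, hΛl, hP0, h₁, hh₁, hh₁1, hΛneg, hΛP, hrm⟩ :=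
    hl.exists_pitchfork_scaling
  have hrp0 := hl.rp_pos (μ := 0) ⟨le_rfl, zero_le_one⟩
  have hrpc : ContinuousOn (fun h : ℝ => rp (h ^ 2)) (Icc 0 1) :=
    hl.rp_continuous.comp (by fun_prop) (fun h hh => ⟨by positivity, pow_le_one₀ hh.1 hh.2⟩)
  have hev : ∀ᶠ h in 𝓝[Icc 0 1] (0 : ℝ), 0 < rp (h ^ 2) - 2 * (h * Y h) := by
    have h1 : ContinuousWithinAt (fun h : ℝ => rp (h ^ 2) - 2 * (h * Y h)) (Icc 0 1) 0 :=
      (hrpc 0 ⟨le_rfl, zero_le_one⟩).sub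
        (continuous_const.mul (continuous_id.mul hY.continuous)).continuousWithinAt
    exact h1.eventually (lt_mem_nhds (by simpa using hrp0))
  obtain ⟨r, hr, hball⟩ := Metric.eventually_nhds_iff.1 (eventually_nhdsWithin_iff.1 hev)
  set h₀ := min h₁ r / 2 with hh₀
  have hh₀p : 0 < h₀ := by have : 0 < min h₁ r := lt_min hh₁ hr; positivity
  have l1 : h₀ < h₁ := by have := min_le_left h₁ r; linarith
  have l2 : h₀ < r := by have := min_le_right h₁ r; linarith
  have hcpl : ∀ h ∈ Icc (0 : ℝ) h₀, 0 < rp (h ^ 2) - 2 * (h * Y h) := fun h hh =>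
    hball (by rw [dist_zero_right, Real.norm_eq_abs, abs_of_nonneg hh.1]; linarith [hh.2])
      ⟨hh.1, by linarith [hh.2]⟩
  have hedge : ∀ p ∈ Zone.edges h₀, p.1 ∈ Icc (0 : ℝ) 1 ∧ p.2 ∈ Icc (0 : ℝ) h₀ ∧
      p.2 * (p.1 * (1 - p.1)) = 0 := by
    rintro ⟨w, h⟩ (⟨h1, h2⟩ | ⟨h1, h2⟩)
    · have h2' : h = 0 := h2
      subst h2'
      exact ⟨h1, ⟨le_rfl, hh₀p.le⟩, by simp⟩
    · rcases h1 with h1 | h1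
      · have h1' : w = 0 := h1
        subst h1'
        exact ⟨by simp, h2, by simp⟩
      · have h1' : w = 1 := h1
        subst h1'
        exact ⟨by simp, h2, by simp⟩
  have hcplE : ∀ p ∈ Zone.edges h₀, 0 < edgeCoupling N m b (rp (p.2 ^ 2)) (p.2 * (p.1 * Y p.2)) := by
    intro p hp
    obtain ⟨h1, h2, -⟩ := hedge p hp
    have h3 := hcpl p.2 h2
    have h4 := hYpos p.2
    have h5 : p.2 * (p.1 * Y p.2) ≤ p.2 * Y p.2 := by
      have : p.1 * Y p.2 ≤ 1 * Y p.2 := mul_le_mul_of_nonneg_right h1.2 h4.le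
      rw [one_mul] at this
      exact mul_le_mul_of_nonneg_left this h2.1
    have h6 : 0 ≤ p.2 * (p.1 * Y p.2) := mul_nonneg h2.1 (mul_nonneg h1.1 h4.le)
    unfold edgeCoupling
    rw [if_pos hm]
    split_ifs <;> linarith
  have hrpE : ContinuousOn (fun p : ℝ × ℝ => rp (p.2 ^ 2)) (Zone.edges h₀) :=
    hrpc.comp continuousOn_snd (fun p hp => ⟨(hedge p hp).2.1.1, by
      have := (hedge p hp).2.1.2; linarith⟩)
  have hh2 : ∀ h ∈ Icc (0 : ℝ) h₀, h ^ 2 ∈ Ico (0 : ℝ) 1 := fun h hh =>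
    ⟨by positivity, by have := hh.1; have := hh.2; nlinarith⟩
  set zn := pitchforkZone m lam Λ P Y with hzn
  have hvalid : ∀ p : ℝ × ℝ, p ∈ strip → p.2 < h₀ → ∀ t, zn.Valid lam p t := by
    intro p hp hph t
    have habs : |p.2| < h₁ := by rw [abs_of_pos hp.2]; linarith
    refine ⟨fun x => hΛl x p.2, ?_, fun ζ => ?_, ?_, ?_, ?_⟩
    · change p.2 ^ 2 * (p.2 * (p.1 * (1 - p.1) * t)) = p.2 ^ 3 * (p.1 * (1 - p.1) * t); ring
    · change 1 * (lam ζ (p.2 ^ 2) * ζ) = lam ζ (p.2 ^ 2) * ζ; ring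
    · change 1 * (p.2 ^ 3 * (p.1 * (1 - p.1) * t)) = p.2 ^ 3 * (p.1 * (1 - p.1) * t); ring
    · change p.2 ^ 3 * (p.1 * (1 - p.1)) * -P p
        = lam (p.2 * (p.1 * Y p.2)) (p.2 ^ 2) * (p.2 * (p.1 * Y p.2))
      rw [← hΛl]
      linear_combination -p.2 ^ 3 * hΛP p.1 p.2 habs
    · change p.2 ^ 3 * (p.1 * (1 - p.1)) * t = p.2 ^ 3 * (p.1 * (1 - p.1) * t); ring
  have hpne : ∀ p ∈ strip, p.2 ^ 3 * (p.1 * (1 - p.1)) ≠ 0 := by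
    intro p hp
    have e1 : 0 < p.2 := hp.2
    have e2 : 0 < p.1 := hp.1.1
    have e3 : 0 < 1 - p.1 := by linarith [hp.1.2]
    positivity
  refine ⟨zn, fun p => rp (p.2 ^ 2), fun p => P p / edgeCoupling N m b (rp (p.2 ^ 2))
    (p.2 * (p.1 * Y p.2)), h₀, c / rp 0, ?_⟩
  have hb : ∀ p ∈ Zone.edges h₀, zn.Base N b p (rp (p.2 ^ 2)) (P p / edgeCoupling N m b
      (rp (p.2 ^ 2)) (p.2 * (p.1 * Y p.2))) := by
    intro p hp
    obtain ⟨h1, h2, h3⟩ := hedge p hp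
    have hτ : ∀ g, zn.tau (p, g) = 0 := fun g => by
      change p.2 * (p.1 * (1 - p.1) * g) = 0
      linear_combination g * h3
    have hε : ∀ g, p.2 ^ 3 * (p.1 * (1 - p.1) * g) = 0 := fun g => by
      linear_combination p.2 ^ 2 * g * h3
    have hμ := hh2 p.2 h2
    have hcE := hcplE p hp
    have hcb : ∀ t, coupling b (zn.pre (N := N) (p, zn.baseVec N p (rp (p.2 ^ 2)) t, 0)) (zn.m - 1)
        = edgeCoupling N m b (rp (p.2 ^ 2)) (p.2 * (p.1 * Y p.2)) := fun t =>
      Zone.coupling_base hN (by change 1 ≤ m; omega) hmN (hτ t)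
    refine ⟨hτ, hε, ?_, Or.inl hε, ?_, ⟨deriv (fun r => lam r (p.2 ^ 2)) (rp (p.2 ^ 2)) *
      rp (p.2 ^ 2), ?_, ?_⟩, ?_, ?_, ?_, ⟨_, hcE.ne', ?_⟩⟩
    · exact hΛneg p.2 (by rw [abs_of_nonneg h2.1]; linarith [h2.2])
    · change lam (rp (p.2 ^ 2)) (p.2 ^ 2) * rp (p.2 ^ 2) = 0
      rw [hl.lam_rp (Ico_subset_Icc_self hμ), zero_mul]
    · exact mul_ne_zero (hl.stable_rp _ hμ).ne (hl.rp_pos (Ico_subset_Icc_self hμ)).ne'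
    · refine ((hl.hasDerivAt_lam (rp (p.2 ^ 2)) (p.2 ^ 2)).fun_mul
        (hasDerivAt_id (rp (p.2 ^ 2)))).congr_deriv ?_
      rw [hl.lam_rp (Ico_subset_Icc_self hμ)]; simp
    · exact hl.rp_pos (Ico_subset_Icc_self hμ)
    · intro h; change m = 1 at h; omega
    · rw [hcb]
      change -P p + P p / edgeCoupling N m b (rp (p.2 ^ 2)) (p.2 * (p.1 * Y p.2)) * _ = 0
      rw [div_mul_cancel₀ _ hcE.ne', neg_add_cancel]
    · simp only [hcb]
      exact ((hasDerivAt_id _).mul_const _).const_add (-P p) |>.congr_deriv (by ring)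
  have hYc : ContDiff ℝ ∞ (fun p : ℝ × ℝ => Y p.2) := hY.comp contDiff_snd
  refine ⟨?_, by change 1 ≤ m; omega, hmN, by norm_num, hh₀p, by positivity, zero_le_one, le_rfl, hrpE,
    ?_, hb, fun p t => rfl, ?_, fun p => ?_, one_ne_zero, hvalid, ?_, ?_, ?_, ?_, ?_, ?_, ?_⟩
  · have w : ContDiff ℝ ∞ (fun p : ℝ × ℝ => p.1 * (1 - p.1)) :=
      contDiff_fst.mul (contDiff_const.sub contDiff_fst)
    have w' : ContDiff ℝ ∞ (fun z : (ℝ × ℝ) × ℝ => z.1.1 * (1 - z.1.1) * z.2) :=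
      (w.comp contDiff_fst).mul contDiff_snd
    have hh : ContDiff ℝ ∞ (fun z : (ℝ × ℝ) × ℝ => z.1.2) := contDiff_snd.comp contDiff_fst
    exact ⟨contDiff_snd.pow 2, contDiff_snd, contDiff_const, (contDiff_snd.pow 3).mul w,
      (hh.pow 3).mul w', hh.mul w', hΛ.comp (contDiff_snd.prodMk hh), contDiff_snd,
      (hl.smooth.comp (contDiff_snd.prodMk (hh.pow 2))).mul contDiff_snd,
      (contDiff_fst.comp contDiff_fst).mul (hY.comp hh), (hh.pow 3).mul w', contDiff_snd,
      (hP.comp contDiff_fst).neg⟩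
  · refine hP.continuous.continuousOn.div (continuousOn_edgeCoupling hrpE ?_)
      (fun p hp => (hcplE p hp).ne')
    exact (continuous_snd.mul (continuous_fst.mul hYc.continuous)).continuousOn
  · intro w hw
    simp only [hP0]
    have : edgeCoupling N m b (rp ((0 : ℝ) ^ 2)) (0 * (w * Y 0)) = rp 0 := by
      unfold edgeCoupling; rw [if_pos hm]; simp
    rw [this]; ring
  · change p.2 ^ 2 = _; ring
  · intro p hp _ t
    have e1 : 0 < p.2 := hp.2
    have e2 : 0 < p.1 := hp.1.1
    refine ⟨one_ne_zero, hpne p hp, ?_⟩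
    change p.2 * (p.1 * Y p.2) ≠ 0
    have := hYpos p.2
    positivity
  · rintro ⟨⟨w, h⟩, t⟩ hz hh ht
    set e := h ^ 3 * (w * (1 - w) * t) with he
    have hh0 : 0 < h := hz.2
    -- The inverse is explicit: `h = √μ`, `w` is the amplitude divided by `h Y h`, and `g` follows
    -- from the fixed value `e` of `ε`.
    set W : ℝ × ℝ → ℝ := fun c => c.2 * (Real.sqrt c.1 * Y (Real.sqrt c.1))⁻¹ with hW
    set pinv : ℝ × ℝ → (ℝ × ℝ) × ℝ := fun c => ((W c, Real.sqrt c.1),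
      e * (Real.sqrt c.1 ^ 3 * (W c * (1 - W c)))⁻¹) with hpinv
    have hleft : ∀ p ∈ strip, ∀ t, (pinv (zn.mu p, zn.sc p * zn.xm (p, t))).1 = p := by
      intro p hp t
      have e1 : 0 < p.2 := hp.2
      have e2 := hYpos p.2
      change (p.2 * (p.1 * Y p.2) * (Real.sqrt (p.2 ^ 2) * Y (Real.sqrt (p.2 ^ 2)))⁻¹,
        Real.sqrt (p.2 ^ 2)) = p
      rw [Real.sqrt_sq e1.le]
      refine Prod.ext ?_ rfl
      simp only
      field_simp
    have hself : pinv (zn.mu (w, h), zn.sc (w, h) * zn.xm ((w, h), t)) = ((w, h), t) := by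
      refine Prod.ext (hleft (w, h) hz t) ?_
      have h1 := hleft (w, h) hz t
      have h2 : W (zn.mu (w, h), zn.sc (w, h) * zn.xm ((w, h), t)) = w := congrArg Prod.fst h1
      have h3 : Real.sqrt (zn.mu (w, h)) = h := congrArg Prod.snd h1
      simp only [hpinv]
      rw [h2, h3]
      have := hpne (w, h) hz
      simp only at this
      rw [he, ← mul_assoc, mul_comm (h ^ 3 * (w * (1 - w))) t, mul_assoc, mul_inv_cancel₀ this, mul_one]
    have hdiff : DifferentiableAt ℝ pinv (zn.mu (w, h), zn.sc (w, h) * zn.xm ((w, h), t)) := by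
      set c₀ : ℝ × ℝ := (zn.mu (w, h), zn.sc (w, h) * zn.xm ((w, h), t)) with hc₀
      have d1 : DifferentiableAt ℝ (fun c : ℝ × ℝ => Real.sqrt c.1) c₀ :=
        differentiableAt_fst.sqrt (by change h ^ 2 ≠ 0; positivity)
      have s1 : Real.sqrt c₀.1 = h := congrArg (fun z => z.1.2) hself
      have s2 : W c₀ = w := congrArg (fun z => z.1.1) hself
      have d2 : DifferentiableAt ℝ (fun c : ℝ × ℝ => Y (Real.sqrt c.1)) c₀ :=
        DifferentiableAt.comp (g := Y) c₀ (hY.differentiable (by simp)).differentiableAt d1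
      have d3 : DifferentiableAt ℝ W c₀ :=
        differentiableAt_snd.fun_mul ((d1.fun_mul d2).fun_inv (by
          rw [s1]; have := hYpos h; positivity))
      refine (d3.prodMk d1).prodMk (DifferentiableAt.fun_mul (differentiableAt_const e)
        (((d1.fun_pow 3).fun_mul (d3.fun_mul (d3.const_sub 1))).fun_inv ?_))
      rw [s1, s2]; exact hpne (w, h) hz
    refine ⟨pinv, hself, hdiff, ?_, fun p hp _ t => hleft p hp t⟩
    have hev1 : ∀ᶠ c in 𝓝 ((zn.mu (w, h), zn.sc (w, h) * zn.xm ((w, h), t)) : ℝ × ℝ),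
        (pinv c).1 ∈ strip ∩ {p | p.2 < h₀} := by
      refine hdiff.continuousAt.fst.eventually ((isOpen_strip.inter
        (isOpen_lt continuous_snd continuous_const)).mem_nhds ?_)
      simp only [hself]; exact ⟨hz, hh⟩
    filter_upwards [hev1] with c hc
    have hs : 0 < Real.sqrt c.1 := hc.1.2
    have hc1 : 0 < c.1 := Real.sqrt_pos.1 hs
    refine ⟨Real.sq_sqrt hc1.le, ?_, ?_, hvalid _ hc.1 hc.2 _⟩
    · change Real.sqrt c.1 * (c.2 * (Real.sqrt c.1 * Y (Real.sqrt c.1))⁻¹ * Y (Real.sqrt c.1)) = c.2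
      have := hYpos (Real.sqrt c.1)
      field_simp
    · change Real.sqrt c.1 ^ 3 * (W c * (1 - W c)
        * (e * (Real.sqrt c.1 ^ 3 * (W c * (1 - W c)))⁻¹)) = e
      have := hpne _ hc.1
      change Real.sqrt c.1 ^ 3 * (W c * (1 - W c)) ≠ 0 at this
      calc _ = e * ((Real.sqrt c.1 ^ 3 * (W c * (1 - W c)))
            * (Real.sqrt c.1 ^ 3 * (W c * (1 - W c)))⁻¹) := by ring
        _ = e := by rw [mul_inv_cancel₀ this, mul_one]
  · exact ⟨fun c => c.2, fun _ _ _ => rfl, fun _ _ => differentiableAt_snd, fun _ _ => rfl⟩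
  · have hsub : ∀ σ ∈ Icc (-h₀ ^ 2) (h₀ ^ 2), σ ∈ Icc (-1 : ℝ) 1 := by
      intro σ hσ
      have := (hh2 h₀ ⟨hh₀p.le, le_rfl⟩).2
      exact ⟨by linarith [hσ.1], by linarith [hσ.2]⟩
    exact continuousOn_pattern hom0 m
      (hl.rp_continuous.comp continuous_abs.continuousOn (fun σ hσ => ⟨abs_nonneg σ,
        abs_le.2 (hsub σ hσ)⟩))
      (hl.rm_continuous.comp (continuous_id.max continuous_const).continuousOn (fun σ hσ =>
        max_mem_Icc (hsub σ hσ))) continuous_abs.continuousOn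
  · intro w hw
    change pattern N om0 m (rp ((0 : ℝ) ^ 2)) (0 * (w * Y 0)) ((0 : ℝ) ^ 2) = _
    simp [pitchforkLimit, hl.pitchfork_root.1]
  · intro h hh
    change pattern N om0 m (rp (h ^ 2)) (h * (0 * Y h)) (h ^ 2) = _
    have h1 : |-h ^ 2| = h ^ 2 := by rw [abs_neg, abs_of_nonneg (by positivity)]
    have h2 : max (-h ^ 2) 0 = 0 := max_eq_right (by simp; positivity)
    simp [pitchforkLimit, h2, hl.pitchfork_root.1]
  · intro h hh
    change pattern N om0 m (rp (h ^ 2)) (h * (1 * Y h)) (h ^ 2) = _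
    have h1 : |h ^ 2| = h ^ 2 := abs_of_nonneg (by positivity)
    have h2 : max (h ^ 2) 0 = h ^ 2 := max_eq_left (by positivity)
    rw [pitchforkLimit, h1, h2, hrm h ⟨hh.1, by linarith [hh.2]⟩, one_mul]

/-- Scaling of the branch on which the node `m` passes through the saddle-node. -/
def saddleNodeZone (m : ℕ) (lam : ℝ → ℝ → ℝ) (Λ P : ℝ × ℝ → ℝ) (Zm Zp : ℝ → ℝ) : Zone where
  m := m
  mu p := 1 - p.2 ^ 2
  sc _ := 1
  fin p := p.2 ^ 2
  fm p := p.2 ^ 2 * (p.1 * (1 - p.1))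
  eps z := z.1.2 ^ 2 * (z.1.1 * (1 - z.1.1) * z.2)
  tau z := z.1.2 ^ 2 * (z.1.1 * (1 - z.1.1) * z.2)
  L z := lam z.2 (1 - z.1.2 ^ 2)
  ain z := 1 + z.1.2 * z.2
  Din z := Λ (z.2, z.1.2) * (1 + z.1.2 * z.2)
  xm z := 1 + z.1.2 * (Zm z.1.2 + z.1.1 * (Zp z.1.2 - Zm z.1.2))
  kin z := z.1.1 * (1 - z.1.1) * z.2
  km z := z.2
  Dm z := P z.1 * (1 + z.1.2 * (Zm z.1.2 + z.1.1 * (Zp z.1.2 - Zm z.1.2)))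

/-- The unperturbed branch near the saddle-node. -/
def saddleNodeLimit (N : ℕ) (om0 rm rp : ℝ → ℝ) (m : ℕ) (σ : ℝ) : P N :=
  pattern N om0 m (rp (1 - |σ|)) (rm (1 - max (-σ) 0) + rp (1 - max σ 0) - 1) (1 - |σ|)

/-- The nonlinearity at `m` is `h² w (1 - w) P` times a positive amplitude, so `d = 2`; `P` is
constant at `h = 0`, so `θ = 0`. The coupling is about `-2 + 1` or `-2`, hence negative, because the
next node is off; for `m = N` this would fail. All inner nodes are within order `h` of the fold as
well, so their equations are also divided by `h²`. -/
theorem exists_saddleNode_foldScaling {N : ℕ} {lam : ℝ → ℝ → ℝ} {rm rp om0 : ℝ → ℝ}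
    (hl : Bistable lam rm rp) (hN : 2 ≤ N) (hom0 : Continuous om0) (b : Site) {m : ℕ} (hm : 1 ≤ m)
    (hmN : m < N) : ∃ (zn : Zone) (a g : ℝ × ℝ → ℝ) (h₀ c₀ : ℝ),
      zn.FoldScaling N lam om0 b 2 a g h₀ c₀ 0 1 (-1) (saddleNodeLimit N om0 rm rp m) := by
  obtain ⟨Λ, P, Zm, Zp, c, hΛ, hP, hZm, hZp, hc, hZmn, hZpp, hΛl, hP0, h₁, hh₁, hh₁1, hΛp, hΛP,
    hpos, hroots⟩ := hl.exists_saddle_node_scaling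
  have hev : ∀ᶠ h in 𝓝 (0 : ℝ), 0 < 2 * (1 + h * Zm h) - (1 + h * Zp h) := by
    have h1 : ContinuousAt (fun h : ℝ => 2 * (1 + h * Zm h) - (1 + h * Zp h)) 0 :=
      ((continuous_const.mul (continuous_const.add (continuous_id.mul hZm.continuous))).sub
        (continuous_const.add (continuous_id.mul hZp.continuous))).continuousAt
    exact h1.eventually (lt_mem_nhds (by norm_num))
  obtain ⟨r, hr, hball⟩ := Metric.eventually_nhds_iff.1 hev
  set h₀ := min h₁ r / 2 with hh₀
  have hh₀p : 0 < h₀ := by have : 0 < min h₁ r := lt_min hh₁ hr; positivity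
  have l1 : h₀ < h₁ := by have := min_le_left h₁ r; linarith
  have l2 : h₀ < r := by have := min_le_right h₁ r; linarith
  set R : ℝ × ℝ → ℝ := fun p => 1 + p.2 * (Zm p.2 + p.1 * (Zp p.2 - Zm p.2)) with hR
  have hRs : ContDiff ℝ ∞ R := by
    have h1 : ContDiff ℝ ∞ (fun p : ℝ × ℝ => Zp p.2) := hZp.comp contDiff_snd
    have h2 : ContDiff ℝ ∞ (fun p : ℝ × ℝ => Zm p.2) := hZm.comp contDiff_snd
    exact contDiff_const.add (contDiff_snd.mul (h2.add (contDiff_fst.mul (h1.sub h2))))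
  have hRpos : ∀ p : ℝ × ℝ, p.1 ∈ Icc (0 : ℝ) 1 → p.2 ∈ Icc (0 : ℝ) h₀ →
      0 < R p ∧ 1 + p.2 * Zp p.2 < 2 * R p := by
    intro p h1 h2
    have habs : |p.2| < h₁ := by rw [abs_of_nonneg h2.1]; linarith [h2.2]
    have h3 := (hpos p.2 habs).1
    have h4 := hball (y := p.2) (by
      rw [dist_zero_right, Real.norm_eq_abs, abs_of_nonneg h2.1]; linarith [h2.2])
    have h5 : 0 ≤ p.2 * (p.1 * (Zp p.2 - Zm p.2)) :=
      mul_nonneg h2.1 (mul_nonneg h1.1 (by have := hZpp p.2; have := hZmn p.2; linarith))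
    have h6 : R p = 1 + p.2 * Zm p.2 + p.2 * (p.1 * (Zp p.2 - Zm p.2)) := by simp only [hR]; ring
    constructor <;> linarith
  have hedge : ∀ p ∈ Zone.edges h₀, p.1 ∈ Icc (0 : ℝ) 1 ∧ p.2 ∈ Icc (0 : ℝ) h₀ ∧
      (p.2 = 0 ∨ p.1 * (1 - p.1) = 0) := by
    rintro ⟨w, h⟩ (⟨h1, h2⟩ | ⟨h1, h2⟩)
    · have h2' : h = 0 := h2
      subst h2'
      exact ⟨h1, ⟨le_rfl, hh₀p.le⟩, by simp⟩
    · rcases h1 with h1 | h1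
      · have h1' : w = 0 := h1
        subst h1'
        exact ⟨by simp, h2, by simp⟩
      · have h1' : w = 1 := h1
        subst h1'
        exact ⟨by simp, h2, by simp⟩
  have hcplE : ∀ p ∈ Zone.edges h₀, edgeCoupling N m b (1 + p.2 * Zp p.2) (R p) < 0 := by
    intro p hp
    obtain ⟨h1, h2, -⟩ := hedge p hp
    obtain ⟨h3, h4⟩ := hRpos p h1 h2
    unfold edgeCoupling
    rw [if_neg (by omega)]
    split_ifs
    · linarith
    · cases b
      · simp only [mirrorAmp]; linarith
      · simp only [mirrorAmp]; linarith
  have hZpE : ContinuousOn (fun p : ℝ × ℝ => Zp p.2) (Zone.edges h₀) :=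
    (hZp.continuous.comp continuous_snd).continuousOn
  have hh2 : ∀ h ∈ Icc (0 : ℝ) h₀, h ^ 2 ∈ Ico (0 : ℝ) 1 := fun h hh =>
    ⟨by positivity, by have := hh.1; have := hh.2; nlinarith⟩
  set zn := saddleNodeZone m lam Λ P Zm Zp with hzn
  have hvalid : ∀ p : ℝ × ℝ, p ∈ strip → p.2 < h₀ → ∀ t, zn.Valid lam p t := by
    intro p hp hph t
    have habs : |p.2| < h₁ := by rw [abs_of_pos hp.2]; linarith
    refine ⟨fun x => ?_, ?_, fun ζ => ?_, ?_, ?_, ?_⟩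
    · change (1 : ℝ) ^ 2 * lam x (1 - p.2 ^ 2) = lam (1 * x) (1 - p.2 ^ 2)
      rw [one_mul, one_pow, one_mul]
    · change (1 : ℝ) ^ 2 * (p.2 ^ 2 * (p.1 * (1 - p.1) * t)) = p.2 ^ 2 * (p.1 * (1 - p.1) * t); ring
    · change p.2 ^ 2 * (Λ (ζ, p.2) * (1 + p.2 * ζ))
        = lam (1 + p.2 * ζ) (1 - p.2 ^ 2) * (1 + p.2 * ζ)
      rw [← hΛl]; ring
    · change p.2 ^ 2 * (p.1 * (1 - p.1) * t) = _; rfl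
    · change p.2 ^ 2 * (p.1 * (1 - p.1)) * (P p * R p) = lam (1 * R p) (1 - p.2 ^ 2) * (1 * R p)
      have h1 := hΛl (Zm p.2 + p.1 * (Zp p.2 - Zm p.2)) p.2
      rw [hΛP p.1 p.2 habs] at h1
      rw [one_mul]
      change _ = lam (R p) _ at h1
      rw [← h1]; ring
    · change p.2 ^ 2 * (p.1 * (1 - p.1)) * t = p.2 ^ 2 * (p.1 * (1 - p.1) * t); ring
  have hpne : ∀ p ∈ strip, p.2 ^ 2 * (p.1 * (1 - p.1)) ≠ 0 := by
    intro p hp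
    have e1 : 0 < p.2 := hp.2
    have e2 : 0 < p.1 := hp.1.1
    have e3 : 0 < 1 - p.1 := by linarith [hp.1.2]
    positivity
  have hE1 : edgeCoupling N m b 1 1 < 0 := by
    have h1 := hcplE (0, 0) (Or.inl ⟨by simp, rfl⟩)
    simpa [hR] using h1
  refine ⟨zn, fun p => Zp p.2, fun p => -(P p * R p) / edgeCoupling N m b (1 + p.2 * Zp p.2) (R p),
    h₀, -c / edgeCoupling N m b 1 1, ?_⟩
  have hb : ∀ p ∈ Zone.edges h₀, zn.Base N b p (Zp p.2)
      (-(P p * R p) / edgeCoupling N m b (1 + p.2 * Zp p.2) (R p)) := by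
    intro p hp
    obtain ⟨h1, h2, h3⟩ := hedge p hp
    have hτ : ∀ g, zn.tau (p, g) = 0 := fun g => by
      change p.2 ^ 2 * (p.1 * (1 - p.1) * g) = 0
      rcases h3 with h3 | h3 <;> rw [h3] <;> ring
    have hμ := hh2 p.2 h2
    have habs : |p.2| < h₁ := by rw [abs_of_nonneg h2.1]; linarith [h2.2]
    have hcE := hcplE p hp
    have hcb : ∀ t, coupling b (zn.pre (N := N) (p, zn.baseVec N p (Zp p.2) t, 0)) (zn.m - 1)
        = edgeCoupling N m b (1 + p.2 * Zp p.2) (R p) := fun t => by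
      have h4 := Zone.coupling_base (b := b) (zn := zn) hN hm hmN.le (hτ t) (a := Zp p.2)
      rw [h4]
      change edgeCoupling N m b (1 + p.2 * Zp p.2) (1 * R p) = _
      rw [one_mul]
    obtain ⟨D, hD, hDd⟩ := (hΛp p.2 habs).2
    have hzp := (hpos p.2 habs).2
    refine ⟨hτ, hτ, ?_, ?_, ?_, ⟨D * (1 + p.2 * Zp p.2), mul_ne_zero hD hzp.ne', ?_⟩, hzp, ?_, ?_,
      ⟨_, hcE.ne, ?_⟩⟩
    · exact hl.stable_zero _ ⟨by linarith [hμ.2], by linarith [hμ.1]⟩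
    -- After this division the coupling of the inner nodes keeps the factor `w (1 - w) g`. On `h =
    -- 0` it is harmless because all excited amplitudes equal `1` and the coupling itself vanishes;
    -- on `w = 0, 1` the factor vanishes.
    · rcases h3 with h3 | h3
      · right
        constructor
        · intro ζ; change 1 + p.2 * ζ = 1; rw [h3]; ring
        · intro g
          change 1 * (1 + p.2 * (Zm p.2 + p.1 * (Zp p.2 - Zm p.2))) = 1
          rw [h3]; ring
      · left
        intro g; change p.1 * (1 - p.1) * g = 0; rw [h3, zero_mul]
    · change Λ (Zp p.2, p.2) * (1 + p.2 * Zp p.2) = 0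
      rw [(hΛp p.2 habs).1, zero_mul]
    · have h4 : HasDerivAt (fun ζ => 1 + p.2 * ζ) p.2 (Zp p.2) := by
        simpa using ((hasDerivAt_id (Zp p.2)).const_mul p.2).const_add 1
      refine (hDd.fun_mul h4).congr_deriv ?_
      rw [(hΛp p.2 habs).1, zero_mul, add_zero]
    · intro _
      change 0 < 1 * R p
      rw [one_mul]; exact (hRpos p h1 h2).1
    · rw [hcb]
      change P p * R p + -(P p * R p) / _ * _ = 0
      rw [div_mul_cancel₀ _ hcE.ne]; ring
    · simp only [hcb]
      exact ((hasDerivAt_id _).mul_const _).const_add (P p * R p) |>.congr_deriv (by ring)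
  have hdZ : ∀ h, 0 < Zp h - Zm h := fun h => by have := hZpp h; have := hZmn h; linarith
  refine ⟨?_, hm, hmN.le, by norm_num, hh₀p, div_pos_of_neg_of_neg (by linarith) hE1, le_rfl,
    zero_le_one, hZpE, ?_, hb, fun p t => rfl, ?_, fun p => ?_, by norm_num, hvalid, ?_, ?_, ?_, ?_,
    ?_, ?_, ?_⟩
  · have w : ContDiff ℝ ∞ (fun p : ℝ × ℝ => p.1 * (1 - p.1)) :=
      contDiff_fst.mul (contDiff_const.sub contDiff_fst)
    have w' : ContDiff ℝ ∞ (fun z : (ℝ × ℝ) × ℝ => z.1.1 * (1 - z.1.1) * z.2) :=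
      (w.comp contDiff_fst).mul contDiff_snd
    have hh : ContDiff ℝ ∞ (fun z : (ℝ × ℝ) × ℝ => z.1.2) := contDiff_snd.comp contDiff_fst
    have ha : ContDiff ℝ ∞ (fun z : (ℝ × ℝ) × ℝ => 1 + z.1.2 * z.2) :=
      contDiff_const.add (hh.mul contDiff_snd)
    exact ⟨contDiff_const.sub (contDiff_snd.pow 2), contDiff_const, contDiff_snd.pow 2,
      (contDiff_snd.pow 2).mul w, (hh.pow 2).mul w', (hh.pow 2).mul w',
      hl.smooth.comp (contDiff_snd.prodMk (contDiff_const.sub (hh.pow 2))), ha,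
      (hΛ.comp (contDiff_snd.prodMk hh)).mul ha, hRs.comp contDiff_fst, w', contDiff_snd,
      (hP.comp contDiff_fst).mul (hRs.comp contDiff_fst)⟩
  · exact ((hP.continuous.mul hRs.continuous).neg.continuousOn).div (continuousOn_edgeCoupling
      (continuous_const.add (continuous_snd.mul (hZp.continuous.comp continuous_snd))).continuousOn
      hRs.continuous.continuousOn) (fun p hp => (hcplE p hp).ne)
  · intro w hw
    simp only [hP0, hR]
    simp
  · change 1 - p.2 ^ 2 = _; ring
  · intro p hp hph t
    have e1 : 0 < p.2 := hp.2
    refine ⟨by change p.2 ^ 2 ≠ 0; positivity, hpne p hp, ?_⟩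
    change 1 * R p ≠ 0
    rw [one_mul]
    exact (hRpos p ⟨hp.1.1.le, hp.1.2.le⟩ ⟨e1.le, hph.le⟩).1.ne'
  · rintro ⟨⟨w, h⟩, t⟩ hz hh ht
    set e := h ^ 2 * (w * (1 - w) * t) with he
    have hh0 : 0 < h := hz.2
    set S : ℝ × ℝ → ℝ := fun c => Real.sqrt (1 - c.1) with hS
    -- Inverse of `r = 1 + h (Zm + w (Zp - Zm))` with `h = √(1 - μ)`.
    set W : ℝ × ℝ → ℝ := fun c => ((c.2 - 1) * (S c)⁻¹ - Zm (S c)) * (Zp (S c) - Zm (S c))⁻¹ with hW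
    set pinv : ℝ × ℝ → (ℝ × ℝ) × ℝ := fun c => ((W c, S c),
      e * (S c ^ 2 * (W c * (1 - W c)))⁻¹) with hpinv
    have hleft : ∀ p ∈ strip, ∀ t, (pinv (zn.mu p, zn.sc p * zn.xm (p, t))).1 = p := by
      intro p hp t
      have e1 : 0 < p.2 := hp.2
      have e2 := hdZ p.2
      have e3 : S (zn.mu p, zn.sc p * zn.xm (p, t)) = p.2 := by
        change Real.sqrt (1 - (1 - p.2 ^ 2)) = p.2
        rw [sub_sub_cancel, Real.sqrt_sq e1.le]
      refine Prod.ext ?_ e3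
      simp only [hpinv, hW]
      rw [e3]
      change ((1 * (1 + p.2 * (Zm p.2 + p.1 * (Zp p.2 - Zm p.2))) - 1) * p.2⁻¹ - Zm p.2)
        * (Zp p.2 - Zm p.2)⁻¹ = p.1
      rw [mul_inv_eq_iff_eq_mul₀ e2.ne']
      field_simp
      ring
    have hself : pinv (zn.mu (w, h), zn.sc (w, h) * zn.xm ((w, h), t)) = ((w, h), t) := by
      refine Prod.ext (hleft (w, h) hz t) ?_
      have h1 := hleft (w, h) hz t
      have h2 : W (zn.mu (w, h), zn.sc (w, h) * zn.xm ((w, h), t)) = w := congrArg Prod.fst h1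
      have h3 : S (zn.mu (w, h), zn.sc (w, h) * zn.xm ((w, h), t)) = h := congrArg Prod.snd h1
      simp only [hpinv]
      rw [h2, h3]
      have := hpne (w, h) hz
      simp only at this
      rw [he, ← mul_assoc, mul_comm (h ^ 2 * (w * (1 - w))) t, mul_assoc, mul_inv_cancel₀ this, mul_one]
    have hdiff : DifferentiableAt ℝ pinv (zn.mu (w, h), zn.sc (w, h) * zn.xm ((w, h), t)) := by
      set c₀ : ℝ × ℝ := (zn.mu (w, h), zn.sc (w, h) * zn.xm ((w, h), t)) with hc₀
      have d1 : DifferentiableAt ℝ S c₀ :=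
        (differentiableAt_fst.const_sub 1).sqrt (by
          change 1 - (1 - h ^ 2) ≠ 0
          rw [sub_sub_cancel]; positivity)
      have s1 : S c₀ = h := congrArg (fun z => z.1.2) hself
      have s2 : W c₀ = w := congrArg (fun z => z.1.1) hself
      have d2 : DifferentiableAt ℝ (fun c : ℝ × ℝ => Zp (S c)) c₀ :=
        DifferentiableAt.comp (g := Zp) c₀ (hZp.differentiable (by simp)).differentiableAt d1
      have d2' : DifferentiableAt ℝ (fun c : ℝ × ℝ => Zm (S c)) c₀ :=
        DifferentiableAt.comp (g := Zm) c₀ (hZm.differentiable (by simp)).differentiableAt d1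
      have d3 : DifferentiableAt ℝ W c₀ :=
        (((differentiableAt_snd.sub_const 1).fun_mul (d1.fun_inv (by
          rw [s1]; exact hh0.ne'))).fun_sub d2').fun_mul ((d2.fun_sub d2').fun_inv (hdZ _).ne')
      refine (d3.prodMk d1).prodMk (DifferentiableAt.fun_mul (differentiableAt_const e)
        (((d1.fun_pow 2).fun_mul (d3.fun_mul (d3.const_sub 1))).fun_inv ?_))
      rw [s1, s2]; exact hpne (w, h) hz
    refine ⟨pinv, hself, hdiff, ?_, fun p hp _ t => hleft p hp t⟩
    have hev1 : ∀ᶠ c in 𝓝 ((zn.mu (w, h), zn.sc (w, h) * zn.xm ((w, h), t)) : ℝ × ℝ),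
        (pinv c).1 ∈ strip ∩ {p | p.2 < h₀} := by
      refine hdiff.continuousAt.fst.eventually ((isOpen_strip.inter
        (isOpen_lt continuous_snd continuous_const)).mem_nhds ?_)
      simp only [hself]; exact ⟨hz, hh⟩
    filter_upwards [hev1] with c hc
    have hs : 0 < S c := hc.1.2
    have hc1 : 0 < 1 - c.1 := Real.sqrt_pos.1 hs
    have hsq : S c ^ 2 = 1 - c.1 := Real.sq_sqrt hc1.le
    refine ⟨?_, ?_, ?_, hvalid _ hc.1 hc.2 _⟩
    · change 1 - S c ^ 2 = c.1
      rw [hsq]; ring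
    · change 1 * (1 + S c * (Zm (S c) + W c * (Zp (S c) - Zm (S c)))) = c.2
      have h1 : W c * (Zp (S c) - Zm (S c)) = (c.2 - 1) * (S c)⁻¹ - Zm (S c) := by
        simp only [hW]
        rw [mul_assoc, inv_mul_cancel₀ (hdZ _).ne', mul_one]
      rw [h1]
      field_simp
      ring
    · change S c ^ 2 * (W c * (1 - W c) * (e * (S c ^ 2 * (W c * (1 - W c)))⁻¹)) = e
      have := hpne _ hc.1
      change S c ^ 2 * (W c * (1 - W c)) ≠ 0 at this
      calc _ = e * ((S c ^ 2 * (W c * (1 - W c))) * (S c ^ 2 * (W c * (1 - W c)))⁻¹) := by ring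
        _ = e := by rw [mul_inv_cancel₀ this, mul_one]
  · refine ⟨fun c => (c.2 - 1) * c.1.2⁻¹, fun p hp t => ?_, fun c hc => ?_, fun c hc => ?_⟩
    · have e1 : 0 < p.2 := hp.2
      change (1 + p.2 * t - 1) * p.2⁻¹ = t
      field_simp; ring
    · have e1 : 0 < c.1.2 := hc.2
      exact (differentiableAt_snd.sub_const 1).fun_mul
        ((differentiableAt_snd.comp c differentiableAt_fst).fun_inv e1.ne')
    · have e1 : 0 < c.1.2 := hc.2
      change 1 + c.1.2 * ((c.2 - 1) * c.1.2⁻¹) = c.2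
      field_simp; ring
  · have hsub : ∀ σ ∈ Icc (-h₀ ^ 2) (h₀ ^ 2), σ ∈ Icc (-1 : ℝ) 1 := by
      intro σ hσ
      have := (hh2 h₀ ⟨hh₀p.le, le_rfl⟩).2
      exact ⟨by linarith [hσ.1], by linarith [hσ.2]⟩
    have hsb : ∀ {x : ℝ}, x ∈ Icc (0 : ℝ) 1 → 1 - x ∈ Icc (0 : ℝ) 1 := fun {x} hx =>
      ⟨by linarith [hx.2], by linarith [hx.1]⟩
    have c1 : Continuous fun σ : ℝ => 1 - |σ| := continuous_const.sub continuous_abs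
    have c2 : Continuous fun σ : ℝ => 1 - max (-σ) 0 := by fun_prop
    have c3 : Continuous fun σ : ℝ => 1 - max σ 0 := by fun_prop
    exact continuousOn_pattern hom0 m
      (hl.rp_continuous.comp c1.continuousOn (fun σ hσ => hsb ⟨abs_nonneg σ,
        abs_le.2 (hsub σ hσ)⟩))
      (((hl.rm_continuous.comp c2.continuousOn (fun σ hσ => hsb (max_mem_Icc
        ⟨by linarith [(hsub σ hσ).2], by linarith [(hsub σ hσ).1]⟩))).add
      (hl.rp_continuous.comp c3.continuousOn (fun σ hσ => hsb (max_mem_Icc (hsub σ hσ))))).sub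
        continuousOn_const) c1.continuousOn
  · intro w hw
    change pattern N om0 m (1 + 0 * Zp 0) (1 * (1 + 0 * _)) (1 - (0 : ℝ) ^ 2) = _
    simp [saddleNodeLimit, hl.fold_root.1, hl.fold_root.2.1]
  · intro h hh
    change pattern N om0 m (1 + h * Zp h) (1 * (1 + h * (Zm h + 0 * (Zp h - Zm h)))) (1 - h ^ 2) = _
    have h1 : |-h ^ 2| = h ^ 2 := by rw [abs_neg, abs_of_nonneg (by positivity)]
    have h2 : max (-h ^ 2) 0 = 0 := max_eq_right (by simp; positivity)
    have h3 : max (- -h ^ 2) 0 = h ^ 2 := by rw [neg_neg]; exact max_eq_left (by positivity)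
    obtain ⟨h4, h5⟩ := hroots h ⟨hh.1, by linarith [hh.2]⟩
    rw [saddleNodeLimit, h1, h2, h3, sub_zero, hl.fold_root.2.1, h4, h5]
    congr 1; ring
  · intro h hh
    change pattern N om0 m (1 + h * Zp h) (1 * (1 + h * (Zm h + 1 * (Zp h - Zm h)))) (1 - h ^ 2) = _
    have h1 : |h ^ 2| = h ^ 2 := abs_of_nonneg (by positivity)
    have h2 : max (h ^ 2) 0 = h ^ 2 := max_eq_left (by positivity)
    have h3 : max (-h ^ 2) 0 = 0 := max_eq_right (by simp; positivity)
    obtain ⟨h4, h5⟩ := hroots h ⟨hh.1, by linarith [hh.2]⟩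
    rw [saddleNodeLimit, h1, h2, h3, sub_zero, hl.fold_root.1, h5]
    congr 1; ring

/-! ### The trivial scaling and limits of the scaled variables -/

section

/-- The trivial scaling, away from the bifurcations of `lam`. -/
def regularZone (m : ℕ) (lam : ℝ → ℝ → ℝ) : Zone where
  m := m
  mu p := p.1
  sc _ := 1
  fin _ := 1
  fm _ := 1
  eps z := z.1.2
  tau z := z.1.2
  L z := lam z.2 z.1.1
  ain z := z.2
  Din z := lam z.2 z.1.1 * z.2
  xm z := z.2
  kin z := z.1.2
  km z := z.1.2
  Dm z := lam z.2 z.1.1 * z.2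

theorem regularZone_smooth {lam : ℝ → ℝ → ℝ} (hlam : ContDiff ℝ ∞ (fun q : ℝ × ℝ => lam q.1 q.2))
    (m : ℕ) : (regularZone m lam).Smooth := by
  have h1 : ContDiff ℝ ∞ (fun z : (ℝ × ℝ) × ℝ => z.1.2) := contDiff_snd.comp contDiff_fst
  have h2 : ContDiff ℝ ∞ (fun z : (ℝ × ℝ) × ℝ => lam z.2 z.1.1) :=
    hlam.comp (contDiff_snd.prodMk (contDiff_fst.comp contDiff_fst))
  exact ⟨contDiff_fst, contDiff_const, contDiff_const, contDiff_const, h1, h1, h2, contDiff_snd,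
    h2.mul contDiff_snd, contDiff_snd, h1, h1, h2.mul contDiff_snd⟩

theorem regularZone_valid (m : ℕ) (lam : ℝ → ℝ → ℝ) (p : ℝ × ℝ) (g : ℝ) :
    (regularZone m lam).Valid lam p g := by
  constructor <;> simp [regularZone]

/-- The scaled variables of a point with respect to the trivial scaling. -/
def regularCoords {N : ℕ} (m : ℕ) (b : Site) (e : ℝ) (q : P N) : Z N :=
  ((q.2, e), fun i => if (i : ℕ) + 1 ≤ m then q.1.1 i
    else amp b q.1 (i + 1) / (e * amp b q.1 i), q.1.2.1)

variable {N : ℕ} {lam : ℝ → ℝ → ℝ} {om : ℝ → ℝ → ℝ → ℝ} {om0 : ℝ → ℝ}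
  {om2 : ℝ → ℝ → ℝ → ℝ} {b : Site} {m : ℕ} {e : ℝ} {q : P N}

theorem entry_regularCoords {j : ℕ} (hj : j < N) : entry (regularCoords m b e q).2.1 (j + 1)
    = if j + 1 ≤ m then amp b q.1 (j + 1) else amp b q.1 (j + 1) / (e * amp b q.1 j) := by
  rw [entry_succ _ hj]
  have := amp_succ b q.1 ⟨j, hj⟩
  simp only at this
  change (if j + 1 ≤ m then q.1.1 ⟨j, hj⟩ else amp b q.1 (j + 1) / (e * amp b q.1 j)) = _
  rw [← this]

theorem radius_regularCoords (hm : 1 ≤ m) (hmN : m ≤ N) (he : e ≠ 0)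
    (hr : ∀ n, 1 ≤ n → n ≤ N → amp b q.1 n ≠ 0) {n : ℕ} (h1 : 1 ≤ n) (h2 : n ≤ N) :
    (regularZone m lam).radius (regularCoords m b e q) n = amp b q.1 n := by
  set z := regularCoords m b e q with hz
  rcases lt_or_ge n m with h | h
  · rw [Zone.radius, if_pos (by exact h)]
    obtain ⟨j, rfl⟩ : ∃ j, n = j + 1 := ⟨n - 1, by omega⟩
    change entry z.2.1 (j + 1) = _
    rw [entry_regularCoords (by omega), if_pos h.le]
  · induction n, h using Nat.le_induction with
    | base =>
      have := Zone.radius_m (zn := regularZone m lam) z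
      change (regularZone m lam).radius z m = 1 * entry z.2.1 m at this
      rw [this, one_mul]
      obtain ⟨j, rfl⟩ : ∃ j, m = j + 1 := ⟨m - 1, by omega⟩
      rw [entry_regularCoords (by omega), if_pos le_rfl]
    | succ n hn ih =>
      have ih := ih (by omega) (by omega)
      have h3 := (regularZone m lam).amp_pre_succ b z hm (n := n) hn (by omega)
      rw [Zone.amp_pre _ _ _ (by omega) (by omega), Zone.amp_pre _ _ _ (by omega) (by omega), ih,
        Zone.ratio, if_neg (by omega)] at h3
      rw [h3]
      change e * entry z.2.1 (n + 1) * _ = _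
      rw [entry_regularCoords (by omega), if_neg (by omega)]
      have := hr n (by omega) (by omega)
      field_simp

/-- The frequency of a solution is determined by its amplitudes. -/
theorem freq_eq (hM : Model N lam om om0 om2) (hr : amp b q.1 1 ≠ 0)
    (hq : q ∈ solutions lam om b e) :
    om0 q.2 + e ^ 2 * meanFreq om2 b q.1 q.2 e - q.1.2.2 = 0 := by
  have hN := hM.two_le
  rw [mem_solutions_iff] at hq
  have hr0 : q.1.1 ⟨0, by omega⟩ ≠ 0 := by
    rw [← amp_succ b]; exact hr
  have hmass := (mass_pos (b := b) (x := q.1) _ hr0).ne'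
  have h1 := sum_weight_imagPart hN hM.om_eq b e q.1 q.2 hmass
  rw [Finset.sum_eq_zero fun j hj => by
    rw [(hq j (Finset.mem_range.1 hj)).2]; ring] at h1
  exact (mul_eq_zero.1 h1.symm).resolve_right hmass

theorem tendsto_meanFreq (hom2 : ContDiff ℝ ∞ (fun q : ℝ × ℝ × ℝ => om2 q.1 q.2.1 q.2.2))
    {x₀ : X N} (hmass : mass b x₀ ≠ 0) {ι : Type*} {l : Filter ι} {x : ι → X N} {μ e : ι → ℝ}
    {μ₀ e₀ : ℝ} (hx : Tendsto (fun k => (x k).1) l (𝓝 x₀.1)) (hμ : Tendsto μ l (𝓝 μ₀))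
    (he : Tendsto e l (𝓝 e₀)) :
    Tendsto (fun k => meanFreq om2 b (x k) (μ k) (e k)) l (𝓝 (meanFreq om2 b x₀ μ₀ e₀)) := by
  unfold meanFreq mass at *
  have hx' := tendsto_pi_nhds.1 hx
  refine Tendsto.div (tendsto_finsetSum _ fun i _ => ?_) (tendsto_finsetSum _ fun i _ => ?_) hmass
  · have h1 : Tendsto (fun k => om2 ((x k).1 i) (μ k) (e k)) l (𝓝 (om2 (x₀.1 i) μ₀ e₀)) :=
      (hom2.continuous.tendsto (x₀.1 i, μ₀, e₀)).comp ((hx' i).prodMk_nhds (hμ.prodMk_nhds he))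
    exact (h1.mul ((hx' i).pow 2)).const_mul _
  · exact ((hx' i).pow 2).const_mul _

/-- The original rows are nonzero multiples of the scaled ones as soon as `e` and all amplitudes are
nonzero; the frequency is the one computed by `pt` because of `freq_eq`. -/
theorem lift_regularCoords (hM : Model N lam om om0 om2) (hm : 1 ≤ m) (hmN : m ≤ N) (he : e ≠ 0)
    (hr : ∀ n, 1 ≤ n → n ≤ N → amp b q.1 n ≠ 0) (hq : q ∈ solutions lam om b e) :
    (regularZone m lam).pt om0 om2 b (regularCoords m b e q) = q ∧
      (regularZone m lam).sys om2 b (regularCoords m b e q) = 0 := by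
  set zn := regularZone m lam with hzn
  set z := regularCoords m b e q with hz
  have hN := hM.two_le
  have hpre : (zn.pre z).1 = q.1.1 := by
    funext i
    change zn.radius z (i + 1) = _
    rw [radius_regularCoords hm hmN he hr (by omega) (by omega), amp_succ]
  have hA : ∀ n, amp b (zn.pre z) n = amp b q.1 n := amp_congr hpre
  have hP : ∀ n, phase b (zn.pre z) n = phase b q.1 n := phase_congr rfl
  have hρ := freq_eq hM (hr 1 le_rfl (by omega)) hq
  rw [mem_solutions_iff] at hq
  have hmf : meanFreq om2 b (zn.pre z) q.2 e = meanFreq om2 b q.1 q.2 e := by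
    unfold meanFreq mass; rw [hpre]
  refine ⟨Prod.ext (Prod.ext hpre (Prod.ext rfl ?_)) rfl, ?_⟩
  · change om0 q.2 + e ^ 2 * meanFreq om2 b (zn.pre z) q.2 e = q.1.2.2
    rw [hmf]; linarith
  · refine Prod.ext (funext fun i => ?_) (funext fun i => ?_)
    · have h1 := Zone.realPart_pre (b := b) (z := z) hm (regularZone_valid m lam _ _) i.2
      change realPart lam b e (zn.pre z) q.2 i = _ at h1
      have h2 : realPart lam b e (zn.pre z) q.2 i = 0 := by
        rw [← (hq i i.2).1]
        unfold realPart coupling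
        simp only [hA, hP]
      rw [h2] at h1
      refine (mul_eq_zero.1 h1.symm).resolve_left ?_
      split_ifs with h3 h4
      · exact one_ne_zero
      · exact one_ne_zero
      · rw [hA]
        refine mul_ne_zero he (hr _ ?_ (by omega))
        change ¬ ((i : ℕ) + 1 < m) at h3
        change ¬ ((i : ℕ) + 1 = m) at h4
        omega
    · have hi : (i : ℕ) + 1 < N := by omega
      have h1 := Zone.imagPart_pre (b := b) (z := z) (zn := zn) (om0 := om0) hM.om_eq hm hpre.symm
        rfl hi
      change imagPart om b e q.1 q.2 (i + 1) = -(e * _) * _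
        + (om0 q.2 + e ^ 2 * meanFreq om2 b (zn.pre z) q.2 e - q.1.2.2) * _ at h1
      rw [hmf, hρ, zero_mul, add_zero, (hq _ hi).2] at h1
      refine (mul_eq_zero.1 h1.symm).resolve_left (neg_ne_zero.2 (mul_ne_zero he ?_))
      split_ifs with h3
      · exact one_ne_zero
      · rw [hA]; exact hr _ (by omega) (by omega)

theorem cos_pos_of_abs_le_one {x : ℝ} (h : |x| ≤ 1) : 0 < Real.cos x := by
  have := Real.pi_gt_three
  have h1 := abs_le.1 h
  exact Real.cos_pos_of_mem_Ioo ⟨by linarith, by linarith⟩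

theorem abs_phase_le {x : X N} (h : ∀ i, |x.2.1 i| ≤ 1) {n : ℕ} (hn : 1 ≤ n) :
    |phase b x n| ≤ 1 := by
  unfold phase entry
  rw [if_neg (by omega)]
  split_ifs
  · simp
  · exact h _
  · simp

-- Closeness of the amplitudes and bounded phases are enough; no decay behind `m` is assumed.
-- Starting from `r_{N+1} = r_N` and going down, the real equation gives `r_{n+1} = -(ε cos φ_n / D)
-- r_n` with `D → lam 0 μ₀ < 0`, so the quotients by `ε` converge once the phases do. The imaginary
-- equations, also read downwards from `φ_N = 0`, force the phases to zero.
set_option maxHeartbeats 1000000 in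
theorem tendsto_regularCoords (hM : Model N lam om om0 om2) (hm : 1 ≤ m) (hmN : m ≤ N)
    {μ₀ a r : ℝ} (hμ₀ : lam 0 μ₀ < 0) (ha : 0 < a) (hr : 0 < r) {ι : Type*} {l : Filter ι}
    {q : ι → P N} {e : ι → ℝ} (he : Tendsto e l (𝓝 0)) (hpos : ∀ k, 0 < e k)
    (hsol : ∀ k, q k ∈ solutions lam om b (e k)) (hμ : Tendsto (fun k => (q k).2) l (𝓝 μ₀))
    (hq : Tendsto (fun k => (q k).1.1) l (𝓝 (pattern N om0 m a r μ₀).1.1))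
    (hφ : ∀ k i, |(q k).1.2.1 i| ≤ 1) :
    (∀ᶠ k in l, ∀ n, 1 ≤ n → n ≤ N → amp b (q k).1 n ≠ 0) ∧
    Tendsto (fun k => regularCoords m b (e k) (q k)) l
      (𝓝 ((μ₀, 0), (regularZone m lam).baseVec N (μ₀, 0) a r, 0)) := by
  have hN := hM.two_le
  set A : ℕ → ι → ℝ := fun n k => amp b (q k).1 n with hAdef
  set F : ℕ → ι → ℝ := fun n k => phase b (q k).1 n with hFdef
  have hA : ∀ j, j < N → Tendsto (A (j + 1)) l
      (𝓝 (if j + 1 < m then a else if j + 1 = m then r else 0)) := by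
    intro j hj
    have h1 := (tendsto_pi_nhds.1 hq) ⟨j, hj⟩
    refine h1.congr fun k => ?_
    exact (amp_succ b (q k).1 ⟨j, hj⟩).symm
  have hA0 : ∀ n, m < n → n ≤ N → Tendsto (A n) l (𝓝 0) := by
    intro n h1 h2
    obtain ⟨j, rfl⟩ : ∃ j, n = j + 1 := ⟨n - 1, by omega⟩
    have := hA j (by omega)
    rwa [if_neg (by omega), if_neg (by omega)] at this
  have hApos : ∀ n, 1 ≤ n → n ≤ m → ∃ c, 0 < c ∧ Tendsto (A n) l (𝓝 c) := by
    intro n h1 h2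
    obtain ⟨j, rfl⟩ : ∃ j, n = j + 1 := ⟨n - 1, by omega⟩
    refine ⟨_, ?_, hA j (by omega)⟩
    split_ifs
    · exact ha
    · exact hr
    · omega
  have hcosb : ∀ n k, |Real.cos (F n k)| ≤ 1 := fun n k => Real.abs_cos_le_one _
  have hcosp : ∀ n k, 1 ≤ n → 0 < Real.cos (F n k) := fun n k hn =>
    cos_pos_of_abs_le_one (abs_phase_le (hφ k) hn)
  have hre : ∀ n k, n + 1 ≤ N → lam (A (n + 1) k) (q k).2 * A (n + 1) k
      + e k * (A (n + 2) k * Real.cos (F (n + 1) k) - 2 * A (n + 1) k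
        + A n k * Real.cos (F n k)) = 0 := fun n k hn =>
    (((mem_solutions_iff _ _ _ _ _).1 (hsol k)) n (by omega)).1
  -- the amplitudes behind the node `m` decay geometrically
  have step : ∀ n, m ≤ n → n + 1 ≤ N →
      (∃ c : ι → ℝ, (∀ᶠ k in l, |c k| ≤ 1) ∧ ∀ᶠ k in l, A (n + 2) k = c k * A (n + 1) k) →
      ∃ D : ι → ℝ, Tendsto D l (𝓝 (lam 0 μ₀)) ∧
        ∀ᶠ k in l, A (n + 1) k = -(e k * Real.cos (F n k) / D k) * A n k := by
    rintro n h1 h2 ⟨c, hc1, hc2⟩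
    have h3 : Tendsto (fun k => lam (A (n + 1) k) (q k).2) l (𝓝 (lam 0 μ₀)) :=
      (hM.lam_smooth.continuous.tendsto (0, μ₀)).comp
        ((hA0 (n + 1) (by omega) h2).prodMk_nhds hμ)
    have h4 : Tendsto (fun k => (c k * Real.cos (F (n + 1) k) - 2) * e k) l (𝓝 0) := by
      refine bdd_le_mul_tendsto_zero' 3 ?_ he
      filter_upwards [hc1] with k hk
      have h5 : |c k * Real.cos (F (n + 1) k)| ≤ 1 := by
        rw [abs_mul]
        exact mul_le_one₀ hk (abs_nonneg _) (hcosb _ _)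
      rw [abs_le] at h5 ⊢
      exact ⟨by linarith [h5.1], by linarith [h5.2]⟩
    have h5 := h3.add h4
    rw [add_zero] at h5
    refine ⟨fun k => lam (A (n + 1) k) (q k).2
      + (c k * Real.cos (F (n + 1) k) - 2) * e k, h5, ?_⟩
    filter_upwards [h5.eventually_ne hμ₀.ne, hc2] with k hk hk2
    have h6 := hre n k h2
    rw [hk2] at h6
    rw [neg_mul, div_mul_eq_mul_div, ← neg_div, eq_div_iff hk]
    linear_combination h6
  have hDc : ∀ n, (∃ D : ι → ℝ, Tendsto D l (𝓝 (lam 0 μ₀)) ∧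
        ∀ᶠ k in l, A (n + 1) k = -(e k * Real.cos (F n k) / D k) * A n k) →
      ∃ c : ι → ℝ, (∀ᶠ k in l, |c k| ≤ 1) ∧ ∀ᶠ k in l, A (n + 1) k = c k * A n k := by
    rintro n ⟨D, hD, hD'⟩
    refine ⟨_, ?_, hD'⟩
    have h1 : Tendsto (fun k => Real.cos (F n k) * e k) l (𝓝 0) :=
      bdd_le_mul_tendsto_zero' 1 (Eventually.of_forall fun k => hcosb n k) he
    have h2 := ((h1.div hD hμ₀.ne).neg).abs
    simp only [zero_div, neg_zero, abs_zero] at h2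
    filter_upwards [h2.eventually (gt_mem_nhds one_pos)] with k hk
    rw [mul_comm (e k)]
    exact le_of_lt hk
  have hlast : ∃ c : ι → ℝ, (∀ᶠ k in l, |c k| ≤ 1) ∧ ∀ᶠ k in l, A (N + 1) k = c k * A N k :=
    ⟨fun _ => 1, by simp, Eventually.of_forall fun k => by
      rw [one_mul]; exact amp_last b _⟩
  have hQ : ∀ d n, n + d = N → m ≤ n →
      ∃ c : ι → ℝ, (∀ᶠ k in l, |c k| ≤ 1) ∧ ∀ᶠ k in l, A (n + 1) k = c k * A n k := by
    intro d
    induction d with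
    | zero => intro n hn _; rw [add_zero] at hn; subst hn; exact hlast
    | succ d ih =>
      intro n hn hmn
      exact hDc n (step n hmn (by omega) (ih (n + 1) (by omega) (by omega)))
  have hD : ∀ n, m ≤ n → n + 1 ≤ N → ∃ D : ι → ℝ, Tendsto D l (𝓝 (lam 0 μ₀)) ∧
        ∀ᶠ k in l, A (n + 1) k = -(e k * Real.cos (F n k) / D k) * A n k := fun n h1 h2 =>
    step n h1 h2 (hQ (N - (n + 1)) (n + 1) (by omega) (by omega))
  -- Going up from `m`, each amplitude is a nonzero multiple of the preceding one, because the
  -- cosines are positive for phases of modulus at most `1`.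
  have hne : ∀ n, 1 ≤ n → n ≤ N → ∀ᶠ k in l, A n k ≠ 0 := by
    intro n h1 h2
    rcases le_or_gt n m with h | h
    · obtain ⟨c, hc, hc'⟩ := hApos n h1 h
      exact hc'.eventually_ne hc.ne'
    · induction n, h using Nat.le_induction with
      | base =>
        obtain ⟨c, hc, hc'⟩ := hApos m hm le_rfl
        obtain ⟨D, h3, h4⟩ := hD m le_rfl h2
        filter_upwards [hc'.eventually_ne hc.ne', h4, h3.eventually_ne hμ₀.ne] with k k1 k2 k3
        rw [Nat.succ_eq_add_one, k2]
        exact mul_ne_zero (neg_ne_zero.2 (div_ne_zero (mul_ne_zero (hpos k).ne'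
          (hcosp m k hm).ne') k3)) k1
      | succ n hn ih =>
        obtain ⟨D, h3, h4⟩ := hD n (by omega) h2
        filter_upwards [ih (by omega) (by omega), h4, h3.eventually_ne hμ₀.ne] with k k1 k2 k3
        rw [k2]
        exact mul_ne_zero (neg_ne_zero.2 (div_ne_zero (mul_ne_zero (hpos k).ne'
          (hcosp n k (by omega)).ne') k3)) k1
  have hneall : ∀ᶠ k in l, ∀ n, 1 ≤ n → n ≤ N → A n k ≠ 0 := by
    have := (Filter.eventually_all_finset (Finset.Icc 1 N)).2 (fun n hn =>
      hne n (Finset.mem_Icc.1 hn).1 (Finset.mem_Icc.1 hn).2)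
    filter_upwards [this] with k hk n h1 h2 using hk n (Finset.mem_Icc.2 ⟨h1, h2⟩)
  refine ⟨hneall, ?_⟩
  have hB : ∀ n, 1 ≤ n → n ≤ N → ∃ C, ∀ᶠ k in l, |A (n + 1) k / A n k| ≤ C := by
    intro n h1 h2
    rcases lt_or_ge n m with h | h
    · obtain ⟨c, hc, hc'⟩ := hApos n h1 h.le
      obtain ⟨c₁, -, hc₁⟩ := hApos (n + 1) (by omega) h
      have h3 := (hc₁.div hc' hc.ne').abs
      refine ⟨|c₁ / c| + 1, ?_⟩
      filter_upwards [h3.eventually (gt_mem_nhds (lt_add_one _))] with k hk using le_of_lt hk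
    · obtain ⟨c, hc, hc'⟩ := hQ (N - n) n (by omega) h
      refine ⟨1, ?_⟩
      filter_upwards [hc, hc', hne n h1 h2] with k k1 k2 k3
      rwa [k2, mul_div_cancel_right₀ _ k3]
  -- the frequency mismatch stays bounded
  have hΩ : Tendsto (fun k => meanFreq om2 b (q k).1 (q k).2 (e k)) l
      (𝓝 (meanFreq om2 b (pattern N om0 m a r μ₀).1 μ₀ 0)) := by
    have hmass : mass b (pattern N om0 m a r μ₀).1 ≠ 0 := by
      refine (mass_pos ⟨m - 1, by omega⟩ ?_).ne'
      change (if m - 1 + 1 < m then a else if m - 1 + 1 = m then r else 0) ≠ 0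
      rw [if_neg (by omega), if_pos (by omega)]
      exact hr.ne'
    exact tendsto_meanFreq hM.om2_smooth hmass hq hμ he
  have hρ : ∀ᶠ k in l, om0 (q k).2 + e k ^ 2 * meanFreq om2 b (q k).1 (q k).2 (e k)
      - (q k).1.2.2 = 0 := by
    filter_upwards [hneall] with k hk
    exact freq_eq hM (hk 1 le_rfl (by omega)) (hsol k)
  -- Solving the imaginary equation at the node `n + 1` for `sin φ_n` expresses it by bounded
  -- amplitude quotients times `ε` times the mismatch and times `sin φ_{n+1}`.
  have hsin : ∀ d n, n + d = N → 1 ≤ n → Tendsto (fun k => Real.sin (F n k)) l (𝓝 0) := by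
    intro d
    induction d with
    | zero =>
      intro n hn _
      rw [add_zero] at hn
      subst hn
      refine tendsto_const_nhds.congr fun k => ?_
      simp only [hFdef]
      rw [phase_last (by omega), Real.sin_zero]
    | succ d ih =>
      intro n hn h1
      have h2 := ih (n + 1) (by omega) (by omega)
      obtain ⟨C, hC⟩ := hB n h1 (by omega)
      obtain ⟨C', hC'⟩ := hB (n + 1) (by omega) (by omega)
      have h3 := bdd_le_mul_tendsto_zero' C' hC' h2
      have hAc : ∃ c, Tendsto (A (n + 1)) l (𝓝 c) := ⟨_, hA n (by omega)⟩
      obtain ⟨c, hc⟩ := hAc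
      have h4 : Tendsto (fun k => om2 (A (n + 1) k) (q k).2 (e k)) l (𝓝 (om2 c μ₀ 0)) :=
        (hM.om2_smooth.continuous.tendsto (c, μ₀, 0)).comp
          (hc.prodMk_nhds (hμ.prodMk_nhds he))
      have h5 := he.mul (h4.sub hΩ)
      rw [zero_mul] at h5
      have h6 := bdd_le_mul_tendsto_zero' C hC (by simpa using h5.add h3)
      refine h6.congr' ?_
      filter_upwards [hneall, hρ] with k k1 k2
      have k3 := ((mem_solutions_iff _ _ _ _ _).1 (hsol k) n (by omega)).2
      unfold imagPart flux at k3
      rw [hM.om_eq] at k3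
      have k4 := k1 n h1 (by omega)
      have k5 := k1 (n + 1) (by omega) (by omega)
      have k6 := (hpos k).ne'
      simp only [hAdef, hFdef] at k4 k5 ⊢
      have k7 : (q k).1.2.2 = om0 (q k).2
        + e k ^ 2 * meanFreq om2 b (q k).1 (q k).2 (e k) := by linarith
      rw [k7] at k3
      field_simp
      apply mul_left_cancel₀ k6
      linear_combination k3
  have hF0 : ∀ n, 1 ≤ n → n ≤ N → Tendsto (F n) l (𝓝 0) := by
    intro n h1 h2
    -- The bound `|φ| ≤ 1 < π / 2` selects the branch on which `arcsin` inverts the sine.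
    have h3 := (Real.continuous_arcsin.tendsto 0).comp (hsin (N - n) n (by omega) h1)
    rw [Real.arcsin_zero] at h3
    refine h3.congr fun k => ?_
    have h4 := abs_le.1 (abs_phase_le (b := b) (hφ k) h1)
    have := Real.pi_gt_three
    exact Real.arcsin_sin (by linarith [h4.1]) (by linarith [h4.2])
  refine (hμ.prodMk_nhds he).prodMk_nhds (Tendsto.prodMk_nhds ?_ ?_)
  · refine tendsto_pi_nhds.2 fun i => ?_
    have hAi := hA i i.2
    change Tendsto _ l (𝓝 (if (i : ℕ) + 1 < m then a else if (i : ℕ) + 1 = m then r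
      else -1 / lam 0 μ₀))
    rcases lt_or_ge m ((i : ℕ) + 1) with h | h
    · rw [if_neg (by omega), if_neg (by omega)]
      obtain ⟨D, h3, h4⟩ := hD i (by omega) (by omega)
      have h5 := ((Real.continuous_cos.tendsto 0).comp (hF0 i (by omega) (by omega))).neg.div h3
        hμ₀.ne
      rw [Real.cos_zero] at h5
      refine h5.congr' ?_
      filter_upwards [h4, h3.eventually_ne hμ₀.ne, hneall] with k k1 k2 k3
      have k4 := k3 i (by omega) (by omega)
      have k5 := (hpos k).ne'
      change -Real.cos (F i k) / D k = if (i : ℕ) + 1 ≤ m then _ else A (i + 1) k / (e k * A i k)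
      rw [if_neg (by omega), k1]
      field_simp
    · have h6 : (if (i : ℕ) + 1 < m then a else if (i : ℕ) + 1 = m then r else -1 / lam 0 μ₀)
          = if (i : ℕ) + 1 < m then a else if (i : ℕ) + 1 = m then r else 0 := by
        split_ifs <;> first | rfl | omega
      rw [h6]
      refine hAi.congr fun k => ?_
      change A (i + 1) k = if (i : ℕ) + 1 ≤ m then (q k).1.1 i else _
      rw [if_pos h]
      exact amp_succ b _ i
  · refine tendsto_pi_nhds.2 fun i => ?_
    refine (hF0 (i + 1) (by omega) (by omega)).congr fun k => ?_
    exact phase_succ b _ i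

end

/-! ### Solutions away from the bifurcations -/

section

/-- A simple positive root of `lam · μ`, depending continuously on `μ ∈ (0, 1)`. -/
structure RegularRoot (lam : ℝ → ℝ → ℝ) (root : ℝ → ℝ) : Prop where
  continuousOn : ContinuousOn root (Ioo 0 1)
  pos : ∀ μ ∈ Ioo (0 : ℝ) 1, 0 < root μ
  lam_eq : ∀ μ ∈ Ioo (0 : ℝ) 1, lam (root μ) μ = 0
  simple : ∀ μ ∈ Ioo (0 : ℝ) 1, deriv (fun r => lam r μ) (root μ) ≠ 0

variable {N : ℕ} {lam : ℝ → ℝ → ℝ} {om : ℝ → ℝ → ℝ → ℝ} {om0 : ℝ → ℝ}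
  {om2 : ℝ → ℝ → ℝ → ℝ} {rm rp root : ℝ → ℝ} {b : Site} {m : ℕ}

theorem Bistable.regularRoot_rm (hl : Bistable lam rm rp) : RegularRoot lam rm where
  continuousOn := hl.rm_continuous.mono Ioo_subset_Icc_self
  pos μ hμ := (hl.ordered μ hμ).1
  lam_eq μ hμ := (hl.roots μ hμ _ (hl.ordered μ hμ).1).2 (Or.inl rfl)
  simple μ hμ := (hl.unstable_rm μ hμ).ne'

theorem Bistable.regularRoot_rp (hl : Bistable lam rm rp) : RegularRoot lam rp where
  continuousOn := hl.rp_continuous.mono Ioo_subset_Icc_self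
  pos μ hμ := (hl.ordered μ hμ).1.trans (hl.ordered μ hμ).2
  lam_eq μ hμ := (hl.roots μ hμ _ ((hl.ordered μ hμ).1.trans (hl.ordered μ hμ).2)).2 (Or.inr rfl)
  simple μ hμ := (hl.stable_rp μ (Ioo_subset_Ico_self hμ)).ne

theorem RegularRoot.hasDerivAt (hr : RegularRoot lam root)
    (hlam : ContDiff ℝ ∞ (fun q : ℝ × ℝ => lam q.1 q.2)) {μ : ℝ} (hμ : μ ∈ Ioo (0 : ℝ) 1) :
    HasDerivAt (fun r => lam r μ * r) (deriv (fun r => lam r μ) (root μ) * root μ) (root μ) := by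
  have h1 : HasDerivAt (fun r => lam r μ) (deriv (fun r => lam r μ) (root μ)) (root μ) :=
    ((hlam.comp (contDiff_id.prodMk contDiff_const)).differentiable (by simp)
      (root μ)).hasDerivAt
  refine (h1.fun_mul (hasDerivAt_id (root μ))).congr_deriv ?_
  rw [hr.lam_eq μ hμ]; simp

theorem regularZone_base (hl : Bistable lam rm rp) (hr : RegularRoot lam root) {μ : ℝ}
    (hμ : μ ∈ Ioo (0 : ℝ) 1) : (regularZone m lam).Base N b (μ, 0) (rp μ) (root μ) := by
  have hp := hl.regularRoot_rp
  refine ⟨fun _ => rfl, fun _ => rfl, hl.stable_zero μ (Ioo_subset_Ioc_self hμ),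
    Or.inl fun _ => rfl, ?_, ⟨_, ?_, hp.hasDerivAt hl.smooth hμ⟩, hp.pos μ hμ, fun _ => ?_, ?_,
    ⟨deriv (fun r => lam r μ) (root μ) * root μ, ?_, ?_⟩⟩
  · change lam (rp μ) μ * rp μ = 0
    rw [hp.lam_eq μ hμ, zero_mul]
  · exact mul_ne_zero (hp.simple μ hμ) (hp.pos μ hμ).ne'
  · change 0 < 1 * root μ
    rw [one_mul]; exact hr.pos μ hμ
  · change lam (root μ) μ * root μ + 0 * _ = 0
    rw [hr.lam_eq μ hμ]; ring
  · exact mul_ne_zero (hr.simple μ hμ) (hr.pos μ hμ).ne'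
  · refine (hr.hasDerivAt hl.smooth hμ).congr_of_eventuallyEq (Eventually.of_forall fun t => ?_)
    change lam t μ * t + 0 * _ = lam t μ * t
    ring

theorem regularZone_localInverse {z : Z N} (hm : 1 ≤ m) (hmN : m ≤ N)
    (hz : (regularZone m lam).Regular z) (hg : 0 < entry z.2.1 m) (he : z.1.2 ≠ 0) :
    Zone.LocalInverse lam (regularZone m lam) z (fun c => ((c.1, z.1.2), c.2)) (fun c => c.2) := by
  have hrm : (regularZone m lam).radius z m = entry z.2.1 m := by
    have := Zone.radius_m (zn := regularZone m lam) z
    change (regularZone m lam).radius z m = 1 * entry z.2.1 m at this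
    rw [this, one_mul]
  refine ⟨hm, hmN, he, one_ne_zero, one_ne_zero, ?_, ?_, ?_, ?_, ?_, ?_, ?_⟩
  · intro n h1 h2
    rw [Zone.radius]
    split_ifs with h
    · exact (hz.2.1 n h1 h).ne'
    · change (1 : ℝ) * (entry z.2.1 m * ∏ l ∈ Finset.Ioc m n, (z.1.2 * entry z.2.1 l)) ≠ 0
      refine mul_ne_zero one_ne_zero (mul_ne_zero hg.ne' (Finset.prod_ne_zero_iff.2 fun l hl => ?_))
      rw [Finset.mem_Ioc] at hl
      exact mul_ne_zero he (hz.2.2 l hl.1 (by omega)).ne'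
  · change ((z.1.1, z.1.2), (regularZone m lam).radius z m) = (z.1, entry z.2.1 m)
    rw [hrm]
  · exact (((contDiff_fst (𝕜 := ℝ) (n := 1)).prodMk contDiff_const).prodMk
      contDiff_snd).differentiable one_ne_zero _
  · refine Eventually.of_forall fun c => ⟨rfl, ?_, rfl, regularZone_valid m lam _ _⟩
    change (1 : ℝ) * c.2 = c.2
    ring
  · intro n h1 h2
    change (regularZone m lam).radius z n = _
    rw [Zone.radius, if_pos (by exact h2)]; rfl
  · exact fun n _ _ => differentiableAt_snd
  · exact fun n _ _ => Eventually.of_forall fun c => rfl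

/-- The solutions near the pattern with `m` excited nodes, for `μ` in a compact subinterval. -/
structure RegularPiece (lam : ℝ → ℝ → ℝ) (om : ℝ → ℝ → ℝ → ℝ) (om0 rp root : ℝ → ℝ)
    (b : Site) (m : ℕ) (η ε₀ κ : ℝ) (U : Set (ℝ × ℝ)) (Γ : ℝ × ℝ → P N) : Prop where
  isOpen : IsOpen U
  subset : Icc η (1 - η) ×ˢ Ico 0 ε₀ ⊆ U
  smooth : ContDiffOn ℝ ∞ Γ U
  mu : ∀ p, (Γ p).2 = p.1
  zero : ∀ μ ∈ Icc η (1 - η), Γ (μ, 0) = pattern N om0 m (rp μ) (root μ) μ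
  sol : ∀ p ∈ U, p.2 ≠ 0 → Γ p ∈ solutions lam om b p.2
  deriv_ne : ∀ p ∈ U, p.2 ≠ 0 → deriv (fun t => Γ (t, p.2)) p.1 ≠ 0
  kernel : ∀ p ∈ U, p.2 ≠ 0 → ∀ v : P N,
    fderiv ℝ (fun p' : P N => system lam om b p.2 p'.1 p'.2) (Γ p) v = 0 →
      ∃ a : ℝ, v = a • deriv (fun t => Γ (t, p.2)) p.1
  unique : ∀ e ∈ Ioo 0 ε₀, ∀ q ∈ solutions (N := N) lam om b e, q.2 ∈ Icc η (1 - η) →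
    dist q.1.1 (pattern N om0 m (rp q.2) (root q.2) q.2).1.1 < κ → (∀ i, |q.1.2.1 i| ≤ 1) →
    q = Γ (q.2, e)

theorem exists_Ico_subset {K : Set ℝ} (hK : IsCompact K) {U : Set (ℝ × ℝ)} (hU : IsOpen U)
    (h : K ×ˢ {(0 : ℝ)} ⊆ U) : ∃ ε₀ > 0, K ×ˢ Ico 0 ε₀ ⊆ U := by
  obtain ⟨u, v, hu, hv, hKu, h0v, huv⟩ := generalized_tube_lemma hK isCompact_singleton hU h
  obtain ⟨ε₀, hε₀, hb⟩ := Metric.isOpen_iff.1 hv 0 (h0v rfl)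
  refine ⟨ε₀, hε₀, fun p hp => huv ⟨hKu hp.1, hb ?_⟩⟩
  rw [Metric.mem_ball, Real.dist_eq, sub_zero, abs_of_nonneg hp.2.1]
  exact hp.2.2

/-- Existence is the implicit function theorem in the parameters `(μ, ε)` along `ε = 0`. For
uniqueness the scaled variables of any competing solution are shown, by compactness, to enter the
neighbourhood in which the implicit function is the only zero. -/
theorem exists_regularPiece (hM : Model N lam om om0 om2) (hl : Bistable lam rm rp)
    (hr : RegularRoot lam root) (hm : 1 ≤ m) (hmN : m ≤ N) {η : ℝ} (hη : 0 < η) (b : Site) :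
    ∃ ε₀ > 0, ∃ κ > 0, ∃ U Γ, RegularPiece (N := N) lam om om0 rp root b m η ε₀ κ U Γ := by
  set zn := regularZone m lam with hzn
  have hs : zn.Smooth := regularZone_smooth hM.lam_smooth m
  have hI : Icc η (1 - η) ⊆ Ioo 0 1 := fun μ hμ => ⟨hη.trans_le hμ.1, by linarith [hμ.2]⟩
  set K : Set (ℝ × ℝ) := Icc η (1 - η) ×ˢ {0} with hK
  have hKc : IsCompact K := isCompact_Icc.prod isCompact_singleton
  have hfst : MapsTo (Prod.fst : ℝ × ℝ → ℝ) K (Ioo 0 1) := fun p hp => hI hp.1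
  obtain ⟨U, y, V, hU, hKU, hy, hyK, hyU, hV, hKV, hVu⟩ := Zone.exists_solution_surface (b := b)
    (zn := zn) hM hs hm hmN hKc (a := fun p => rp p.1) (g := fun p => root p.1)
    (hl.regularRoot_rp.continuousOn.comp continuousOn_fst hfst)
    (hr.continuousOn.comp continuousOn_fst hfst)
    (by
      rintro ⟨μ, e⟩ ⟨h1, h2⟩
      rw [mem_singleton_iff] at h2
      simp only at h2 h1
      subst h2
      exact regularZone_base hl hr (hI h1))
  set G : ℝ × ℝ → ℝ := fun p => entry (y p).1 m with hG
  have hGs : ContinuousOn G U :=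
    ((contDiff_entry m).comp_contDiffOn (contDiff_fst.comp_contDiffOn hy)).continuousOn
  have hGK : ∀ μ ∈ Icc η (1 - η), 0 < G (μ, 0) := by
    intro μ hμ
    simp only [hG]
    rw [hyK (μ, 0) ⟨hμ, rfl⟩]
    obtain ⟨j, rfl⟩ : ∃ j, m = j + 1 := ⟨m - 1, by omega⟩
    simp only
    rw [zn.entry_baseVec (by omega), if_neg (by simp [hzn, regularZone]),
      if_pos (by simp [hzn, regularZone])]
    exact hr.pos _ (hI hμ)
  -- `Regular` does not control the amplitude at `m` when `m > 1`, and the local inverse needs it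
  -- positive.
  set U' := U ∩ G ⁻¹' Ioi 0 with hU'
  have hU'o : IsOpen U' := hGs.isOpen_inter_preimage hU isOpen_Ioi
  have hKU' : K ⊆ U' := by
    rintro ⟨μ, e⟩ hp
    refine ⟨hKU hp, ?_⟩
    have h2 : e = 0 := hp.2
    subst h2
    exact hGK μ hp.1
  obtain ⟨ε₁, hε₁, hsub⟩ := exists_Ico_subset isCompact_Icc hU'o hKU'
  set Γ : ℝ × ℝ → P N := fun p => zn.pt om0 om2 b ((p, y p) : Z N) with hΓ
  have hptU : ContDiffOn ℝ ∞ Γ U := by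
    intro p hp
    have h1 := Zone.contDiffAt_pt (b := b) hs hM.om0_smooth hM.om2_smooth
      ((hyU p hp).1.mass_ne hM.two_le)
    have h2 : ContDiffAt ℝ ∞ (fun p => ((p, y p) : Z N)) p :=
      contDiffAt_id.prodMk (hy.contDiffAt (hU.mem_nhds hp))
    exact (ContDiffAt.comp (f := fun p => ((p, y p) : Z N)) p h1 h2).contDiffWithinAt
  have hker : ∀ p ∈ U', p.2 ≠ 0 → deriv (fun t => Γ (t, p.2)) p.1 ≠ 0 ∧ ∀ v : P N,
      fderiv ℝ (fun p' : P N => system lam om b p.2 p'.1 p'.2) (Γ p) v = 0 →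
      ∃ a : ℝ, v = a • deriv (fun t => Γ (t, p.2)) p.1 := by
    rintro ⟨μ, e⟩ hp he
    refine Zone.deriv_ne_zero_and_kernel (zn := zn) hM hs hU hy (fun p hp => (hyU p hp).2.1)
      (c := fun t => (t, e)) (c' := (1, 0)) (t₀ := μ)
      ((hasDerivAt_id μ).prodMk (hasDerivAt_const μ e)) (by simp) hp.1
      (hyU _ hp.1).2.2 (regularZone_localInverse hm hmN (hyU _ hp.1).1 hp.2 he)
      (Eventually.of_forall fun t => rfl) (Eventually.of_forall fun t => rfl) ?_
    intro h0
    have h1 : HasFDerivAt (fun p : ℝ × ℝ => p.2) (ContinuousLinearMap.snd ℝ ℝ ℝ) (μ, e) :=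
      hasFDerivAt_snd
    have h2 : fderiv ℝ (fun p : ℝ × ℝ => p.2) (μ, e) = 0 := h0
    rw [h1.fderiv] at h2
    have := congrArg (fun f => f (0, 1)) h2
    simp at this
  have hsol : ∀ p ∈ U', p.2 ≠ 0 → Γ p ∈ solutions lam om b p.2 := by
    intro p hp he
    exact Zone.pt_mem_solutions (b := b) (z := ((p, y p) : Z N)) hM hm
      (regularZone_valid m lam _ _) (hyU p hp.1).1.1.ne' (hyU p hp.1).2.1
  have hzero : ∀ μ ∈ Icc η (1 - η), Γ (μ, 0) = pattern N om0 m (rp μ) (root μ) μ := by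
    intro μ hμ
    simp only [hΓ]
    rw [hyK (μ, 0) ⟨hμ, rfl⟩, (regularZone_base hl hr (hI hμ)).pt_eq hm hmN]
    simp [regularZone]
  obtain ⟨κ, hκ, huniq⟩ : ∃ κ > 0, ∀ e ∈ Ioo 0 κ, ∀ q ∈ solutions (N := N) lam om b e,
      q.2 ∈ Icc η (1 - η) →
      dist q.1.1 (pattern N om0 m (rp q.2) (root q.2) q.2).1.1 < κ → (∀ i, |q.1.2.1 i| ≤ 1) →
      q = Γ (q.2, e) := by
    -- A sequence of counterexamples with `ε` and the distance tending to zero has a subsequence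
    -- along which `μ` converges; `tendsto_regularCoords` then places it in `V`.
    by_contra! hcon
    choose e he q hq hqμ hqd hqφ hqne using fun k : ℕ => hcon (1 / ((k : ℝ) + 1)) (by positivity)
    obtain ⟨μ₀, hμ₀, s, hsm, hlim⟩ := isCompact_Icc.tendsto_subseq hqμ
    have hinv : Tendsto (fun k => 1 / ((s k : ℝ) + 1)) atTop (𝓝 0) :=
      tendsto_one_div_add_atTop_nhds_zero_nat.comp hsm.tendsto_atTop
    have he0 : Tendsto (fun k => e (s k)) atTop (𝓝 0) :=
      squeeze_zero (fun k => (he (s k)).1.le) (fun k => (he (s k)).2.le) hinv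
    have hd0 : Tendsto (fun k => dist (q (s k)).1.1
        (pattern N om0 m (rp (q (s k)).2) (root (q (s k)).2) (q (s k)).2).1.1) atTop (𝓝 0) :=
      squeeze_zero (fun k => dist_nonneg) (fun k => (hqd (s k)).le) hinv
    have hμI := hI hμ₀
    have hcp := hl.regularRoot_rp.continuousOn.continuousAt (isOpen_Ioo.mem_nhds hμI)
    have hcr := hr.continuousOn.continuousAt (isOpen_Ioo.mem_nhds hμI)
    have hpat : Tendsto (fun k => (pattern N om0 m (rp (q (s k)).2) (root (q (s k)).2)
        (q (s k)).2).1.1) atTop (𝓝 (pattern N om0 m (rp μ₀) (root μ₀) μ₀).1.1) := by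
      refine tendsto_pi_nhds.2 fun i => ?_
      change Tendsto (fun k => if (i : ℕ) + 1 < m then rp (q (s k)).2
        else if (i : ℕ) + 1 = m then root (q (s k)).2 else 0) atTop
        (𝓝 (if (i : ℕ) + 1 < m then rp μ₀ else if (i : ℕ) + 1 = m then root μ₀ else 0))
      split_ifs
      · exact hcp.tendsto.comp hlim
      · exact hcr.tendsto.comp hlim
      · exact tendsto_const_nhds
    have hqlim : Tendsto (fun k => (q (s k)).1.1) atTop
        (𝓝 (pattern N om0 m (rp μ₀) (root μ₀) μ₀).1.1) :=
      (tendsto_iff_of_dist hd0).2 hpat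
    obtain ⟨hne, hcoord⟩ := tendsto_regularCoords (b := b) (q := fun k => q (s k))
      (e := fun k => e (s k)) hM hm hmN (hl.stable_zero μ₀ (Ioo_subset_Ioc_self hμI))
      (hl.regularRoot_rp.pos μ₀ hμI) (hr.pos μ₀ hμI) he0 (fun k => (he _).1) (fun k => hq _) hlim
      hqlim (fun k => hqφ _)
    have hVev := hcoord.eventually (hV.mem_nhds (hKV (μ₀, 0) ⟨hμ₀, rfl⟩))
    obtain ⟨k, hk1, hk2⟩ := (hne.and hVev).exists
    obtain ⟨h1, h2⟩ := lift_regularCoords hM hm hmN (he (s k)).1.ne' hk1 (hq (s k))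
    obtain ⟨h3, h4⟩ := hVu _ _ hk2 h2
    refine hqne (s k) ?_
    conv_lhs => rw [← h1]
    simp only [hΓ]
    refine congrArg (zn.pt om0 om2 b) ?_
    exact Prod.ext rfl h4
  refine ⟨min ε₁ κ, lt_min hε₁ hκ, κ, hκ, U', Γ, hU'o, fun p hp => hsub ⟨hp.1, hp.2.1,
    hp.2.2.trans_le (min_le_left _ _)⟩, hptU.mono inter_subset_left, fun p => rfl, hzero, hsol,
    fun p hp he => (hker p hp he).1, fun p hp he => (hker p hp he).2, fun e he => huniq e
      ⟨he.1, he.2.trans_le (min_le_right _ _)⟩⟩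

end

/-! ### The unperturbed snaking curve, cut into halves of its sheets -/

section

variable {N : ℕ} {lam : ℝ → ℝ → ℝ} {om0 : ℝ → ℝ} {rm rp : ℝ → ℝ}

/-- The root at the last excited node on the `i`-th half of the snaking curve. -/
def halfRoot (rm rp : ℝ → ℝ) (i : ℕ) : ℝ → ℝ := if Even i then rm else rp

/-- The parameter `μ` on the `i`-th half, `i ≤ s ≤ i + 1`. -/
def halfMu (i : ℕ) (s : ℝ) : ℝ := if Even i then s - i else i + 1 - s

/-- The `i`-th half, `i ≤ s ≤ i + 1`, of the snaking curve at `ε = 0`. -/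
def halfSheet (N : ℕ) (rm rp om0 : ℝ → ℝ) (i : ℕ) (s : ℝ) : P N :=
  pattern N om0 (i / 2 + 1) (rp (halfMu i s)) (halfRoot rm rp i (halfMu i s)) (halfMu i s)

theorem halfRoot_even (k : ℕ) : halfRoot rm rp (2 * k) = rm := if_pos (even_two_mul k)

theorem halfRoot_odd (k : ℕ) : halfRoot rm rp (2 * k + 1) = rp :=
  if_neg (Nat.not_even_iff_odd.2 (odd_two_mul_add_one k))

theorem halfMu_even (k : ℕ) (s : ℝ) : halfMu (2 * k) s = s - 2 * k := by
  rw [halfMu, if_pos (even_two_mul k)]; push_cast; ring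

theorem halfMu_odd (k : ℕ) (s : ℝ) : halfMu (2 * k + 1) s = 2 * k + 2 - s := by
  rw [halfMu, if_neg (Nat.not_even_iff_odd.2 (odd_two_mul_add_one k))]; push_cast; ring

theorem continuous_halfMu (i : ℕ) : Continuous (halfMu i) := by
  unfold halfMu
  split_ifs <;> fun_prop

theorem halfMu_mem_Icc {i : ℕ} {s : ℝ} {η : ℝ} :
    halfMu i s ∈ Icc η (1 - η) ↔ s ∈ Icc (i + η) (i + 1 - η) := by
  unfold halfMu
  split_ifs <;> constructor <;> rintro ⟨h1, h2⟩ <;> constructor <;> linarith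

theorem halfMu_inj {i : ℕ} {s t : ℝ} (h : halfMu i s = halfMu i t) : s = t := by
  unfold halfMu at h
  split_ifs at h <;> linarith

theorem abs_halfMu_sub {i : ℕ} {s t : ℝ} : |halfMu i s - halfMu i t| = |s - t| := by
  unfold halfMu
  split_ifs
  · congr 1; ring
  · rw [abs_sub_comm s t]; congr 1; ring

theorem exists_halfMu_eq (i : ℕ) (μ : ℝ) : ∃ s, halfMu i s = μ := by
  unfold halfMu
  split_ifs
  · exact ⟨μ + i, by ring⟩
  · exact ⟨i + 1 - μ, by ring⟩

/-- At a pitchfork the end of one sheet is the start of the next: an added node with amplitude `0`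
changes nothing. -/
theorem pattern_self (m : ℕ) (a μ : ℝ) : pattern N om0 (m + 1) a 0 μ = pattern N om0 m a a μ := by
  refine Prod.ext (Prod.ext (funext fun i => ?_) rfl) rfl
  simp only [pattern]
  split_ifs <;> first | rfl | omega

theorem sheet_eq (k : ℕ) (t : ℝ) : sheet N rm rp om0 k t
    = pattern N om0 (k + 1) (RPlus rp t) (RZero rm rp t) (muStar t) := by
  refine Prod.ext (Prod.ext (funext fun i => ?_) rfl) rfl
  simp only [pattern, sheet]
  split_ifs <;> first | rfl | omega

/-- At `t = 2` the floor in `curve0` has already jumped to the next sheet, so the closed interval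
requires that the sheets match, by `rm 0 = 0`. -/
theorem curve0_two_mul_add (hl : Bistable lam rm rp) (k : ℕ) {t : ℝ} (ht : t ∈ Icc (0 : ℝ) 2) :
    curve0 N rm rp om0 (2 * k + t) = sheet N rm rp om0 k t := by
  rcases ht.2.lt_or_eq with h | h
  · have : ⌊(2 * k + t) / 2⌋₊ = k := by
      rw [Nat.floor_eq_iff (by have := ht.1; positivity)]
      constructor <;> linarith [ht.1]
    rw [curve0, this]
    congr 1; ring
  · subst h
    have : ⌊(2 * (k : ℝ) + 2) / 2⌋₊ = k + 1 := by
      rw [Nat.floor_eq_iff (by positivity)]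
      push_cast
      constructor <;> linarith
    rw [curve0, this, sheet_eq, sheet_eq]
    have e : (2 * (k : ℝ) + 2) - 2 * ((k + 1 : ℕ) : ℝ) = 0 := by push_cast; ring
    rw [e]
    simp only [RPlus, RZero, muStar]
    norm_num
    rw [hl.pitchfork_root.1, pattern_self]

theorem curve0_eq_halfSheet (hl : Bistable lam rm rp) {i : ℕ} {s : ℝ}
    (hs : s ∈ Icc (i : ℝ) (i + 1)) : curve0 N rm rp om0 s = halfSheet N rm rp om0 i s := by
  obtain ⟨k, rfl | rfl⟩ := Nat.even_or_odd' i
  · have h1 : s = 2 * k + (s - 2 * k) := by ring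
    push_cast at hs
    rw [halfSheet, halfMu_even, halfRoot_even]
    conv_lhs => rw [h1]
    rw [curve0_two_mul_add hl k ⟨by linarith [hs.1], by linarith [hs.2]⟩, sheet_eq]
    have h2 : s - 2 * k ≤ 1 := by linarith [hs.2]
    have h3 : 2 * k / 2 = k := by omega
    simp only [RPlus, RZero, muStar, if_pos h2, h3]
  · have h1 : s = 2 * k + (s - 2 * k) := by ring
    push_cast at hs
    rw [halfSheet, halfMu_odd, halfRoot_odd]
    conv_lhs => rw [h1]
    rw [curve0_two_mul_add hl k ⟨by linarith [hs.1], by linarith [hs.2]⟩, sheet_eq]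
    have h3 : (2 * k + 1) / 2 = k := by omega
    have h4 : 2 - (s - 2 * k) = 2 * k + 2 - s := by ring
    have h5 : muStar (s - 2 * k) = 2 * k + 2 - s := by
      unfold muStar
      split_ifs with h
      · linarith [hs.1]
      · ring
    have h6 : RZero rm rp (s - 2 * k) = rp (2 * k + 2 - s) := by
      unfold RZero
      rw [h5]
      split_ifs with h
      · have : 2 * (k : ℝ) + 2 - s = 1 := by linarith [hs.1]
        rw [this, hl.fold_root.1, hl.fold_root.2.1]
      · rfl
    rw [h6, RPlus, h5, h3]

/-- In `saddleNodeLimit` one of the two roots is always taken at `μ = 1`, where it equals `1`;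
subtracting `1` leaves `rm` for `σ ≤ 0` and `rp` for `σ ≥ 0`. -/
theorem curve0_eq_saddleNodeLimit (hl : Bistable lam rm rp) (k : ℕ) {σ : ℝ}
    (hσ : |σ| ≤ 1) : curve0 N rm rp om0 (((2 * k + 1 : ℕ) : ℝ) + σ)
      = saddleNodeLimit N om0 rm rp (k + 1) σ := by
  have h1 := abs_le.1 hσ
  have h2 : (2 * k + 1) / 2 = k := by omega
  have h3 : 2 * k / 2 = k := by omega
  unfold saddleNodeLimit
  rcases le_total σ 0 with h | h
  · rw [curve0_eq_halfSheet hl (i := 2 * k) (by push_cast; constructor <;> linarith), halfSheet,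
      halfMu_even, halfRoot_even, abs_of_nonpos h, max_eq_left (by linarith : (0 : ℝ) ≤ -σ),
      max_eq_right h, h3]
    push_cast
    rw [sub_zero, hl.fold_root.2.1]
    have e : 2 * (k : ℝ) + 1 + σ - 2 * k = 1 - -σ := by ring
    rw [e]
    congr 1; ring
  · rw [curve0_eq_halfSheet hl (i := 2 * k + 1) (by push_cast; constructor <;> linarith), halfSheet,
      halfMu_odd, halfRoot_odd, abs_of_nonneg h, max_eq_right (by linarith : -σ ≤ (0 : ℝ)),
      max_eq_left h, h2]
    push_cast
    rw [sub_zero, hl.fold_root.1]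
    have e : 2 * (k : ℝ) + 2 - (2 * k + 1 + σ) = 1 - σ := by ring
    rw [e]
    congr 1; ring

theorem curve0_eq_pitchforkLimit (hl : Bistable lam rm rp) (k : ℕ) {σ : ℝ}
    (hσ : |σ| ≤ 1) : curve0 N rm rp om0 (((2 * k + 2 : ℕ) : ℝ) + σ)
      = pitchforkLimit N om0 rm rp (k + 2) σ := by
  have h1 := abs_le.1 hσ
  have h2 : (2 * k + 1) / 2 = k := by omega
  have h3 : 2 * (k + 1) / 2 = k + 1 := by omega
  unfold pitchforkLimit
  rcases le_total σ 0 with h | h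
  · rw [curve0_eq_halfSheet hl (i := 2 * k + 1) (by push_cast; constructor <;> linarith), halfSheet,
      halfMu_odd, halfRoot_odd, abs_of_nonpos h, max_eq_right h, h2, hl.pitchfork_root.1,
      pattern_self]
    push_cast
    have e : 2 * (k : ℝ) + 2 - (2 * k + 2 + σ) = -σ := by ring
    rw [e]
  · rw [curve0_eq_halfSheet hl (i := 2 * (k + 1)) (by push_cast; constructor <;> linarith),
      halfSheet, halfMu_even, halfRoot_even, abs_of_nonneg h, max_eq_left h, h3]
    push_cast
    have e : 2 * (k : ℝ) + 2 + σ - 2 * (k + 1) = σ := by ring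
    rw [e]

theorem curve0_snd (hl : Bistable lam rm rp) {i : ℕ} {s : ℝ}
    (hs : s ∈ Icc (i : ℝ) (i + 1)) : (curve0 N rm rp om0 s).2 = halfMu i s := by
  rw [curve0_eq_halfSheet hl hs]; rfl

theorem Bistable.continuousOn_halfRoot (hl : Bistable lam rm rp) (i : ℕ) :
    ContinuousOn (halfRoot rm rp i) (Icc 0 1) := by
  unfold halfRoot
  split_ifs
  · exact hl.rm_continuous
  · exact hl.rp_continuous

theorem Bistable.regularRoot_halfRoot (hl : Bistable lam rm rp) (i : ℕ) :
    RegularRoot lam (halfRoot rm rp i) := by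
  unfold halfRoot
  split_ifs
  · exact hl.regularRoot_rm
  · exact hl.regularRoot_rp

theorem continuousOn_curve0 (hl : Bistable lam rm rp) (hom0 : Continuous om0) (n : ℕ) :
    ContinuousOn (curve0 N rm rp om0) (Icc 0 n) := by
  induction n with
  | zero => simp
  | succ n ih =>
    have h1 : ContinuousOn (curve0 N rm rp om0) (Icc (n : ℝ) (n + 1)) := by
      have hm : MapsTo (halfMu n) (Icc (n : ℝ) (n + 1)) (Icc 0 1) := by
        intro s hs
        have := (halfMu_mem_Icc (i := n) (s := s) (η := 0)).2 (by simpa using hs)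
        simpa using this
      refine ContinuousOn.congr ?_ fun s hs => curve0_eq_halfSheet hl hs
      have hc := (continuous_halfMu n).continuousOn (s := Icc (n : ℝ) (n + 1))
      exact continuousOn_pattern hom0 _ (hl.rp_continuous.comp hc hm)
        ((hl.continuousOn_halfRoot n).comp hc hm) hc
    have h2 : Icc (0 : ℝ) ((n + 1 : ℕ) : ℝ) = Icc 0 (n : ℝ) ∪ Icc (n : ℝ) (n + 1) := by
      push_cast
      rw [Icc_union_Icc_eq_Icc (by positivity) (by linarith)]
    rw [h2]
    exact ih.union_of_isClosed h1 isClosed_Icc isClosed_Icc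

theorem sum_pattern {m : ℕ} (hm : m + 1 ≤ N) (a r μ : ℝ) :
    ∑ i, (pattern N om0 (m + 1) a r μ).1.1 i = m * a + r := by
  have h1 : ∀ i : Fin N, (pattern N om0 (m + 1) a r μ).1.1 i
      = (fun j : ℕ => if j < m then a else if j = m then r else 0) i := by
    intro i
    simp only [pattern]
    split_ifs <;> first | rfl | omega
  rw [Finset.sum_congr rfl fun i _ => h1 i,
    Fin.sum_univ_eq_sum_range (fun j : ℕ => if j < m then a else if j = m then r else 0) N]
  have h2 : Finset.range (m + 1) ⊆ Finset.range N := by simpa using hm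
  rw [← Finset.sum_subset h2 fun j _ hj => by
    rw [Finset.mem_range] at hj
    rw [if_neg (by omega), if_neg (by omega)], Finset.sum_range_succ]
  simp only [lt_irrefl, if_false, if_true]
  rw [Finset.sum_congr rfl fun j hj => if_pos (Finset.mem_range.1 hj)]
  simp

theorem exists_half {s : ℝ} (hs : 0 ≤ s) : s ∈ Ico (⌊s⌋₊ : ℝ) (⌊s⌋₊ + 1) :=
  ⟨Nat.floor_le hs, Nat.lt_floor_add_one s⟩

theorem half_lt {i : ℕ} {s : ℝ} (h : (i : ℝ) ≤ s) (hs : s < 2 * N - 1) : i + 2 ≤ 2 * N := by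
  have : (i : ℝ) + 1 < ((2 * N : ℕ) : ℝ) := by push_cast; linarith
  have h2 : i + 1 < 2 * N := by exact_mod_cast this
  omega

/-- The parameter `μ` and the sum of the amplitudes separate points. For `0 < μ < 1` the sum
increases strictly with the index of the half. At `μ = 0` and `μ = 1` the half-open intervals leave
only even, respectively odd, indices, and the sum counts the excited nodes. -/
theorem injOn_curve0 (hl : Bistable lam rm rp) :
    InjOn (curve0 N rm rp om0) (Ico 0 (2 * N - 1)) := by
  intro s hs t ht heq
  set i := ⌊s⌋₊
  set j := ⌊t⌋₊
  have hi := exists_half hs.1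
  have hj := exists_half ht.1
  have hiN := half_lt hi.1 hs.2
  have hjN := half_lt hj.1 ht.2
  change s ∈ Ico (i : ℝ) (i + 1) at hi
  change t ∈ Ico (j : ℝ) (j + 1) at hj
  rw [curve0_eq_halfSheet hl (Ico_subset_Icc_self hi),
    curve0_eq_halfSheet hl (Ico_subset_Icc_self hj)] at heq
  have hμ : halfMu i s = halfMu j t := congrArg Prod.snd heq
  have hS := congrArg (fun p : P N => ∑ n, p.1.1 n) heq
  simp only [halfSheet] at hS
  rw [sum_pattern (by omega), sum_pattern (by omega), ← hμ] at hS
  set μ := halfMu i s with hμd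
  have h01 : μ ∈ Icc (0 : ℝ) 1 := by
    have := (halfMu_mem_Icc (i := i) (s := s) (η := 0)).2 (by simpa using Ico_subset_Icc_self hi)
    simpa using this
  suffices hij : i = j by
    rw [hij] at hμd
    exact halfMu_inj (hμd.symm.trans hμ)
  rcases h01.1.eq_or_lt with h0 | h0
  · have hev : ∀ (i : ℕ) (s : ℝ), s ∈ Ico (i : ℝ) (i + 1) → 0 = halfMu i s → ∃ k, i = 2 * k := by
      intro i s hs h
      obtain ⟨k, rfl | rfl⟩ := Nat.even_or_odd' i
      · exact ⟨k, rfl⟩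
      · rw [halfMu_odd] at h
        have := hs.2
        push_cast at this
        linarith
    obtain ⟨k, hk⟩ := hev i s hi h0
    obtain ⟨k', hk'⟩ := hev j t hj (h0.trans hμ)
    rw [hk, hk', halfRoot_even, halfRoot_even, ← h0] at hS
    have hp := hl.rp_pos (μ := 0) ⟨le_rfl, zero_le_one⟩
    have h1 : 2 * k / 2 = k := by omega
    have h2 : 2 * k' / 2 = k' := by omega
    rw [h1, h2] at hS
    have h3 : (k : ℝ) = k' := by
      apply mul_right_cancel₀ hp.ne'
      linarith
    have h4 : k = k' := by exact_mod_cast h3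
    omega
  rcases h01.2.eq_or_lt with h1 | h1
  · have hodd : ∀ (i : ℕ) (s : ℝ), s ∈ Ico (i : ℝ) (i + 1) → halfMu i s = 1 →
        ∃ k, i = 2 * k + 1 := by
      intro i s hs h
      obtain ⟨k, rfl | rfl⟩ := Nat.even_or_odd' i
      · rw [halfMu_even] at h
        have := hs.2
        push_cast at this
        linarith
      · exact ⟨k, rfl⟩
    obtain ⟨k, hk⟩ := hodd i s hi h1
    obtain ⟨k', hk'⟩ := hodd j t hj (hμ.symm.trans h1)
    rw [hk, hk', halfRoot_odd, halfRoot_odd, h1, hl.fold_root.2.1] at hS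
    have h1 : (2 * k + 1) / 2 = k := by omega
    have h2 : (2 * k' + 1) / 2 = k' := by omega
    rw [h1, h2] at hS
    have h3 : (k : ℝ) = k' := by linarith
    have h4 : k = k' := by exact_mod_cast h3
    omega
  · obtain ⟨hr1, hr2⟩ := hl.ordered μ ⟨h0, h1⟩
    -- From an even to an odd index `rm` becomes `rp`; from an odd to an even one a further node at
    -- `rm` is added.
    have hmono : StrictMono fun i : ℕ => ((i / 2 : ℕ) : ℝ) * rp μ + halfRoot rm rp i μ := by
      refine strictMono_nat_of_lt_succ fun n => ?_
      obtain ⟨k, rfl | rfl⟩ := Nat.even_or_odd' n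
      · simp only [halfRoot_even, halfRoot_odd]
        have e1 : 2 * k / 2 = k := by omega
        have e2 : (2 * k + 1) / 2 = k := by omega
        rw [e1, e2]; linarith
      · have e0 : 2 * k + 1 + 1 = 2 * (k + 1) := by ring
        simp only [e0, halfRoot_even, halfRoot_odd]
        have e1 : (2 * k + 1) / 2 = k := by omega
        have e2 : 2 * (k + 1) / 2 = k + 1 := by omega
        rw [e1, e2]; push_cast; linarith
    exact hmono.injective hS

theorem Gamma0_eq (hl : Bistable lam rm rp) (hN : 2 ≤ N) {δ : ℝ} (hδ : 0 < δ) (hδ1 : δ < 1) :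
    Gamma0 N rm rp om0 δ = curve0 N rm rp om0 '' Icc δ (2 * N - 1 - δ) := by
  have hN' : (2 : ℝ) ≤ N := by exact_mod_cast hN
  apply Subset.antisymm
  · rintro p ((⟨t, ht, rfl⟩ | hp) | ⟨t, ht, rfl⟩)
    · refine ⟨2 * ((0 : ℕ) : ℝ) + t, ?_, curve0_two_mul_add hl 0 ⟨hδ.le.trans ht.1, ht.2⟩⟩
      simp only [Nat.cast_zero, mul_zero, zero_add]
      exact ⟨ht.1, by linarith [ht.2]⟩
    · simp only [mem_iUnion] at hp
      obtain ⟨k, hk, t, ht, rfl⟩ := hp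
      refine ⟨2 * (k : ℝ) + t, ?_, curve0_two_mul_add hl k ht⟩
      have h1 : (1 : ℝ) ≤ k := by exact_mod_cast hk.1
      have h2 : (k : ℝ) + 2 ≤ N := by
        have h3 := hk.2
        have : k + 2 ≤ N := by omega
        exact_mod_cast this
      exact ⟨by linarith [ht.1], by linarith [ht.2]⟩
    · refine ⟨2 * ((N - 1 : ℕ) : ℝ) + t, ?_,
        curve0_two_mul_add hl (N - 1) ⟨ht.1, by linarith [ht.2]⟩⟩
      have h2 : ((N - 1 : ℕ) : ℝ) = N - 1 := by
        rw [Nat.cast_sub (by omega)]; simp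
      rw [h2]
      exact ⟨by linarith [ht.1], by linarith [ht.2]⟩
  · rintro p ⟨s, hs, rfl⟩
    have hs0 : 0 ≤ s / 2 := by linarith [hs.1]
    set k := ⌊s / 2⌋₊ with hk
    have h1 : (k : ℝ) ≤ s / 2 := Nat.floor_le hs0
    have h2 : s / 2 < k + 1 := Nat.lt_floor_add_one _
    have hkN : k < N := by
      have : (k : ℝ) < N := by linarith [hs.2]
      exact_mod_cast this
    change sheet N rm rp om0 k (s - 2 * k) ∈ _
    rcases Nat.eq_zero_or_pos k with h0 | h0
    · refine Or.inl (Or.inl ⟨s - 2 * k, ?_, by rw [h0]⟩)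
      rw [h0] at h2 ⊢
      simp only [Nat.cast_zero, mul_zero, sub_zero] at *
      exact ⟨hs.1, by linarith⟩
    · rcases Nat.lt_or_ge k (N - 1) with h3 | h3
      · refine Or.inl (Or.inr ?_)
        simp only [mem_iUnion]
        exact ⟨k, ⟨h0, by omega⟩, s - 2 * k, ⟨by linarith, by linarith⟩, rfl⟩
      · have h4 : k = N - 1 := by omega
        refine Or.inr ⟨s - 2 * k, ⟨by linarith, ?_⟩, by rw [h4]⟩
        have h5 : (k : ℝ) = N - 1 := by rw [h4, Nat.cast_sub (by omega)]; simp
        linarith [hs.2]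

theorem mem_nbhd_walls {δ : ℝ} {p : P N} :
    p ∈ nbhd δ (walls N) ↔ p.2 ∈ Icc (0 : ℝ) 1 ∧ (p.2 < δ ∨ 1 - δ < p.2) := by
  refine and_congr_right fun h01 => ?_
  rw [Metric.mem_thickening_iff]
  constructor
  · rintro ⟨w, hw, hd⟩
    have h1 : dist p.2 w.2 < δ := lt_of_le_of_lt (le_max_right _ _) hd
    rw [Real.dist_eq, abs_lt] at h1
    rcases hw with h | h
    · left; rw [h] at h1; linarith [h1.2]
    · right; rw [h] at h1; linarith [h1.1]
  · have hd : ∀ c : ℝ, dist p ((p.1, c) : P N) = |p.2 - c| := by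
      intro c
      rw [Prod.dist_eq]
      simp [Real.dist_eq]
    rintro (h | h)
    · refine ⟨(p.1, 0), Or.inl rfl, ?_⟩
      rw [hd, sub_zero, abs_of_nonneg h01.1]; exact h
    · refine ⟨(p.1, 1), Or.inr rfl, ?_⟩
      rw [hd, abs_sub_comm, abs_of_nonneg (by linarith [h01.2])]; linarith

end

/-! ### Separation of the roots and location of solutions near the curve -/

section

variable {N : ℕ} {lam : ℝ → ℝ → ℝ} {om : ℝ → ℝ → ℝ → ℝ} {om0 : ℝ → ℝ} {rm rp : ℝ → ℝ}

theorem exists_pos_le_of_isCompact {K : Set ℝ} (hK : IsCompact K) {f : ℝ → ℝ}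
    (hf : ContinuousOn f K) (hpos : ∀ x ∈ K, 0 < f x) : ∃ c > 0, ∀ x ∈ K, c ≤ f x := by
  rcases K.eq_empty_or_nonempty with h | h
  · exact ⟨1, one_pos, fun x hx => by rw [h] at hx; exact hx.elim⟩
  · obtain ⟨x₀, hx₀, hmin⟩ := hK.exists_isMinOn h hf
    exact ⟨f x₀, hpos x₀ hx₀, fun x hx => hmin hx⟩

namespace Bistable

/-- Square-root behaviour of the roots at the bifurcation points. -/
theorem exists_sqrt_bounds (hl : Bistable lam rm rp) : ∃ c > 0, ∃ h > 0, h < 1 ∧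
    (∀ μ ∈ Icc (0 : ℝ) 1, c * √μ ≤ rm μ) ∧
    ∀ μ ∈ Icc (1 - h) 1, rm μ ≤ 1 - c * √(1 - μ) ∧ 1 + c * √(1 - μ) ≤ rp μ := by
  obtain ⟨-, -, Y, -, -, -, hY, -, hYpos, -, -, h₀, hh₀, hh₁, -, -, hrm⟩ :=
    hl.exists_pitchfork_scaling
  obtain ⟨-, -, Zm, Zp, -, -, -, hZm, hZp, -, hZm0, hZp0, -, -, k₀, hk₀, hk₁, -, -, -, hroots⟩ :=
    hl.exists_saddle_node_scaling
  obtain ⟨c₁, hc₁, h1⟩ := exists_pos_le_of_isCompact (isCompact_Icc (a := (0 : ℝ)) (b := h₀ / 2))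
    hY.continuous.continuousOn fun x _ => hYpos x
  -- Away from the pitchfork a positive lower bound for `rm` suffices, since `√μ ≤ 1`.
  obtain ⟨c₂, hc₂, h2⟩ := exists_pos_le_of_isCompact (isCompact_Icc (a := (h₀ / 2) ^ 2) (b := 1))
    (hl.rm_continuous.mono (Icc_subset_Icc (by positivity) le_rfl)) fun x hx => by
      rcases hx.2.eq_or_lt with h | h
      · rw [h, hl.fold_root.1]; exact one_pos
      · exact (hl.ordered x ⟨lt_of_lt_of_le (by positivity) hx.1, h⟩).1
  obtain ⟨c₃, hc₃, h3⟩ := exists_pos_le_of_isCompact (isCompact_Icc (a := (0 : ℝ)) (b := k₀ / 2))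
    hZm.continuous.neg.continuousOn fun x _ => neg_pos.2 (hZm0 x)
  obtain ⟨c₄, hc₄, h4⟩ := exists_pos_le_of_isCompact (isCompact_Icc (a := (0 : ℝ)) (b := k₀ / 2))
    hZp.continuous.continuousOn fun x _ => hZp0 x
  set c := min (min c₁ c₂) (min c₃ c₄) with hc
  have l1 : c ≤ c₁ := (min_le_left _ _).trans (min_le_left _ _)
  have l2 : c ≤ c₂ := (min_le_left _ _).trans (min_le_right _ _)
  have l3 : c ≤ c₃ := (min_le_right _ _).trans (min_le_left _ _)
  have l4 : c ≤ c₄ := (min_le_right _ _).trans (min_le_right _ _)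
  have hcp : 0 < c := lt_min (lt_min hc₁ hc₂) (lt_min hc₃ hc₄)
  refine ⟨c, hcp, (k₀ / 2) ^ 2, by positivity, by nlinarith, fun μ hμ => ?_, fun μ hμ => ?_⟩
  · rcases le_total μ ((h₀ / 2) ^ 2) with h | h
    · have h5 : √μ ≤ h₀ / 2 := Real.sqrt_le_iff.2 ⟨by positivity, h⟩
      have h6 := hrm (√μ) ⟨Real.sqrt_nonneg _, by linarith⟩
      rw [Real.sq_sqrt hμ.1] at h6
      rw [h6, mul_comm]
      exact mul_le_mul_of_nonneg_left (l1.trans (h1 _ ⟨Real.sqrt_nonneg _, h5⟩))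
        (Real.sqrt_nonneg _)
    · have h5 : √μ ≤ 1 := Real.sqrt_le_iff.2 ⟨zero_le_one, by linarith [hμ.2]⟩
      have h6 := h2 μ ⟨h, hμ.2⟩
      nlinarith [Real.sqrt_nonneg μ]
  · have h0 : 0 ≤ 1 - μ := by linarith [hμ.2]
    have h5 : √(1 - μ) ≤ k₀ / 2 := Real.sqrt_le_iff.2 ⟨by positivity, by linarith [hμ.1]⟩
    have hs := Real.sqrt_nonneg (1 - μ)
    obtain ⟨h6, h7⟩ := hroots (√(1 - μ)) ⟨hs, by linarith⟩
    rw [Real.sq_sqrt h0, sub_sub_cancel] at h6 h7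
    have h8 := h3 _ ⟨hs, h5⟩
    have h9 := h4 _ ⟨hs, h5⟩
    simp only [Pi.neg_apply] at h8
    rw [h6, h7]
    constructor
    · nlinarith
    · nlinarith

/-- The roots at nearby parameters are separated by much more than the parameters are apart from
each other and from the bifurcations. -/
theorem exists_separation (hl : Bistable lam rm rp) {δ : ℝ} (hδ : 0 < δ) :
    ∃ d > 0, ∀ t ∈ Ioo 0 d, ∀ μ ∈ Icc t (1 - t), ∀ μ₁ ∈ Icc (0 : ℝ) 1, |μ - μ₁| < t →
      2 * t < rm μ ∧ 2 * t < rp μ₁ - rm μ ∧ 2 * t < rp μ - rm μ₁ ∧ (δ ≤ μ₁ → 2 * t < rm μ₁) := by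
  obtain ⟨c, hc, h, hh, hh1, hr0, hr1⟩ := hl.exists_sqrt_bounds
  obtain ⟨g, hg, hgap⟩ := exists_pos_le_of_isCompact (isCompact_Icc (a := (0 : ℝ)) (b := 1 - h / 2))
    (f := fun μ => rp μ - rm μ)
    ((hl.rp_continuous.sub hl.rm_continuous).mono (Icc_subset_Icc le_rfl (by linarith)))
    fun x hx => by
      rcases hx.1.eq_or_lt with h0 | h0
      · rw [← h0, hl.pitchfork_root.1, sub_zero]
        exact hl.rp_pos ⟨le_rfl, zero_le_one⟩
      · exact sub_pos.2 (hl.ordered x ⟨h0, by linarith [hx.2]⟩).2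
  obtain ⟨d₁, hd₁, hu₁⟩ := Metric.uniformContinuousOn_iff.1
    (isCompact_Icc.uniformContinuousOn_of_continuous hl.rp_continuous) (g / 2) (by positivity)
  obtain ⟨d₂, hd₂, hu₂⟩ := Metric.uniformContinuousOn_iff.1
    (isCompact_Icc.uniformContinuousOn_of_continuous hl.rm_continuous) (g / 2) (by positivity)
  -- The bound `c² / 4` yields `2 t < c √t`, so square-root gaps exceed `2 t` near the bifurcations.
  -- The bounds `d₁`, `d₂`, `g / 4` handle parameters away from the saddle-node, and `c √δ / 2` the
  -- start of the curve.
  refine ⟨min (min (min d₁ d₂) (h / 2)) (min (min (c ^ 2 / 4) (g / 4)) (c * √δ / 2)),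
    by positivity, fun t ht μ hμ μ₁ hμ₁ hd => ?_⟩
  have ht0 := ht.1
  have ht1 := ht.2
  simp only [lt_min_iff] at ht1
  obtain ⟨⟨⟨e1, e2⟩, e3⟩, ⟨e4, e5⟩, e6⟩ := ht1
  have hμ01 : μ ∈ Icc (0 : ℝ) 1 := ⟨ht0.le.trans hμ.1, by linarith [hμ.2]⟩
  have hs : 2 * t < c * √t := by
    have h1 : √t < c / 2 := (Real.sqrt_lt' (by positivity)).2 (by linarith [show (c / 2) ^ 2 = c ^ 2 / 4 by ring])
    have h2 := Real.mul_self_sqrt ht0.le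
    have h3 := Real.sqrt_pos.2 ht0
    nlinarith
  have hst : ∀ x, t ≤ x → 2 * t < c * √x := fun x hx =>
    hs.trans_le (mul_le_mul_of_nonneg_left (Real.sqrt_le_sqrt hx) hc.le)
  refine ⟨(hst μ hμ.1).trans_le (hr0 μ hμ01), ?_, ?_, fun hδ1 => ?_⟩
  · rcases le_total μ (1 - h / 2) with h1 | h1
    · have h2 := hgap μ ⟨hμ01.1, h1⟩
      have h3 := hu₁ μ hμ01 μ₁ hμ₁ (by rw [Real.dist_eq]; linarith)
      rw [Real.dist_eq, abs_lt] at h3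
      linarith [h3.2]
    · have hd' := abs_lt.1 hd
      have h2 := (hr1 μ₁ ⟨by linarith [hd'.2], hμ₁.2⟩).2
      have h3 := (hr1 μ ⟨by linarith, hμ01.2⟩).1
      have h4 := hst (1 - μ) (by linarith [hμ.2])
      have h5 := mul_nonneg hc.le (Real.sqrt_nonneg (1 - μ₁))
      linarith
  · rcases le_total μ (1 - h / 2) with h1 | h1
    · have h2 := hgap μ ⟨hμ01.1, h1⟩
      have h3 := hu₂ μ hμ01 μ₁ hμ₁ (by rw [Real.dist_eq]; linarith)
      rw [Real.dist_eq, abs_lt] at h3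
      linarith [h3.1]
    · have hd' := abs_lt.1 hd
      have h2 := (hr1 μ₁ ⟨by linarith [hd'.2], hμ₁.2⟩).1
      have h3 := (hr1 μ ⟨by linarith, hμ01.2⟩).2
      have h4 := hst (1 - μ) (by linarith [hμ.2])
      have h5 := mul_nonneg hc.le (Real.sqrt_nonneg (1 - μ₁))
      linarith
  · have h1 := hr0 μ₁ hμ₁
    have h2 := mul_le_mul_of_nonneg_left (Real.sqrt_le_sqrt hδ1) hc.le
    linarith

/-- Approximate zeros of `lam r μ * r` are close to zeros. -/
theorem exists_near_root (hl : Bistable lam rm rp) {t κ : ℝ} (ht : 0 < t) (hκ : 0 < κ) (M : ℝ) :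
    ∃ ε' > 0, ∀ μ ∈ Icc t (1 - t), ∀ r, |r| ≤ M → |lam r μ * r| < ε' →
      |r| < κ ∨ |(|r| - rm μ)| < κ ∨ |(|r| - rp μ)| < κ := by
  set S : Set (ℝ × ℝ) := Icc (-M) M ×ˢ Icc t (1 - t) with hS
  have hSc : IsCompact S := isCompact_Icc.prod isCompact_Icc
  have hmap : MapsTo (Prod.snd : ℝ × ℝ → ℝ) S (Icc 0 1) := fun p hp =>
    ⟨ht.le.trans hp.2.1, by linarith [hp.2.2]⟩
  set F : ℝ × ℝ → ℝ × ℝ × ℝ := fun p =>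
    (|p.1|, |(|p.1| - rm p.2)|, |(|p.1| - rp p.2)|) with hF
  have hFc : ContinuousOn F S := by
    have h1 : ContinuousOn (fun p : ℝ × ℝ => |p.1|) S := continuous_fst.abs.continuousOn
    exact h1.prodMk (((h1.sub (hl.rm_continuous.comp continuousOn_snd hmap)).abs).prodMk
      ((h1.sub (hl.rp_continuous.comp continuousOn_snd hmap)).abs))
  have hT : IsCompact (S ∩ F ⁻¹' (Ici κ ×ˢ Ici κ ×ˢ Ici κ)) := hSc.of_isClosed_subset
    (hFc.preimage_isClosed_of_isClosed hSc.isClosed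
      (isClosed_Ici.prod (isClosed_Ici.prod isClosed_Ici))) inter_subset_left
  have hfc : Continuous (fun p : ℝ × ℝ => |lam p.1 p.2 * p.1|) :=
    (hl.continuous_lam.mul continuous_fst).abs
  have hzero : ∀ p ∈ S ∩ F ⁻¹' (Ici κ ×ˢ Ici κ ×ˢ Ici κ), 0 < |lam p.1 p.2 * p.1| := by
    rintro ⟨r, μ⟩ ⟨hp, h1, h2, h3⟩
    have h1 : κ ≤ |r| := h1
    have h2 : κ ≤ |(|r| - rm μ)| := h2
    have h3 : κ ≤ |(|r| - rp μ)| := h3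
    have hr : r ≠ 0 := fun h => by rw [h, abs_zero] at h1; linarith
    have hlr : lam |r| μ = lam r μ := by
      rcases abs_choice r with h | h
      · rw [h]
      · rw [h, hl.even]
    refine abs_pos.2 (mul_ne_zero (fun h => ?_) hr)
    simp only at h
    rw [← hlr, hl.roots μ ⟨ht.trans_le hp.2.1, by linarith [hp.2.2]⟩ _ (abs_pos.2 hr)] at h
    rcases h with h | h
    · rw [h, sub_self, abs_zero] at h2; linarith
    · rw [h, sub_self, abs_zero] at h3; linarith
  obtain ⟨ε', hε', hlow⟩ : ∃ ε' > 0, ∀ p ∈ S ∩ F ⁻¹' (Ici κ ×ˢ Ici κ ×ˢ Ici κ),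
      ε' ≤ |lam p.1 p.2 * p.1| := by
    rcases (S ∩ F ⁻¹' (Ici κ ×ˢ Ici κ ×ˢ Ici κ)).eq_empty_or_nonempty with h | h
    · exact ⟨1, one_pos, fun x hx => by rw [h] at hx; exact hx.elim⟩
    · obtain ⟨x₀, hx₀, hmin⟩ := hT.exists_isMinOn h hfc.continuousOn
      exact ⟨_, hzero x₀ hx₀, fun x hx => hmin hx⟩
  refine ⟨ε', hε', fun μ hμ r hr hlr => ?_⟩
  by_contra! hcon
  exact absurd (hlow (r, μ) ⟨⟨abs_le.1 hr, hμ⟩, hcon⟩) (not_le.2 hlr)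

end Bistable

theorem abs_amp_le {b : Site} {x : X N} {M : ℝ} (hM : 0 ≤ M) (h : ∀ i, |x.1 i| ≤ M) (n : ℕ) :
    |amp b x n| ≤ M := by
  have he : ∀ n, |entry x.1 n| ≤ M := by
    intro n
    unfold entry
    split_ifs
    · exact h _
    · simpa using hM
  unfold amp
  split_ifs
  · cases b <;> exact he _
  · exact he _
  · exact he _

theorem abs_coupling_le {b : Site} {x : X N} {M : ℝ} (hM : 0 ≤ M) (h : ∀ i, |x.1 i| ≤ M) (j : ℕ) :
    |coupling b x j| ≤ 4 * M := by
  have hp : ∀ n c, |amp b x n * Real.cos c| ≤ M := by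
    intro n c
    rw [abs_mul]
    have h1 := Real.abs_cos_le_one c
    have h2 := abs_amp_le (b := b) hM h n
    nlinarith [abs_nonneg (amp b x n), abs_nonneg (Real.cos c)]
  have h1 := abs_le.1 (hp (j + 2) (phase b x (j + 1)))
  have h2 := abs_le.1 (hp j (phase b x j))
  have h3 := abs_le.1 (abs_amp_le (b := b) hM h (j + 1))
  unfold coupling
  rw [abs_le]
  constructor <;> linarith [h1.1, h1.2, h2.1, h2.2, h3.1, h3.2]

/-- Away from the bifurcations, every solution near the snaking curve is close to one of its
patterns at the same parameter. -/
theorem exists_near_half (hl : Bistable lam rm rp) {δ : ℝ} (hδ : 0 < δ)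
    (hδ1 : δ < 1) : ∃ d > 0, ∀ t ∈ Ioo 0 d, ∀ κ > 0, ∃ ε' > 0, ∀ b, ∀ e ∈ Ioo 0 ε',
      ∀ q ∈ solutions (N := N) lam om b e, q.2 ∈ Icc t (1 - t) →
      q ∈ Metric.thickening t (curve0 N rm rp om0 '' Icc δ (2 * N - 1 - δ)) →
      ∃ (i : ℕ) (s : ℝ), i + 2 ≤ 2 * N ∧ s ∈ Icc (δ - t) (2 * N - 1 - δ + t) ∧ halfMu i s = q.2 ∧
        dist q.1.1 (halfSheet N rm rp om0 i s).1.1 < κ ∧ ∀ k, |q.1.2.1 k| ≤ 1 := by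
  obtain ⟨d, hd, hsep⟩ := hl.exists_separation hδ
  obtain ⟨M₀, hM₀⟩ := isCompact_Icc.exists_bound_of_continuousOn hl.rp_continuous
  have hM₀' : ∀ μ ∈ Icc (0 : ℝ) 1, rp μ ≤ M₀ := fun μ hμ => (le_abs_self _).trans (hM₀ μ hμ)
  have hM0 : 0 ≤ M₀ := (hl.rp_pos ⟨le_rfl, zero_le_one⟩).le.trans (hM₀' 0 ⟨le_rfl, zero_le_one⟩)
  refine ⟨min d 1, lt_min hd one_pos, fun t ht κ hκ => ?_⟩
  have ht0 := ht.1
  have htd : t < d := ht.2.trans_le (min_le_left _ _)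
  have ht1 : t < 1 := ht.2.trans_le (min_le_right _ _)
  set κ' := min κ t with hκ'
  have hκ'0 : 0 < κ' := lt_min hκ ht0
  obtain ⟨ε₁, hε₁, hroot⟩ := hl.exists_near_root ht0 hκ'0 (M₀ + 1)
  -- Amplitudes are at most `M₀ + 1`, so the coupling is at most `4 (M₀ + 1)` and the real equation
  -- makes `lam r μ * r` smaller than `ε₁`.
  refine ⟨ε₁ / (4 * (M₀ + 1)), by positivity, fun b e he q hq hqμ hqΓ => ?_⟩
  obtain ⟨w, ⟨s₁, hs₁, rfl⟩, hdist⟩ := Metric.mem_thickening_iff.1 hqΓ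
  have hs₁0 : 0 ≤ s₁ := hδ.le.trans hs₁.1
  set i₁ := ⌊s₁⌋₊ with hi₁
  have hi := exists_half hs₁0
  change s₁ ∈ Ico (i₁ : ℝ) (i₁ + 1) at hi
  have hiN : i₁ + 2 ≤ 2 * N := half_lt hi.1 (by linarith [hs₁.2])
  rw [curve0_eq_halfSheet hl (Ico_subset_Icc_self hi)] at hdist
  set μ := q.2 with hμ
  set μ₁ := halfMu i₁ s₁ with hμ₁
  have hμ₁01 : μ₁ ∈ Icc (0 : ℝ) 1 := by
    have := (halfMu_mem_Icc (i := i₁) (s := s₁) (η := 0)).2 (by simpa using Ico_subset_Icc_self hi)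
    simpa using this
  have hμ01 : μ ∈ Icc (0 : ℝ) 1 := ⟨ht0.le.trans hqμ.1, by linarith [hqμ.2]⟩
  have hdμ : |μ - μ₁| < t := lt_of_le_of_lt (le_max_right _ _) hdist
  have hdx := lt_of_le_of_lt (le_max_left _ _) hdist
  have hdr : ∀ k, |q.1.1 k - (halfSheet N rm rp om0 i₁ s₁).1.1 k| < t := fun k =>
    (dist_pi_lt_iff ht0).1 (lt_of_le_of_lt (le_max_left _ _) hdx) k
  have hdφ : ∀ k, |q.1.2.1 k| ≤ 1 := by
    intro k
    have h1 := (dist_pi_lt_iff ht0).1 (lt_of_le_of_lt (le_max_left _ _)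
      (lt_of_le_of_lt (le_max_right _ _) hdx)) k
    change |q.1.2.1 k - 0| < t at h1
    rw [sub_zero] at h1
    linarith
  obtain ⟨g1, g2, g3, g4⟩ := hsep t ⟨ht0, htd⟩ μ hqμ μ₁ hμ₁01 hdμ
  have hrm := hl.rm_le_rp hμ01
  have hrm₁ := hl.rm_le_rp hμ₁01
  have hpat : ∀ k : Fin N, (halfSheet N rm rp om0 i₁ s₁).1.1 k = if (k : ℕ) < i₁ / 2 then rp μ₁
      else if (k : ℕ) = i₁ / 2 then halfRoot rm rp i₁ μ₁ else 0 := by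
    intro k
    simp only [halfSheet, pattern]
    split_ifs <;> first | rfl | omega
  have hroot₁ : halfRoot rm rp i₁ μ₁ = rm μ₁ ∨ halfRoot rm rp i₁ μ₁ = rp μ₁ := by
    unfold halfRoot; split_ifs <;> simp
  have hbd : ∀ k, |q.1.1 k| ≤ M₀ + 1 := by
    intro k
    have h1 := abs_lt.1 (hdr k)
    have h2 : 0 ≤ (halfSheet N rm rp om0 i₁ s₁).1.1 k ∧
        (halfSheet N rm rp om0 i₁ s₁).1.1 k ≤ M₀ := by
      have h3 := hM₀' μ₁ hμ₁01
      rw [hpat]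
      split_ifs
      · exact ⟨hrm₁.1.trans hrm₁.2, h3⟩
      · rcases hroot₁ with h | h <;> rw [h]
        · exact ⟨hrm₁.1, hrm₁.2.trans h3⟩
        · exact ⟨hrm₁.1.trans hrm₁.2, h3⟩
      · exact ⟨le_rfl, hM0⟩
    rw [abs_le]
    constructor <;> linarith [h1.1, h1.2, h2.1, h2.2]
  have hnear : ∀ k, |q.1.1 k| < κ' ∨ |(|q.1.1 k| - rm μ)| < κ' ∨ |(|q.1.1 k| - rp μ)| < κ' := by
    intro k
    refine hroot μ hqμ _ (hbd k) ?_
    have h1 := ((mem_solutions_iff _ _ _ _ _).1 hq k k.2).1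
    unfold realPart at h1
    rw [amp_succ] at h1
    have h2 : lam (q.1.1 k) μ * q.1.1 k = -(e * coupling b q.1 k) := by linarith
    rw [h2, abs_neg, abs_mul, abs_of_pos he.1]
    have h3 := abs_coupling_le (b := b) (x := q.1) (by linarith : (0 : ℝ) ≤ M₀ + 1) hbd k
    have h4 := (lt_div_iff₀ (by positivity : (0 : ℝ) < 4 * (M₀ + 1))).1 he.2
    exact lt_of_le_of_lt (mul_le_mul_of_nonneg_left h3 he.1.le) h4
  have hκt : κ' ≤ t := min_le_right _ _
  have hκκ : κ' ≤ κ := min_le_left _ _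
  have hP : ∀ k, |q.1.1 k - rp μ₁| < t → |q.1.1 k - rp μ| < κ := by
    intro k hk
    have hk' := abs_lt.1 hk
    have hpos : 0 < q.1.1 k := by linarith [hk'.1]
    have h1 := hnear k
    rw [abs_of_pos hpos] at h1
    rcases h1 with h | h | h
    · linarith [hk'.1]
    · have := abs_lt.1 h; linarith [hk'.1, this.2]
    · exact h.trans_le hκκ
  have hZ : ∀ k, |q.1.1 k| < t → |q.1.1 k| < κ := by
    intro k hk
    rcases hnear k with h | h | h
    · exact h.trans_le hκκ
    · have := abs_lt.1 h; linarith [this.1]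
    · have := abs_lt.1 h; linarith [this.1, hrm.2]
  have hR : ∀ k, |q.1.1 k - rm μ₁| < t →
      |q.1.1 k - rm μ| < κ ∨ |q.1.1 k| < κ ∧ rm μ₁ < 2 * t := by
    intro k hk
    have hk' := abs_lt.1 hk
    rcases hnear k with h | h | h
    · refine Or.inr ⟨h.trans_le hκκ, ?_⟩
      have := abs_lt.1 h
      linarith [hk'.1, this.2]
    · left
      have h2 := abs_lt.1 h
      rcases abs_cases (q.1.1 k) with ⟨h3, -⟩ | ⟨h3, -⟩
      · rw [h3] at h; exact h.trans_le hκκ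
      · rw [h3] at h2; linarith [hk'.1, h2.1, hrm₁.1]
    · have h2 := abs_lt.1 h
      rcases abs_cases (q.1.1 k) with ⟨h3, -⟩ | ⟨h3, -⟩
      · rw [h3] at h2; linarith [hk'.2, h2.1]
      · rw [h3] at h2; linarith [hk'.1, h2.1, hrm₁.1, hrm.2]
  have hsame : ∃ s ∈ Icc (δ - t) (2 * N - 1 - δ + t), halfMu i₁ s = μ := by
    obtain ⟨s, hs⟩ := exists_halfMu_eq i₁ μ
    refine ⟨s, ?_, hs⟩
    have h1 : |s - s₁| < t := by rw [← abs_halfMu_sub (i := i₁), hs]; exact hdμ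
    have h2 := abs_lt.1 h1
    exact ⟨by linarith [hs₁.1, h2.1], by linarith [hs₁.2, h2.2]⟩
  have hclose : ∀ r : ℝ, (∀ k : Fin N, (k : ℕ) = i₁ / 2 → |q.1.1 k - r| < κ) →
      dist q.1.1 (pattern N om0 (i₁ / 2 + 1) (rp μ) r μ).1.1 < κ := by
    intro r hr
    refine (dist_pi_lt_iff hκ).2 fun k => ?_
    have hk := hdr k
    rw [hpat] at hk
    change |q.1.1 k - if (k : ℕ) + 1 < i₁ / 2 + 1 then rp μ
      else if (k : ℕ) + 1 = i₁ / 2 + 1 then r else 0| < κ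
    rcases lt_trichotomy (k : ℕ) (i₁ / 2) with h | h | h
    · rw [if_pos h] at hk
      rw [if_pos (by omega)]
      exact hP k hk
    · rw [if_neg (by omega), if_pos (by omega)]
      exact hr k h
    · rw [if_neg (by omega), if_neg (by omega), sub_zero] at hk ⊢
      exact hZ k hk
  obtain ⟨k₁, hk₁⟩ := Nat.even_or_odd' i₁
  have hmid : ∀ k : Fin N, (k : ℕ) = i₁ / 2 → |q.1.1 k - halfRoot rm rp i₁ μ₁| < t := by
    intro k hk
    have := hdr k
    rwa [hpat, if_neg (by omega), if_pos hk] at this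
  rcases hk₁ with hk₁ | hk₁
  · have hrt : halfRoot rm rp i₁ = rm := by rw [hk₁, halfRoot_even]
    rw [hrt] at hmid
    have hk₁N : k₁ < N := by omega
    rcases hR ⟨k₁, hk₁N⟩ (hmid _ (by simp only; omega)) with h | ⟨h, hsmall⟩
    · obtain ⟨s, hs, hsμ⟩ := hsame
      refine ⟨i₁, s, hiN, hs, hsμ, ?_, hdφ⟩
      rw [halfSheet, hsμ, hrt]
      refine hclose _ fun k hk => ?_
      have : k = ⟨k₁, hk₁N⟩ := Fin.ext (by simp only; omega)
      rw [this]; exact h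
    -- Near a pitchfork the last node of the nearby pattern may be so small that the solution has it
    -- switched off. The solution then belongs to the upper half of the preceding sheet. The first
    -- sheet is excluded, since there `μ₁ = s₁ ≥ δ` keeps `rm μ₁` above `2 t`.
    · obtain ⟨k₂, rfl⟩ : ∃ k₂, k₁ = k₂ + 1 := by
        refine Nat.exists_eq_succ_of_ne_zero fun h0 => ?_
        rw [h0] at hk₁
        have : μ₁ = s₁ := by
          rw [hμ₁, hk₁, halfMu_even]; simp
        exact absurd hsmall (not_lt.2 (g4 (by rw [this]; exact hs₁.1)).le)
      have hodd : halfMu (2 * k₂ + 1) (2 * k₂ + 2 - μ) = μ := by rw [halfMu_odd]; ring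
      refine ⟨2 * k₂ + 1, 2 * k₂ + 2 - μ, by omega, ?_, hodd, ?_, hdφ⟩
      · have h1 : (i₁ : ℝ) = 2 * k₂ + 2 := by rw [hk₁]; push_cast; ring
        have h2 : (0 : ℝ) ≤ k₂ := by positivity
        have h3 := hi.1
        constructor
        · linarith [hqμ.2]
        · linarith [hqμ.1, hs₁.2]
      · rw [halfSheet, hodd, halfRoot_odd]
        have e1 : (2 * k₂ + 1) / 2 = k₂ := by omega
        have e2 : i₁ / 2 + 1 = (k₂ + 1) + 1 := by omega
        rw [e1, ← pattern_self, ← e2]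
        refine hclose 0 fun k hk => ?_
        have : k = ⟨k₂ + 1, hk₁N⟩ := Fin.ext (by simp only; omega)
        rw [this, sub_zero]; exact h
  · have hrt : halfRoot rm rp i₁ = rp := by rw [hk₁, halfRoot_odd]
    rw [hrt] at hmid
    obtain ⟨s, hs, hsμ⟩ := hsame
    refine ⟨i₁, s, hiN, hs, hsμ, ?_, hdφ⟩
    rw [halfSheet, hsμ, hrt]
    exact hclose _ fun k hk => hP k (hmid k hk)

end

/-! ### Uniform estimates by compactness; local structure of the solution set; fold families -/

section

theorem exists_uniform_close {E : Type*} [PseudoMetricSpace E] {W : Set (ℝ × ℝ)} (hW : IsOpen W) {h : ℝ × ℝ → E}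
    (hh : ContinuousOn h W) {K : Set ℝ} (hK : IsCompact K) (hKW : K ×ˢ {(0 : ℝ)} ⊆ W) {κ : ℝ}
    (hκ : 0 < κ) : ∃ ε₂ > 0, ∀ e ∈ Ioo 0 ε₂, ∀ s ∈ K, (s, e) ∈ W ∧
      dist (h (s, e)) (h (s, 0)) < κ := by
  obtain ⟨ε₀, hε₀, hsub⟩ := exists_Ico_subset hK hW hKW
  have hsub' : K ×ˢ Icc 0 (ε₀ / 2) ⊆ W := fun p hp => hsub ⟨hp.1, hp.2.1, by linarith [hp.2.2]⟩
  obtain ⟨d, hd, hu⟩ := Metric.uniformContinuousOn_iff.1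
    ((hK.prod isCompact_Icc).uniformContinuousOn_of_continuous (hh.mono hsub')) κ hκ
  refine ⟨min (ε₀ / 2) d, by positivity, fun e he s hs => ?_⟩
  have h1 : e < ε₀ / 2 := he.2.trans_le (min_le_left _ _)
  have h2 : e < d := he.2.trans_le (min_le_right _ _)
  have hm : (s, e) ∈ K ×ˢ Icc 0 (ε₀ / 2) := ⟨hs, he.1.le, h1.le⟩
  refine ⟨hsub' hm, hu _ hm _ ⟨hs, le_rfl, by positivity⟩ ?_⟩
  rw [Prod.dist_eq, dist_self, Real.dist_eq, sub_zero, abs_of_pos he.1]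
  exact max_lt hd h2

/-- On the compact set of pairs at distance at least `τ` the distance of the images is positive,
hence bounded below. -/
theorem exists_modulus_of_injOn {E : Type*} [MetricSpace E] {K : Set ℝ} (hK : IsCompact K) {f : ℝ → E}
    (hf : ContinuousOn f K) (hinj : InjOn f K) {τ : ℝ} (hτ : 0 < τ) :
    ∃ κ > 0, ∀ s ∈ K, ∀ t ∈ K, dist (f s) (f t) < κ → |s - t| < τ := by
  set S : Set (ℝ × ℝ) := (K ×ˢ K) ∩ (fun p : ℝ × ℝ => |p.1 - p.2|) ⁻¹' Ici τ with hS
  have hSc : IsCompact S := (hK.prod hK).inter_right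
    (isClosed_Ici.preimage (by fun_prop : Continuous fun p : ℝ × ℝ => |p.1 - p.2|))
  have hc : ContinuousOn (fun p : ℝ × ℝ => dist (f p.1) (f p.2)) S :=
    continuous_dist.comp_continuousOn ((hf.comp continuousOn_fst fun p hp => hp.1.1).prodMk
      (hf.comp continuousOn_snd fun p hp => hp.1.2))
  obtain ⟨κ, hκ, hlow⟩ : ∃ κ > 0, ∀ p ∈ S, κ ≤ dist (f p.1) (f p.2) := by
    rcases S.eq_empty_or_nonempty with h | h
    · exact ⟨1, one_pos, fun x hx => by rw [h] at hx; exact hx.elim⟩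
    · obtain ⟨x₀, hx₀, hmin⟩ := hSc.exists_isMinOn h hc
      refine ⟨_, dist_pos.2 fun heq => ?_, fun x hx => hmin hx⟩
      have h1 := hinj hx₀.1.1 hx₀.1.2 heq
      have h2 : τ ≤ |x₀.1 - x₀.2| := hx₀.2
      rw [h1, sub_self, abs_zero] at h2
      linarith
  refine ⟨κ, hκ, fun s hs t ht hd => ?_⟩
  by_contra! hcon
  exact absurd (hlow (s, t) ⟨⟨hs, ht⟩, hcon⟩) (not_le.2 hd)

section Generic

variable {E F : Type*} [NormedAddCommGroup E] [NormedSpace ℝ E] [NormedAddCommGroup F]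
  [NormedSpace ℝ F]

/-- Derivatives in the first variable alone are again smooth functions of both variables, hence
continuous up to `ε = 0` when `W` contains that line. This is what carries `C^m` convergence. -/
theorem exists_iteratedDeriv_eq {W : Set (ℝ × ℝ)} (hW : IsOpen W) {h : ℝ × ℝ → E}
    (hh : ContDiffOn ℝ ∞ h W) (m : ℕ) : ∃ k : ℝ × ℝ → E, ContDiffOn ℝ ∞ k W ∧
      ∀ p ∈ W, iteratedDeriv m (fun t => h (t, p.2)) p.1 = k p := by
  induction m with
  | zero => exact ⟨h, hh, fun p _ => by simp⟩
  | succ m ih =>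
    obtain ⟨k, hk, hk'⟩ := ih
    refine ⟨fun p => fderiv ℝ k p (1, 0),
      (hk.fderiv_of_isOpen hW (by simp)).clm_apply contDiffOn_const, fun p hp => ?_⟩
    rw [iteratedDeriv_succ]
    have hc : Continuous fun t : ℝ => (t, p.2) := by fun_prop
    have h1 : iteratedDeriv m (fun t => h (t, p.2)) =ᶠ[𝓝 p.1] fun t => k (t, p.2) := by
      filter_upwards [hc.continuousAt.preimage_mem_nhds (hW.mem_nhds hp)] with t ht
      exact hk' (t, p.2) ht
    rw [h1.deriv_eq]
    have h2 : HasFDerivAt k (fderiv ℝ k p) (p.1, p.2) :=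
      ((hk.contDiffAt (hW.mem_nhds hp)).differentiableAt (by simp)).hasFDerivAt
    exact (h2.comp_hasDerivAt p.1 ((hasDerivAt_id p.1).prodMk (hasDerivAt_const p.1 p.2))).deriv

/-- A curve of zeros whose tangent spans the kernel contains all zeros nearby. -/
theorem eventually_mem_image_of_kernel [FiniteDimensional ℝ E] [FiniteDimensional ℝ F]
    (hdim : Module.finrank ℝ E = Module.finrank ℝ F + 1) {f : E → F} (hf : ContDiff ℝ ∞ f)
    {γ : ℝ → E} {s₀ : ℝ} (hγ : ContDiffAt ℝ ∞ γ s₀) {J : Set ℝ} (hJ : J ∈ 𝓝 s₀)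
    (hzero : ∀ᶠ s in 𝓝 s₀, f (γ s) = 0) (hne : deriv γ s₀ ≠ 0)
    (hker : ∀ v, fderiv ℝ f (γ s₀) v = 0 → ∃ a : ℝ, v = a • deriv γ s₀) :
    ∀ᶠ q in 𝓝 (γ s₀), f q = 0 → q ∈ γ '' J := by
  -- Adding a functional with `ℓ γ' = 1` makes `(f, ℓ)` a local diffeomorphism. Nearby zeros of `f`
  -- are then determined by their value of `ℓ`, and the curve attains every value of `ℓ` close to
  -- the one at `s₀`.
  obtain ⟨ℓ, hℓ⟩ := SeparatingDual.exists_eq_one (R := ℝ) hne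
  set Φ : E → F × ℝ := fun q => (f q, ℓ q) with hΦ
  have hΦs : ContDiff ℝ ∞ Φ := hf.prodMk ℓ.contDiff
  have hΦd : HasFDerivAt Φ ((fderiv ℝ f (γ s₀)).prod ℓ) (γ s₀) :=
    ((hf.differentiable (by simp) (γ s₀)).hasFDerivAt).prodMk ℓ.hasFDerivAt
  obtain ⟨G, -, -, -, hG⟩ := exists_smooth_local_inverse (f := Φ) (a := γ s₀)
    (by rw [hdim, Module.finrank_prod, Module.finrank_self]) hΦs.contDiffAt (by
      intro v hv
      rw [hΦd.fderiv] at hv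
      obtain ⟨a, rfl⟩ := hker v (congrArg Prod.fst hv)
      have h2 : ℓ (a • deriv γ s₀) = 0 := congrArg Prod.snd hv
      rw [map_smul, hℓ, smul_eq_mul, mul_one] at h2
      rw [h2, zero_smul])
  have hψ : HasStrictDerivAt (fun s => ℓ (γ s)) 1 s₀ := by
    have h1 := hγ.hasStrictDerivAt (by simp)
    have h2 := ℓ.hasStrictFDerivAt.comp_hasStrictDerivAt s₀ h1
    rwa [hℓ] at h2
  have hA : {s | s ∈ J ∧ f (γ s) = 0 ∧ G (Φ (γ s)) = γ s} ∈ 𝓝 s₀ :=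
    by filter_upwards [hJ, hzero, hγ.continuousAt.eventually hG] with s h1 h2 h3 using ⟨h1, h2, h3⟩
  have himg : (fun s => ℓ (γ s)) '' {s | s ∈ J ∧ f (γ s) = 0 ∧ G (Φ (γ s)) = γ s}
      ∈ 𝓝 (ℓ (γ s₀)) := by
    rw [← hψ.map_nhds_eq one_ne_zero]
    exact image_mem_map hA
  filter_upwards [ℓ.continuous.continuousAt.preimage_mem_nhds himg, hG] with q h1 h2 hq
  obtain ⟨s, ⟨hsJ, hs0, hsG⟩, hsℓ⟩ := h1
  refine ⟨s, hsJ, ?_⟩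
  rw [← hsG, ← h2]
  congr 1
  exact Prod.ext (hs0.trans hq.symm) hsℓ

end Generic

/-- `N` amplitudes, `N - 1` phases, the frequency and `μ` are `2N + 1` real unknowns for `2N` real
equations. -/
theorem finrank_unknowns {N : ℕ} (hN : 2 ≤ N) :
    Module.finrank ℝ (P N) = Module.finrank ℝ (Fin N → ℂ) + 1 := by
  rw [Module.finrank_prod, Module.finrank_prod, Module.finrank_prod,
    Module.finrank_pi_fintype (R := ℝ) (M := fun _ : Fin N => ℂ)]
  simp only [Module.finrank_fintype_fun_eq_card, Fintype.card_fin, Module.finrank_self,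
    Complex.finrank_real_complex, Finset.sum_const, Finset.card_univ, smul_eq_mul]
  omega

theorem exists_pos_le_of_lt (f : ℕ → ℝ) (hf : ∀ j, 0 < f j) (n : ℕ) :
    ∃ ε > 0, ∀ j < n, ε ≤ f j := by
  induction n with
  | zero => exact ⟨1, one_pos, fun j hj => absurd hj (by omega)⟩
  | succ n ih =>
    obtain ⟨ε, hε, h⟩ := ih
    refine ⟨min ε (f n), lt_min hε (hf n), fun j hj => ?_⟩
    rcases Nat.lt_succ_iff_lt_or_eq.1 hj with h1 | rfl
    · exact (min_le_left _ _).trans (h j h1)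
    · exact min_le_right _ _

variable {N : ℕ} {lam : ℝ → ℝ → ℝ} {om : ℝ → ℝ → ℝ → ℝ} {om0 : ℝ → ℝ}
  {om2 : ℝ → ℝ → ℝ → ℝ} {rm rp : ℝ → ℝ} {b : Site}

theorem FoldPiece.mono {α β σ₀ σ₁ η ε₁ ε₂ : ℝ} {Γ : ℝ × ℝ → P N}
    (h : FoldPiece lam om b α β σ₀ η ε₁ Γ) (hσ : σ₁ ≤ σ₀) (hε : ε₂ ≤ ε₁) :
    FoldPiece lam om b α β σ₁ η ε₂ Γ := by
  have h1 : Ioo (-σ₁) σ₁ ⊆ Ioo (-σ₀) σ₀ := Ioo_subset_Ioo (neg_le_neg hσ) hσ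
  have h2 : Ioo 0 ε₂ ⊆ Ioo 0 ε₁ := Ioo_subset_Ioo le_rfl hε
  refine ⟨h.smooth.mono (prod_mono h1 h2), fun e he σ hs => h.sol e (h2 he) σ (h1 hs),
    fun e he σ hs => h.deriv_ne e (h2 he) σ (h1 hs), fun e he σ hs => h.kernel e (h2 he) σ (h1 hs),
    fun e he => (h.injOn e (h2 he)).mono h1, fun e he σ hs => h.mu_outer e (h2 he) σ (h1 hs),
    fun e he σ hs => h.mu_inner e (h2 he) σ (h1 hs), fun e he => ?_⟩
  obtain ⟨σc, k1, k2, k3⟩ := h.crit e (h2 he)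
  exact ⟨σc, k1, k2, fun σ hs => k3 σ (h1 hs)⟩

theorem RegularPiece.mono {root : ℝ → ℝ} {m : ℕ} {η ε₀ ε₁ κ κ₁ : ℝ} {U : Set (ℝ × ℝ)}
    {Γ : ℝ × ℝ → P N} (h : RegularPiece lam om om0 rp root b m η ε₀ κ U Γ) (hε : ε₁ ≤ ε₀)
    (hκ : κ₁ ≤ κ) : RegularPiece lam om om0 rp root b m η ε₁ κ₁ U Γ :=
  ⟨h.isOpen, fun _ hp => h.subset ⟨hp.1, hp.2.1, hp.2.2.trans_le hε⟩, h.smooth, h.mu, h.zero,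
    h.sol, h.deriv_ne, h.kernel, fun e he q hq hμ hd hφ =>
      h.unique e ⟨he.1, he.2.trans_le hε⟩ q hq hμ (hd.trans_le hκ) hφ⟩

/-- The value of `μ` at the `j`-th fold. -/
def foldAlpha (j : ℕ) : ℝ := if Even j then 0 else 1

def foldBeta (j : ℕ) : ℝ := if Even j then 1 else -1

theorem fold_cases (j : ℕ) (t : ℝ) : foldAlpha j + foldBeta j * t = t ∨
    foldAlpha j + foldBeta j * t = 1 - t := by
  unfold foldAlpha foldBeta
  split_ifs
  · left; ring
  · right; ring

theorem halfMu_fold_right (j : ℕ) {σ : ℝ} (h : 0 ≤ σ) :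
    halfMu j (j + σ) = foldAlpha j + foldBeta j * |σ| := by
  unfold halfMu foldAlpha foldBeta
  rw [abs_of_nonneg h]
  split_ifs <;> ring

theorem halfMu_fold_left (j : ℕ) {σ : ℝ} (h : σ ≤ 0) :
    halfMu j (((j + 1 : ℕ) : ℝ) + σ) = foldAlpha (j + 1) + foldBeta (j + 1) * |σ| := by
  unfold halfMu foldAlpha foldBeta
  rw [abs_of_nonpos h]
  by_cases hj : Even j
  · have : ¬ Even (j + 1) := by rw [Nat.even_add_one]; exact not_not.2 hj
    rw [if_pos hj, if_neg this, if_neg this]; push_cast; ring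
  · have : Even (j + 1) := Nat.even_add_one.2 hj
    rw [if_neg hj, if_pos this, if_pos this]; push_cast; ring

/-- The solution branch near the `j`-th fold. -/
theorem exists_fold_family (hM : Model N lam om om0 om2) (hl : Bistable lam rm rp) (b : Site)
    (j : ℕ) : ∃ σ₀ > 0, ∃ Γ : ℝ × ℝ → P N, 1 ≤ j → j + 2 ≤ 2 * N →
      (∀ η ∈ Ioo 0 σ₀, ∃ ε₁ > 0, FoldPiece lam om b (foldAlpha j) (foldBeta j) σ₀ η ε₁ Γ) ∧
      ∀ κ > 0, ∃ ε₂ > 0, ∀ e ∈ Ioo 0 ε₂, ∀ σ ∈ Ioo (-σ₀) σ₀, |σ| ≤ 1 →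
        dist (Γ (σ, e)) (curve0 N rm rp om0 (j + σ)) < κ := by
  by_cases hj : 1 ≤ j ∧ j + 2 ≤ 2 * N
  swap
  -- Dummy data outside the range of folds, so that the families can be chosen for all `j` at once.
  · exact ⟨1, one_pos, fun _ => 0, fun h1 h2 => absurd ⟨h1, h2⟩ hj⟩
  obtain ⟨h1, h2⟩ := hj
  have hN := hM.two_le
  have hc := hM.om0_smooth.continuous
  obtain ⟨k, rfl | rfl⟩ := Nat.even_or_odd' j
  · obtain ⟨k, rfl⟩ : ∃ l, k = l + 1 := ⟨k - 1, by omega⟩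
    obtain ⟨zn, a, g, h₀, c₀, hF⟩ := exists_pitchfork_foldScaling (m := k + 2) hl hN hc b
      (by omega) (by omega)
    obtain ⟨σ₀, hσ₀, Γ, hΓ, hlim⟩ := hF.exists_branch hM
    refine ⟨σ₀, hσ₀, Γ, fun _ _ => ⟨?_, fun κ hκ => ?_⟩⟩
    · have e1 : foldAlpha (2 * (k + 1)) = 0 := if_pos (even_two_mul _)
      have e2 : foldBeta (2 * (k + 1)) = 1 := if_pos (even_two_mul _)
      rw [e1, e2]; exact hΓ
    · obtain ⟨ε₂, hε₂, h⟩ := hlim κ hκ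
      refine ⟨ε₂, hε₂, fun e he σ hσ hσ1 => ?_⟩
      have := curve0_eq_pitchforkLimit (N := N) (om0 := om0) hl k hσ1
      rw [show 2 * (k + 1) = 2 * k + 2 by ring, this]
      exact h e he σ hσ
  · obtain ⟨zn, a, g, h₀, c₀, hF⟩ := exists_saddleNode_foldScaling (m := k + 1) hl hN hc b
      (by omega) (by omega)
    obtain ⟨σ₀, hσ₀, Γ, hΓ, hlim⟩ := hF.exists_branch hM
    have hodd : ¬ Even (2 * k + 1) := Nat.not_even_iff_odd.2 (odd_two_mul_add_one k)
    refine ⟨σ₀, hσ₀, Γ, fun _ _ => ⟨?_, fun κ hκ => ?_⟩⟩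
    · have e1 : foldAlpha (2 * k + 1) = 1 := if_neg hodd
      have e2 : foldBeta (2 * k + 1) = -1 := if_neg hodd
      rw [e1, e2]; exact hΓ
    · obtain ⟨ε₂, hε₂, h⟩ := hlim κ hκ
      refine ⟨ε₂, hε₂, fun e he σ hσ hσ1 => ?_⟩
      rw [curve0_eq_saddleNodeLimit (N := N) (om0 := om0) hl k hσ1]
      exact h e he σ hσ

end

/-! ### Gluing the arcs into one branch -/

section

/-- Arcs of solutions near the folds and between them, for `0 < ε < ε₀`. -/
structure Atlas (N : ℕ) (lam : ℝ → ℝ → ℝ) (om : ℝ → ℝ → ℝ → ℝ) (om0 rm rp : ℝ → ℝ) (b : Site)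
    (δ t ε₀ κ : ℝ) (Γ R : ℕ → ℝ × ℝ → P N) (U : ℕ → Set (ℝ × ℝ)) : Prop where
  pos : 0 < t
  lt : 4 * t < δ
  lt_one : δ < 1
  kappa_le : κ ≤ t
  fold : ∀ j, 1 ≤ j → j + 2 ≤ 2 * N →
    FoldPiece lam om b (foldAlpha j) (foldBeta j) t (t / 2) ε₀ (Γ j)
  fold_close : ∀ j, 1 ≤ j → j + 2 ≤ 2 * N → ∀ e ∈ Ioo 0 ε₀, ∀ σ ∈ Ioo (-t) t,
    dist (Γ j (σ, e)) (curve0 N rm rp om0 (j + σ)) < κ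
  fold_tendsto : ∀ j, 1 ≤ j → j + 2 ≤ 2 * N → ∀ κ' > 0, ∃ ε₂ > 0, ∀ e ∈ Ioo 0 ε₂,
    ∀ σ ∈ Ioo (-t) t, dist (Γ j (σ, e)) (curve0 N rm rp om0 (j + σ)) < κ'
  regular : ∀ i, i + 2 ≤ 2 * N →
    RegularPiece lam om om0 rp (halfRoot rm rp i) b (i / 2 + 1) (t / 2) ε₀ κ (U i) (R i)
  regular_close : ∀ i, i + 2 ≤ 2 * N → ∀ e ∈ Ioo 0 ε₀, ∀ μ ∈ Icc (t / 2) (1 - t / 2),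
    dist (R i (μ, e)) (R i (μ, 0)) < κ
  modulus : ∀ s ∈ Icc (δ / 2) (2 * N - 1 - δ / 2), ∀ u ∈ Icc (δ / 2) (2 * N - 1 - δ / 2),
    dist (curve0 N rm rp om0 s) (curve0 N rm rp om0 u) < 2 * κ → |s - u| < t / 4
  near : ∀ e ∈ Ioo 0 ε₀, ∀ q ∈ solutions (N := N) lam om b e, q.2 ∈ Icc t (1 - t) →
    q ∈ Metric.thickening t (curve0 N rm rp om0 '' Icc δ (2 * N - 1 - δ)) →
    ∃ (i : ℕ) (s : ℝ), i + 2 ≤ 2 * N ∧ s ∈ Icc (δ - t) (2 * N - 1 - δ + t) ∧ halfMu i s = q.2 ∧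
      dist q.1.1 (halfSheet N rm rp om0 i s).1.1 < κ ∧ ∀ k, |q.1.2.1 k| ≤ 1

/-- The branch obtained from the arcs. -/
def glue {N : ℕ} (t : ℝ) (Γ R : ℕ → ℝ × ℝ → P N) (e s : ℝ) : P N :=
  if 1 ≤ ⌊s + 1 / 2⌋₊ ∧ ⌊s + 1 / 2⌋₊ + 2 ≤ 2 * N ∧ |s - ⌊s + 1 / 2⌋₊| < t
  then Γ ⌊s + 1 / 2⌋₊ (s - ⌊s + 1 / 2⌋₊, e)
  else R ⌊s⌋₊ (halfMu ⌊s⌋₊ s, e)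

theorem contDiff_halfMu (i : ℕ) : ContDiff ℝ ∞ (halfMu i) := by
  unfold halfMu
  split_ifs
  · exact contDiff_id.sub contDiff_const
  · exact contDiff_const.sub contDiff_id

theorem deriv_comp_halfMu {E : Type*} [NormedAddCommGroup E] [NormedSpace ℝ E] (i : ℕ)
    (f : ℝ → E) : ∃ c : ℝ, c ≠ 0 ∧ ∀ s, deriv (fun τ => f (halfMu i τ)) s
      = c • deriv f (halfMu i s) := by
  unfold halfMu
  split_ifs
  · exact ⟨1, one_ne_zero, fun s => by rw [one_smul, deriv_comp_sub_const]⟩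
  · exact ⟨-1, by norm_num, fun s => by rw [neg_one_smul, deriv_comp_const_sub]⟩

namespace Atlas

variable {N : ℕ} {lam : ℝ → ℝ → ℝ} {om : ℝ → ℝ → ℝ → ℝ} {om0 : ℝ → ℝ}
  {om2 : ℝ → ℝ → ℝ → ℝ} {rm rp : ℝ → ℝ} {b : Site} {δ t ε₀ κ : ℝ} {Γ R : ℕ → ℝ × ℝ → P N}
  {U : ℕ → Set (ℝ × ℝ)}

/-- The margin `3 t / 4` lies between `t / 2`, from which on the regular arcs are used, and `t`, up
to which the fold arcs are. Each point thus keeps a distance of at least `t / 4` from the ends of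
its chart. The integers `0` and `2N - 1` need no fold arc because `δ / 2 > 2 t`. -/
theorem chart (hA : Atlas N lam om om0 rm rp b δ t ε₀ κ Γ R U) {s : ℝ}
    (hs : s ∈ Ioo (δ / 2) (2 * N - 1 - δ / 2)) :
    (∃ j : ℕ, 1 ≤ j ∧ j + 2 ≤ 2 * N ∧ |s - j| < 3 * t / 4) ∨
      ∃ i : ℕ, i + 2 ≤ 2 * N ∧ s ∈ Icc (i + 3 * t / 4) (i + 1 - 3 * t / 4) := by
  have h1 := hA.pos
  have h2 := hA.lt
  have h3 := hA.lt_one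
  have hi := exists_half (s := s) (by linarith [hs.1])
  set i := ⌊s⌋₊
  have hiN : i + 2 ≤ 2 * N := half_lt hi.1 (by linarith [hs.2])
  rcases lt_or_ge s (i + 3 * t / 4) with h | h
  · left
    refine ⟨i, ?_, hiN, abs_lt.2 ⟨by linarith [hi.1], by linarith⟩⟩
    by_contra! h0
    have : i = 0 := by omega
    rw [this] at h
    push_cast at h
    linarith [hs.1]
  · rcases lt_or_ge (i + 1 - 3 * t / 4) s with h' | h'
    · left
      refine ⟨i + 1, by omega, ?_, abs_lt.2 ⟨?_, ?_⟩⟩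
      · by_contra! h0
        have : i + 2 = 2 * N := by omega
        have h4 : (i : ℝ) + 2 = 2 * N := by exact_mod_cast this
        linarith [hs.2]
      · push_cast; linarith
      · push_cast; linarith [hi.2]
    · exact Or.inr ⟨i, hiN, h, h'⟩

theorem glue_fold (hA : Atlas N lam om om0 rm rp b δ t ε₀ κ Γ R U) {j : ℕ} (h1 : 1 ≤ j)
    (h2 : j + 2 ≤ 2 * N) (e : ℝ) {s : ℝ} (hs : |s - j| < t) :
    glue t Γ R e s = Γ j (s - j, e) := by
  have h3 := hA.pos
  have h4 := hA.lt
  have h5 := hA.lt_one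
  have h6 := abs_lt.1 hs
  have hj : ⌊s + 1 / 2⌋₊ = j := by
    rw [Nat.floor_eq_iff (by have : (0 : ℝ) ≤ j := by positivity
                             linarith)]
    constructor <;> linarith
  rw [glue, hj, if_pos ⟨h1, h2, hs⟩]

/-- The arcs agree where they overlap. -/
theorem agree (hA : Atlas N lam om om0 rm rp b δ t ε₀ κ Γ R U) (hl : Bistable lam rm rp)
    {j i : ℕ} (h1 : 1 ≤ j) (h2 : j + 2 ≤ 2 * N) (hi : i + 2 ≤ 2 * N) {e : ℝ} (he : e ∈ Ioo 0 ε₀)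
    {s : ℝ} (hs : |s - j| < t) (hsi : s ∈ Icc (i + t / 2) (i + 1 - t / 2)) :
    Γ j (s - j, e) = R i (halfMu i s, e) := by
  have h3 := hA.pos
  have h4 := hA.lt
  have h5 := hA.lt_one
  have h6 := abs_lt.1 hs
  have hsi' : s ∈ Icc (i : ℝ) (i + 1) := ⟨by linarith [hsi.1], by linarith [hsi.2]⟩
  have hij : j = i ∨ j = i + 1 := by
    have k1 : (j : ℝ) < i + 2 := by linarith [hsi.2]
    have k2 : (i : ℝ) < j + 1 := by linarith [hsi.1]
    have k3 : j < i + 2 := by exact_mod_cast k1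
    have k4 : i < j + 1 := by exact_mod_cast k2
    omega
  set σ := s - j with hσ
  have hσm : σ ∈ Ioo (-t) t := h6
  have hF := hA.fold j h1 h2
  have hR := hA.regular i hi
  have key : halfMu i s = foldAlpha j + foldBeta j * |σ| ∧ t / 2 ≤ |σ| := by
    rcases hij with rfl | rfl
    · have hp : 0 ≤ σ := by linarith [hsi'.1]
      have := halfMu_fold_right j hp
      rw [hσ, add_sub_cancel] at this
      exact ⟨this, by rw [abs_of_nonneg hp]; linarith [hsi.1]⟩
    · have hp : σ ≤ 0 := by rw [hσ]; push_cast; linarith [hsi'.2]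
      have := halfMu_fold_left i hp
      rw [hσ, add_sub_cancel] at this
      refine ⟨this, ?_⟩
      rw [abs_of_nonpos hp, hσ]; push_cast; linarith [hsi.2]
  have hμ := hF.mu_outer e he σ hσm key.2
  rw [← key.1] at hμ
  have hc := hA.fold_close j h1 h2 e he σ hσm
  rw [show (j : ℝ) + σ = s by rw [hσ]; ring, curve0_eq_halfSheet hl hsi', halfSheet, ← hμ] at hc
  -- On the overlap the fold arc has `|σ| ≥ t / 2`, hence the same `μ` as the unperturbed curve, and
  -- it is close to that curve. Uniqueness in the regular piece identifies the two arcs.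
  have hu := hR.unique e he _ (hF.sol e he σ hσm) (by rw [hμ]; exact halfMu_mem_Icc.2 hsi)
    (lt_of_le_of_lt (le_max_left _ _) (lt_of_le_of_lt (le_max_left _ _) hc)) (by
      intro k
      have hpos : 0 < κ := lt_of_le_of_lt dist_nonneg hc
      have k1 := (dist_pi_lt_iff hpos).1 (lt_of_le_of_lt (le_max_left _ _) (lt_of_le_of_lt
        (le_max_right _ _) (lt_of_le_of_lt (le_max_left _ _) hc))) k
      change |_ - (0 : ℝ)| < κ at k1
      rw [sub_zero] at k1
      linarith [hA.kappa_le])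
  rw [hu, hμ]

theorem glue_regular (hA : Atlas N lam om om0 rm rp b δ t ε₀ κ Γ R U) (hl : Bistable lam rm rp)
    {i : ℕ} (hi : i + 2 ≤ 2 * N) {e : ℝ} (he : e ∈ Ioo 0 ε₀) {s : ℝ}
    (hs : s ∈ Icc (i + t / 2) (i + 1 - t / 2)) : glue t Γ R e s = R i (halfMu i s, e) := by
  have h3 := hA.pos
  have hfl : ⌊s⌋₊ = i := by
    have : (0 : ℝ) ≤ i := by positivity
    rw [Nat.floor_eq_iff (by linarith [hs.1])]
    constructor <;> linarith [hs.1, hs.2]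
  rw [glue, hfl]
  split_ifs with h
  · exact hA.agree hl h.1 h.2.1 hi he h.2.2 hs
  · rfl

theorem close (hA : Atlas N lam om om0 rm rp b δ t ε₀ κ Γ R U) (hl : Bistable lam rm rp) {e : ℝ}
    (he : e ∈ Ioo 0 ε₀) {s : ℝ} (hs : s ∈ Ioo (δ / 2) (2 * N - 1 - δ / 2)) :
    dist (glue t Γ R e s) (curve0 N rm rp om0 s) < κ := by
  have h3 := hA.pos
  rcases hA.chart hs with ⟨j, h1, h2, h⟩ | ⟨i, hi, h⟩
  · have h' : |s - j| < t := by linarith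
    rw [hA.glue_fold h1 h2 e h']
    have := hA.fold_close j h1 h2 e he (s - j) (abs_lt.1 h')
    rwa [add_sub_cancel] at this
  · have h' : s ∈ Icc (i + t / 2) (i + 1 - t / 2) := ⟨by linarith [h.1], by linarith [h.2]⟩
    rw [hA.glue_regular hl hi he h', curve0_eq_halfSheet hl (i := i)
      ⟨by linarith [h.1], by linarith [h.2]⟩, halfSheet,
      ← (hA.regular i hi).zero _ (halfMu_mem_Icc.2 h')]
    exact hA.regular_close i hi e he _ (halfMu_mem_Icc.2 h')

/-- If two points of the branch coincide, their unperturbed points are within `2 κ`, so the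
positions differ by less than `t / 4`. Both then lie in one chart, where the arc is injective. -/
theorem injOn_glue (hA : Atlas N lam om om0 rm rp b δ t ε₀ κ Γ R U) (hl : Bistable lam rm rp)
    {e : ℝ} (he : e ∈ Ioo 0 ε₀) : InjOn (glue t Γ R e) (Ioo (δ / 2) (2 * N - 1 - δ / 2)) := by
  intro s hs u hu heq
  have h3 := hA.pos
  have hd : dist (curve0 N rm rp om0 s) (curve0 N rm rp om0 u) < 2 * κ := by
    have k1 := hA.close hl he hs
    have k2 := hA.close hl he hu
    rw [← heq] at k2
    have k3 := dist_triangle_left (curve0 N rm rp om0 s) (curve0 N rm rp om0 u) (glue t Γ R e s)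
    linarith
  have hsu := abs_lt.1 (hA.modulus s (Ioo_subset_Icc_self hs) u (Ioo_subset_Icc_self hu) hd)
  rcases hA.chart hs with ⟨j, h1, h2, h⟩ | ⟨i, hi, h⟩
  · have h' := abs_lt.1 h
    have hs' : |s - j| < t := by linarith
    have hu' : |u - j| < t := abs_lt.2 ⟨by linarith, by linarith⟩
    rw [hA.glue_fold h1 h2 e hs', hA.glue_fold h1 h2 e hu'] at heq
    have := (hA.fold j h1 h2).injOn e he (abs_lt.1 hs') (abs_lt.1 hu') heq
    linarith
  · have hs' : s ∈ Icc (i + t / 2) (i + 1 - t / 2) := ⟨by linarith [h.1], by linarith [h.2]⟩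
    have hu' : u ∈ Icc (i + t / 2) (i + 1 - t / 2) := ⟨by linarith [h.1], by linarith [h.2]⟩
    rw [hA.glue_regular hl hi he hs', hA.glue_regular hl hi he hu'] at heq
    have h4 := congrArg Prod.snd heq
    rw [(hA.regular i hi).mu, (hA.regular i hi).mu] at h4
    exact halfMu_inj h4

theorem local_fold (hA : Atlas N lam om om0 rm rp b δ t ε₀ κ Γ R U) {j : ℕ} (h1 : 1 ≤ j)
    (h2 : j + 2 ≤ 2 * N) {e : ℝ} (he : e ∈ Ioo 0 ε₀) {s : ℝ} (hs : |s - j| < t) :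
    ContDiffAt ℝ ∞ (fun q : ℝ × ℝ => glue t Γ R q.1 q.2) (e, s) ∧
    glue t Γ R e s ∈ solutions lam om b e ∧ deriv (glue t Γ R e) s ≠ 0 ∧
    ∀ v : P N, fderiv ℝ (fun p : P N => system lam om b e p.1 p.2) (glue t Γ R e s) v = 0 →
      ∃ a : ℝ, v = a • deriv (glue t Γ R e) s := by
  have hF := hA.fold j h1 h2
  have hσ : s - j ∈ Ioo (-t) t := abs_lt.1 hs
  have hev : ∀ᶠ u : ℝ in 𝓝 s, |u - j| < t :=
    (by fun_prop : Continuous fun u : ℝ => |u - j|).continuousAt.eventually (gt_mem_nhds hs)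
  have hd : deriv (glue t Γ R e) s = deriv (fun τ => Γ j (τ, e)) (s - j) := by
    have : glue t Γ R e =ᶠ[𝓝 s] fun u => Γ j (u - j, e) := by
      filter_upwards [hev] with u hu using hA.glue_fold h1 h2 e hu
    rw [this.deriv_eq]
    exact deriv_comp_sub_const (f := fun τ => Γ j (τ, e)) _ _
  refine ⟨?_, ?_, ?_, ?_⟩
  · have h3 : ContDiffAt ℝ ∞ (fun q : ℝ × ℝ => Γ j (q.2 - j, q.1)) (e, s) := by
      have h4 : ContDiffAt ℝ ∞ (Γ j) (s - j, e) :=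
        hF.smooth.contDiffAt ((isOpen_Ioo.prod isOpen_Ioo).mem_nhds ⟨hσ, he⟩)
      exact ContDiffAt.comp (g := Γ j) (e, s) h4
        ((contDiffAt_snd.sub contDiffAt_const).prodMk contDiffAt_fst)
    refine h3.congr_of_eventuallyEq ?_
    filter_upwards [continuousAt_snd.eventually hev] with q hq using hA.glue_fold h1 h2 q.1 hq
  · rw [hA.glue_fold h1 h2 e hs]; exact hF.sol e he _ hσ
  · rw [hd]; exact hF.deriv_ne e he _ hσ
  · rw [hd, hA.glue_fold h1 h2 e hs]; exact hF.kernel e he _ hσ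

theorem local_regular (hA : Atlas N lam om om0 rm rp b δ t ε₀ κ Γ R U) (hl : Bistable lam rm rp)
    {i : ℕ} (hi : i + 2 ≤ 2 * N) {e : ℝ} (he : e ∈ Ioo 0 ε₀) {s : ℝ}
    (hs : s ∈ Ioo (i + t / 2) (i + 1 - t / 2)) :
    ContDiffAt ℝ ∞ (fun q : ℝ × ℝ => glue t Γ R q.1 q.2) (e, s) ∧
    glue t Γ R e s ∈ solutions lam om b e ∧ deriv (glue t Γ R e) s ≠ 0 ∧
    ∀ v : P N, fderiv ℝ (fun p : P N => system lam om b e p.1 p.2) (glue t Γ R e s) v = 0 →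
      ∃ a : ℝ, v = a • deriv (glue t Γ R e) s := by
  have hR := hA.regular i hi
  have hU : (halfMu i s, e) ∈ U i :=
    hR.subset ⟨halfMu_mem_Icc.2 (Ioo_subset_Icc_self hs), he.1.le, he.2⟩
  obtain ⟨c, hc, hcd⟩ := deriv_comp_halfMu i (fun μ => R i (μ, e))
  have hd : deriv (glue t Γ R e) s = c • deriv (fun μ => R i (μ, e)) (halfMu i s) := by
    have : glue t Γ R e =ᶠ[𝓝 s] fun u => R i (halfMu i u, e) := by
      filter_upwards [isOpen_Ioo.mem_nhds hs] with u hu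
      exact hA.glue_regular hl hi he (Ioo_subset_Icc_self hu)
    rw [this.deriv_eq, hcd]
  have hg := hA.glue_regular hl hi he (Ioo_subset_Icc_self hs)
  refine ⟨?_, ?_, ?_, fun v hv => ?_⟩
  · have h3 : ContDiffAt ℝ ∞ (fun q : ℝ × ℝ => R i (halfMu i q.2, q.1)) (e, s) := by
      have h4 : ContDiffAt ℝ ∞ (R i) (halfMu i s, e) := hR.smooth.contDiffAt (hR.isOpen.mem_nhds hU)
      exact ContDiffAt.comp (g := R i) (e, s) h4
        (((contDiff_halfMu i).contDiffAt.comp (e, s) contDiffAt_snd).prodMk contDiffAt_fst)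
    refine h3.congr_of_eventuallyEq ?_
    filter_upwards [continuousAt_fst.eventually (isOpen_Ioo.mem_nhds he),
      continuousAt_snd.eventually (isOpen_Ioo.mem_nhds hs)] with q hq1 hq2
    exact hA.glue_regular hl hi hq1 (Ioo_subset_Icc_self hq2)
  · rw [hg]; exact hR.sol _ hU he.1.ne'
  · rw [hd]; exact smul_ne_zero hc (hR.deriv_ne _ hU he.1.ne')
  · rw [hg] at hv
    obtain ⟨a, ha⟩ := hR.kernel _ hU he.1.ne' v hv
    refine ⟨a * c⁻¹, ?_⟩
    rw [hd, smul_smul, mul_assoc, inv_mul_cancel₀ hc, mul_one]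
    exact ha

theorem local_properties (hA : Atlas N lam om om0 rm rp b δ t ε₀ κ Γ R U) (hl : Bistable lam rm rp)
    {e : ℝ} (he : e ∈ Ioo 0 ε₀) {s : ℝ} (hs : s ∈ Ioo (δ / 2) (2 * N - 1 - δ / 2)) :
    ContDiffAt ℝ ∞ (fun q : ℝ × ℝ => glue t Γ R q.1 q.2) (e, s) ∧
    glue t Γ R e s ∈ solutions lam om b e ∧ deriv (glue t Γ R e) s ≠ 0 ∧
    ∀ v : P N, fderiv ℝ (fun p : P N => system lam om b e p.1 p.2) (glue t Γ R e s) v = 0 →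
      ∃ a : ℝ, v = a • deriv (glue t Γ R e) s := by
  have h3 := hA.pos
  rcases hA.chart hs with ⟨j, h1, h2, h⟩ | ⟨i, hi, h⟩
  · exact hA.local_fold h1 h2 he (by linarith)
  · exact hA.local_regular hl hi he ⟨by linarith [h.1], by linarith [h.2]⟩

theorem contDiffAt_glue (hA : Atlas N lam om om0 rm rp b δ t ε₀ κ Γ R U) (hl : Bistable lam rm rp)
    {e : ℝ} (he : e ∈ Ioo 0 ε₀) {s : ℝ} (hs : s ∈ Ioo (δ / 2) (2 * N - 1 - δ / 2)) :
    ContDiffAt ℝ ∞ (glue t Γ R e) s :=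
  ContDiffAt.comp (g := fun q : ℝ × ℝ => glue t Γ R q.1 q.2) s (hA.local_properties hl he hs).1
    (contDiffAt_const.prodMk contDiffAt_id)

theorem fold_mem_walls {j : ℕ} {p : P N} {τ : ℝ} (hτ : τ ∈ Ico 0 t) (ht : t < 1)
    (hp : p.2 = foldAlpha j + foldBeta j * τ) : p ∈ nbhd t (walls N) := by
  rw [mem_nbhd_walls, hp]
  rcases fold_cases j τ with h | h
  · rw [h]; exact ⟨⟨hτ.1, by linarith [hτ.2]⟩, Or.inl hτ.2⟩
  · rw [h]; exact ⟨⟨by linarith [hτ.2], by linarith [hτ.1]⟩, Or.inr (by linarith [hτ.2])⟩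

theorem fold_snd (hA : Atlas N lam om om0 rm rp b δ t ε₀ κ Γ R U) {j : ℕ} (h1 : 1 ≤ j)
    (h2 : j + 2 ≤ 2 * N) {e : ℝ} (he : e ∈ Ioo 0 ε₀) {σ : ℝ} (hσ : |σ| < t) :
    Γ j (σ, e) ∈ nbhd t (walls N) := by
  have h3 := hA.pos
  have h4 := hA.lt
  have h5 := hA.lt_one
  have hF := hA.fold j h1 h2
  rcases le_or_gt (t / 2) |σ| with h | h
  · exact fold_mem_walls ⟨abs_nonneg σ, hσ⟩ (by linarith)
      (hF.mu_outer e he σ (abs_lt.1 hσ) h)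
  · obtain ⟨τ, hτ, hμ⟩ := hF.mu_inner e he σ (abs_lt.1 hσ) h
    exact fold_mem_walls ⟨hτ.1.le, by linarith [hτ.2]⟩ (by linarith) hμ

/-- A point of the branch is near a fold or it has the same parameter as the curve at `ε = 0`. -/
theorem snd_cases (hA : Atlas N lam om om0 rm rp b δ t ε₀ κ Γ R U) (hl : Bistable lam rm rp)
    {s : ℝ} (hs : s ∈ Ioo (δ / 2) (2 * N - 1 - δ / 2)) :
    (∃ j : ℕ, 1 ≤ j ∧ j + 2 ≤ 2 * N ∧ |s - j| < t ∧ curve0 N rm rp om0 s ∈ nbhd t (walls N)) ∨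
      ∃ i : ℕ, i + 2 ≤ 2 * N ∧ s ∈ Icc (i + t) (i + 1 - t) ∧
        curve0 N rm rp om0 s ∉ nbhd t (walls N) := by
  have h3 := hA.pos
  have h4 := hA.lt
  have h5 := hA.lt_one
  have hN : (0 : ℝ) ≤ N := by positivity
  have hi := exists_half (s := s) (by linarith [hs.1])
  set i := ⌊s⌋₊
  have hiN : i + 2 ≤ 2 * N := half_lt hi.1 (by linarith [hs.2])
  by_cases hm : s ∈ Icc (i + t) (i + 1 - t)
  · refine Or.inr ⟨i, hiN, hm, ?_⟩
    rw [mem_nbhd_walls, curve0_snd hl (Ico_subset_Icc_self hi)]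
    have := halfMu_mem_Icc.2 hm
    rintro ⟨-, h | h⟩
    · linarith [this.1]
    · linarith [this.2]
  · left
    have hfar : ∃ j : ℕ, 1 ≤ j ∧ j + 2 ≤ 2 * N ∧ |s - j| < t := by
      rcases lt_or_ge s (i + t) with h | h
      · refine ⟨i, ?_, hiN, abs_lt.2 ⟨by linarith [hi.1], by linarith⟩⟩
        by_contra! h0
        have : i = 0 := by omega
        rw [this] at h
        push_cast at h
        linarith [hs.1]
      · have h' : i + 1 - t < s := by
          by_contra! hcon
          exact hm ⟨h, hcon⟩
        refine ⟨i + 1, by omega, ?_, abs_lt.2 ⟨by push_cast; linarith, by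
          push_cast; linarith [hi.2]⟩⟩
        by_contra! h0
        have : i + 2 = 2 * N := by omega
        have h4 : (i : ℝ) + 2 = 2 * N := by exact_mod_cast this
        linarith [hs.2]
    obtain ⟨j, k1, k2, k3⟩ := hfar
    refine ⟨j, k1, k2, k3, ?_⟩
    rw [mem_nbhd_walls, curve0_snd hl (Ico_subset_Icc_self hi)]
    have h01 : halfMu i s ∈ Icc (0 : ℝ) 1 := by
      have := (halfMu_mem_Icc (i := i) (s := s) (η := 0)).2 (by simpa using Ico_subset_Icc_self hi)
      simpa using this
    refine ⟨h01, ?_⟩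
    by_contra! hcon
    exact hm (halfMu_mem_Icc.1 hcon)

theorem glue_snd (hA : Atlas N lam om om0 rm rp b δ t ε₀ κ Γ R U) (hl : Bistable lam rm rp) {e : ℝ}
    (he : e ∈ Ioo 0 ε₀) {s : ℝ} (hs : s ∈ Ioo (δ / 2) (2 * N - 1 - δ / 2)) :
    (curve0 N rm rp om0 s ∈ nbhd t (walls N) → glue t Γ R e s ∈ nbhd t (walls N)) ∧
    (curve0 N rm rp om0 s ∉ nbhd t (walls N) →
      (glue t Γ R e s).2 = (curve0 N rm rp om0 s).2) := by
  have h3 := hA.pos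
  rcases hA.snd_cases hl hs with ⟨j, k1, k2, k3, k4⟩ | ⟨i, k1, k2, k3⟩
  · refine ⟨fun _ => ?_, fun h => absurd k4 h⟩
    rw [hA.glue_fold k1 k2 e k3]
    exact hA.fold_snd k1 k2 he k3
  · refine ⟨fun h => absurd h k3, fun _ => ?_⟩
    rw [hA.glue_regular hl k1 he ⟨by linarith [k2.1], by linarith [k2.2]⟩, (hA.regular i k1).mu,
      curve0_snd hl (i := i) ⟨by linarith [k2.1], by linarith [k2.2]⟩]

theorem glue_snd_mem_Icc (hA : Atlas N lam om om0 rm rp b δ t ε₀ κ Γ R U)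
    (hl : Bistable lam rm rp) {e : ℝ} (he : e ∈ Ioo 0 ε₀) {s : ℝ}
    (hs : s ∈ Ioo (δ / 2) (2 * N - 1 - δ / 2)) : (glue t Γ R e s).2 ∈ Icc (0 : ℝ) 1 := by
  have h3 := hA.pos
  rcases hA.snd_cases hl hs with ⟨j, k1, k2, k3, k4⟩ | ⟨i, k1, k2, k3⟩
  · exact (mem_nbhd_walls.1 ((hA.glue_snd hl he hs).1 k4)).1
  · rw [(hA.glue_snd hl he hs).2 k3,
      curve0_snd hl (i := i) ⟨by linarith [k2.1], by linarith [k2.2]⟩]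
    have := halfMu_mem_Icc.2 k2
    exact ⟨by linarith [this.1], by linarith [this.2]⟩

theorem generic_fold (hA : Atlas N lam om om0 rm rp b δ t ε₀ κ Γ R U)
    (hM : Model N lam om om0 om2) (hl : Bistable lam rm rp) {e : ℝ} (he : e ∈ Ioo 0 ε₀) {j : ℕ}
    (h1 : 1 ≤ j) (h2 : j + 2 ≤ 2 * N) : ∃ s₀ ∈ Ioo ((j : ℝ) - t) (j + t),
      IsGenericFold (system lam om b e) (glue t Γ R e s₀).1 (glue t Γ R e s₀).2 ∧
      deriv (deriv (fun s => (glue t Γ R e s).2)) s₀ ≠ 0 ∧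
      ∀ s ∈ Ioo ((j : ℝ) - t) (j + t), deriv (fun s => (glue t Γ R e s).2) s = 0 ↔ s = s₀ := by
  have h3 := hA.pos
  have h4 := hA.lt
  have h5 := hA.lt_one
  have hF := hA.fold j h1 h2
  obtain ⟨σc, hσc, hcc, hcrit⟩ := hF.crit e he
  have habs : ∀ s ∈ Ioo ((j : ℝ) - t) (j + t), |s - j| < t := fun s hs =>
    abs_lt.2 ⟨by linarith [hs.1], by linarith [hs.2]⟩
  have hd : ∀ s ∈ Ioo ((j : ℝ) - t) (j + t), deriv (fun s => (glue t Γ R e s).2) s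
      = deriv (fun τ => (Γ j (τ, e)).2) (s - j) := by
    intro s hs
    have : (fun s => (glue t Γ R e s).2) =ᶠ[𝓝 s] fun u => (Γ j (u - j, e)).2 := by
      filter_upwards [isOpen_Ioo.mem_nhds hs] with u hu
      rw [hA.glue_fold h1 h2 e (habs u hu)]
    rw [this.deriv_eq]
    exact deriv_comp_sub_const (f := fun τ => (Γ j (τ, e)).2) _ _
  have hs₀ : (j : ℝ) + σc ∈ Ioo ((j : ℝ) - t) (j + t) := ⟨by linarith [hσc.1], by linarith [hσc.2]⟩
  have hdd : deriv (deriv (fun s => (glue t Γ R e s).2)) (j + σc)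
      = deriv (deriv (fun τ => (Γ j (τ, e)).2)) σc := by
    have : deriv (fun s => (glue t Γ R e s).2) =ᶠ[𝓝 ((j : ℝ) + σc)]
        fun s => deriv (fun τ => (Γ j (τ, e)).2) (s - j) := by
      filter_upwards [isOpen_Ioo.mem_nhds hs₀] with u hu using hd u hu
    rw [this.deriv_eq, deriv_comp_sub_const (f := deriv fun τ => (Γ j (τ, e)).2),
      add_sub_cancel_left]
  have hiff : ∀ s ∈ Ioo ((j : ℝ) - t) (j + t),
      deriv (fun s => (glue t Γ R e s).2) s = 0 ↔ s = j + σc := by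
    intro s hs
    rw [hd s hs, hcrit _ (abs_lt.1 (habs s hs))]
    constructor <;> intro h <;> linarith
  have hJ : (j : ℝ) + σc ∈ Ioo (δ / 2) (2 * N - 1 - δ / 2) := by
    have k1 : (1 : ℝ) ≤ j := by exact_mod_cast h1
    have k2 : (j : ℝ) + 2 ≤ 2 * N := by exact_mod_cast h2
    exact ⟨by linarith [hs₀.1], by linarith [hs₀.2]⟩
  refine ⟨j + σc, hs₀, ?_, by rw [hdd]; exact hcc, hiff⟩
  obtain ⟨-, -, k3, k4⟩ := hA.local_properties hl he hJ
  refine isGenericFold_of_curve (contDiff_system hM.lam_smooth hM.om0_smooth hM.om2_smooth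
    hM.om_eq b e) (hA.contDiffAt_glue hl he hJ) ?_ k3 k4 ((hiff _ hs₀).2 rfl)
    (by rw [hdd]; exact hcc)
  filter_upwards [isOpen_Ioo.mem_nhds hJ] with s hs
  exact (hA.local_properties hl he hs).2.1

/-- A solution away from the bifurcations that is close to the snaking curve is on the branch. -/
theorem exists_eq_glue (hA : Atlas N lam om om0 rm rp b δ t ε₀ κ Γ R U) (hl : Bistable lam rm rp)
    {e : ℝ} (he : e ∈ Ioo 0 ε₀) {q : P N} (hq : q ∈ solutions lam om b e)
    (hμ : q.2 ∈ Icc t (1 - t))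
    (hd : q ∈ Metric.thickening t (curve0 N rm rp om0 '' Icc δ (2 * N - 1 - δ))) :
    ∃ s ∈ Icc (δ - t) (2 * N - 1 - δ + t), q = glue t Γ R e s := by
  have h3 := hA.pos
  obtain ⟨i, s, hi, hs, hsμ, hdist, hφ⟩ := hA.near e he q hq hμ hd
  refine ⟨s, hs, ?_⟩
  have h1 : s ∈ Icc (i + t) (i + 1 - t) := halfMu_mem_Icc.1 (by rw [hsμ]; exact hμ)
  rw [hA.glue_regular hl hi he ⟨by linarith [h1.1], by linarith [h1.2]⟩, hsμ]
  refine (hA.regular i hi).unique e he q hq ⟨by linarith [hμ.1], by linarith [hμ.2]⟩ ?_ hφ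
  rw [halfSheet, hsμ] at hdist
  exact hdist

/-- The set `C` meets the branch because some point of `C` is not near the walls and is therefore
located by `exists_eq_glue`. If `C` left the branch, it would be separated by the open set of points
near which all solutions lie on the branch and by the complement of the compact subarc over `I`. -/
theorem unique (hA : Atlas N lam om om0 rm rp b δ t ε₀ κ Γ R U) (hM : Model N lam om om0 om2)
    (hl : Bistable lam rm rp) {e : ℝ} (he : e ∈ Ioo 0 ε₀) {C : Set (P N)} (hC : IsPreconnected C)
    (hsub : C ⊆ solutions lam om b e ∩ nbhd t (curve0 N rm rp om0 '' Icc δ (2 * N - 1 - δ)))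
    (hne : ¬ C ⊆ nbhd t (walls N)) :
    C ⊆ glue t Γ R e '' Ioo (δ / 2) (2 * N - 1 - δ / 2) := by
  have h3 := hA.pos
  have h4 := hA.lt
  have h5 := hA.lt_one
  set J := Ioo (δ / 2) (2 * (N : ℝ) - 1 - δ / 2) with hJ
  set I := Icc (δ - t) (2 * (N : ℝ) - 1 - δ + t) with hI
  have hIJ : I ⊆ J := fun s hs => ⟨by linarith [hs.1], by linarith [hs.2]⟩
  have hbranch : ∀ q ∈ C, q.2 ∈ Icc t (1 - t) → ∃ s ∈ I, q = glue t Γ R e s := fun q hq hμ =>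
    hA.exists_eq_glue hl he (hsub hq).1 hμ (hsub hq).2.2
  -- A point of `C` on the longer arc over `J` is either near a fold, and folds are far from the
  -- ends, or has `μ` in `[t, 1 - t]`, where closeness to the curve puts it on the shorter arc over
  -- `I`.
  have hCI : ∀ q ∈ C, q ∈ glue t Γ R e '' J → q ∈ glue t Γ R e '' I := by
    rintro q hq ⟨s, hs, rfl⟩
    rcases hA.snd_cases hl hs with ⟨j, k1, k2, k3, -⟩ | ⟨i, k1, k2, k3⟩
    · refine ⟨s, ?_, rfl⟩
      have k4 := abs_lt.1 k3
      have k5 : (1 : ℝ) ≤ j := by exact_mod_cast k1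
      have k6 : (j : ℝ) + 2 ≤ 2 * N := by exact_mod_cast k2
      exact ⟨by linarith [k4.1], by linarith [k4.2]⟩
    · obtain ⟨u, hu, heq⟩ := hbranch _ hq (by
        rw [(hA.glue_snd hl he hs).2 k3,
          curve0_snd hl (i := i) ⟨by linarith [k2.1], by linarith [k2.2]⟩]
        exact halfMu_mem_Icc.2 k2)
      exact ⟨u, hu, heq.symm⟩
  have hcont : ContinuousOn (glue t Γ R e) I := fun s hs =>
    (hA.contDiffAt_glue hl he (hIJ hs)).continuousAt.continuousWithinAt
  have hclosed : IsClosed (glue t Γ R e '' I) := (isCompact_Icc.image_of_continuousOn hcont).isClosed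
  -- The kernel is one-dimensional at every point of the branch, folds included, so nearby solutions
  -- stay on it.
  have hopen : ∀ q ∈ glue t Γ R e '' J, ∀ᶠ q' in 𝓝 q, q' ∈ solutions lam om b e →
      q' ∈ glue t Γ R e '' J := by
    rintro q ⟨s, hs, rfl⟩
    obtain ⟨-, -, k3, k4⟩ := hA.local_properties hl he hs
    refine eventually_mem_image_of_kernel (finrank_unknowns hM.two_le)
      (contDiff_system hM.lam_smooth hM.om0_smooth hM.om2_smooth hM.om_eq b e)
      (hA.contDiffAt_glue hl he hs) (isOpen_Ioo.mem_nhds hs) ?_ k3 k4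
    filter_upwards [isOpen_Ioo.mem_nhds hs] with s hs
    exact (hA.local_properties hl he hs).2.1
  obtain ⟨c, hcC, hcw⟩ := not_subset.1 hne
  have hcμ : c.2 ∈ Icc t (1 - t) := by
    rw [mem_nbhd_walls] at hcw
    have h01 := (hsub hcC).2.1
    constructor
    · by_contra! h
      exact hcw ⟨h01, Or.inl h⟩
    · by_contra! h
      exact hcw ⟨h01, Or.inr h⟩
  obtain ⟨s, hs, hcs⟩ := hbranch c hcC hcμ
  set O := {q : P N | ∀ᶠ q' in 𝓝 q, q' ∈ solutions lam om b e → q' ∈ glue t Γ R e '' J} with hO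
  have hOo : IsOpen O := isOpen_setOfPred_eventually_nhds
  by_contra hcon
  obtain ⟨q, hqC, hq⟩ := not_subset.1 hcon
  obtain ⟨x, hxC, hx1, hx2⟩ := hC O (glue t Γ R e '' I)ᶜ hOo hclosed.isOpen_compl (by
      intro x hx
      by_cases h : x ∈ glue t Γ R e '' I
      · exact Or.inl (hopen x (image_mono hIJ h))
      · exact Or.inr h)
    ⟨c, hcC, hopen c ⟨s, hIJ hs, hcs.symm⟩⟩ ⟨q, hqC, fun h => hq (image_mono hIJ h)⟩
  exact hx2 (hCI x hxC (hx1.self_of_nhds (hsub hxC).1))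

theorem exists_close (hA : Atlas N lam om om0 rm rp b δ t ε₀ κ Γ R U) (hl : Bistable lam rm rp)
    (hε₀ : 0 < ε₀) {κ' : ℝ} (hκ' : 0 < κ') : ∃ ε₂ > 0, ∀ e ∈ Ioo 0 ε₂,
      ∀ s ∈ Ioo (δ / 2) (2 * N - 1 - δ / 2),
      dist (curve0 N rm rp om0 s) (glue t Γ R e s) < κ' := by
  have h3 := hA.pos
  have hf : ∀ j, ∃ ε₂ > 0, 1 ≤ j → j + 2 ≤ 2 * N → ∀ e ∈ Ioo 0 ε₂,
      ∀ σ ∈ Ioo (-t) t, dist (Γ j (σ, e)) (curve0 N rm rp om0 (j + σ)) < κ' := by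
    intro j
    by_cases hj : 1 ≤ j ∧ j + 2 ≤ 2 * N
    · obtain ⟨ε₂, hε₂, h⟩ := hA.fold_tendsto j hj.1 hj.2 κ' hκ'
      exact ⟨ε₂, hε₂, fun _ _ => h⟩
    · exact ⟨1, one_pos, fun k1 k2 => absurd ⟨k1, k2⟩ hj⟩
  have hr : ∀ i, ∃ ε₂ > 0, i + 2 ≤ 2 * N → ∀ e ∈ Ioo 0 ε₂, ∀ μ ∈ Icc (t / 2) (1 - t / 2),
      dist (R i (μ, e)) (R i (μ, 0)) < κ' := by
    intro i
    by_cases hi : i + 2 ≤ 2 * N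
    · have hR := hA.regular i hi
      obtain ⟨ε₂, hε₂, h⟩ := exists_uniform_close hR.isOpen hR.smooth.continuousOn isCompact_Icc
        (fun p hp => hR.subset ⟨hp.1, by rw [hp.2], by rw [hp.2]; exact hε₀⟩) hκ'
      exact ⟨ε₂, hε₂, fun _ e he μ hμ => (h e he μ hμ).2⟩
    · exact ⟨1, one_pos, fun k1 => absurd k1 hi⟩
  choose f hf0 hf1 using hf
  choose r hr0 hr1 using hr
  obtain ⟨ε₁, hε₁, h1⟩ := exists_pos_le_of_lt f hf0 (2 * N)
  obtain ⟨ε₂, hε₂, h2⟩ := exists_pos_le_of_lt r hr0 (2 * N)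
  refine ⟨min ε₀ (min ε₁ ε₂), by positivity, fun e he s hs => ?_⟩
  have e0 : e < ε₀ := he.2.trans_le (min_le_left _ _)
  have e1 : e < ε₁ := he.2.trans_le ((min_le_right _ _).trans (min_le_left _ _))
  have e2 : e < ε₂ := he.2.trans_le ((min_le_right _ _).trans (min_le_right _ _))
  rw [dist_comm]
  rcases hA.chart hs with ⟨j, k1, k2, h⟩ | ⟨i, hi, h⟩
  · have h' : |s - j| < t := by linarith
    rw [hA.glue_fold k1 k2 e h']
    have := hf1 j k1 k2 e ⟨he.1, e1.trans_le (h1 j (by omega))⟩ (s - j) (abs_lt.1 h')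
    rwa [add_sub_cancel] at this
  · have h' : s ∈ Icc (i + t / 2) (i + 1 - t / 2) := ⟨by linarith [h.1], by linarith [h.2]⟩
    rw [hA.glue_regular hl hi ⟨he.1, e0⟩ h', curve0_eq_halfSheet hl (i := i)
      ⟨by linarith [h.1], by linarith [h.2]⟩, halfSheet,
      ← (hA.regular i hi).zero _ (halfMu_mem_Icc.2 h')]
    exact hr1 i hi e ⟨he.1, e2.trans_le (h2 i (by omega))⟩ _ (halfMu_mem_Icc.2 h')

/-- Away from the walls only regular pieces occur. They are smooth on open sets containing `ε = 0`,
where they reduce to the unperturbed curve, so all their derivatives converge uniformly on compact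
intervals. -/
theorem exists_close_iteratedDeriv (hA : Atlas N lam om om0 rm rp b δ t ε₀ κ Γ R U)
    (hl : Bistable lam rm rp) (hε₀ : 0 < ε₀) (m : ℕ) {κ' : ℝ} (hκ' : 0 < κ') :
    ∃ ε₂ > 0, ∀ e ∈ Ioo 0 ε₂, ∀ s ∈ Ioo (δ / 2) (2 * N - 1 - δ / 2),
      curve0 N rm rp om0 s ∉ nbhd t (walls N) →
      dist (iteratedDeriv m (curve0 N rm rp om0) s) (iteratedDeriv m (glue t Γ R e) s) < κ' := by
  have h3 := hA.pos
  have hr : ∀ i, ∃ ε₂ > 0, i + 2 ≤ 2 * N → ∀ e ∈ Ioo 0 ε₂, ∀ s ∈ Icc (i + t) (i + 1 - t),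
      dist (iteratedDeriv m (fun u => R i (halfMu i u, e)) s)
        (iteratedDeriv m (fun u => R i (halfMu i u, 0)) s) < κ' := by
    intro i
    by_cases hi : i + 2 ≤ 2 * N
    · have hR := hA.regular i hi
      set φ : ℝ × ℝ → ℝ × ℝ := fun p => (halfMu i p.1, p.2) with hφ
      have hφs : ContDiff ℝ ∞ φ := ((contDiff_halfMu i).comp contDiff_fst).prodMk contDiff_snd
      set W : Set (ℝ × ℝ) := φ ⁻¹' U i with hW
      have hWo : IsOpen W := hR.isOpen.preimage hφs.continuous
      have hs : ContDiffOn ℝ ∞ (fun p => R i (φ p)) W :=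
        hR.smooth.comp hφs.contDiffOn fun p hp => hp
      obtain ⟨k, hk, hk'⟩ := exists_iteratedDeriv_eq hWo hs m
      have hK : ∀ s ∈ Icc ((i : ℝ) + t) (i + 1 - t), (s, (0 : ℝ)) ∈ W := fun s hs =>
        hR.subset ⟨halfMu_mem_Icc.2 ⟨by linarith [hs.1], by linarith [hs.2]⟩, le_rfl, hε₀⟩
      obtain ⟨ε₂, hε₂, h⟩ := exists_uniform_close hWo hk.continuousOn
        (isCompact_Icc (a := (i : ℝ) + t) (b := i + 1 - t)) (by
          rintro ⟨s, z⟩ ⟨h1, h2⟩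
          have h2 : z = 0 := h2
          subst h2
          exact hK s h1) hκ'
      refine ⟨ε₂, hε₂, fun _ e he s hs => ?_⟩
      obtain ⟨h1, h2⟩ := h e he s hs
      have k1 := hk' (s, e) h1
      have k2 := hk' (s, 0) (hK s hs)
      simp only [hφ] at k1 k2
      rw [k1, k2]
      exact h2
    · exact ⟨1, one_pos, fun k1 => absurd k1 hi⟩
  choose r hr0 hr1 using hr
  obtain ⟨ε₂, hε₂, h2⟩ := exists_pos_le_of_lt r hr0 (2 * N)
  refine ⟨min ε₀ ε₂, by positivity, fun e he s hs hw => ?_⟩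
  have e0 : e < ε₀ := he.2.trans_le (min_le_left _ _)
  have e2 : e < ε₂ := he.2.trans_le (min_le_right _ _)
  rcases hA.snd_cases hl hs with ⟨j, k1, k2, k3, k4⟩ | ⟨i, k1, k2, k3⟩
  · exact absurd k4 hw
  · have hev : ∀ᶠ u in 𝓝 s, u ∈ Icc ((i : ℝ) + t / 2) (i + 1 - t / 2) :=
      Icc_mem_nhds (by linarith [k2.1]) (by linarith [k2.2])
    have g1 : curve0 N rm rp om0 =ᶠ[𝓝 s] fun u => R i (halfMu i u, 0) := by
      filter_upwards [hev] with u hu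
      rw [(hA.regular i k1).zero _ (halfMu_mem_Icc.2 hu), curve0_eq_halfSheet hl (i := i)
        ⟨by linarith [hu.1], by linarith [hu.2]⟩, halfSheet]
    have g2 : glue t Γ R e =ᶠ[𝓝 s] fun u => R i (halfMu i u, e) := by
      filter_upwards [hev] with u hu using hA.glue_regular hl k1 ⟨he.1, e0⟩ hu
    rw [g1.iteratedDeriv_eq, g2.iteratedDeriv_eq, dist_comm]
    exact hr1 i k1 e ⟨he.1, e2.trans_le (h2 i (by omega))⟩ s k2

end Atlas

end

/-! ### Choice of constants and the final branch -/

section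

variable {N : ℕ} {lam : ℝ → ℝ → ℝ} {om : ℝ → ℝ → ℝ → ℝ} {om0 : ℝ → ℝ}
  {om2 : ℝ → ℝ → ℝ → ℝ} {rm rp : ℝ → ℝ} {b : Site} {δ t ε₀ κ : ℝ} {Γ R : ℕ → ℝ × ℝ → P N}
  {U : ℕ → Set (ℝ × ℝ)}

/-- The constants are chosen in the order `t`, `κ`, `ε₀`: first `t` below all fold ranges and the
root separation, then `κ` for this `t`, then `ε₀`. Only finitely many arcs are involved, so minima
over `j < 2N` suffice. -/
theorem exists_atlas (hM : Model N lam om om0 om2) (hl : Bistable lam rm rp) (hδ : 0 < δ)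
    (hδ1 : δ < 1) (b : Site) : ∃ δ₀ > 0, ∀ t ∈ Ioo 0 δ₀, ∃ ε₀ > 0, ∃ κ Γ R U,
      Atlas N lam om om0 rm rp b δ t ε₀ κ Γ R U := by
  choose σ₀ hσ₀ Γ hΓ using exists_fold_family hM hl b
  obtain ⟨d₁, hd₁, hd₁'⟩ := exists_pos_le_of_lt σ₀ hσ₀ (2 * N)
  obtain ⟨d₂, hd₂, hnear⟩ := exists_near_half (N := N) (om := om) (om0 := om0) hl hδ hδ1
  refine ⟨min (min d₁ d₂) (δ / 4), by positivity, fun t ht => ?_⟩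
  obtain ⟨ht0, ht1⟩ := ht
  simp only [lt_min_iff] at ht1
  obtain ⟨⟨l1, l2⟩, l3⟩ := ht1
  have hJ0 : Icc (δ / 2) (2 * (N : ℝ) - 1 - δ / 2) ⊆ Ico 0 (2 * N - 1) := fun s hs =>
    ⟨by linarith [hs.1], by linarith [hs.2]⟩
  have hJ1 : Icc (δ / 2) (2 * (N : ℝ) - 1 - δ / 2) ⊆ Icc 0 ((2 * N : ℕ) : ℝ) := fun s hs =>
    ⟨by linarith [hs.1], by push_cast; linarith [hs.2]⟩
  obtain ⟨κm, hκm, hmod⟩ := exists_modulus_of_injOn isCompact_Icc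
    ((continuousOn_curve0 (N := N) hl hM.om0_smooth.continuous (2 * N)).mono hJ1)
    ((injOn_curve0 hl).mono hJ0) (by linarith : 0 < t / 4)
  have hreg : ∀ i, ∃ ε₀ > 0, ∃ κ > 0, ∃ U R, i + 2 ≤ 2 * N →
      RegularPiece (N := N) lam om om0 rp (halfRoot rm rp i) b (i / 2 + 1) (t / 2) ε₀ κ U R := by
    intro i
    by_cases hi : i + 2 ≤ 2 * N
    · obtain ⟨ε₀, h1, κ, h2, U, R, h3⟩ := exists_regularPiece hM hl (hl.regularRoot_halfRoot i)
        (m := i / 2 + 1) (by omega) (by omega) (by linarith : 0 < t / 2) b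
      exact ⟨ε₀, h1, κ, h2, U, R, fun _ => h3⟩
    · exact ⟨1, one_pos, 1, one_pos, ∅, fun _ => 0, fun h => absurd h hi⟩
  choose er her kr hkr U R hR using hreg
  obtain ⟨κr, hκr, hκr'⟩ := exists_pos_le_of_lt kr hkr (2 * N)
  obtain ⟨ε₁, hε₁, hε₁'⟩ := exists_pos_le_of_lt er her (2 * N)
  -- `t` bounds the distance to the curve, `κm / 2` serves injectivity, and `κr` uniqueness in the
  -- regular pieces.
  set κ := min t (min (κm / 2) κr) with hκ
  have hκ0 : 0 < κ := lt_min ht0 (lt_min (by positivity) hκr)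
  have hκm' : κ ≤ κm / 2 := (min_le_right _ _).trans (min_le_left _ _)
  have hκr'' : κ ≤ κr := (min_le_right _ _).trans (min_le_right _ _)
  have hfold : ∀ j, ∃ ε > 0, 1 ≤ j → j + 2 ≤ 2 * N →
      FoldPiece lam om b (foldAlpha j) (foldBeta j) (σ₀ j) (t / 2) ε (Γ j) ∧
      ∀ e ∈ Ioo 0 ε, ∀ σ ∈ Ioo (-t) t,
        dist (Γ j (σ, e)) (curve0 N rm rp om0 (j + σ)) < κ := by
    intro j
    by_cases hj : 1 ≤ j ∧ j + 2 ≤ 2 * N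
    · have hσj := hd₁' j (by omega)
      obtain ⟨h1, h2⟩ := hΓ j hj.1 hj.2
      obtain ⟨ε, hε, h3⟩ := h1 (t / 2) ⟨by linarith, by linarith⟩
      obtain ⟨ε', hε', h4⟩ := h2 κ hκ0
      refine ⟨min ε ε', by positivity, fun _ _ => ⟨h3.mono le_rfl (min_le_left _ _),
        fun e he σ hσ => h4 e ⟨he.1, he.2.trans_le (min_le_right _ _)⟩ σ
          ⟨by linarith [hσ.1], by linarith [hσ.2]⟩ ?_⟩⟩
      exact abs_le.2 ⟨by linarith [hσ.1], by linarith [hσ.2]⟩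
    · exact ⟨1, one_pos, fun k1 k2 => absurd ⟨k1, k2⟩ hj⟩
  choose ef hef hf using hfold
  obtain ⟨ε₂, hε₂, hε₂'⟩ := exists_pos_le_of_lt ef hef (2 * N)
  have hrc : ∀ i, ∃ ε > 0, i + 2 ≤ 2 * N → ∀ e ∈ Ioo 0 ε, ∀ μ ∈ Icc (t / 2) (1 - t / 2),
      dist (R i (μ, e)) (R i (μ, 0)) < κ := by
    intro i
    by_cases hi : i + 2 ≤ 2 * N
    · have hRi := hR i hi
      obtain ⟨ε₂, hε₂, h⟩ := exists_uniform_close hRi.isOpen hRi.smooth.continuousOn isCompact_Icc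
        (fun p hp => hRi.subset ⟨hp.1, by rw [hp.2], by rw [hp.2]; exact her i⟩) hκ0
      exact ⟨ε₂, hε₂, fun _ e he μ hμ => (h e he μ hμ).2⟩
    · exact ⟨1, one_pos, fun k1 => absurd k1 hi⟩
  choose ec hec hc using hrc
  obtain ⟨ε₃, hε₃, hε₃'⟩ := exists_pos_le_of_lt ec hec (2 * N)
  obtain ⟨ε₄, hε₄, hε₄'⟩ := hnear t ⟨ht0, l2⟩ κ hκ0
  set ε₀ := min (min ε₁ ε₂) (min ε₃ ε₄) with hε₀
  have m1 : ε₀ ≤ ε₁ := (min_le_left _ _).trans (min_le_left _ _)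
  have m2 : ε₀ ≤ ε₂ := (min_le_left _ _).trans (min_le_right _ _)
  have m3 : ε₀ ≤ ε₃ := (min_le_right _ _).trans (min_le_left _ _)
  have m4 : ε₀ ≤ ε₄ := (min_le_right _ _).trans (min_le_right _ _)
  refine ⟨ε₀, by positivity, κ, Γ, R, U, ht0, by linarith, hδ1, min_le_left _ _, ?_, ?_, ?_, ?_, ?_,
    ?_, ?_⟩
  · intro j h1 h2
    exact (hf j h1 h2).1.mono (l1.le.trans (hd₁' j (by omega))) (m2.trans (hε₂' j (by omega)))
  · intro j h1 h2 e he
    exact (hf j h1 h2).2 e ⟨he.1, he.2.trans_le (m2.trans (hε₂' j (by omega)))⟩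
  · intro j h1 h2 κ' hκ'
    have hσj := hd₁' j (by omega)
    obtain ⟨ε', hε', h4⟩ := (hΓ j h1 h2).2 κ' hκ'
    exact ⟨ε', hε', fun e he σ hσ => h4 e he σ ⟨by linarith [hσ.1], by linarith [hσ.2]⟩
      (abs_le.2 ⟨by linarith [hσ.1], by linarith [hσ.2]⟩)⟩
  · intro i hi
    exact (hR i hi).mono (m1.trans (hε₁' i (by omega))) (hκr''.trans (hκr' i (by omega)))
  · intro i hi e he
    exact hc i hi e ⟨he.1, he.2.trans_le (m3.trans (hε₃' i (by omega)))⟩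
  · intro s hs u hu h
    exact hmod s hs u hu (by linarith)
  · intro e he
    exact hε₄' b e ⟨he.1, he.2.trans_le m4⟩

theorem tendstoUniformlyOn_of_exists {f : ℝ → ℝ → P N} {f₀ : ℝ → P N} {S : Set ℝ}
    (h : ∀ κ > 0, ∃ ε₂ > 0, ∀ e ∈ Ioo 0 ε₂, ∀ s ∈ S, dist (f₀ s) (f e s) < κ) :
    TendstoUniformlyOn f f₀ (𝓝[>] 0) S := by
  rw [Metric.tendstoUniformlyOn_iff]
  intro κ hκ
  obtain ⟨ε₂, hε₂, h'⟩ := h κ hκ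
  filter_upwards [Ioo_mem_nhdsGT hε₂] with e he using h' e he

/-- The snaking branch. -/
theorem Atlas.exists_branch (hA : Atlas N lam om om0 rm rp b δ t ε₀ κ Γ R U)
    (hM : Model N lam om om0 om2) (hl : Bistable lam rm rp) (hε₀ : 0 < ε₀) {εs : ℝ}
    (hεs : εs ≤ ε₀) : ∃ g : ℝ → ℝ → P N,
      ContDiffOn ℝ ∞ (fun q : ℝ × ℝ => g q.1 q.2)
        (Ioo 0 εs ×ˢ Ioo (δ / 2) (2 * N - 1 - δ / 2)) ∧
      (∀ ε ∈ Ioo 0 εs,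
        InjOn (g ε) (Ioo (δ / 2) (2 * N - 1 - δ / 2)) ∧
        (∀ s ∈ Ioo (δ / 2) (2 * N - 1 - δ / 2),
          deriv (g ε) s ≠ 0 ∧ g ε s ∈ solutions lam om b ε) ∧
        g ε '' Icc δ (2 * N - 1 - δ) ⊆ nbhd t (Gamma0 N rm rp om0 δ) ∧
        (∀ C : Set (P N), IsPreconnected C →
          C ⊆ solutions lam om b ε ∩ nbhd t (Gamma0 N rm rp om0 δ) →
          ¬ C ⊆ nbhd t (walls N) →
          C ⊆ g ε '' Ioo (δ / 2) (2 * N - 1 - δ / 2)) ∧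
        (∀ s ∈ Ioo (δ / 2) (2 * N - 1 - δ / 2),
          (curve0 N rm rp om0 s ∈ nbhd t (walls N) → g ε s ∈ nbhd t (walls N)) ∧
          (curve0 N rm rp om0 s ∉ nbhd t (walls N) →
            (g ε s).2 = (curve0 N rm rp om0 s).2)) ∧
        (∀ j : ℕ, 1 ≤ j → j ≤ 2 * N - 2 → ∃ s₀ ∈ Ioo ((j : ℝ) - t) (j + t),
          IsGenericFold (system lam om b ε) (g ε s₀).1 (g ε s₀).2 ∧
          deriv (deriv (fun s => (g ε s).2)) s₀ ≠ 0 ∧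
          ∀ s ∈ Ioo ((j : ℝ) - t) (j + t), deriv (fun s => (g ε s).2) s = 0 ↔ s = s₀)) ∧
      TendstoUniformlyOn g (curve0 N rm rp om0) (𝓝[>] 0)
        (Ioo (δ / 2) (2 * N - 1 - δ / 2)) ∧
      (∀ m : ℕ, TendstoUniformlyOn (fun ε => iteratedDeriv m (g ε))
        (iteratedDeriv m (curve0 N rm rp om0)) (𝓝[>] 0)
        {s ∈ Ioo (δ / 2) (2 * N - 1 - δ / 2) | curve0 N rm rp om0 s ∉ nbhd t (walls N)}) := by
  have h3 := hA.pos
  have h4 := hA.lt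
  have h5 := hA.lt_one
  have hin : ∀ ε ∈ Ioo 0 εs, ε ∈ Ioo 0 ε₀ := fun ε h => ⟨h.1, h.2.trans_le hεs⟩
  rw [Gamma0_eq hl hM.two_le (by linarith) h5]
  refine ⟨glue t Γ R, fun q hq => ?_, fun ε hε => ⟨hA.injOn_glue hl (hin ε hε), fun s hs => ?_, ?_,
    fun C hC hsub hne => hA.unique hM hl (hin ε hε) hC hsub hne,
    fun s hs => hA.glue_snd hl (hin ε hε) hs, fun j h1 h2 => ?_⟩, ?_, fun m => ?_⟩
  · exact (hA.local_properties hl (hin _ hq.1) hq.2).1.contDiffWithinAt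
  · have := hA.local_properties hl (hin ε hε) hs
    exact ⟨this.2.2.1, this.2.1⟩
  · rintro q ⟨s, hs, rfl⟩
    have hs' : s ∈ Ioo (δ / 2) (2 * (N : ℝ) - 1 - δ / 2) :=
      ⟨by linarith [hs.1], by linarith [hs.2]⟩
    refine ⟨hA.glue_snd_mem_Icc hl (hin ε hε) hs', Metric.mem_thickening_iff.2
      ⟨_, ⟨s, hs, rfl⟩, (hA.close hl (hin ε hε) hs').trans_le hA.kappa_le⟩⟩
  · have := hM.two_le
    exact hA.generic_fold hM hl (hin ε hε) h1 (by omega)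
  · exact tendstoUniformlyOn_of_exists fun κ' hκ' => hA.exists_close hl hε₀ hκ'
  · refine tendstoUniformlyOn_of_exists fun κ' hκ' => ?_
    obtain ⟨ε₂, hε₂, h⟩ := hA.exists_close_iteratedDeriv hl hε₀ m hκ'
    exact ⟨ε₂, hε₂, fun e he s hs => h e he s hs.1 hs.2⟩

end

end Snaking

end

open Snaking in
theorem theorem1 (N : ℕ) (hN : 2 ≤ N)
    (lam : ℝ → ℝ → ℝ) (rm rp : ℝ → ℝ) (hlam : Bistable lam rm rp)
    (om : ℝ → ℝ → ℝ → ℝ) (om0 : ℝ → ℝ) (om2 : ℝ → ℝ → ℝ → ℝ)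
    (hom0 : ContDiff ℝ ∞ om0)
    (hom2 : ContDiff ℝ ∞ (fun q : ℝ × ℝ × ℝ => om2 q.1 q.2.1 q.2.2))
    (hom : ∀ r μ ε, om r μ ε = om0 μ + ε ^ 2 * om2 r μ ε)
    (δ : ℝ) (hδ : 0 < δ) (hδ1 : δ < 1) :
    ∃ δ₀ > 0, ∀ δs : ℝ, 0 < δs → δs < δ₀ → ∃ εs > 0, ∀ b : Site, ∃ g : ℝ → ℝ → P N,
      -- smooth dependence on the position `s` along the branch and on `ε`
      ContDiffOn ℝ ∞ (fun q : ℝ × ℝ => g q.1 q.2)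
        (Ioo 0 εs ×ˢ Ioo (δ / 2) (2 * N - 1 - δ / 2)) ∧
      (∀ ε ∈ Ioo 0 εs,
        -- regular, embedded curves of solutions inside the neighbourhood
        InjOn (g ε) (Ioo (δ / 2) (2 * N - 1 - δ / 2)) ∧
        (∀ s ∈ Ioo (δ / 2) (2 * N - 1 - δ / 2),
          deriv (g ε) s ≠ 0 ∧ g ε s ∈ solutions lam om b ε) ∧
        g ε '' Icc δ (2 * N - 1 - δ) ⊆ nbhd δs (Gamma0 N rm rp om0 δ) ∧
        -- uniqueness: a connected set of solutions in the neighbourhood that is not confined to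
        -- `μ` within `δs` of `0` and `1` is part of the branch (continued past its end points)
        (∀ C : Set (P N), IsPreconnected C →
          C ⊆ solutions lam om b ε ∩ nbhd δs (Gamma0 N rm rp om0 δ) →
          ¬ C ⊆ nbhd δs (walls N) →
          C ⊆ g ε '' Ioo (δ / 2) (2 * N - 1 - δ / 2)) ∧
        -- outside the neighbourhood of `μ = 0, 1` the branch is parametrized by `μ`
        (∀ s ∈ Ioo (δ / 2) (2 * N - 1 - δ / 2),
          (curve0 N rm rp om0 s ∈ nbhd δs (walls N) → g ε s ∈ nbhd δs (walls N)) ∧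
          (curve0 N rm rp om0 s ∉ nbhd δs (walls N) →
            (g ε s).2 = (curve0 N rm rp om0 s).2)) ∧
        -- each of the pieces inside that neighbourhood is a generic fold
        (∀ j : ℕ, 1 ≤ j → j ≤ 2 * N - 2 → ∃ s₀ ∈ Ioo ((j : ℝ) - δs) (j + δs),
          IsGenericFold (system lam om b ε) (g ε s₀).1 (g ε s₀).2 ∧
          deriv (deriv (fun s => (g ε s).2)) s₀ ≠ 0 ∧
          ∀ s ∈ Ioo ((j : ℝ) - δs) (j + δs), deriv (fun s => (g ε s).2) s = 0 ↔ s = s₀)) ∧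
      -- convergence in `C^0`
      TendstoUniformlyOn g (curve0 N rm rp om0) (𝓝[>] 0)
        (Ioo (δ / 2) (2 * N - 1 - δ / 2)) ∧
      -- convergence in `C^m` outside the neighbourhood of `μ = 0, 1`
      (∀ m : ℕ, TendstoUniformlyOn (fun ε => iteratedDeriv m (g ε))
        (iteratedDeriv m (curve0 N rm rp om0)) (𝓝[>] 0)
        {s ∈ Ioo (δ / 2) (2 * N - 1 - δ / 2) | curve0 N rm rp om0 s ∉ nbhd δs (walls N)}) := by
  have hM : Model N lam om om0 om2 := ⟨hN, hlam.smooth, hom0, hom2, hom⟩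
  obtain ⟨d₁, hd₁, h₁⟩ := exists_atlas hM hlam hδ hδ1 Site.on
  obtain ⟨d₂, hd₂, h₂⟩ := exists_atlas hM hlam hδ hδ1 Site.off
  refine ⟨min d₁ d₂, lt_min hd₁ hd₂, fun δs h0 hlt => ?_⟩
  obtain ⟨ε₁, hε₁, κ₁, Γ₁, R₁, U₁, hA₁⟩ := h₁ δs ⟨h0, hlt.trans_le (min_le_left _ _)⟩
  obtain ⟨ε₂, hε₂, κ₂, Γ₂, R₂, U₂, hA₂⟩ := h₂ δs ⟨h0, hlt.trans_le (min_le_right _ _)⟩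
  -- One bound on `ε` has to serve both boundary conditions, so both atlases are built before `b` is
  -- fixed.
  refine ⟨min ε₁ ε₂, lt_min hε₁ hε₂, fun b => ?_⟩
  cases b
  · exact hA₁.exists_branch hM hlam hε₁ (min_le_left _ _)
  · exact hA₂.exists_branch hM hlam hε₂ (min_le_right _ _)
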